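/- Let $N\ge 2$ be an integer, $0<\gamma_*\le\infty$, and let $f:[-\gamma_*,\gamma_*]\to\mathbb R$ (with $[-\infty,\infty]$ read as $\mathbb R$) be a function; put $F(s)=\int_0^s f(t)\,dt$ and $Q(s)=2NF(s)-(N-2)sf(s)$. Assume: $(A_1)$ $f$ is continuous and odd, $f(0)=0$, and $f$ is locally Lipschitz in $[-\gamma_*,\gamma_*]\setminus\{0\}$. $(A_2)$ There is $\delta>0$ such that $F(s)<0$ for $0<|s|<\delta$, and $F(s)<F(\gamma_*)$ for all $s\in(-\gamma_*,\gamma_*)$ (if $\gamma_*=\infty$, $F(\gamma_*)$ denotes $\lim_{s\to\infty}F(s)\in[-\infty,\infty]$, which is assumed to exist). $(A_3)$ $F$ has a local maximum at some $\gamma\in(\delta,\gamma_*)$ with $F(\gamma)>0$. $(A_4)$ $f$ has finitely many zeros in $(\delta,\gamma_*)$ and changes sign at each of them. $(A_5)$ Either $\gamma_*<\infty$ and $f(\gamma_*)=0$, or $\gamma_*=\infty$ and, for some $\theta\in(0,1)$, $\lim_{s\to\infty}\inf_{s_1,s_2\in[\theta s,s]}Q(s_2)\bigl(s/f(s_1)\bigr)^{N/2}=\infty$.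 Let $\gamma_1$ be the first local maximum of $F$ in $(0,\gamma_*)$ with $F(\gamma_1)>0$ and, inductively, let $\gamma_{i}$ be the first local maximum with $F(\gamma_{i})>F(\gamma_{i-1})$, $i=2,\dots,M$, where no local maximum of $F$ in $(0,\gamma_*)$ has a value larger than $F(\gamma_M)$. Let $\beta_1$ be the largest zero of $F$ in $(0,\gamma_1)$ and $\beta_*$ the largest point of $(\gamma_M,\gamma_*)$ with $F(\beta_*)=F(\gamma_M)$. Let $\bar\beta\in(\beta_*,\gamma_*)$ and $s_0\in[0,\bar\beta]$ be arbitrary, and set $$\bar F=-\min_{[0,\beta_1]}F,\qquad \bar C=2(N-1)\frac{\bar\beta-\beta_1}{F(\bar\beta)-F(\gamma_M)}\Bigl(2\bigl(F(\bar\beta)-\min_{[\beta_1,\beta_*]}F\bigr)\Bigr)^{1/2},$$ $$A_0=\frac{\beta_*-\beta_1}{(F(\bar\beta)-F(\gamma_M))^{1/2}}+\Bigl(\frac{2N(\bar\beta-\beta_*)}{\min_{[\beta_*,\bar\beta]}f}\Bigr)^{1/2}.$$ If $\gamma_*<\infty$ let $A=A_0$ and $\bar I=F(\gamma_*)$; if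 $\gamma_*=\infty$ let $A=\max\{1,A_0\}$ and $$\bar I=\Bigl(\frac{\bar C+1}{\bar C}\Bigr)^N\Bigl(2F(\bar\beta)+(\bar\beta-\beta_1)^2+\frac1N\bigl(\sup_{[\beta_1,\bar\beta]}Q-\min_{[s_0,\bar\beta]}Q\bigr)\Bigr)+\frac{(N-2)^2\bar\beta^2}{2\bar C^2}.$$ If $$(\bar C+A)\bar I<\frac{2^{1/2}(N-1)}{(\bar I+\bar F)^{1/2}}\int_0^{\beta_1}|F(s)|\,ds,$$ then for every integer $k\ge0$ there exist at least two distinct solutions $u$ (with values in $[-\gamma_*,\gamma_*]$) of $$u''+\frac{N-1}{r}u'+f(u)=0\ (r>0),\qquad u'(0)=0,\qquad \lim_{r\to\infty}u(r)=0,$$ with $u(0)\in(\beta_*,\gamma_*)$ and exactly $k$ sign changes in $(0,\infty)$. -/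

import Mathlib

open Set Filter Topology

noncomputable section

/-- `F(s) = ∫₀ˢ f(t) dt`. -/
def primF (f : ℝ → ℝ) (s : ℝ) : ℝ := ∫ t in (0 : ℝ)..s, f t

/-- `Q(s) = 2 N F(s) - (N - 2) s f(s)`. -/
def pohozaevQ (N : ℕ) (f : ℝ → ℝ) (s : ℝ) : ℝ :=
  2 * (N : ℝ) * primF f s - ((N : ℝ) - 2) * s * f s

/-- The interval `[-γs, γs]` on which the nonlinearity lives; it is all of `ℝ` when `γs = ⊤`. -/
def fDomain (γs : EReal) : Set ℝ := {s | ((|s| : ℝ) : EReal) ≤ γs}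

/-- `f` changes sign at `z`. -/
def ChangesSignAt (f : ℝ → ℝ) (z : ℝ) : Prop :=
  ((∀ᶠ s in 𝓝[<] z, f s < 0) ∧ (∀ᶠ s in 𝓝[>] z, 0 < f s)) ∨
  ((∀ᶠ s in 𝓝[<] z, 0 < f s) ∧ (∀ᶠ s in 𝓝[>] z, f s < 0))

/-- The standing assumptions on the nonlinearity. Only the values of `f` on `[-γs, γs]` matter. -/
structure NonlinearityAssumptions (N : ℕ) (f : ℝ → ℝ) (γs : EReal) (δ : ℝ) : Prop where
  cont : ContinuousOn f (fDomain γs)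
  odd : ∀ s ∈ fDomain γs, f (-s) = -f s
  map_zero : f 0 = 0
  locLip : LocallyLipschitzOn (fDomain γs \ {0}) f
  delta_pos : 0 < δ
  primF_neg : ∀ s : ℝ, 0 < |s| → |s| < δ → primF f s < 0
  /-- `F(s) < F(γs)` for `|s| < γs`, when `γs` is finite. -/
  primF_lt_end : γs ≠ ⊤ →
    ∀ s : ℝ, ((|s| : ℝ) : EReal) < γs → primF f s < primF f γs.toReal
  /-- `F(s) < F(∞) = lim_{t → ∞} F(t) ∈ [-∞, ∞]` for all `s`, when `γs = ∞`. -/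
  primF_lt_top : γs = ⊤ →
    ∃ L : EReal, Tendsto (fun t : ℝ => ((primF f t : ℝ) : EReal)) atTop (𝓝 L) ∧
      ∀ s : ℝ, ((primF f s : ℝ) : EReal) < L
  exists_localMax : ∃ g : ℝ, δ < g ∧ (g : EReal) < γs ∧ IsLocalMax (primF f) g ∧ 0 < primF f g
  finite_zeros : {s : ℝ | δ < s ∧ (s : EReal) < γs ∧ f s = 0}.Finite
  sign_change : ∀ z : ℝ, δ < z → (z : EReal) < γs → f z = 0 → ChangesSignAt f z
  end_zero : γs ≠ ⊤ → f γs.toReal = 0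
  /-- `inf_{s₁, s₂ ∈ [θ s, s]} Q(s₂) (s / f(s₁))^{N/2} → ∞` as `s → ∞`, for some `θ ∈ (0, 1)`. -/
  subcritical : γs = ⊤ → ∃ θ : ℝ, 0 < θ ∧ θ < 1 ∧
    ∀ K : ℝ, ∀ᶠ s : ℝ in atTop, ∀ s₁ ∈ Icc (θ * s) s, ∀ s₂ ∈ Icc (θ * s) s,
      K ≤ pohozaevQ N f s₂ * (s / f s₁) ^ ((N : ℝ) / 2)

/-- The local maximum points of `F` in `(0, γs)` at which `F` exceeds the level `c`. -/
def localMaxAbove (f : ℝ → ℝ) (γs : EReal) (c : ℝ) : Set ℝ :=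
  {g | 0 < g ∧ (g : EReal) < γs ∧ IsLocalMax (primF f) g ∧ c < primF f g}

/-- `γ 1, …, γ M` is the complete sequence of successive record local maxima of `F`: `γ 1` is the
first local maximum with `F > 0`, `γ (i + 1)` is the first local maximum with `F > F (γ i)`, and
there is no local maximum in `(0, γs)` with `F > F (γ M)`. -/
structure IsRecordMaxima (f : ℝ → ℝ) (γs : EReal) (M : ℕ) (γ : ℕ → ℝ) : Prop where
  one_le : 1 ≤ M
  first : IsLeast (localMaxAbove f γs 0) (γ 1)
  next : ∀ i, 1 ≤ i → i < M → IsLeast (localMaxAbove f γs (primF f (γ i))) (γ (i + 1))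
  last : localMaxAbove f γs (primF f (γ M)) = ∅

/-- `F̄ = - min_{[0, β₁]} F`. -/
def Fbar (f : ℝ → ℝ) (β₁ : ℝ) : ℝ := -sInf (primF f '' Icc 0 β₁)

/-- `C̄ = 2(N-1) (β̄ - β₁)/(F(β̄) - F(γ_M)) (2 (F(β̄) - min_{[β₁, βs]} F))^{1/2}`. -/
def Cbar (N : ℕ) (f : ℝ → ℝ) (γM β₁ βs βbar : ℝ) : ℝ :=
  2 * ((N : ℝ) - 1) * ((βbar - β₁) / (primF f βbar - primF f γM)) *
    √(2 * (primF f βbar - sInf (primF f '' Icc β₁ βs)))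

/-- `(βs - β₁)/(F(β̄) - F(γ_M))^{1/2} + (2N(β̄ - βs)/min_{[βs, β̄]} f)^{1/2}`. -/
def Abase (N : ℕ) (f : ℝ → ℝ) (γM β₁ βs βbar : ℝ) : ℝ :=
  (βs - β₁) / √(primF f βbar - primF f γM) +
    √(2 * (N : ℝ) * (βbar - βs) / sInf (f '' Icc βs βbar))

open Classical in
/-- The constant `A`. -/
def Aconst (N : ℕ) (f : ℝ → ℝ) (γs : EReal) (γM β₁ βs βbar : ℝ) : ℝ :=
  if γs = ⊤ then max 1 (Abase N f γM β₁ βs βbar) else Abase N f γM β₁ βs βbar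

open Classical in
/-- The constant `Ī`; it is `F(γs)` when `γs` is finite. -/
def Ibar (N : ℕ) (f : ℝ → ℝ) (γs : EReal) (γM β₁ βs βbar s₀ : ℝ) : ℝ :=
  if γs = ⊤ then
    ((Cbar N f γM β₁ βs βbar + 1) / Cbar N f γM β₁ βs βbar) ^ N *
        (2 * primF f βbar + (βbar - β₁) ^ 2 +
          1 / (N : ℝ) * (sSup (pohozaevQ N f '' Icc β₁ βbar) -
            sInf (pohozaevQ N f '' Icc s₀ βbar))) +
      ((N : ℝ) - 2) ^ 2 * βbar ^ 2 / (2 * Cbar N f γM β₁ βs βbar ^ 2)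
  else primF f γs.toReal

/-- `u : [0, ∞) → [-γs, γs]` is a classical solution of
`u'' + (N-1)/r u' + f(u) = 0` for `r > 0`, `u'(0) = 0`, `u(r) → 0` as `r → ∞`
(the values of `u` at negative arguments play no role). -/
structure IsRadialBoundState (N : ℕ) (f : ℝ → ℝ) (γs : EReal) (u : ℝ → ℝ) : Prop where
  mem_domain : ∀ r, 0 ≤ r → u r ∈ fDomain γs
  ode : ∃ v : ℝ → ℝ, ContinuousOn v (Ici 0) ∧ v 0 = 0 ∧
    (∀ r, 0 ≤ r → HasDerivWithinAt u (v r) (Ici 0) r) ∧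
    ∀ r, 0 < r → ∃ w : ℝ, HasDerivAt v w r ∧ w + ((N : ℝ) - 1) / r * v r + f (u r) = 0
  tendsto_zero : Tendsto u atTop (𝓝 0)

/-- `u` has at least `k` sign changes in `(0, ∞)`. -/
def HasSignChangesAtLeast (u : ℝ → ℝ) (k : ℕ) : Prop :=
  ∃ r : Fin (k + 1) → ℝ, StrictMono r ∧ (∀ i, 0 < r i) ∧
    ∀ i : Fin k, u (r i.castSucc) * u (r i.succ) < 0

/-- `u` has exactly `k` sign changes in `(0, ∞)`. -/
def HasExactlySignChanges (u : ℝ → ℝ) (k : ℕ) : Prop :=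
  HasSignChangesAtLeast u k ∧ ¬ HasSignChangesAtLeast u (k + 1)

end

/-! The proof shoots in the height α = u(0). With n = N - 1 the energy E = u'²/2 + F(u) satisfies E'
= -(n/r) u'², so it never increases. Freezing f outside an interval [-B, B] that the relevant
solutions do not leave gives a bounded odd nonlinearity that is locally Lipschitz off 0. Uniqueness
can then fail only at the state (u, u') = (0, 0). Letting solutions rest there (`exists_canonical`)
makes them depend continuously on α, together with u', up to any time at which u ≠ 0
(`exists_family`).

Let b = β₁ be the rim of the first well of F, and let lam lie slightly beyond it. A solution from
beyond b with boundedly many sign changes acquires negative energy inside the well (`Trapped`),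
stays beyond lam for ever (`Stuck`), tends to 0 (`Vanishing`), is confined to one half of the well
(`Settling`), or tends to the rim without touching it (`Rimming`); this is `Well.alternatives`. The
engine is `IsSol.dissipation`: on a monotone stretch in the well, r E drops by at least a constant
times the integral of |F| over the range covered.

The number of sign changes is lower semicontinuous in α. Near a trapped or settling solution it does
not grow, and near a vanishing one it grows by at most one. A rimming solution cannot be approached
from one side by solutions with more sign changes (`Branch.rim_isolated`): the heights at half the
crossing time would sweep out an interval above b on which F' ≤ D F, although F(b) = 0 < F there.
Near a stuck solution every solution is again stuck with no new sign changes, or oscillates as often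
as desired (`Family.eventually_of_stuck`), because a solution that lingers near an equilibrium
leaves with energy barely above a barrier and is then slowed only by friction of order 1/r. Hence a
last parameter before the count rises from k to k + 1 belongs to a vanishing solution. The
topological bookkeeping is `exists_of_path`, and its outcome `Family.exists_bound_states` finds
bound states with prescribed counts between a height from which solutions settle positively in the
well and a height that is stuck without sign changes or oscillates often.

The quantitative hypothesis supplies the first kind of height. The lowest height whose solution
stays above β̄ up to time C̄ reaches β₁ before C̄ + A, since `Landscape.nrg_ge` keeps enough energy
for a definite speed; in the unbounded case the selection also allows an early contact with β₁,
which controls the energy (`Family.exists_descent_of_zero`, `Family.exists_descent_of_large`). The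
energy at β₁ is at most Ī, so r E is at most (C̄ + A) Ī, which by hypothesis is less than the price
of descending from β₁ to 0.

From this height one path leads down and one leads up. Downwards lies βs, whose potential equals
that at γ M, so its solution never falls to γ M and is stuck. Upwards lies the equilibrium γs, or,
when γs is infinite, a height whose solution oscillates often; there the subcriticality condition
and the Pohozaev functional (`IsSol.pohozaev_large`) prevent position and velocity from both being
small for a long time. The two paths yield two bound states with different initial values. -/

/-! ### The radial equation as an integral equation -/

/-- `(u, v)` solves `u' = v`, `v' = -(n / r) v - g(u)` for `r > 0`; it is constant for `r ≤ 0`. -/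
structure IsSol (n : ℕ) (g : ℝ → ℝ) (u v : ℝ → ℝ) : Prop where
  du : ∀ r, HasDerivAt u (v r) r
  dv : ∀ r, 0 < r → HasDerivAt v (-(n : ℝ) / r * v r - g (u r)) r
  cv : Continuous v
  v_nonpos : ∀ r, r ≤ 0 → v r = 0

/-- The averaged force `∫₀¹ tⁿ g(u(rt)) dt`. -/
noncomputable def avgForce (n : ℕ) (g u : ℝ → ℝ) (r : ℝ) : ℝ :=
  ∫ t in (0 : ℝ)..1, t ^ n * g (u (r * t))

theorem avgForce_continuous (n : ℕ) {g u : ℝ → ℝ} (hg : Continuous g) (hu : Continuous u) :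
    Continuous (avgForce n g u) := by
  unfold avgForce
  apply intervalIntegral.continuous_parametric_intervalIntegral_of_continuous'
  fun_prop

theorem abs_avgForce_sub_le (n : ℕ) {g u g' u' : ℝ → ℝ} (hg : Continuous g) (hu : Continuous u)
    (hg' : Continuous g') (hu' : Continuous u') {r r' ε : ℝ}
    (h : ∀ t ∈ Icc (0 : ℝ) 1, |g (u (r * t)) - g' (u' (r' * t))| ≤ ε) :
    |avgForce n g u r - avgForce n g' u' r'| ≤ ε := by
  unfold avgForce
  rw [← intervalIntegral.integral_sub]
  · have := intervalIntegral.norm_integral_le_of_norm_le_const (a := (0 : ℝ)) (b := 1) (C := ε)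
      (f := fun t => t ^ n * g (u (r * t)) - t ^ n * g' (u' (r' * t))) ?_
    · simpa using this
    · intro t ht
      rw [uIoc_of_le zero_le_one] at ht
      have h1 := h t ⟨ht.1.le, ht.2⟩
      rw [← mul_sub, norm_mul, Real.norm_eq_abs, Real.norm_eq_abs,
        abs_of_nonneg (pow_nonneg ht.1.le n)]
      have h2 : t ^ n ≤ 1 := pow_le_one₀ ht.1.le ht.2
      calc t ^ n * _ ≤ 1 * ε := by gcongr
        _ = ε := one_mul _
  · apply Continuous.intervalIntegrable; fun_prop
  · apply Continuous.intervalIntegrable; fun_prop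

theorem abs_avgForce_le (n : ℕ) {g u : ℝ → ℝ} (hg : Continuous g) (hu : Continuous u) {G : ℝ}
    (h : ∀ s, |g s| ≤ G) (r : ℝ) : |avgForce n g u r| ≤ G := by
  have := abs_avgForce_sub_le n hg hu (g' := fun _ => 0) (u' := fun _ => 0) continuous_const
    continuous_const (r := r) (r' := 0) (ε := G) (by intro t _; simpa using h _)
  simpa [avgForce] using this

/-- The substitution s = r t trades the singular coefficient n/r for a factor r, so that the
velocity formula is continuous up to r = 0. -/
theorem pow_mul_avgForce (n : ℕ) (g u : ℝ → ℝ) (r : ℝ) :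
    r ^ n * (r * avgForce n g u r) = ∫ s in (0 : ℝ)..r, s ^ n * g (u s) := by
  have h := intervalIntegral.mul_integral_comp_mul_left (a := 0) (b := 1)
    (f := fun s => s ^ n * g (u s)) r
  simp only [mul_zero, mul_one] at h
  rw [← h, avgForce, mul_left_comm, ← intervalIntegral.integral_const_mul]
  congr 1
  apply intervalIntegral.integral_congr
  intro t _
  simp only [mul_pow]
  ring

/-- The velocity determined by the profile `u`. -/
noncomputable def velocityOf (n : ℕ) (g u : ℝ → ℝ) (r : ℝ) : ℝ := -(max r 0 * avgForce n g u (max r 0))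

theorem velocityOf_continuous (n : ℕ) {g u : ℝ → ℝ} (hg : Continuous g) (hu : Continuous u) :
    Continuous (velocityOf n g u) := by
  have := avgForce_continuous n hg hu
  unfold velocityOf
  fun_prop

theorem isSol_of_integral (n : ℕ) {g u : ℝ → ℝ} (hg : Continuous g) (hu : Continuous u) {α : ℝ}
    (h : ∀ r, u r = α + ∫ s in (0 : ℝ)..r, velocityOf n g u s) :
    IsSol n g u (velocityOf n g u) := by
  have hv := velocityOf_continuous n hg hu
  refine ⟨fun r => ?_, fun r hr => ?_, hv, fun r hr => by simp [velocityOf, max_eq_right hr]⟩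
  · have h1 := (hv.integral_hasStrictDerivAt 0 r).hasDerivAt.const_add α
    exact h1.congr_of_eventuallyEq (Eventually.of_forall h)
  · have hc : Continuous fun s => s ^ n * g (u s) := by fun_prop
    have hI := (hc.integral_hasStrictDerivAt 0 r).hasDerivAt
    have hp := ((hasDerivAt_pow n r).inv (pow_ne_zero n hr.ne')).mul hI
    have heq : velocityOf n g u =ᶠ[𝓝 r]
        fun x => -((x ^ n)⁻¹ * ∫ s in (0 : ℝ)..x, s ^ n * g (u s)) := by
      filter_upwards [lt_mem_nhds hr] with x hx
      rw [← pow_mul_avgForce n g u x, velocityOf, max_eq_left hx.le]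
      field_simp
    refine (hp.neg.congr_of_eventuallyEq heq).congr_deriv ?_
    simp only [Pi.inv_apply]
    rw [← pow_mul_avgForce n g u r, velocityOf, max_eq_left hr.le]
    rcases n with _ | n
    · simp
    · simp only [Nat.add_sub_cancel]
      field_simp
      ring

namespace IsSol

variable {n : ℕ} {g u v : ℝ → ℝ}

theorem cu (h : IsSol n g u v) : Continuous u :=
  continuous_iff_continuousAt.2 fun r => (h.du r).continuousAt

theorem deriv_flux (h : IsSol n g u v) {r : ℝ} (hr : 0 < r) :
    HasDerivAt (fun s => s ^ n * v s) (-(r ^ n * g (u r))) r := by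
  refine ((hasDerivAt_pow n r).mul (h.dv r hr)).congr_deriv ?_
  rcases n with _ | n
  · simp
  · simp only [Nat.add_sub_cancel]
    field_simp
    ring

/-- The flux r^n v vanishes at 0 and has derivative -r^n g(u). Hence every solution obeys the
integral formula, and comparisons can start at the singular point r = 0. -/
theorem v_eq (hn : 1 ≤ n) (hg : Continuous g) (h : IsSol n g u v) : v = velocityOf n g u := by
  funext r
  rcases le_or_gt r 0 with hr | hr
  · rw [h.v_nonpos r hr, velocityOf, max_eq_right hr]; simp
  · have hc : Continuous fun s => s ^ n * g (u s) := by have := h.cu; fun_prop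
    have h1 := intervalIntegral.integral_eq_sub_of_hasDerivAt_of_le hr.le
      (f := fun s => s ^ n * v s) (f' := fun s => -(s ^ n * g (u s)))
      (by have := h.cv; fun_prop) (fun x hx => h.deriv_flux hx.1)
      (hc.neg.intervalIntegrable _ _)
    rw [intervalIntegral.integral_neg, ← pow_mul_avgForce n g u r, zero_pow (by omega)] at h1
    have h2 : r ^ n ≠ 0 := pow_ne_zero n hr.ne'
    rw [velocityOf, max_eq_left hr.le]
    apply mul_left_cancel₀ h2
    linarith

theorem abs_v_le (hn : 1 ≤ n) (hg : Continuous g) (h : IsSol n g u v) {G : ℝ}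
    (hG : ∀ s, |g s| ≤ G) {r : ℝ} (hr : 0 ≤ r) : |v r| ≤ G * r := by
  rw [h.v_eq hn hg, velocityOf, max_eq_left hr, abs_neg, abs_mul, abs_of_nonneg hr, mul_comm]
  gcongr
  exact abs_avgForce_le n hg h.cu hG r

theorem neg (hodd : ∀ s, g (-s) = -g s) (h : IsSol n g u v) :
    IsSol n g (fun r => -u r) (fun r => -v r) :=
  ⟨fun r => (h.du r).neg,
    fun r hr => (h.dv r hr).neg.congr_deriv (by rw [hodd]; ring),
    h.cv.neg, fun r hr => by rw [h.v_nonpos r hr, neg_zero]⟩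

end IsSol

/-! ### Compactness of approximate solutions -/

/-- Arzelà–Ascoli along an ultrafilter: bounded values converge pointwise without passing to
subsequences, and the common Lipschitz bound upgrades this to uniform convergence through a finite
net. -/
theorem exists_tendstoUniformly_of_lipschitz {ι : Type*} (𝒰 : Ultrafilter ι) (u : ι → ℝ → ℝ)
    {C G : ℝ} (hG : 0 ≤ G) (h0 : ∀ i, |u i 0| ≤ C)
    (hL : ∀ i T, 0 ≤ T → ∀ r ≤ T, ∀ s ≤ T, |u i r - u i s| ≤ G * T * |r - s|) :
    ∃ w : ℝ → ℝ, (∀ r, Tendsto (fun i => u i r) 𝒰 (𝓝 (w r))) ∧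
      (∀ T, 0 ≤ T → ∀ r ≤ T, ∀ s ≤ T, |w r - w s| ≤ G * T * |r - s|) ∧
      ∀ T, ∀ ε > 0, ∀ᶠ i in (𝒰 : Filter ι), ∀ r ∈ Icc 0 T, |u i r - w r| < ε := by
  have hlim : ∀ r, ∃ x, Tendsto (fun i => u i r) 𝒰 (𝓝 x) := by
    intro r
    have hb : ∀ i, u i r ∈ Icc (-(C + G * max r 0 * |r|)) (C + G * max r 0 * |r|) := by
      intro i
      have h1 := hL i (max r 0) (le_max_right _ _) r (le_max_left _ _) 0 (le_max_right _ _)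
      rw [sub_zero] at h1
      have h2 := h0 i
      rw [abs_le] at h1 h2
      constructor <;> linarith [h1.1, h1.2, h2.1, h2.2]
    obtain ⟨x, -, hx⟩ := isCompact_Icc.ultrafilter_le_nhds (𝒰.map fun i => u i r)
      (le_principal_iff.2 (Filter.mem_map.2 (Filter.univ_mem' hb)))
    exact ⟨x, hx⟩
  choose w hw using hlim
  have hwL : ∀ T, 0 ≤ T → ∀ r ≤ T, ∀ s ≤ T, |w r - w s| ≤ G * T * |r - s| := by
    intro T hT r hr s hs
    exact le_of_tendsto ((hw r).sub (hw s)).abs (Eventually.of_forall fun i => hL i T hT r hr s hs)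
  refine ⟨w, hw, hwL, fun T ε hε => ?_⟩
  rcases lt_or_ge T 0 with hT | hT
  · exact Eventually.of_forall fun i r hr => absurd (hr.1.trans hr.2) (not_le.2 hT)
  set η := ε / (4 * (G * T + 1)) with hη
  have hGT : 0 ≤ G * T := mul_nonneg hG hT
  have hηpos : 0 < η := by positivity
  obtain ⟨t, htsub, htfin, htcov⟩ := (isCompact_Icc (a := (0 : ℝ)) (b := T)).finite_cover_balls hηpos
  have hev : ∀ᶠ i in (𝒰 : Filter ι), ∀ x ∈ t, |u i x - w x| < ε / 4 := by
    rw [eventually_all_finite htfin]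
    intro x _
    have := (hw x).eventually (Metric.ball_mem_nhds _ (show 0 < ε / 4 by positivity))
    simpa [Real.dist_eq] using this
  filter_upwards [hev] with i hi r hr
  obtain ⟨x, hx, hrx⟩ := mem_iUnion₂.1 (htcov hr)
  rw [Metric.mem_ball, Real.dist_eq] at hrx
  have h1 := hL i T hT r hr.2 x (htsub hx).2
  have h2 := hwL T hT r hr.2 x (htsub hx).2
  have h3 := hi x hx
  have h4 : G * T * |r - x| ≤ ε / 4 := by
    have : G * T * |r - x| ≤ (G * T + 1) * η := by gcongr; linarith
    refine this.trans (le_of_eq ?_)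
    rw [hη]; field_simp
  rw [abs_le] at h1 h2
  rw [abs_lt] at h3 ⊢
  constructor <;> linarith [h1.1, h1.2, h2.1, h2.2, h3.1, h3.2]

theorem lipschitz_of_velocity {u v : ℝ → ℝ} (hu : ∀ r, HasDerivAt u (v r) r) {G : ℝ}
    (hv0 : ∀ r ≤ 0, v r = 0) (hG : 0 ≤ G) (hv : ∀ r, 0 ≤ r → |v r| ≤ G * r) (T : ℝ) (hT : 0 ≤ T) :
    ∀ r ≤ T, ∀ s ≤ T, |u r - u s| ≤ G * T * |r - s| := by
  intro r hr s hs
  have := (convex_Iic T).norm_image_sub_le_of_norm_hasDerivWithin_le (f := u) (f' := v)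
    (C := G * T) (fun x _ => (hu x).hasDerivWithinAt) ?_ hs hr
  · simpa using this
  · intro x hx
    rcases le_total x 0 with h | h
    · rw [hv0 x h, norm_zero]; positivity
    · exact (hv x h).trans (by gcongr; exact hx)

/-- A family of approximate solutions clusters, along any ultrafilter, at a solution. -/
theorem exists_limit_isSol {ι : Type*} (𝒰 : Ultrafilter ι) {n : ℕ} {g : ℝ → ℝ}
    (hg : Continuous g) {C G : ℝ} (hG : 0 ≤ G) (u v : ι → ℝ → ℝ)
    (hu : ∀ i r, HasDerivAt (u i) (v i r) r) (hvc : ∀ i, Continuous (v i))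
    (hv0 : ∀ i, ∀ r ≤ 0, v i r = 0) (hv : ∀ i r, 0 ≤ r → |v i r| ≤ G * r)
    (hC : ∀ i, |u i 0| ≤ C)
    (happ : ∀ T, ∀ ε > 0, ∀ᶠ i in (𝒰 : Filter ι), ∀ r ∈ Icc 0 T,
      |v i r - velocityOf n g (u i) r| < ε)
    {α : ℝ} (hα : Tendsto (fun i => u i 0) 𝒰 (𝓝 α)) :
    ∃ u₀ v₀, IsSol n g u₀ v₀ ∧ u₀ 0 = α ∧ ∀ T, ∀ ε > 0, ∀ᶠ i in (𝒰 : Filter ι), ∀ r ∈ Icc 0 T,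
      |u i r - u₀ r| < ε ∧ |v i r - v₀ r| < ε := by
  have hLip := fun i => lipschitz_of_velocity (hu i) (hv0 i) hG (hv i)
  obtain ⟨w, hw, hwL, hunif⟩ := exists_tendstoUniformly_of_lipschitz 𝒰 u hG hC hLip
  have hwc : Continuous w := by
    rw [continuous_iff_continuousAt]
    intro r
    have : ContinuousOn w (Iio (max r 0 + 1)) := by
      have hl : LipschitzOnWith (Real.toNNReal (G * (max r 0 + 1))) w (Iio (max r 0 + 1)) := by
        apply LipschitzOnWith.of_dist_le_mul
        intro x hx y hy
        have hp : 0 ≤ max r 0 + 1 := by positivity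
        rw [Real.coe_toNNReal _ (by positivity), Real.dist_eq, Real.dist_eq]
        exact hwL _ hp x (le_of_lt hx) y (le_of_lt hy)
      exact hl.continuousOn
    exact this.continuousAt (Iio_mem_nhds (by linarith [le_max_left r 0]))
  have huc : ∀ i, Continuous (u i) := fun i =>
    continuous_iff_continuousAt.2 fun r => (hu i r).continuousAt
  have hvun : ∀ T, ∀ ε > 0, ∀ᶠ i in (𝒰 : Filter ι), ∀ r ∈ Icc 0 T,
      |v i r - velocityOf n g w r| < ε := by
    intro T ε hε
    rcases lt_or_ge T 0 with hT | hT
    · exact Eventually.of_forall fun i r hr => absurd (hr.1.trans hr.2) (not_le.2 hT)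
    -- The limit is bounded by D on [0, T] and eventually every approximation by D + 1, so only the
    -- uniform continuity of g on a compact interval is needed.
    obtain ⟨D, hD⟩ := (isCompact_Icc (a := (0 : ℝ)) (b := T)).exists_bound_of_continuousOn
      hwc.continuousOn
    have hguc := (isCompact_Icc (a := -(D + 1)) (b := D + 1)).uniformContinuousOn_of_continuous
      hg.continuousOn
    rw [Metric.uniformContinuousOn_iff] at hguc
    obtain ⟨δ, hδ, hδ'⟩ := hguc (ε / (2 * (T + 1))) (by positivity)
    filter_upwards [happ T (ε / 2) (by positivity), hunif T (min δ 1) (by positivity)]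
      with i h1 h2 r hr
    have h3 : |avgForce n g (u i) r - avgForce n g w r| ≤ ε / (2 * (T + 1)) := by
      refine abs_avgForce_sub_le n hg (huc i) hg hwc fun t ht => ?_
      have hrt : r * t ∈ Icc 0 T :=
        ⟨mul_nonneg hr.1 ht.1, (mul_le_of_le_one_right hr.1 ht.2).trans hr.2⟩
      have h4 := h2 _ hrt
      have h5 := hD _ hrt
      rw [Real.norm_eq_abs] at h5
      have h6 := h4.trans_le (min_le_left _ _)
      have h7 := h4.trans_le (min_le_right _ _)
      rw [abs_lt] at h7
      rw [abs_le] at h5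
      have h8 := hδ' (u i (r * t)) ⟨by linarith [h7.1, h5.1], by linarith [h7.2, h5.2]⟩
        (w (r * t)) ⟨by linarith [h5.1], by linarith [h5.2]⟩ h6
      exact h8.le
    have h4 : |velocityOf n g (u i) r - velocityOf n g w r| ≤ ε / 2 := by
      have : velocityOf n g (u i) r - velocityOf n g w r =
          -(r * (avgForce n g (u i) r - avgForce n g w r)) := by
        simp only [velocityOf, max_eq_left hr.1]; ring
      rw [this, abs_neg, abs_mul, abs_of_nonneg hr.1]
      calc r * _ ≤ (T + 1) * (ε / (2 * (T + 1))) := by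
            gcongr
            linarith [hr.2]
        _ = ε / 2 := by field_simp
    have := h1 r hr
    rw [abs_lt] at this ⊢
    rw [abs_le] at h4
    constructor <;> linarith [this.1, this.2, h4.1, h4.2]
  have hvc' := velocityOf_continuous n hg hwc
  have hw0 : w 0 = α := tendsto_nhds_unique (hw 0) hα
  -- Passing to the limit in u(r) = u(0) + ∫ v shows that the limit obeys the integral equation,
  -- from which differentiability follows.
  have hint : ∀ r, w r = α + ∫ s in (0 : ℝ)..r, velocityOf n g w s := by
    intro r
    refine tendsto_nhds_unique (hw r) ?_
    have h1 : ∀ i, u i r = u i 0 + ∫ s in (0 : ℝ)..r, v i s := by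
      intro i
      rw [intervalIntegral.integral_eq_sub_of_hasDerivAt (fun x _ => hu i x)
        ((hvc i).intervalIntegrable _ _)]
      ring
    simp_rw [h1]
    refine hα.add ?_
    rw [Metric.tendsto_nhds]
    intro ε hε
    filter_upwards [hvun r (ε / (2 * (|r| + 1))) (by positivity)] with i hi
    rw [Real.dist_eq, ← intervalIntegral.integral_sub ((hvc i).intervalIntegrable _ _)
      (hvc'.intervalIntegrable _ _), ← Real.norm_eq_abs]
    have h2 := intervalIntegral.norm_integral_le_of_norm_le_const (a := (0 : ℝ)) (b := r)
      (C := ε / (2 * (|r| + 1))) (f := fun s => v i s - velocityOf n g w s) ?_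
    · refine h2.trans_lt ?_
      rw [sub_zero]
      have h3 : ε / (2 * (|r| + 1)) * |r| ≤ ε / (2 * (|r| + 1)) * (|r| + 1) := by
        gcongr; linarith
      have h4 : ε / (2 * (|r| + 1)) * (|r| + 1) = ε / 2 := by field_simp
      linarith
    · intro s hs
      rcases le_total s 0 with h | h
      · rw [hv0 i s h, velocityOf, max_eq_right h]
        simp; positivity
      · rcases le_total r 0 with hr | hr
        · rw [uIoc_of_ge hr] at hs
          have : s = 0 := le_antisymm hs.2 h
          rw [hv0 i s this.le, velocityOf, this, max_self]
          simp; positivity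
        · rw [uIoc_of_le hr] at hs
          exact (hi s ⟨h, hs.2⟩).le
  exact ⟨w, velocityOf n g w, isSol_of_integral n hg hwc hint, hw0, fun T ε hε => by
    filter_upwards [hunif T ε hε, hvun T ε hε] with i h1 h2 r hr using ⟨h1 r hr, h2 r hr⟩⟩

/-! ### Existence by Tonelli's delays -/

/-- One step of the iteration with delay `h`. -/
noncomputable def delayStep (n : ℕ) (g : ℝ → ℝ) (α h : ℝ) (w : ℝ → ℝ) (r : ℝ) : ℝ :=
  α + ∫ s in (0 : ℝ)..r, -(max s 0 * avgForce n g (fun x => w (x - h)) (max s 0))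

theorem delayStep_of_nonpos (n : ℕ) (g : ℝ → ℝ) (α h : ℝ) (w : ℝ → ℝ) {r : ℝ} (hr : r ≤ 0) :
    delayStep n g α h w r = α := by
  unfold delayStep
  rw [intervalIntegral.integral_congr (g := fun _ => (0 : ℝ))]
  · simp
  · intro s hs
    rw [uIcc_of_ge hr] at hs
    simp [max_eq_right hs.2]

/-- The delayed profile is only read at arguments at most r - h. Each application of the step thus
settles the solution on a further interval of length h. -/
theorem delayStep_congr (n : ℕ) (g : ℝ → ℝ) {α h : ℝ} {w w' : ℝ → ℝ} {a : ℝ}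
    (hw : ∀ r ≤ a, w r = w' r) {r : ℝ} (hr : r ≤ a + h) :
    delayStep n g α h w r = delayStep n g α h w' r := by
  rcases le_total r 0 with h0 | h0
  · rw [delayStep_of_nonpos _ _ _ _ _ h0, delayStep_of_nonpos _ _ _ _ _ h0]
  unfold delayStep avgForce
  congr 1
  apply intervalIntegral.integral_congr
  intro s hs
  rw [uIcc_of_le h0] at hs
  simp only [max_eq_left hs.1]
  congr 2
  apply intervalIntegral.integral_congr
  intro t ht
  rw [uIcc_of_le zero_le_one] at ht
  simp only
  rw [hw]
  have : s * t ≤ s := mul_le_of_le_one_right hs.1 ht.2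
  linarith [hs.2]

theorem delayStep_continuous (n : ℕ) {g : ℝ → ℝ} (hg : Continuous g) (α h : ℝ) {w : ℝ → ℝ}
    (hw : Continuous w) : Continuous (delayStep n g α h w) := by
  have hw' : Continuous fun x => w (x - h) := by fun_prop
  have := avgForce_continuous n hg hw'
  unfold delayStep
  refine continuous_const.add (intervalIntegral.continuous_primitive (fun a b => ?_) 0)
  apply Continuous.intervalIntegrable
  fun_prop

theorem exists_delay_solution (n : ℕ) {g : ℝ → ℝ} (hg : Continuous g) (α : ℝ) {h : ℝ} (hh : 0 < h) :
    ∃ u : ℝ → ℝ, Continuous u ∧ delayStep n g α h u = u := by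
  set w : ℕ → ℝ → ℝ := fun j => (delayStep n g α h)^[j] fun _ => α with hw
  have hsucc : ∀ j, w (j + 1) = delayStep n g α h (w j) := fun j => by
    simp only [hw, Function.iterate_succ_apply']
  have hwc : ∀ j, Continuous (w j) := by
    intro j
    induction j with
    | zero => exact continuous_const
    | succ j ih => rw [hsucc]; exact delayStep_continuous n hg α h ih
  have hstep : ∀ j : ℕ, ∀ r ≤ j * h, w (j + 1) r = w j r := by
    intro j
    induction j with
    | zero =>
      intro r hr
      rw [hsucc, delayStep_of_nonpos _ _ _ _ _ (by simpa using hr)]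
      rfl
    | succ j ih =>
      intro r hr
      rw [hsucc (j + 1)]
      conv_rhs => rw [hsucc j]
      exact delayStep_congr n g (α := α) (h := h) (a := j * h) ih (by push_cast at hr; linarith)
  have hmono : ∀ i j : ℕ, i ≤ j → ∀ r ≤ i * h, w j r = w i r := by
    intro i j hij
    induction j, hij using Nat.le_induction with
    | base => intros; rfl
    | succ j hij ih =>
      intro r hr
      rw [hstep j r (hr.trans (by gcongr)), ih r hr]
  -- The iterates are stationary at r from index ⌈r / h⌉ on, so this diagonal is their common limit.
  set u : ℝ → ℝ := fun r => w ⌈r / h⌉₊ r with hu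
  have hagree : ∀ j : ℕ, ∀ r ≤ j * h, u r = w j r := by
    intro j r hr
    refine (hmono _ j (Nat.ceil_le.2 ((div_le_iff₀ hh).2 hr)) r ?_).symm
    exact (div_le_iff₀ hh).1 (Nat.le_ceil _)
  have hex : ∀ r, ∃ j : ℕ, r < j * h := by
    intro r
    obtain ⟨j, hj⟩ := exists_nat_gt (r / h)
    exact ⟨j, (div_lt_iff₀ hh).1 hj⟩
  refine ⟨u, ?_, ?_⟩
  · rw [continuous_iff_continuousAt]
    intro r
    obtain ⟨j, hj⟩ := hex r
    refine ((hwc j).continuousAt).congr ?_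
    filter_upwards [Iio_mem_nhds hj] with x hx using (hagree j x (le_of_lt hx)).symm
  · funext r
    obtain ⟨j, hj⟩ := hex r
    rw [delayStep_congr n g (hagree j) (by linarith), ← hsucc, hstep j r hj.le, hagree j r hj.le]

/-- Peano's theorem for the singular problem: g need not be Lipschitz at 0, so solutions of the
equations with delay 1/(i + 1) are taken to a limit instead of iterating a contraction. -/
theorem exists_isSol {n : ℕ} {g : ℝ → ℝ} (hg : Continuous g) {G : ℝ}
    (hG : ∀ s, |g s| ≤ G) (α : ℝ) : ∃ u v, IsSol n g u v ∧ u 0 = α := by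
  have hG0 : 0 ≤ G := (abs_nonneg _).trans (hG 0)
  choose u huc hu using fun i : ℕ =>
    exists_delay_solution n hg α (h := 1 / ((i : ℝ) + 1)) (by positivity)
  set d : ℕ → ℝ := fun i => 1 / ((i : ℝ) + 1) with hd
  have hus : ∀ i, Continuous fun x => u i (x - d i) := fun i => by
    have := huc i
    fun_prop
  set v : ℕ → ℝ → ℝ := fun i s => -(max s 0 * avgForce n g (fun x => u i (x - d i)) (max s 0))
    with hv
  have hvc : ∀ i, Continuous (v i) := by
    intro i
    have := avgForce_continuous n hg (hus i)
    simp only [hv]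
    fun_prop
  have hint : ∀ i r, u i r = α + ∫ s in (0 : ℝ)..r, v i s := fun i r => by
    conv_lhs => rw [← hu i]
    rfl
  have hu0 : ∀ i, u i 0 = α := fun i => by rw [hint]; simp
  have hder : ∀ i r, HasDerivAt (u i) (v i r) r := fun i r =>
    (((hvc i).integral_hasStrictDerivAt 0 r).hasDerivAt.const_add α).congr_of_eventuallyEq
      (Eventually.of_forall (hint i))
  have hv0 : ∀ i, ∀ r ≤ 0, v i r = 0 := fun i r hr => by simp [hv, max_eq_right hr]
  have hvb : ∀ i r, 0 ≤ r → |v i r| ≤ G * r := by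
    intro i r hr
    simp only [hv, max_eq_left hr]
    rw [abs_neg, abs_mul, abs_of_nonneg hr, mul_comm]
    gcongr
    exact abs_avgForce_le n hg (hus i) hG r
  have hLip := fun i => lipschitz_of_velocity (hder i) (hv0 i) hG0 (hvb i)
  have happ : ∀ T, ∀ ε > 0, ∀ᶠ i in ((hyperfilter ℕ : Ultrafilter ℕ) : Filter ℕ), ∀ r ∈ Icc 0 T,
      |v i r - velocityOf n g (u i) r| < ε := by
    intro T ε hε
    rcases lt_or_ge T 0 with hT | hT
    · exact Eventually.of_forall fun i r hr => absurd (hr.1.trans hr.2) (not_le.2 hT)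
    set D := |α| + G * T * (T + 1) with hD
    have hguc := (isCompact_Icc (a := -D) (b := D)).uniformContinuousOn_of_continuous
      hg.continuousOn
    rw [Metric.uniformContinuousOn_iff] at hguc
    obtain ⟨δ, hδ, hδ'⟩ := hguc (ε / (2 * (T + 1))) (by positivity)
    -- A shift of the argument by d i changes u i by at most G T (d i); this makes the delayed
    -- velocity asymptotically the true one.
    have hlim : Tendsto (fun i : ℕ => G * T * d i) atTop (𝓝 (G * T * 0)) :=
      tendsto_one_div_add_atTop_nhds_zero_nat.const_mul _
    rw [mul_zero] at hlim
    have hev := (hlim.eventually (gt_mem_nhds hδ)).filter_mono Nat.hyperfilter_le_atTop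
    filter_upwards [hev] with i hi r hr
    have hdpos : 0 < d i := by simp only [hd]; positivity
    have hdle : d i ≤ 1 := by
      simp only [hd]
      rw [div_le_one (by positivity)]
      linarith [(Nat.cast_nonneg i : (0 : ℝ) ≤ i)]
    have hmem : ∀ x ≤ T, -1 ≤ x → u i x ∈ Icc (-D) D := by
      intro x hx hx1
      have h1 := hLip i T hT x hx 0 hT
      rw [hu0, sub_zero] at h1
      have h2 : |x| ≤ T + 1 := abs_le.2 ⟨by linarith, by linarith⟩
      have h3 : G * T * |x| ≤ G * T * (T + 1) := by gcongr
      have h4 := abs_le.1 h1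
      have h5 := abs_le.1 (le_refl |α|)
      constructor <;> linarith [h4.1, h4.2, h5.1, h5.2]
    have h3 : |avgForce n g (fun x => u i (x - d i)) r - avgForce n g (u i) r|
        ≤ ε / (2 * (T + 1)) := by
      refine abs_avgForce_sub_le n hg (hus i) hg (huc i) fun t ht => ?_
      have hrt0 : 0 ≤ r * t := mul_nonneg hr.1 ht.1
      have hrt : r * t ≤ T := (mul_le_of_le_one_right hr.1 ht.2).trans hr.2
      refine (hδ' _ (hmem _ (by linarith) (by linarith)) _ (hmem _ hrt (by linarith)) ?_).le
      have := hLip i T hT (r * t - d i) (by linarith) (r * t) hrt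
      rw [show r * t - d i - r * t = -d i by ring, abs_neg, abs_of_pos hdpos] at this
      exact this.trans_lt hi
    have h4 : |v i r - velocityOf n g (u i) r| ≤ ε / 2 := by
      have : v i r - velocityOf n g (u i) r =
          -(r * (avgForce n g (fun x => u i (x - d i)) r - avgForce n g (u i) r)) := by
        simp only [hv, velocityOf, max_eq_left hr.1]; ring
      rw [this, abs_neg, abs_mul, abs_of_nonneg hr.1]
      calc r * _ ≤ (T + 1) * (ε / (2 * (T + 1))) := by
            gcongr
            linarith [hr.2]
        _ = ε / 2 := by field_simp
    linarith
  obtain ⟨w, w', h1, h2, -⟩ := exists_limit_isSol (hyperfilter ℕ) hg hG0 u v hder hvc hv0 hvb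
    (C := |α|) (fun i => by rw [hu0]) happ (α := α) (by simp [hu0])
  exact ⟨w, w', h1, h2⟩

/-- Solutions cluster along any ultrafilter at a solution. -/
theorem exists_limit_of_isSol {ι : Type*} (𝒰 : Ultrafilter ι) {n : ℕ} (hn : 1 ≤ n) {g : ℝ → ℝ}
    (hg : Continuous g) {C G : ℝ} (hG : ∀ s, |g s| ≤ G) (u v : ι → ℝ → ℝ)
    (hs : ∀ i, IsSol n g (u i) (v i)) (hC : ∀ i, |u i 0| ≤ C)
    {α : ℝ} (hα : Tendsto (fun i => u i 0) 𝒰 (𝓝 α)) :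
    ∃ u₀ v₀, IsSol n g u₀ v₀ ∧ u₀ 0 = α ∧ ∀ T, ∀ ε > 0, ∀ᶠ i in (𝒰 : Filter ι), ∀ r ∈ Icc 0 T,
      |u i r - u₀ r| < ε ∧ |v i r - v₀ r| < ε := by
  have hG0 : 0 ≤ G := (abs_nonneg _).trans (hG 0)
  refine exists_limit_isSol 𝒰 hg hG0 u v (fun i => (hs i).du) (fun i => (hs i).cv)
    (fun i => (hs i).v_nonpos) (fun i r hr => (hs i).abs_v_le hn hg hG hr) hC ?_ hα
  intro T ε hε
  refine Eventually.of_forall fun i r _ => ?_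
  rw [← (hs i).v_eq hn hg, sub_self, abs_zero]
  exact hε

/-! ### Energy -/

/-- The energy `v² / 2 + F(u)`. -/
noncomputable def nrg (g u v : ℝ → ℝ) (r : ℝ) : ℝ := v r ^ 2 / 2 + primF g (u r)

theorem hasDerivAt_primF {g : ℝ → ℝ} (hg : Continuous g) (s : ℝ) :
    HasDerivAt (primF g) (g s) s :=
  (hg.integral_hasStrictDerivAt 0 s).hasDerivAt

theorem continuous_primF {g : ℝ → ℝ} (hg : Continuous g) : Continuous (primF g) :=
  continuous_iff_continuousAt.2 fun s => (hasDerivAt_primF hg s).continuousAt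

@[simp] theorem primF_zero (g : ℝ → ℝ) : primF g 0 = 0 := by simp [primF]

theorem primF_neg {g : ℝ → ℝ} (hodd : ∀ s, g (-s) = -g s) (s : ℝ) :
    primF g (-s) = primF g s := by
  have := intervalIntegral.integral_comp_neg (a := 0) (b := s) g
  simp only [hodd, intervalIntegral.integral_neg, neg_zero] at this
  unfold primF
  rw [intervalIntegral.integral_symm, ← this, neg_neg]

theorem primF_abs {g : ℝ → ℝ} (hodd : ∀ s, g (-s) = -g s) (s : ℝ) :
    primF g |s| = primF g s := by
  rcases abs_choice s with h | h <;> rw [h]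
  exact primF_neg hodd s

theorem nrg_neg {g : ℝ → ℝ} (hodd : ∀ s, g (-s) = -g s) (u v : ℝ → ℝ) (r : ℝ) :
    nrg g (fun r => -u r) (fun r => -v r) r = nrg g u v r := by
  simp [nrg, primF_neg hodd]

theorem primF_le_nrg (g u v : ℝ → ℝ) (r : ℝ) : primF g (u r) ≤ nrg g u v r := by
  unfold nrg
  nlinarith [sq_nonneg (v r)]

namespace IsSol

variable {n : ℕ} {g u v : ℝ → ℝ}

theorem continuous_nrg (hg : Continuous g) (h : IsSol n g u v) : Continuous (nrg g u v) := by
  have := h.cu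
  have := h.cv
  have := continuous_primF hg
  unfold nrg
  fun_prop

theorem hasDerivAt_nrg (hg : Continuous g) (h : IsSol n g u v) {r : ℝ} (hr : 0 < r) :
    HasDerivAt (nrg g u v) (-((n : ℝ) / r * v r ^ 2)) r := by
  have h1 := ((h.dv r hr).pow 2).div_const 2
  have h2 := (hasDerivAt_primF hg (u r)).comp r (h.du r)
  refine (h1.add h2).congr_deriv ?_
  simp only [Nat.add_one_sub_one, pow_one]
  ring

theorem nrg_antitoneOn (hg : Continuous g) (h : IsSol n g u v) :
    AntitoneOn (nrg g u v) (Ici 0) := by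
  apply antitoneOn_of_hasDerivWithinAt_nonpos (convex_Ici 0)
    (h.continuous_nrg hg).continuousOn (f' := fun r => -((n : ℝ) / r * v r ^ 2))
  · intro r hr
    rw [interior_Ici] at hr
    exact (h.hasDerivAt_nrg hg hr).hasDerivWithinAt
  · intro r hr
    rw [interior_Ici, mem_Ioi] at hr
    simp only [Left.neg_nonpos_iff]
    positivity

theorem nrg_le (hg : Continuous g) (h : IsSol n g u v) {a b : ℝ} (ha : 0 ≤ a) (hab : a ≤ b) :
    nrg g u v b ≤ nrg g u v a :=
  h.nrg_antitoneOn hg ha (ha.trans hab : (0 : ℝ) ≤ b) hab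

/-- If the energy takes the same value twice, the solution is stationary in between. -/
theorem eq_of_nrg_le (hn : 1 ≤ n) (hg : Continuous g) (h : IsSol n g u v) {a b : ℝ} (ha : 0 ≤ a)
    (hE : nrg g u v a ≤ nrg g u v b) : ∀ r ∈ Icc a b, u r = u a := by
  -- Monotonicity makes the energy constant on [a, b]; its derivative -(n/r) v² then vanishes
  -- inside, and n ≥ 1 gives v = 0.
  have hv : ∀ r ∈ Ioo a b, v r = 0 := by
    intro r hr
    have hr0 : 0 < r := ha.trans_lt hr.1
    have hconst : nrg g u v =ᶠ[𝓝 r] fun _ => nrg g u v a := by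
      filter_upwards [Ioo_mem_nhds hr.1 hr.2] with x hx
      exact le_antisymm (h.nrg_le hg ha hx.1.le)
        (hE.trans (h.nrg_le hg (ha.trans hx.1.le) hx.2.le))
    have h1 := (h.hasDerivAt_nrg hg hr0).unique
      ((hasDerivAt_const r (nrg g u v a)).congr_of_eventuallyEq hconst)
    have hnr : (n : ℝ) / r ≠ 0 := by positivity
    have h2 : v r ^ 2 = 0 := by
      rcases mul_eq_zero.1 (neg_eq_zero.1 h1) with h3 | h3
      · exact absurd h3 hnr
      · exact h3
    exact pow_eq_zero_iff (two_ne_zero) |>.1 h2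
  intro r hr
  rcases eq_or_lt_of_le hr.1 with heq | hlt
  · rw [heq]
  obtain ⟨c, hc, hc'⟩ := exists_hasDerivAt_eq_slope u v hlt h.cu.continuousOn (fun x _ => h.du x)
  rw [hv c ⟨hc.1, hc.2.trans_le hr.2⟩] at hc'
  have := (div_eq_zero_iff.1 hc'.symm).resolve_right (by linarith)
  linarith

end IsSol

/-! ### Uniqueness away from the state (0, 0) -/

/-- Uniqueness for a linear differential inequality, by contraction of the supremum. -/
theorem eventually_zero_of_deriv_le {a b a' b' : ℝ → ℝ} {r₀ C : ℝ}
    (ha : ∀ᶠ r in 𝓝 r₀, HasDerivAt a (a' r) r) (hb : ∀ᶠ r in 𝓝 r₀, HasDerivAt b (b' r) r)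
    (ha0 : a r₀ = 0) (hb0 : b r₀ = 0)
    (ha' : ∀ᶠ r in 𝓝 r₀, |a' r| ≤ C * (|a r| + |b r|))
    (hb' : ∀ᶠ r in 𝓝 r₀, |b' r| ≤ C * (|a r| + |b r|)) :
    ∀ᶠ r in 𝓝 r₀, a r = 0 ∧ b r = 0 := by
  obtain ⟨ε, hε, hball⟩ := Metric.eventually_nhds_iff_ball.1 (ha.and (hb.and (ha'.and hb')))
  set D := |C| + 1 with hD
  have hDpos : 0 < D := by positivity
  -- With D h ≤ 1/4 the mean value inequality bounds each of |a| and |b|, at the point where their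
  -- sum has its maximum A, by A/4. Hence A ≤ A/2 and A = 0.
  set h := min (ε / 2) (1 / (4 * D)) with hh
  have hhpos : 0 < h := by positivity
  have hhε : h < ε := (min_le_left _ _).trans_lt (by linarith)
  have hhD : D * h ≤ 1 / 4 := by
    have : D * h ≤ D * (1 / (4 * D)) := by gcongr; exact min_le_right _ _
    refine this.trans (le_of_eq ?_)
    field_simp
  have hsub : ∀ r ∈ Icc (r₀ - h) (r₀ + h), r ∈ Metric.ball r₀ ε := by
    intro r hr
    rw [Metric.mem_ball, Real.dist_eq, abs_lt]
    constructor <;> linarith [hr.1, hr.2]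
  have hca : ContinuousOn (fun r => |a r| + |b r|) (Icc (r₀ - h) (r₀ + h)) := by
    intro r hr
    have h1 := (hball r (hsub r hr)).1.continuousAt
    have h2 := (hball r (hsub r hr)).2.1.continuousAt
    exact (h1.abs.add h2.abs).continuousWithinAt
  have hr0 : r₀ ∈ Icc (r₀ - h) (r₀ + h) := ⟨by linarith, by linarith⟩
  obtain ⟨m, hm, hmax⟩ := isCompact_Icc.exists_isMaxOn ⟨r₀, hr0⟩ hca
  set A := |a m| + |b m| with hA
  have hA0 : 0 ≤ A := by positivity
  have key : ∀ (f f' : ℝ → ℝ), (∀ r ∈ Icc (r₀ - h) (r₀ + h), HasDerivAt f (f' r) r) →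
      (∀ r ∈ Icc (r₀ - h) (r₀ + h), |f' r| ≤ C * (|a r| + |b r|)) → f r₀ = 0 →
      |f m| ≤ A / 4 := by
    intro f f' hf hf' hf0
    have := (convex_Icc (r₀ - h) (r₀ + h)).norm_image_sub_le_of_norm_hasDerivWithin_le (f := f)
      (f' := f') (C := D * A) (fun x hx => (hf x hx).hasDerivWithinAt) ?_ hr0 hm
    · rw [hf0, sub_zero, Real.norm_eq_abs, Real.norm_eq_abs] at this
      have h3 : |m - r₀| ≤ h := abs_le.2 ⟨by linarith [hm.1], by linarith [hm.2]⟩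
      calc |f m| ≤ D * A * |m - r₀| := this
        _ ≤ D * A * h := by gcongr
        _ = (D * h) * A := by ring
        _ ≤ 1 / 4 * A := by gcongr
        _ = A / 4 := by ring
    · intro x hx
      have h1 : |a x| + |b x| ≤ A := hmax hx
      rw [Real.norm_eq_abs]
      calc |f' x| ≤ C * (|a x| + |b x|) := hf' x hx
        _ ≤ D * (|a x| + |b x|) := by gcongr; linarith [le_abs_self C]
        _ ≤ D * A := by gcongr
  have h1 := key a a' (fun r hr => (hball r (hsub r hr)).1)
    (fun r hr => (hball r (hsub r hr)).2.2.1) ha0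
  have h2 := key b b' (fun r hr => (hball r (hsub r hr)).2.1)
    (fun r hr => (hball r (hsub r hr)).2.2.2) hb0
  have hAz : A = 0 := by linarith
  filter_upwards [Ioo_mem_nhds (show r₀ - h < r₀ by linarith) (show r₀ < r₀ + h by linarith)]
    with r hr
  have h3 : |a r| + |b r| ≤ A := hmax ⟨hr.1.le, hr.2.le⟩
  have h4 := abs_nonneg (a r)
  have h5 := abs_nonneg (b r)
  exact ⟨abs_eq_zero.1 (by linarith), abs_eq_zero.1 (by linarith)⟩

theorem exists_lipschitz_nhds {g : ℝ → ℝ} (hL : LocallyLipschitzOn {0}ᶜ g) {x : ℝ} (hx : x ≠ 0) :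
    ∃ K : ℝ, 0 ≤ K ∧ ∃ t ∈ 𝓝 x, ∀ a ∈ t, ∀ b ∈ t, |g a - g b| ≤ K * |a - b| := by
  obtain ⟨K, t, ht, hKt⟩ := hL (show x ∈ ({0}ᶜ : Set ℝ) from hx)
  rw [IsOpen.nhdsWithin_eq isOpen_compl_singleton hx] at ht
  refine ⟨K, K.2, t, ht, fun a ha b hb => ?_⟩
  simpa [Real.dist_eq] using hKt.dist_le_mul a ha b hb

namespace IsSol

variable {n : ℕ} {g u v u' v' : ℝ → ℝ}

/-- Off 0 the force is locally Lipschitz, so the differences of positions and of velocities satisfy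
a linear differential inequality. -/
theorem eventually_eq_of_u_ne (hL : LocallyLipschitzOn {0}ᶜ g) (h : IsSol n g u v)
    (h' : IsSol n g u' v') {r₀ : ℝ} (hr₀ : 0 < r₀) (hu : u r₀ = u' r₀) (hv : v r₀ = v' r₀)
    (hne : u r₀ ≠ 0) : ∀ᶠ r in 𝓝 r₀, u r = u' r ∧ v r = v' r := by
  obtain ⟨K, hK, t, ht, hKt⟩ := exists_lipschitz_nhds hL hne
  have hev := eventually_zero_of_deriv_le (a := fun r => u r - u' r) (b := fun r => v r - v' r)
    (a' := fun r => v r - v' r)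
    (b' := fun r => (-(n : ℝ) / r * v r - g (u r)) - (-(n : ℝ) / r * v' r - g (u' r)))
    (r₀ := r₀) (C := 1 + 2 * n / r₀ + K)
    (Eventually.of_forall fun r => (h.du r).sub (h'.du r))
    (by filter_upwards [lt_mem_nhds hr₀] with r hr using (h.dv r hr).sub (h'.dv r hr))
    (by simp [hu]) (by simp [hv]) ?_ ?_
  · filter_upwards [hev] with r hr
    exact ⟨by linarith [hr.1], by linarith [hr.2]⟩
  · refine Eventually.of_forall fun r => ?_
    have h1 := abs_nonneg (u r - u' r)
    have h2 := abs_nonneg (v r - v' r)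
    have h3 : 0 ≤ 2 * n / r₀ + K := by positivity
    nlinarith
  · filter_upwards [h.cu.continuousAt.preimage_mem_nhds ht,
      h'.cu.continuousAt.preimage_mem_nhds (by rwa [← hu]),
      lt_mem_nhds (show r₀ / 2 < r₀ by linarith)] with r h1 h2 h3
    have hr : 0 < r := by linarith
    have h4 := hKt _ h1 _ h2
    have h5 : (-(n : ℝ) / r * v r - g (u r)) - (-(n : ℝ) / r * v' r - g (u' r)) =
        -((n : ℝ) / r * (v r - v' r)) - (g (u r) - g (u' r)) := by ring
    rw [h5]
    have h6 : (n : ℝ) / r ≤ 2 * n / r₀ := by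
      rw [div_le_div_iff₀ hr hr₀]
      have : (0 : ℝ) ≤ n := Nat.cast_nonneg n
      nlinarith
    have h7 := abs_nonneg (u r - u' r)
    have h8 := abs_nonneg (v r - v' r)
    have h9 : 0 ≤ (n : ℝ) / r := by positivity
    calc |-((n : ℝ) / r * (v r - v' r)) - (g (u r) - g (u' r))|
        ≤ |-((n : ℝ) / r * (v r - v' r))| + |g (u r) - g (u' r)| := abs_sub _ _
      _ ≤ 2 * n / r₀ * |v r - v' r| + K * |u r - u' r| := by
          rw [abs_neg, abs_mul, abs_of_nonneg h9]
          gcongr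
      _ ≤ _ := by
          have : 0 ≤ 2 * n / r₀ := by positivity
          nlinarith [mul_nonneg this h7, mul_nonneg hK h8]

/-- This covers transversal zeros of u, where g may fail to be Lipschitz. The pair (u, E) replaces
(u, v): its equations involve g only through F, which is Lipschitz because g is bounded, and v is
recovered from v² = 2(E - F(u)) since v + v' is bounded away from 0. -/
theorem eventually_eq_of_v_ne (hg : Continuous g) {G : ℝ} (hG : ∀ s, |g s| ≤ G)
    (h : IsSol n g u v) (h' : IsSol n g u' v') {r₀ : ℝ} (hr₀ : 0 < r₀) (hu : u r₀ = u' r₀)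
    (hv : v r₀ = v' r₀) (hne : v r₀ ≠ 0) : ∀ᶠ r in 𝓝 r₀, u r = u' r ∧ v r = v' r := by
  have hG0 : 0 ≤ G := (abs_nonneg _).trans (hG 0)
  set m := |v r₀| with hm
  have hmpos : 0 < m := abs_pos.2 hne
  have hsum : ∀ᶠ r in 𝓝 r₀, m < |v r + v' r| := by
    have hc : ContinuousAt (fun r => |v r + v' r|) r₀ :=
      (h.cv.continuousAt.add h'.cv.continuousAt).abs
    apply hc.eventually (lt_mem_nhds _)
    show m < |v r₀ + v' r₀|
    rw [← hv, ← two_mul, abs_mul, abs_two]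
    linarith
  have hF : ∀ x y, |primF g x - primF g y| ≤ G * |x - y| := by
    intro x y
    have := (convex_univ (𝕜 := ℝ) (E := ℝ)).norm_image_sub_le_of_norm_hasDerivWithin_le
      (f := primF g) (f' := g) (C := G) (fun x _ => (hasDerivAt_primF hg x).hasDerivWithinAt)
      (fun x _ => hG x) (mem_univ y) (mem_univ x)
    simpa using this
  have hvsq : ∀ r, |v r ^ 2 - v' r ^ 2| ≤
      2 * (1 + G) * (|u r - u' r| + |nrg g u v r - nrg g u' v' r|) := by
    intro r
    have h1 : v r ^ 2 - v' r ^ 2 = 2 * (nrg g u v r - nrg g u' v' r) -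
        2 * (primF g (u r) - primF g (u' r)) := by unfold nrg; ring
    rw [h1]
    have h2 := hF (u r) (u' r)
    have h3 := abs_nonneg (u r - u' r)
    have h4 := abs_nonneg (nrg g u v r - nrg g u' v' r)
    calc _ ≤ |2 * (nrg g u v r - nrg g u' v' r)| + |2 * (primF g (u r) - primF g (u' r))| :=
          abs_sub _ _
      _ ≤ 2 * |nrg g u v r - nrg g u' v' r| + 2 * (G * |u r - u' r|) := by
          rw [abs_mul, abs_mul, abs_two]
          gcongr
      _ ≤ _ := by nlinarith [mul_nonneg hG0 h4]
  have hdv : ∀ r, m < |v r + v' r| → |v r - v' r| ≤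
      2 * (1 + G) / m * (|u r - u' r| + |nrg g u v r - nrg g u' v' r|) := by
    intro r hr
    have h1 : |v r - v' r| * |v r + v' r| = |v r ^ 2 - v' r ^ 2| := by
      rw [← abs_mul]; ring_nf
    have h2 := hvsq r
    rw [div_mul_eq_mul_div, le_div_iff₀ hmpos]
    refine le_trans ?_ h2
    rw [← h1]
    gcongr
  have hev := eventually_zero_of_deriv_le (a := fun r => u r - u' r)
    (b := fun r => nrg g u v r - nrg g u' v' r)
    (a' := fun r => v r - v' r)
    (b' := fun r => -((n : ℝ) / r * v r ^ 2) - -((n : ℝ) / r * v' r ^ 2))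
    (r₀ := r₀) (C := 2 * (1 + G) / m + 2 * n / r₀ * (2 * (1 + G)))
    (Eventually.of_forall fun r => (h.du r).sub (h'.du r))
    (by filter_upwards [lt_mem_nhds hr₀] with r hr using
      (h.hasDerivAt_nrg hg hr).sub (h'.hasDerivAt_nrg hg hr))
    (by simp [hu]) (by simp [nrg, hu, hv]) ?_ ?_
  · filter_upwards [hev, hsum] with r hr hs
    have h1 := hdv r hs
    rw [hr.1, hr.2] at h1
    simp only [abs_zero, add_zero, mul_zero, abs_nonpos_iff] at h1
    exact ⟨by linarith [hr.1], by linarith⟩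
  · filter_upwards [hsum] with r hr
    refine (hdv r hr).trans ?_
    have h1 : 0 ≤ 2 * n / r₀ * (2 * (1 + G)) := by positivity
    gcongr
    linarith
  · filter_upwards [lt_mem_nhds (show r₀ / 2 < r₀ by linarith)] with r h3
    have hr : 0 < r := by linarith
    have h6 : (n : ℝ) / r ≤ 2 * n / r₀ := by
      rw [div_le_div_iff₀ hr hr₀]
      have : (0 : ℝ) ≤ n := Nat.cast_nonneg n
      nlinarith
    have h5 : -((n : ℝ) / r * v r ^ 2) - -((n : ℝ) / r * v' r ^ 2) =
        -((n : ℝ) / r * (v r ^ 2 - v' r ^ 2)) := by ring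
    have h9 : 0 ≤ (n : ℝ) / r := by positivity
    rw [h5, abs_neg, abs_mul, abs_of_nonneg h9]
    have h1 : 0 ≤ 2 * (1 + G) / m := by positivity
    calc (n : ℝ) / r * |v r ^ 2 - v' r ^ 2| ≤ 2 * n / r₀ *
          (2 * (1 + G) * (|u r - u' r| + |nrg g u v r - nrg g u' v' r|)) := by
            gcongr
            exact hvsq r
      _ = (2 * n / r₀ * (2 * (1 + G))) * (|u r - u' r| + |nrg g u v r - nrg g u' v' r|) := by ring
      _ ≤ _ := by
          gcongr
          linarith

/-- Two solutions agreeing at one point agree as long as `(u, v) ≠ (0, 0)`. -/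
theorem eq_on_Ioc (hg : Continuous g) {G : ℝ} (hG : ∀ s, |g s| ≤ G)
    (hL : LocallyLipschitzOn {0}ᶜ g) (h : IsSol n g u v) (h' : IsSol n g u' v') {T r₀ : ℝ}
    (hr₀ : r₀ ∈ Ioc 0 T) (hu : u r₀ = u' r₀) (hv : v r₀ = v' r₀)
    (hne : ∀ r ∈ Ioc 0 T, u r ≠ 0 ∨ v r ≠ 0) : ∀ r ∈ Ioc 0 T, u r = u' r ∧ v r = v' r := by
  set A := {r | u r = u' r ∧ v r = v' r} with hA
  have hclosed : IsClosed A :=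
    (isClosed_eq h.cu h'.cu).inter (isClosed_eq h.cv h'.cv)
  have hint : ∀ r ∈ Ioc 0 T, r ∈ A → r ∈ interior A := by
    intro r hr hrA
    rw [mem_interior_iff_mem_nhds]
    rcases hne r hr with h1 | h1
    · exact h.eventually_eq_of_u_ne hL h' hr.1 hrA.1 hrA.2 h1
    · exact h.eventually_eq_of_v_ne hg hG h' hr.1 hrA.1 hrA.2 h1
  -- The set of agreement is closed, and on (0, T] local uniqueness makes it open; connectedness
  -- finishes.
  have := isPreconnected_Ioc.subset_left_of_subset_union isOpen_interior hclosed.isOpen_compl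
    (disjoint_compl_right.mono_left interior_subset)
    (fun r hr => by
      by_cases hrA : r ∈ A
      · exact Or.inl (hint r hr hrA)
      · exact Or.inr hrA) ⟨r₀, hr₀, hint r₀ hr₀ ⟨hu, hv⟩⟩
  intro r hr
  exact (interior_subset (this hr) : r ∈ A)

/-- At r = 0 the coefficient n/r is singular, so the contraction is run on the integral formula for
the velocity: the maximal difference A on [0, δ] satisfies A ≤ K A δ ≤ A/2. -/
theorem eventually_eq_zero (hn : 1 ≤ n) (hg : Continuous g) (hL : LocallyLipschitzOn {0}ᶜ g)
    (h : IsSol n g u v) (h' : IsSol n g u' v') (hu : u 0 = u' 0) (hne : u 0 ≠ 0) :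
    ∀ᶠ r in 𝓝[>] (0 : ℝ), u r = u' r ∧ v r = v' r := by
  obtain ⟨K, hK, t, ht, hKt⟩ := exists_lipschitz_nhds hL hne
  obtain ⟨ε, hε, hball⟩ := Metric.eventually_nhds_iff_ball.1
    ((h.cu.continuousAt.eventually ht).and (h'.cu.continuousAt.eventually (by rwa [← hu])))
  set δ := min (min (ε / 2) 1) (1 / (2 * (K + 1))) with hδ
  have hδpos : 0 < δ := by positivity
  have hδ1 : δ ≤ 1 := (min_le_left _ _).trans (min_le_right _ _)
  have hδε : δ < ε := ((min_le_left _ _).trans (min_le_left _ _)).trans_lt (by linarith)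
  have hδK : K * δ ≤ 1 / 2 := by
    have : K * δ ≤ (K + 1) * (1 / (2 * (K + 1))) := by
      gcongr
      · linarith
      · exact min_le_right _ _
    refine this.trans (le_of_eq ?_)
    field_simp
  have hc : ContinuousOn (fun r => |u r - u' r|) (Icc 0 δ) :=
    (h.cu.sub h'.cu).abs.continuousOn
  obtain ⟨m, hm, hmax⟩ := isCompact_Icc.exists_isMaxOn ⟨0, left_mem_Icc.2 hδpos.le⟩ hc
  set A := |u m - u' m| with hA
  have hA0 : 0 ≤ A := abs_nonneg _
  have hvd : ∀ r ∈ Icc 0 δ, |v r - v' r| ≤ K * A := by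
    intro r hr
    have hf : |avgForce n g u r - avgForce n g u' r| ≤ K * A := by
      refine abs_avgForce_sub_le n hg h.cu hg h'.cu fun s hs => ?_
      have hrs : r * s ∈ Icc 0 δ :=
        ⟨mul_nonneg hr.1 hs.1, (mul_le_of_le_one_right hr.1 hs.2).trans hr.2⟩
      have hb := hball (r * s) (by
        rw [Metric.mem_ball, Real.dist_eq, sub_zero, abs_of_nonneg hrs.1]
        linarith [hrs.2])
      refine (hKt _ hb.1 _ hb.2).trans ?_
      gcongr
      exact hmax hrs
    rw [h.v_eq hn hg, h'.v_eq hn hg]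
    simp only [velocityOf, max_eq_left hr.1]
    rw [← neg_sub_neg, neg_neg, neg_neg, ← mul_sub, abs_mul, abs_of_nonneg hr.1, abs_sub_comm]
    calc r * _ ≤ 1 * (K * A) := by gcongr; exact hr.2.trans hδ1
      _ = K * A := one_mul _
  have hmA : A ≤ K * A * δ := by
    have := (convex_Icc 0 δ).norm_image_sub_le_of_norm_hasDerivWithin_le
      (f := fun r => u r - u' r) (f' := fun r => v r - v' r) (C := K * A)
      (fun x _ => ((h.du x).sub (h'.du x)).hasDerivWithinAt) (fun x hx => hvd x hx)
      (left_mem_Icc.2 hδpos.le) hm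
    simp only [hu, sub_self, sub_zero, Real.norm_eq_abs] at this
    rw [abs_of_nonneg hm.1] at this
    refine this.trans ?_
    gcongr
    exact hm.2
  have hAz : A = 0 := by nlinarith
  filter_upwards [Ioo_mem_nhdsGT hδpos] with r hr
  have h1 : |u r - u' r| ≤ A := hmax ⟨hr.1.le, hr.2.le⟩
  have h2 := hvd r ⟨hr.1.le, hr.2.le⟩
  rw [hAz] at h1 h2
  rw [mul_zero] at h2
  exact ⟨by linarith [abs_nonpos_iff.1 h1], by linarith [abs_nonpos_iff.1 h2]⟩

theorem eq_of_init (hn : 1 ≤ n) (hg : Continuous g) {G : ℝ} (hG : ∀ s, |g s| ≤ G)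
    (hL : LocallyLipschitzOn {0}ᶜ g) (h : IsSol n g u v) (h' : IsSol n g u' v')
    (hu : u 0 = u' 0) {T : ℝ} (hne : ∀ r ∈ Icc 0 T, u r ≠ 0 ∨ v r ≠ 0) :
    ∀ r ∈ Icc 0 T, u r = u' r ∧ v r = v' r := by
  intro r hr
  rcases eq_or_lt_of_le hr.1 with h0 | h0
  · rw [← h0, h.v_nonpos 0 le_rfl, h'.v_nonpos 0 le_rfl]
    exact ⟨hu, rfl⟩
  have hT : 0 < T := h0.trans_le hr.2
  have hu0 : u 0 ≠ 0 := by
    rcases hne 0 ⟨le_rfl, hT.le⟩ with h1 | h1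
    · exact h1
    · exact absurd (h.v_nonpos 0 le_rfl) h1
  obtain ⟨r₀, hr₀, hr₀'⟩ :=
    ((h.eventually_eq_zero hn hg hL h' hu hu0).and (Ioo_mem_nhdsGT hT)).exists
  exact h.eq_on_Ioc hg hG hL h' ⟨hr₀'.1, hr₀'.2.le⟩ hr₀.1 hr₀.2
    (fun r hr => hne r ⟨hr.1.le, hr.2⟩) r ⟨h0, hr.2⟩

theorem const (hg : g s₀ = 0) : IsSol n g (fun _ => s₀) (fun _ => 0) :=
  ⟨fun r => hasDerivAt_const r s₀, fun r _ => (hasDerivAt_const r (0 : ℝ)).congr_deriv (by simp [hg]),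
    continuous_const, fun _ _ => rfl⟩

end IsSol

/-! ### Canonical solutions and continuous dependence -/

theorem hasDerivAt_truncate {f : ℝ → ℝ} {r₀ : ℝ} (hf : HasDerivAt f 0 r₀) (h0 : f r₀ = 0) :
    HasDerivAt (fun r => if r ≤ r₀ then f r else 0) 0 r₀ := by
  rw [hasDerivAt_iff_isLittleO] at hf ⊢
  refine Asymptotics.IsBigO.trans_isLittleO (Asymptotics.IsBigO.of_bound 1 ?_) hf
  refine Eventually.of_forall fun r => ?_
  simp only [le_refl, if_true, h0, smul_zero, sub_zero, one_mul]
  split_ifs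
  · exact le_rfl
  · simp

/-- A solution that stays at `0` once `(u, v) = (0, 0)`. -/
theorem exists_canonical {n : ℕ} {g : ℝ → ℝ} (hg : Continuous g) (g0 : g 0 = 0) {G : ℝ}
    (hG : ∀ s, |g s| ≤ G) (α : ℝ) : ∃ u v, IsSol n g u v ∧ u 0 = α ∧
      ∀ r, 0 ≤ r → u r = 0 → v r = 0 → ∀ s, r ≤ s → u s = 0 := by
  rcases eq_or_ne α 0 with rfl | hα
  · exact ⟨_, _, IsSol.const g0, rfl, fun _ _ _ _ _ _ => rfl⟩
  obtain ⟨u, v, h, hu0⟩ := exists_isSol (n := n) hg hG α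
  set D := {r : ℝ | 0 ≤ r ∧ u r = 0 ∧ v r = 0} with hD
  rcases D.eq_empty_or_nonempty with hDe | hDne
  · refine ⟨u, v, h, hu0, fun r hr h1 h2 => ?_⟩
    exact absurd (show r ∈ D from ⟨hr, h1, h2⟩) (by rw [hDe]; exact notMem_empty r)
  have hDc : IsClosed D := isClosed_Ici.inter
    ((isClosed_eq h.cu continuous_const).inter (isClosed_eq h.cv continuous_const))
  have hDb : BddBelow D := ⟨0, fun r hr => hr.1⟩
  -- This is the first time at which u and v vanish together. The solution may leave the rest state
  -- again; replacing it by 0 from then on gives another solution, which does not.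
  set r₀ := sInf D with hr₀
  obtain ⟨hr0, hur, hvr⟩ : r₀ ∈ D := hDc.csInf_mem hDne hDb
  have hr0pos : 0 < r₀ := by
    rcases eq_or_lt_of_le hr0 with h1 | h1
    · rw [← h1, hu0] at hur
      exact absurd hur hα
    · exact h1
  refine ⟨fun r => if r ≤ r₀ then u r else 0, fun r => if r ≤ r₀ then v r else 0,
    ⟨fun r => ?_, fun r hr => ?_, ?_, fun r hr => ?_⟩, ?_, ?_⟩
  · rcases lt_trichotomy r r₀ with h1 | h1 | h1
    · rw [if_pos h1.le]
      refine (h.du r).congr_of_eventuallyEq ?_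
      filter_upwards [Iio_mem_nhds h1] with x hx using if_pos (le_of_lt hx)
    · rw [h1, if_pos le_rfl, hvr]
      exact hasDerivAt_truncate (by simpa [hvr] using h.du r₀) hur
    · rw [if_neg (not_le.2 h1)]
      refine (hasDerivAt_const r (0 : ℝ)).congr_of_eventuallyEq ?_
      filter_upwards [Ioi_mem_nhds h1] with x hx using if_neg (not_le.2 hx)
  · rcases lt_trichotomy r r₀ with h1 | h1 | h1
    · rw [if_pos h1.le, if_pos h1.le]
      refine (h.dv r hr).congr_of_eventuallyEq ?_
      filter_upwards [Iio_mem_nhds h1] with x hx using if_pos (le_of_lt hx)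
    · rw [h1, if_pos le_rfl, if_pos le_rfl, hvr, hur, g0]
      simp only [mul_zero, sub_zero]
      exact hasDerivAt_truncate (by simpa [hvr, hur, g0] using h.dv r₀ hr0pos) hvr
    · rw [if_neg (not_le.2 h1), if_neg (not_le.2 h1), g0]
      simp only [mul_zero, sub_zero]
      refine (hasDerivAt_const r (0 : ℝ)).congr_of_eventuallyEq ?_
      filter_upwards [Ioi_mem_nhds h1] with x hx using if_neg (not_le.2 hx)
  · exact Continuous.if_le h.cv continuous_const continuous_id continuous_const
      (fun x hx => by rw [show x = r₀ from hx, hvr])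
  · simp only [if_pos (hr.trans hr0)]
    exact h.v_nonpos r hr
  · simp only [if_pos hr0]
    exact hu0
  · intro r hr h1 h2 s hs
    simp only at h1 h2 ⊢
    split_ifs at h1 h2 with hle
    · have : r₀ ≤ r := csInf_le hDb ⟨hr, h1, h2⟩
      have hrr : r = r₀ := le_antisymm hle this
      split_ifs with h3
      · rw [le_antisymm h3 (hrr ▸ hs), hur]
      · rfl
    · rw [if_neg (by linarith [not_le.1 hle])]

/-- A family of canonical solutions, continuous in the initial height. -/
theorem exists_family {n : ℕ} (hn : 1 ≤ n) {g : ℝ → ℝ} (hg : Continuous g) (g0 : g 0 = 0) {G : ℝ}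
    (hG : ∀ s, |g s| ≤ G) (hL : LocallyLipschitzOn {0}ᶜ g) :
    ∃ U V : ℝ → ℝ → ℝ, (∀ α, IsSol n g (U α) (V α)) ∧ (∀ α, U α 0 = α) ∧
      (∀ α r, 0 ≤ r → U α r = 0 → V α r = 0 → ∀ s, r ≤ s → U α s = 0) ∧
      ∀ α T, U α T ≠ 0 → ∀ ε > 0, ∀ᶠ α' in 𝓝 α, ∀ r ∈ Icc 0 T,
        |U α' r - U α r| < ε ∧ |V α' r - V α r| < ε := by
  choose U V h1 h2 h3 using fun α => exists_canonical (n := n) hg g0 hG α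
  refine ⟨U, V, h1, h2, h3, fun α T hT ε hε => ?_⟩
  by_contra hcon
  have hfreq : ∃ᶠ α' in 𝓝 α, ¬ ∀ r ∈ Icc 0 T,
      |U α' r - U α r| < ε ∧ |V α' r - V α r| < ε :=
    not_eventually.1 hcon
  rw [frequently_iff_neBot] at hfreq
  set l := 𝓝 α ⊓ 𝓟 {α' | ¬ ∀ r ∈ Icc 0 T, |U α' r - U α r| < ε ∧ |V α' r - V α r| < ε} with hl
  set 𝒰 := Ultrafilter.of l with h𝒰
  have hle : (𝒰 : Filter ℝ) ≤ l := Ultrafilter.of_le l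
  -- The compactness lemma wants a bound on all initial heights, so the index is clamped to [α - 1,
  -- α + 1]; this changes nothing near α.
  set p : ℝ → ℝ := fun x => max (α - 1) (min (α + 1) x) with hp
  have hpc : Continuous p := by fun_prop
  have hpα : p α = α := by simp [hp]
  have hpid : ∀ᶠ x in (𝒰 : Filter ℝ), p x = x := by
    refine (hle.trans inf_le_left) ?_
    filter_upwards [Ioo_mem_nhds (show α - 1 < α by linarith) (show α < α + 1 by linarith)] with x hx
    simp only [hp]
    rw [min_eq_right hx.2.le, max_eq_right hx.1.le]
  obtain ⟨u₀, v₀, hs, hu0, hconv⟩ := exists_limit_of_isSol 𝒰 hn hg hG (fun i => U (p i))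
    (fun i => V (p i)) (fun i => h1 _) (C := |α| + 1) (α := α)
    (fun i => by
      rw [h2, abs_le]
      have ha : α - 1 ≤ p i := le_max_left _ _
      have hb : p i ≤ α + 1 := max_le (by linarith) (min_le_left _ _)
      constructor <;> linarith [neg_abs_le α, le_abs_self α])
    (by
      simp only [h2]
      have := hpc.tendsto α
      rw [hpα] at this
      exact this.mono_left (hle.trans inf_le_left))
  -- A canonical solution that is nonzero at T has not met (0, 0) before, so it coincides with the
  -- ultrafilter limit on [0, T].
  have hnd : ∀ r ∈ Icc 0 T, U α r ≠ 0 ∨ V α r ≠ 0 := by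
    intro r hr
    by_contra hcon
    push Not at hcon
    exact hT (h3 α r hr.1 hcon.1 hcon.2 T hr.2)
  have heq := (h1 α).eq_of_init hn hg hG hL hs (by rw [h2, hu0]) hnd
  have hbad : ∀ᶠ x in (𝒰 : Filter ℝ), ¬ ∀ r ∈ Icc 0 T,
      |U x r - U α r| < ε ∧ |V x r - V α r| < ε :=
    (hle.trans inf_le_right) (mem_principal_self _)
  obtain ⟨x, hx1, hx2, hx3⟩ := (hbad.and (hpid.and (hconv T ε hε))).exists
  apply hx1
  intro r hr
  have := hx3 r hr
  rw [hx2] at this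
  rw [(heq r hr).1, (heq r hr).2]
  exact this

/-! ### Counting sign changes -/

/-- `u` has at least `k` sign changes in `(0, T]`. -/
def SignChangesOn (u : ℝ → ℝ) (T : ℝ) (k : ℕ) : Prop :=
  ∃ r : ℕ → ℝ, 0 < r 0 ∧ r k ≤ T ∧ (∀ i < k, r i < r (i + 1)) ∧ ∀ i < k, u (r i) * u (r (i + 1)) < 0

theorem hasSignChangesAtLeast_iff {u : ℝ → ℝ} {k : ℕ} :
    HasSignChangesAtLeast u k ↔ ∃ T, SignChangesOn u T k := by
  constructor
  · rintro ⟨r, hr, hpos, hsign⟩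
    refine ⟨r (Fin.last k), fun i => if h : i < k + 1 then r ⟨i, h⟩ else 0, ?_, ?_, ?_, ?_⟩
    · simpa using hpos 0
    · simp [Fin.last]
    · intro i hi
      dsimp only
      rw [dif_pos (by omega), dif_pos (by omega)]
      exact hr (Fin.mk_lt_mk.2 (Nat.lt_succ_self i))
    · intro i hi
      dsimp only
      rw [dif_pos (by omega), dif_pos (by omega)]
      exact hsign ⟨i, hi⟩
  · rintro ⟨T, r, h0, -, hlt, hsign⟩
    have hmono : StrictMono fun i : Fin (k + 1) => r i := by
      rw [Fin.strictMono_iff_lt_succ]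
      intro i
      simpa using hlt i i.2
    refine ⟨fun i => r i, hmono, fun i => ?_, fun i => ?_⟩
    · exact h0.trans_le (hmono.monotone (Fin.zero_le i))
    · simpa using hsign i i.2

theorem HasSignChangesAtLeast.mono {u : ℝ → ℝ} {j k : ℕ} (hjk : j ≤ k)
    (h : HasSignChangesAtLeast u k) : HasSignChangesAtLeast u j := by
  rw [hasSignChangesAtLeast_iff] at h ⊢
  obtain ⟨T, r, h0, -, hlt, hs⟩ := h
  exact ⟨r j, r, h0, le_rfl, fun i hi => hlt i (hi.trans_le hjk), fun i hi => hs i (hi.trans_le hjk)⟩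

theorem HasSignChangesAtLeast.neg {u : ℝ → ℝ} {k : ℕ} (h : HasSignChangesAtLeast u k) :
    HasSignChangesAtLeast (fun r => -u r) k := by
  obtain ⟨r, h1, h2, h3⟩ := h
  exact ⟨r, h1, h2, fun i => by simpa using h3 i⟩

theorem hasSignChangesAtLeast_neg {u : ℝ → ℝ} {k : ℕ} :
    HasSignChangesAtLeast (fun r => -u r) k ↔ HasSignChangesAtLeast u k :=
  ⟨fun h => by simpa using h.neg, fun h => h.neg⟩

theorem hasSignChangesAtLeast_zero (u : ℝ → ℝ) : HasSignChangesAtLeast u 0 :=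
  hasSignChangesAtLeast_iff.2 ⟨1, fun _ => 1, one_pos, le_rfl, by simp, by simp⟩

theorem monotone_chain {r : ℕ → ℝ} {k : ℕ} (h : ∀ i < k, r i < r (i + 1)) {i j : ℕ} (hij : i ≤ j)
    (hj : j ≤ k) : r i ≤ r j := by
  induction j, hij using Nat.le_induction with
  | base => exact le_rfl
  | succ j hij ih => exact (ih (by omega)).trans (h j (by omega)).le

theorem mul_neg_of_mul_pos {a b x y : ℝ} (h1 : 0 < a * x) (h2 : 0 < b * y) (h3 : x * y < 0) :
    a * b < 0 := by
  by_contra hab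
  have h4 : a * b * (x * y) ≤ 0 := mul_nonpos_of_nonneg_of_nonpos (not_lt.1 hab) h3.le
  have h5 := mul_pos h1 h2
  nlinarith

theorem mul_pos_of_abs_sub_lt {a b : ℝ} (h : |a - b| < |b|) : 0 < a * b := by
  rcases lt_trichotomy b 0 with hb | hb | hb
  · rw [abs_of_neg hb, abs_lt] at h
    exact mul_pos_of_neg_of_neg (by linarith [h.2]) hb
  · rw [hb, abs_zero] at h
    exact absurd h (not_lt.2 (abs_nonneg _))
  · rw [abs_of_pos hb, abs_lt] at h
    exact mul_pos (by linarith [h.1]) hb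

namespace SignChangesOn

variable {u : ℝ → ℝ} {T T' : ℝ} {k : ℕ}

/-- Sign changes all occur before a time after which the sign is constant. -/
theorem of_tail (h : SignChangesOn u T' k) (hT : 0 < T) (hne : u T ≠ 0)
    (htail : ∀ r, T ≤ r → r ≤ T' → 0 ≤ u r * u T) : SignChangesOn u T k := by
  obtain ⟨r, h0, hk, hlt, hs⟩ := h
  rcases le_or_gt (r k) T with hkT | hkT
  · exact ⟨r, h0, hkT, hlt, hs⟩
  rcases k with _ | j
  · exact ⟨fun _ => T, hT, le_rfl, by simp, by simp⟩
  have hsj := hs j (Nat.lt_succ_self j)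
  have hltj := hlt j (Nat.lt_succ_self j)
  have h1 := htail (r (j + 1)) hkT.le hk
  have h2 : 0 < u (r (j + 1)) * u T := by
    refine lt_of_le_of_ne h1 (Ne.symm (mul_ne_zero ?_ hne))
    intro hz
    rw [hz, mul_zero] at hsj
    exact lt_irrefl _ hsj
  -- Two consecutive sample points cannot both lie in the tail, where the sign is constant. So the
  -- last point alone exceeds T and may be replaced by T.
  have hrj : r j < T := by
    by_contra hcon
    have h3 := htail (r j) (not_lt.1 hcon) (hltj.le.trans hk)
    have h4 : 0 < u T * u T := mul_self_pos.2 hne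
    nlinarith [mul_nonneg h3 h1, mul_pos_of_neg_of_neg hsj (neg_neg_of_pos h4)]
  refine ⟨fun i => if i ≤ j then r i else T, by simpa using h0, by simp, ?_, ?_⟩
  · intro i hi
    rcases Nat.lt_succ_iff_lt_or_eq.1 hi with h3 | h3
    · simpa [h3.le, Nat.succ_le_of_lt h3] using hlt i (by omega)
    · subst h3
      simpa using hrj
  · intro i hi
    rcases Nat.lt_succ_iff_lt_or_eq.1 hi with h3 | h3
    · simpa [h3.le, Nat.succ_le_of_lt h3] using hs i (by omega)
    · subst h3
      simp only [le_refl, if_true, Nat.not_succ_le_self, if_false]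
      have h4 : 0 < u (r i) * u (r i) := mul_self_pos.2 (fun hz => by simp [hz] at hsj)
      exact mul_neg_of_mul_pos h4 (by linarith [mul_comm (u T) (u (r (i + 1)))]) hsj

/-- If the sign changes only once after time `T`, at most one sign change is lost. -/
theorem of_tail_succ {z : ℝ} (h : SignChangesOn u T' (k + 1)) (hT : 0 < T) (hne : u T ≠ 0)
    (h1 : ∀ r, T ≤ r → r ≤ z → 0 ≤ u r * u T) (h2 : ∀ r, z ≤ r → u r * u T ≤ 0) :
    SignChangesOn u T k := by
  obtain ⟨r, h0, hk, hlt, hs⟩ := h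
  rcases le_or_gt (r k) T with hkT | hkT
  · exact ⟨r, h0, hkT, fun i hi => hlt i (by omega), fun i hi => hs i (by omega)⟩
  have hsk := hs k (Nat.lt_succ_self k)
  have hltk := hlt k (Nat.lt_succ_self k)
  have hrz : r k ≤ z := by
    by_contra hcon
    have h3 := h2 (r k) (not_le.1 hcon).le
    have h4 := h2 (r (k + 1)) ((not_le.1 hcon).le.trans hltk.le)
    have h5 : 0 < u T * u T := mul_self_pos.2 hne
    nlinarith [mul_nonneg_of_nonpos_of_nonpos h3 h4,
      mul_pos_of_neg_of_neg hsk (neg_neg_of_pos h5)]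
  have h3 : SignChangesOn u z k :=
    ⟨r, h0, hrz, fun i hi => hlt i (by omega), fun i hi => hs i (by omega)⟩
  exact h3.of_tail hT hne h1

/-- The number of sign changes is lower semicontinuous. -/
theorem exists_stable (h : SignChangesOn u T k) : ∃ ε > 0, ∀ w : ℝ → ℝ,
    (∀ r ∈ Icc 0 T, |w r - u r| < ε) → SignChangesOn w T k := by
  obtain ⟨r, h0, hk, hlt, hs⟩ := h
  rcases Nat.eq_zero_or_pos k with rfl | hkpos
  · exact ⟨1, one_pos, fun w _ => ⟨r, h0, hk, by simp, by simp⟩⟩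
  have hne : ∀ i ≤ k, u (r i) ≠ 0 := by
    intro i hi hz
    rcases Nat.lt_or_ge i k with h1 | h1
    · have := hs i h1
      simp [hz] at this
    · have := hs (i - 1) (by omega)
      rw [Nat.sub_add_cancel (by omega), hz, mul_zero] at this
      exact lt_irrefl _ this
  -- The tolerance is the smallest value of |u| at the sample points, so none of the sampled signs
  -- can change.
  refine ⟨(Finset.range (k + 1)).inf' (Finset.nonempty_range_iff.2 (Nat.succ_ne_zero k))
    fun i => |u (r i)|, ?_, fun w hw => ?_⟩
  · rw [gt_iff_lt, Finset.lt_inf'_iff]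
    intro i hi
    exact abs_pos.2 (hne i (by simpa [Nat.lt_succ_iff] using hi))
  · refine ⟨r, h0, hk, hlt, fun i hi => ?_⟩
    have hw' : ∀ i ≤ k, 0 < w (r i) * u (r i) := by
      intro i hi
      apply mul_pos_of_abs_sub_lt
      refine (hw (r i) ⟨h0.le.trans (monotone_chain hlt (Nat.zero_le i) hi),
        (monotone_chain hlt hi le_rfl).trans hk⟩).trans_le ?_
      exact Finset.inf'_le _ (by simpa [Nat.lt_succ_iff] using hi)
    exact mul_neg_of_mul_pos (hw' i hi.le) (hw' (i + 1) hi) (hs i hi)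

end SignChangesOn

/-- The number of sign changes is upper semicontinuous, in the `C¹` topology, at a function with
only nondegenerate zeros. -/
theorem exists_signChangesOn_of_near {u v : ℝ → ℝ} (hu : Continuous u) (hv : Continuous v) {T : ℝ}
    (hT : 0 < T) (h0 : u 0 ≠ 0) (hTne : u T ≠ 0) (hne : ∀ r ∈ Icc 0 T, u r ≠ 0 ∨ v r ≠ 0) :
    ∃ ε > 0, ∀ u' v' : ℝ → ℝ, (∀ r, HasDerivAt u' (v' r) r) →
      (∀ r ∈ Icc 0 T, |u' r - u r| < ε ∧ |v' r - v r| < ε) →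
      ∀ k, SignChangesOn u' T k → SignChangesOn u T k := by
  have hc : ContinuousOn (fun r => |u r| + |v r|) (Icc 0 T) := (hu.abs.add hv.abs).continuousOn
  obtain ⟨m, hm, hmin⟩ := isCompact_Icc.exists_isMinOn ⟨0, left_mem_Icc.2 hT.le⟩ hc
  have hmpos : 0 < |u m| + |v m| := by
    rcases hne m hm with h | h
    · have := abs_pos.2 h; positivity
    · have := abs_pos.2 h; positivity
  -- The margin 3 ε lies below |u| + |v| on [0, T] and below |u| at both ends. At a critical point
  -- of a nearby function this forces |u| ≥ 2 ε, hence equal signs.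
  set ε := min ((|u m| + |v m|) / 3) (min (|u 0| / 3) (|u T| / 3)) with hε
  have hεpos : 0 < ε := by
    have := abs_pos.2 h0
    have := abs_pos.2 hTne
    positivity
  have hε1 : ∀ r ∈ Icc 0 T, 3 * ε ≤ |u r| + |v r| := by
    intro r hr
    have h1 : |u m| + |v m| ≤ |u r| + |v r| := hmin hr
    have h2 : ε ≤ (|u m| + |v m|) / 3 := min_le_left _ _
    linarith
  have hε2 : 3 * ε ≤ |u 0| := by
    have : ε ≤ |u 0| / 3 := (min_le_right _ _).trans (min_le_left _ _)
    linarith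
  have hε3 : 3 * ε ≤ |u T| := by
    have : ε ≤ |u T| / 3 := (min_le_right _ _).trans (min_le_right _ _)
    linarith
  obtain ⟨η, hη, hη'⟩ := Metric.continuous_iff.1 hu 0 |u 0| (abs_pos.2 h0)
  refine ⟨ε, hεpos, fun u' v' hu' hclose k hk => ?_⟩
  obtain ⟨r, hr0, hrk, hlt, hs⟩ := hk
  rcases Nat.eq_zero_or_pos k with rfl | hkpos
  · exact ⟨r, hr0, hrk, by simp, by simp⟩
  have huc : Continuous u' := continuous_iff_continuousAt.2 fun r => (hu' r).continuousAt
  have hz : ∀ i, ∃ z, i < k → z ∈ Ioo (r i) (r (i + 1)) ∧ u' z = 0 := by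
    intro i
    by_cases hi : i < k
    · have hlti := hlt i hi
      have hsi := hs i hi
      rcases mul_neg_iff.1 hsi with ⟨h1, h2⟩ | ⟨h1, h2⟩
      · obtain ⟨z, hz1, hz2⟩ := intermediate_value_Ioo' hlti.le huc.continuousOn ⟨h2, h1⟩
        exact ⟨z, fun _ => ⟨hz1, hz2⟩⟩
      · obtain ⟨z, hz1, hz2⟩ := intermediate_value_Ioo hlti.le huc.continuousOn ⟨h1, h2⟩
        exact ⟨z, fun _ => ⟨hz1, hz2⟩⟩
    · exact ⟨0, fun h => absurd h hi⟩
  choose z hz using hz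
  have hne' : ∀ i ≤ k, u' (r i) ≠ 0 := by
    intro i hi hz
    rcases Nat.lt_or_ge i k with h1 | h1
    · have := hs i h1
      simp [hz] at this
    · have := hs (i - 1) (by omega)
      rw [Nat.sub_add_cancel (by omega), hz, mul_zero] at this
      exact lt_irrefl _ this
  -- Between the chosen zeros of u' surrounding r i, take a point c maximizing u' in the direction
  -- of its sign at r i. Such a point is critical, or it is 0 or T; in all cases u has the sign of
  -- u' there. The zeros of u' separate these points and keep them ordered.
  have key : ∀ i, ∃ c, i ≤ k → 0 < c ∧ c ≤ T ∧ 0 < u c * u' (r i) ∧ (i < k → c < z i) ∧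
      ∀ j, i = j + 1 → z j < c := by
    intro i
    by_cases hi : i ≤ k
    swap
    · exact ⟨0, fun h => absurd h hi⟩
    obtain ⟨a, b, ha0, har, hrb, hbT, ha, hb⟩ : ∃ a b, 0 ≤ a ∧ a < r i ∧ r i ≤ b ∧ b ≤ T ∧
        ((a = 0 ∧ i = 0) ∨ (u' a = 0 ∧ ∀ j, i = j + 1 → z j = a)) ∧
        ((b = T ∧ i = k) ∨ (u' b = 0 ∧ z i = b)) := by
      have hA : ∃ a, 0 ≤ a ∧ a < r i ∧
          ((a = 0 ∧ i = 0) ∨ (u' a = 0 ∧ ∀ j, i = j + 1 → z j = a)) := by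
        rcases i with _ | j
        · exact ⟨0, le_rfl, hr0, Or.inl ⟨rfl, rfl⟩⟩
        · have := hz j (by omega)
          refine ⟨z j, ?_, this.1.2, Or.inr ⟨this.2, fun j' hj' => ?_⟩⟩
          · exact hr0.le.trans ((monotone_chain hlt (Nat.zero_le j) (by omega)).trans this.1.1.le)
          · rw [Nat.succ_injective hj']
      have hB : ∃ b, r i ≤ b ∧ b ≤ T ∧ ((b = T ∧ i = k) ∨ (u' b = 0 ∧ z i = b)) := by
        rcases Nat.lt_or_ge i k with h1 | h1
        · have := hz i h1
          exact ⟨z i, this.1.1.le, this.1.2.le.trans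
            ((monotone_chain hlt h1 le_rfl).trans hrk), Or.inr ⟨this.2, rfl⟩⟩
        · have hik : i = k := by omega
          exact ⟨T, hik ▸ hrk, le_rfl, Or.inl ⟨rfl, hik⟩⟩
      obtain ⟨a, h1, h2, h3⟩ := hA
      obtain ⟨b, h4, h5, h6⟩ := hB
      exact ⟨a, b, h1, h2, h4, h5, h3, h6⟩
    have hcφ : ContinuousOn (fun x => u' (r i) * u' x) (Icc a b) :=
      (continuous_const.mul huc).continuousOn
    obtain ⟨c, hc, hmax⟩ := isCompact_Icc.exists_isMaxOn ⟨r i, har.le, hrb⟩ hcφ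
    have hcpos : 0 < u' (r i) * u' c :=
      (mul_self_pos.2 (hne' i hi)).trans_le (hmax (show r i ∈ Icc a b from ⟨har.le, hrb⟩))
    have hcne : u' c ≠ 0 := fun h => by simp [h] at hcpos
    have hcT : c ∈ Icc 0 T := ⟨ha0.trans hc.1, hc.2.trans hbT⟩
    have hsign : 2 * ε ≤ |u c| → 0 < u c * u' (r i) := by
      intro h2
      have h3 := mul_pos_of_abs_sub_lt (((hclose c hcT).1).trans_le (by linarith : ε ≤ |u c|))
      by_contra hcon
      have h4 : 0 < u' c * u' c := mul_self_pos.2 hcne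
      nlinarith [mul_pos h3 hcpos]
    rcases eq_or_lt_of_le hc.1 with hca | hca
    · -- the maximum is at the left end, which must be `0`
      rcases ha with ⟨ha, hi0⟩ | ⟨ha, -⟩
      · subst hi0
        have hb0 : 0 < b := hr0.trans_le hrb
        have hc0 : c = 0 := by rw [← hca, ha]
        have hs0 := hsign (by rw [hc0]; linarith)
        rw [hc0] at hs0
        -- Sample times must be positive, so a maximum at 0 is moved slightly to the right, where u
        -- keeps its sign.
        set c' := min (η / 2) (b / 2) with hc'
        have hc'pos : 0 < c' := by positivity
        have hc'b : c' < b := (min_le_right _ _).trans_lt (by linarith)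
        refine ⟨c', fun _ => ⟨hc'pos, hc'b.le.trans hbT, ?_, fun hk0 => ?_, fun j hj => by omega⟩⟩
        · have h5 := hη' c' (by
            rw [Real.dist_eq, sub_zero, abs_of_pos hc'pos]
            exact (min_le_left _ _).trans_lt (by linarith))
          rw [Real.dist_eq] at h5
          have h6 := mul_pos_of_abs_sub_lt h5
          by_contra hcon
          have h4 : 0 < u 0 * u 0 := mul_self_pos.2 h0
          nlinarith [mul_pos h6 hs0]
        · rcases hb with ⟨-, hb⟩ | ⟨-, hb⟩
          · omega
          · rwa [hb]
      · rw [hca] at ha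
        exact absurd ha hcne
    · have hcpos' : 0 < c := ha0.trans_lt hca
      have hleft : ∀ j, i = j + 1 → z j < c := by
        intro j hj
        rcases ha with ⟨-, ha⟩ | ⟨-, ha⟩
        · omega
        · rwa [ha j hj]
      rcases eq_or_lt_of_le hc.2 with hcb | hcb
      · rcases hb with ⟨hb, hik⟩ | ⟨hb, -⟩
        · refine ⟨c, fun _ => ⟨hcpos', hcT.2, hsign ?_, fun h => by omega, hleft⟩⟩
          rw [hcb, hb]
          linarith
        · rw [← hcb] at hb
          exact absurd hb hcne
      · refine ⟨c, fun _ => ⟨hcpos', hcT.2, hsign ?_, fun h => ?_, hleft⟩⟩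
        · have hloc : IsLocalMax (fun x => u' (r i) * u' x) c :=
            hmax.isLocalMax (Icc_mem_nhds hca hcb)
          have h5 := hloc.hasDerivAt_eq_zero ((hu' c).const_mul (u' (r i)))
          have h6 : v' c = 0 := (mul_eq_zero.1 h5).resolve_left (hne' i hi)
          have h7 := (hclose c hcT).2
          rw [h6, zero_sub, abs_neg] at h7
          linarith [hε1 c hcT]
        · rcases hb with ⟨-, hb⟩ | ⟨-, hb⟩
          · omega
          · rwa [hb]
  choose c hc using key
  refine ⟨c, (hc 0 (Nat.zero_le k)).1, (hc k le_rfl).2.1, fun i hi => ?_, fun i hi => ?_⟩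
  · exact ((hc i hi.le).2.2.2.1 hi).trans ((hc (i + 1) hi).2.2.2.2 i rfl)
  · exact mul_neg_of_mul_pos (hc i hi.le).2.2.1 (hc (i + 1) hi).2.2.1 (hs i hi)

/-- A function with boundedly many sign changes eventually has constant sign. -/
theorem exists_tail_sign {u : ℝ → ℝ} (hu : Continuous u) (h0 : u 0 ≠ 0) {k : ℕ}
    (hk : ¬ HasSignChangesAtLeast u (k + 1)) :
    ∃ R > 0, u R ≠ 0 ∧ ∀ r ≥ R, 0 ≤ u r * u R := by
  classical
  -- Take a chain realizing the maximal number of sign changes: a later value of the opposite sign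
  -- would lengthen it.
  have hex : ∃ j, ¬ HasSignChangesAtLeast u j := ⟨_, hk⟩
  obtain ⟨j, hj⟩ : ∃ j, Nat.find hex = j + 1 := by
    refine Nat.exists_eq_succ_of_ne_zero fun hz => Nat.find_spec hex ?_
    rw [hz]
    exact hasSignChangesAtLeast_zero u
  have h1 : HasSignChangesAtLeast u j := not_not.1 (Nat.find_min hex (by omega))
  have h2 : ¬ HasSignChangesAtLeast u (j + 1) := hj ▸ Nat.find_spec hex
  obtain ⟨T, r, hr0, hrT, hlt, hs⟩ := hasSignChangesAtLeast_iff.1 h1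
  obtain ⟨r, hr0, hlt, hs, hne⟩ : ∃ r : ℕ → ℝ, 0 < r 0 ∧ (∀ i < j, r i < r (i + 1)) ∧
      (∀ i < j, u (r i) * u (r (i + 1)) < 0) ∧ u (r j) ≠ 0 := by
    rcases j with _ | j
    · obtain ⟨x, hx1, hx2⟩ := ((hu.continuousAt.eventually_ne h0).filter_mono
        nhdsWithin_le_nhds |>.and (self_mem_nhdsWithin (a := (0 : ℝ)) (s := Ioi 0))).exists
      exact ⟨fun _ => x, hx2, by simp, by simp, hx1⟩
    · refine ⟨r, hr0, hlt, hs, fun hz => ?_⟩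
      have := hs j (Nat.lt_succ_self j)
      simp [hz] at this
  refine ⟨r j, hr0.trans_le (monotone_chain hlt (Nat.zero_le j) le_rfl), hne, fun x hx => ?_⟩
  by_contra hcon
  apply h2
  have hx' : r j < x := by
    refine lt_of_le_of_ne hx fun heq => hcon ?_
    rw [heq]
    exact mul_self_nonneg _
  refine hasSignChangesAtLeast_iff.2 ⟨x, fun i => if i ≤ j then r i else x, by simpa using hr0,
    by simp, fun i hi => ?_, fun i hi => ?_⟩
  · rcases Nat.lt_succ_iff_lt_or_eq.1 hi with h3 | h3
    · simpa [h3.le, Nat.succ_le_of_lt h3] using hlt i h3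
    · subst h3
      simpa using hx'
  · rcases Nat.lt_succ_iff_lt_or_eq.1 hi with h3 | h3
    · simpa [h3.le, Nat.succ_le_of_lt h3] using hs i h3
    · subst h3
      simp only [le_refl, if_true, Nat.not_succ_le_self, if_false]
      rw [mul_comm]
      exact not_le.1 hcon

/-! ### First zeros and monotone stretches -/

theorem exists_first_zero {φ : ℝ → ℝ} (hφ : Continuous φ) {a b : ℝ} (hab : a ≤ b) (ha : 0 < φ a)
    (hb : φ b ≤ 0) : ∃ c, a < c ∧ c ≤ b ∧ φ c = 0 ∧ ∀ x, a ≤ x → x < c → 0 < φ x := by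
  set S := {x | x ∈ Icc a b ∧ φ x ≤ 0} with hS
  have hSc : IsClosed S := isClosed_Icc.inter (isClosed_le hφ continuous_const)
  have hSb : BddBelow S := ⟨a, fun x hx => hx.1.1⟩
  obtain ⟨⟨h1, h2⟩, h3⟩ : sInf S ∈ S := hSc.csInf_mem ⟨b, ⟨hab, le_rfl⟩, hb⟩ hSb
  have hpos : ∀ x, a ≤ x → x < sInf S → 0 < φ x := by
    intro x hx hxS
    by_contra hcon
    exact absurd (csInf_le hSb ⟨⟨hx, hxS.le.trans h2⟩, not_lt.1 hcon⟩) (not_le.2 hxS)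
  have hac : a < sInf S := lt_of_le_of_ne h1 fun heq => by rw [← heq] at h3; linarith
  refine ⟨sInf S, hac, h2, le_antisymm h3 ?_, hpos⟩
  refine ge_of_tendsto (hφ.continuousWithinAt (s := Iio (sInf S)) (x := sInf S)) ?_
  filter_upwards [Ioo_mem_nhdsLT hac] with x hx using (hpos x hx.1.le hx.2).le

theorem exists_last_zero {φ : ℝ → ℝ} (hφ : Continuous φ) {a b : ℝ} (hab : a ≤ b) (ha : φ a ≤ 0)
    (hb : 0 < φ b) : ∃ c, a ≤ c ∧ c < b ∧ φ c = 0 ∧ ∀ x, c < x → x ≤ b → 0 < φ x := by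
  obtain ⟨c, h1, h2, h3, h4⟩ := exists_first_zero (φ := fun x => φ (-x)) (by fun_prop)
    (neg_le_neg hab) (by simpa using hb) (by simpa using ha)
  refine ⟨-c, by linarith, by linarith, h3, fun x hx hx' => ?_⟩
  simpa using h4 (-x) (by linarith) (by linarith)

theorem exists_lt_of_hasDerivAt_neg {u : ℝ → ℝ} {a b d : ℝ} (hu : HasDerivAt u d a) (hd : d < 0)
    (hab : a < b) : ∃ x, a < x ∧ x < b ∧ u x < u a := by
  have h1 := hu.tendsto_slope.mono_left (nhdsGT_le_nhdsNE a)
  obtain ⟨x, hx, hx'⟩ := ((h1.eventually (gt_mem_nhds hd)).and (Ioo_mem_nhdsGT hab)).exists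
  refine ⟨x, hx'.1, hx'.2, ?_⟩
  rw [slope_def_field, div_neg_iff] at hx
  rcases hx with h | h
  · linarith [h.2, hx'.1]
  · linarith [h.1]

theorem exists_gt_of_hasDerivAt_pos {u : ℝ → ℝ} {a b d : ℝ} (hu : HasDerivAt u d a) (hd : 0 < d)
    (hab : a < b) : ∃ x, a < x ∧ x < b ∧ u a < u x := by
  obtain ⟨x, h1, h2, h3⟩ := exists_lt_of_hasDerivAt_neg hu.neg (neg_neg_of_pos hd) hab
  exact ⟨x, h1, h2, by simpa using h3⟩

namespace IsSol

variable {n : ℕ} {g u v : ℝ → ℝ}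

theorem antitoneOn_Icc (h : IsSol n g u v) {a b : ℝ} (hv : ∀ r ∈ Icc a b, v r ≤ 0) :
    AntitoneOn u (Icc a b) :=
  antitoneOn_of_hasDerivWithinAt_nonpos (convex_Icc a b) h.cu.continuousOn
    (fun r _ => (h.du r).hasDerivWithinAt) fun r hr => hv r (interior_subset hr)

theorem monotoneOn_Icc (h : IsSol n g u v) {a b : ℝ} (hv : ∀ r ∈ Icc a b, 0 ≤ v r) :
    MonotoneOn u (Icc a b) :=
  monotoneOn_of_hasDerivWithinAt_nonneg (convex_Icc a b) h.cu.continuousOn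
    (fun r _ => (h.du r).hasDerivWithinAt) fun r hr => hv r (interior_subset hr)

theorem lt_of_v_neg (h : IsSol n g u v) {a b : ℝ} (hab : a < b) (hv : ∀ r ∈ Ioo a b, v r < 0) :
    u b < u a := by
  obtain ⟨c, hc, hc'⟩ := exists_hasDerivAt_eq_slope u v hab h.cu.continuousOn fun x _ => h.du x
  have := hv c hc
  rw [hc', div_neg_iff] at this
  rcases this with h1 | h1 <;> linarith [h1.1, h1.2]

theorem lt_of_v_pos (h : IsSol n g u v) {a b : ℝ} (hab : a < b) (hv : ∀ r ∈ Ioo a b, 0 < v r) :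
    u a < u b := by
  obtain ⟨c, hc, hc'⟩ := exists_hasDerivAt_eq_slope u v hab h.cu.continuousOn fun x _ => h.du x
  have := hv c hc
  rw [hc', div_pos_iff] at this
  rcases this with h1 | h1 <;> linarith [h1.1, h1.2]

theorem exists_mvt (h : IsSol n g u v) {a b : ℝ} (hab : a < b) :
    ∃ c ∈ Ioo a b, v c * (b - a) = u b - u a := by
  obtain ⟨c, hc, hc'⟩ := exists_hasDerivAt_eq_slope u v hab h.cu.continuousOn fun x _ => h.du x
  exact ⟨c, hc, by rw [hc', div_mul_cancel₀ _ (by linarith)]⟩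

theorem v_sq (_ : IsSol n g u v) (r : ℝ) : v r ^ 2 = 2 * (nrg g u v r - primF g (u r)) := by
  unfold nrg; ring

/-! ### Asymptotics and loss of energy -/

/-- On a stretch where `u` hardly moves, the velocity and the force are small somewhere. -/
theorem exists_slow (h : IsSol n g u v) {s η V : ℝ} (hs : 0 < s)
    (hV : ∀ r ∈ Icc s (s + 3), |v r| ≤ V) (h1 : |u (s + 1) - u s| ≤ η)
    (h2 : |u (s + 3) - u (s + 2)| ≤ η) :
    (∃ p ∈ Ioo s (s + 1), |v p| ≤ η) ∧
      ∃ ξ ∈ Ioo s (s + 3), |g (u ξ)| ≤ 2 * η + n / s * V := by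
  obtain ⟨p, hp, hp'⟩ := h.exists_mvt (show s < s + 1 by linarith)
  obtain ⟨q, hq, hq'⟩ := h.exists_mvt (show s + 2 < s + 3 by linarith)
  have hvp : |v p| ≤ η := by
    rw [show v p = u (s + 1) - u s by linarith]; exact h1
  have hvq : |v q| ≤ η := by
    rw [show v q = u (s + 3) - u (s + 2) by linarith]; exact h2
  refine ⟨⟨p, hp, hvp⟩, ?_⟩
  have hpq : p < q := by linarith [hp.2, hq.1]
  obtain ⟨ξ, hξ, hξ'⟩ := exists_hasDerivAt_eq_slope v (fun r => -(n : ℝ) / r * v r - g (u r)) hpq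
    h.cv.continuousOn fun x hx => h.dv x (by linarith [hx.1, hp.1])
  have hξs : s < ξ := hp.1.trans hξ.1
  have hξ3 : ξ < s + 3 := hξ.2.trans hq.2
  refine ⟨ξ, ⟨hξs, hξ3⟩, ?_⟩
  have h3 : |(v q - v p) / (q - p)| ≤ 2 * η := by
    rw [abs_div, abs_of_pos (show 0 < q - p by linarith), div_le_iff₀ (by linarith)]
    have h4 : |v q - v p| ≤ 2 * η := (abs_sub _ _).trans (by linarith)
    have h5 : 0 ≤ η := (abs_nonneg _).trans hvp
    nlinarith [hp.2, hq.1]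
  have h4 : |(n : ℝ) / ξ * v ξ| ≤ n / s * V := by
    have hξ0 : 0 < ξ := hs.trans hξs
    rw [abs_mul, abs_of_nonneg (by positivity)]
    have hV0 := hV ξ ⟨hξs.le, hξ3.le⟩
    gcongr
  have h5 : g (u ξ) = -((n : ℝ) / ξ * v ξ) - (v q - v p) / (q - p) := by
    rw [← hξ']; ring
  rw [h5]
  calc _ ≤ |-((n : ℝ) / ξ * v ξ)| + |(v q - v p) / (q - p)| := abs_sub _ _
    _ ≤ _ := by rw [abs_neg]; linarith

/-- A convergent solution converges to a zero of `g`, and its energy to the potential there. -/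
theorem limit (hg : Continuous g) (h : IsSol n g u v) {l : ℝ} (hl : Tendsto u atTop (𝓝 l)) :
    g l = 0 ∧ Tendsto (nrg g u v) atTop (𝓝 (primF g l)) := by
  have hFl : Tendsto (fun r => primF g (u r)) atTop (𝓝 (primF g l)) :=
    ((continuous_primF hg).tendsto l).comp hl
  -- The energy is squeezed: it is at least F(u r), and at most its value at some p in (r - 1, r)
  -- where the mean value theorem makes v small.
  have hE : Tendsto (nrg g u v) atTop (𝓝 (primF g l)) := by
    rw [Metric.tendsto_atTop] at hFl hl ⊢
    intro ε hε
    obtain ⟨R1, hR1⟩ := hFl (ε / 2) (by positivity)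
    obtain ⟨R2, hR2⟩ := hl (min (1 / 2) (ε / 8)) (by positivity)
    refine ⟨max (max R1 R2) 0 + 1, fun r hr => ?_⟩
    have hr1 : R1 ≤ r - 1 := by linarith [le_max_left R1 R2, le_max_left (max R1 R2) 0]
    have hr2 : R2 ≤ r - 1 := by linarith [le_max_right R1 R2, le_max_left (max R1 R2) 0]
    have hr0 : 0 ≤ r - 1 := by linarith [le_max_right (max R1 R2) 0]
    obtain ⟨p, hp, hp'⟩ := h.exists_mvt (show r - 1 < r by linarith)
    have h1 := hR1 p (by linarith [hp.1])
    have h2 := hR1 r (by linarith)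
    have h3 := hR2 r (by linarith)
    have h4 := hR2 (r - 1) hr2
    rw [Real.dist_eq] at h1 h2 h3 h4 ⊢
    rw [abs_lt] at h1 h2
    have h5 := h.nrg_le hg (hr0.trans hp.1.le) hp.2.le
    have h6 := primF_le_nrg g u v r
    have h7 : |v p| ≤ 2 * min (1 / 2) (ε / 8) := by
      rw [show v p = (u r - l) - (u (r - 1) - l) by linarith]
      exact (abs_sub _ _).trans (by linarith)
    have h8 : |v p| ≤ 1 := h7.trans (by linarith [min_le_left (1 / 2) (ε / 8)])
    have h9 : |v p| ≤ ε / 4 := h7.trans (by linarith [min_le_right (1 / 2) (ε / 8)])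
    have h10 : v p ^ 2 ≤ ε / 4 := by
      rw [← sq_abs]
      nlinarith [abs_nonneg (v p)]
    have h11 : nrg g u v p = v p ^ 2 / 2 + primF g (u p) := rfl
    rw [abs_lt]
    constructor <;> linarith [h1.1, h1.2, h2.1, h2.2]
  refine ⟨?_, hE⟩
  -- If g l ≠ 0, then |g(u)| eventually exceeds 2 c, whereas `exists_slow` yields late times at
  -- which it is below c.
  by_contra hne
  set c := |g l| / 3 with hc
  have hcpos : 0 < c := by have := abs_pos.2 hne; positivity
  have hgl : ∀ᶠ r in atTop, 2 * c < |g (u r)| := by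
    have := ((hg.tendsto l).comp hl).abs.eventually (lt_mem_nhds (show 2 * c < |g l| by
      rw [hc]; have := abs_pos.2 hne; linarith))
    exact this
  have hvb : ∀ᶠ r in atTop, |v r| ≤ 2 := by
    filter_upwards [hE.eventually (gt_mem_nhds (lt_add_one _)),
      hFl.eventually (lt_mem_nhds (sub_one_lt _))] with r h1 h2
    have := h.v_sq r
    exact abs_le_of_sq_le_sq (by linarith) (by norm_num)
  have hcauchy : ∀ a : ℝ, ∀ᶠ r in atTop, |u (r + (a + 1)) - u (r + a)| ≤ c / 4 := by
    intro a
    have h1 : Tendsto (fun r => u (r + (a + 1)) - u (r + a)) atTop (𝓝 (l - l)) :=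
      (hl.comp (tendsto_atTop_add_const_right _ _ tendsto_id)).sub
        (hl.comp (tendsto_atTop_add_const_right _ _ tendsto_id))
    rw [sub_self] at h1
    have h2 := h1.abs.eventually (gt_mem_nhds (show |(0 : ℝ)| < c / 4 by simp; positivity))
    exact h2.mono fun r hr => hr.le
  have hns : ∀ᶠ s : ℝ in atTop, (n : ℝ) / s * 2 < c / 2 := by
    have : Tendsto (fun s : ℝ => (n : ℝ) / s * 2) atTop (𝓝 (0 * 2)) :=
      (tendsto_const_nhds.div_atTop tendsto_id).mul_const 2
    rw [zero_mul] at this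
    exact this.eventually (gt_mem_nhds (by positivity))
  obtain ⟨R1, hR1⟩ := eventually_atTop.1 (hgl.and hvb)
  obtain ⟨s, hs1, hs2, hs3, hs4, hs5⟩ := ((eventually_ge_atTop R1).and
    ((eventually_gt_atTop (0 : ℝ)).and ((hcauchy 0).and ((hcauchy 2).and hns)))).exists
  obtain ⟨-, ξ, hξ, hξ'⟩ := h.exists_slow hs2 (η := c / 4) (V := 2)
    (fun r hr => (hR1 r (hs1.trans hr.1)).2) (by simpa using hs3)
    (by convert hs4 using 4; norm_num)
  have := (hR1 ξ (hs1.trans hξ.1.le)).1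
  linarith

/-- A solution which is eventually decreasing and bounded below converges. -/
theorem exists_limit_of_antitone (h : IsSol n g u v) {R m : ℝ} (hv : ∀ r ≥ R, v r ≤ 0)
    (hm : ∀ r ≥ R, m ≤ u r) : ∃ l, Tendsto u atTop (𝓝 l) ∧ m ≤ l ∧ ∀ r ≥ R, l ≤ u r := by
  have hanti : ∀ x ≥ R, ∀ y ≥ x, u y ≤ u x := fun x hx y hy =>
    h.antitoneOn_Icc (fun r hr => hv r (hx.trans hr.1)) ⟨le_rfl, hy⟩ ⟨hy, le_rfl⟩ hy
  have h1 : Antitone fun r => u (max r R) := fun x y hxy =>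
    hanti _ (le_max_right _ _) _ (max_le_max_right R hxy)
  have h2 : BddBelow (range fun r => u (max r R)) :=
    ⟨m, by rintro _ ⟨r, rfl⟩; exact hm _ (le_max_right _ _)⟩
  have h3 := tendsto_atTop_ciInf h1 h2
  have h4 : Tendsto u atTop (𝓝 (⨅ r, u (max r R))) := by
    refine h3.congr' ?_
    filter_upwards [eventually_ge_atTop R] with r hr
    rw [max_eq_left hr]
  refine ⟨_, h4, le_ciInf fun r => hm _ (le_max_right _ _), fun r hr => ?_⟩
  have := ciInf_le h2 r
  rwa [max_eq_left hr] at this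

theorem exists_limit_of_monotone (h : IsSol n g u v) {R m : ℝ} (hv : ∀ r ≥ R, 0 ≤ v r)
    (hm : ∀ r ≥ R, u r ≤ m) : ∃ l, Tendsto u atTop (𝓝 l) ∧ l ≤ m ∧ ∀ r ≥ R, u r ≤ l := by
  have hmono : ∀ x ≥ R, ∀ y ≥ x, u x ≤ u y := fun x hx y hy =>
    h.monotoneOn_Icc (fun r hr => hv r (hx.trans hr.1)) ⟨le_rfl, hy⟩ ⟨hy, le_rfl⟩ hy
  have h1 : Monotone fun r => u (max r R) := fun x y hxy =>
    hmono _ (le_max_right _ _) _ (max_le_max_right R hxy)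
  have h2 : BddAbove (range fun r => u (max r R)) :=
    ⟨m, by rintro _ ⟨r, rfl⟩; exact hm _ (le_max_right _ _)⟩
  have h3 := tendsto_atTop_ciSup h1 h2
  have h4 : Tendsto u atTop (𝓝 (⨆ r, u (max r R))) := by
    refine h3.congr' ?_
    filter_upwards [eventually_ge_atTop R] with r hr
    rw [max_eq_left hr]
  refine ⟨_, h4, ciSup_le fun r => hm _ (le_max_right _ _), fun r hr => ?_⟩
  have := le_ciSup h2 r
  rwa [max_eq_left hr] at this

/-- Loss of `√(E + F₀)` along a decreasing piece of the solution. -/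
theorem sqrt_nrg_loss (hg : Continuous g) (h : IsSol n g u v) {R a c F₀ : ℝ} (hR : 0 < R)
    (hRa : R ≤ a) (hac : a ≤ c) (hF : ∀ r ∈ Icc a c, -F₀ < primF g (u r))
    (hv : ∀ r ∈ Icc a c, v r ≤ 0) :
    √(nrg g u v a + F₀) - n / (√2 * R) * (u a - u c) ≤ √(nrg g u v c + F₀) := by
  have hpos : ∀ r ∈ Icc a c, 0 < nrg g u v r + F₀ := fun r hr => by
    linarith [hF r hr, primF_le_nrg g u v r]
  -- Since |v| ≤ √2 √(E + F₀), the derivative of √(E + F₀) is at least -k |v|. The loss is therefore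
  -- k times the distance travelled, whatever the speed.
  set k := (n : ℝ) / (√2 * R) with hk
  have hmono : MonotoneOn (fun r => √(nrg g u v r + F₀) - k * u r) (Icc a c) := by
    apply monotoneOn_of_hasDerivWithinAt_nonneg (convex_Icc a c)
      (f' := fun r => -((n : ℝ) / r * v r ^ 2) / (2 * √(nrg g u v r + F₀)) - k * v r)
    · have := h.continuous_nrg hg
      have := h.cu
      fun_prop
    · intro r hr
      have hr' := interior_subset hr
      exact ((((h.hasDerivAt_nrg hg (by linarith [hr'.1])).add_const F₀).sqrt
        (hpos r hr').ne').sub ((h.du r).const_mul k)).hasDerivWithinAt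
    · intro r hr
      have hr' := interior_subset hr
      have hr0 : 0 < r := by linarith [hr'.1]
      set J := √(nrg g u v r + F₀) with hJ
      have hJpos : 0 < J := Real.sqrt_pos.2 (hpos r hr')
      have hJsq : J ^ 2 = nrg g u v r + F₀ := Real.sq_sqrt (hpos r hr').le
      have hvle : |v r| ≤ √2 * J := by
        refine abs_le_of_sq_le_sq ?_ (by positivity)
        rw [mul_pow, Real.sq_sqrt (by norm_num), hJsq, h.v_sq]
        linarith [hF r hr']
      rw [abs_of_nonpos (hv r hr')] at hvle
      have h2 : √2 * √2 = 2 := Real.mul_self_sqrt (by norm_num)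
      have hkv : (n : ℝ) / r * v r ^ 2 ≤ -(k * v r) * (2 * J) := by
        have h3 : (n : ℝ) / r ≤ n / R := by gcongr; linarith [hr'.1]
        have h4 : v r ^ 2 ≤ (-v r) * (√2 * J) := by nlinarith [hv r hr']
        calc (n : ℝ) / r * v r ^ 2 ≤ n / R * ((-v r) * (√2 * J)) := by
              gcongr
          _ = -(k * v r) * (2 * J) := by
              have h6 : k * R * √2 = n := by rw [hk]; field_simp
              rw [div_mul_eq_mul_div, div_eq_iff hR.ne', ← h6]
              linear_combination (-(k * R * v r * J)) * h2
      have h5 : (n : ℝ) / r * v r ^ 2 / (2 * J) ≤ -(k * v r) := by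
        rw [div_le_iff₀ (by positivity)]
        exact hkv
      rw [neg_div]
      linarith
  have := hmono ⟨le_rfl, hac⟩ ⟨hac, le_rfl⟩ hac
  simp only at this
  linarith

theorem sqrt_nrg_loss' (hg : Continuous g) (hodd : ∀ s, g (-s) = -g s) (h : IsSol n g u v)
    {R a c F₀ : ℝ} (hR : 0 < R)
    (hRa : R ≤ a) (hac : a ≤ c) (hF : ∀ r ∈ Icc a c, -F₀ < primF g (u r))
    (hv : ∀ r ∈ Icc a c, 0 ≤ v r) :
    √(nrg g u v a + F₀) - n / (√2 * R) * (u c - u a) ≤ √(nrg g u v c + F₀) := by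
  have := (h.neg hodd).sqrt_nrg_loss hg hR hRa hac (F₀ := F₀)
    (fun r hr => by rw [primF_neg hodd]; exact hF r hr) (fun r hr => by linarith [hv r hr])
  rw [nrg_neg hodd, nrg_neg hodd] at this
  rw [show u c - u a = -u a - -u c by ring]
  exact this

end IsSol

/-! ### Dissipation inside the well -/

/-- `∫₀ˢ |F|`. -/
noncomputable def absPot (g : ℝ → ℝ) : ℝ → ℝ := primF fun s => |primF g s|

theorem hasDerivAt_absPot {g : ℝ → ℝ} (hg : Continuous g) (s : ℝ) :
    HasDerivAt (absPot g) |primF g s| s :=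
  hasDerivAt_primF (continuous_primF hg).abs s

theorem continuous_absPot {g : ℝ → ℝ} (hg : Continuous g) : Continuous (absPot g) :=
  continuous_primF (continuous_primF hg).abs

@[simp] theorem absPot_zero (g : ℝ → ℝ) : absPot g 0 = 0 := primF_zero _

theorem absPot_mono {g : ℝ → ℝ} (hg : Continuous g) : Monotone (absPot g) :=
  monotone_of_hasDerivAt_nonneg (hasDerivAt_absPot hg) fun _ => abs_nonneg _

theorem absPot_neg {g : ℝ → ℝ} (hodd : ∀ s, g (-s) = -g s) (s : ℝ) :
    absPot g (-s) = -absPot g s := by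
  have := intervalIntegral.integral_comp_neg (a := 0) (b := s) fun s => |primF g s|
  simp only [primF_neg hodd, neg_zero] at this
  unfold absPot primF at *
  rw [intervalIntegral.integral_symm, ← this]

/-- The coefficient in the dissipation estimate. -/
noncomputable def dissip (n : ℕ) (Em Fb : ℝ) : ℝ := √2 * n / √(Em + Fb)

theorem dissip_pos {n : ℕ} (hn : 1 ≤ n) {Em Fb : ℝ} (h : 0 < Em + Fb) : 0 < dissip n Em Fb := by
  unfold dissip
  have := Real.sqrt_pos.2 h
  positivity

namespace IsSol

variable {n : ℕ} {g u v : ℝ → ℝ}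

/-- Dissipation of `r E(r)` along a decreasing piece inside the well. -/
theorem dissipation (hn : 1 ≤ n) (hg : Continuous g) (h : IsSol n g u v) {a c Em Fb : ℝ}
    (ha : 0 < a) (hac : a ≤ c) (hF : ∀ r ∈ Icc a c, primF g (u r) ≤ 0)
    (hFb : ∀ r ∈ Icc a c, -Fb ≤ primF g (u r)) (hv : ∀ r ∈ Icc a c, v r ≤ 0)
    (hEc : 0 ≤ nrg g u v c) (hEa : nrg g u v a ≤ Em) (hpos : 0 < Em + Fb) :
    c * nrg g u v c + dissip n Em Fb * (absPot g (u a) - absPot g (u c)) ≤ a * nrg g u v a := by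
  set κ := dissip n Em Fb with hκ
  have hκ0 : 0 < κ := dissip_pos hn hpos
  -- From v² = 2(E - F) one gets (r E)' = E - n v² = -(2n - 1) E - 2n |F| ≤ -2n |F|, as F ≤ 0 ≤ E.
  -- The speed is at most √2 √(Em + Fb), so 2n |F| dominates κ |F| |v|, and κ is chosen to make this
  -- sharp.
  have hanti : AntitoneOn (fun r => r * nrg g u v r - κ * absPot g (u r)) (Icc a c) := by
    apply antitoneOn_of_hasDerivWithinAt_nonpos (convex_Icc a c)
      (f' := fun r => (1 * nrg g u v r + r * -((n : ℝ) / r * v r ^ 2)) -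
        κ * (|primF g (u r)| * v r))
    · have := h.continuous_nrg hg
      have := h.cu
      have := continuous_absPot hg
      fun_prop
    · intro r hr
      have hr' := interior_subset hr
      have hr0 : 0 < r := by linarith [hr'.1]
      exact (((hasDerivAt_id r).mul (h.hasDerivAt_nrg hg hr0)).sub
        (((hasDerivAt_absPot hg (u r)).comp r (h.du r)).const_mul κ)).hasDerivWithinAt
    · intro r hr
      have hr' := interior_subset hr
      have hr0 : 0 < r := by linarith [hr'.1]
      have hE0 : 0 ≤ nrg g u v r := hEc.trans (h.nrg_le hg hr0.le hr'.2)
      have hEm : nrg g u v r ≤ Em := (h.nrg_le hg ha.le hr'.1).trans hEa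
      have hF0 := hF r hr'
      have hvr := hv r hr'
      rw [abs_of_nonpos hF0]
      have hvsq := h.v_sq r
      have h1 : r * -((n : ℝ) / r * v r ^ 2) = -(n * v r ^ 2) := by field_simp
      rw [h1]
      set S := √(Em + Fb) with hS
      have hSpos : 0 < S := Real.sqrt_pos.2 hpos
      have hSsq : S ^ 2 = Em + Fb := Real.sq_sqrt hpos.le
      have h2 : √2 ^ 2 = (2 : ℝ) := Real.sq_sqrt (by norm_num)
      have hvle : -v r ≤ √2 * S := by
        refine (le_abs_self _).trans (abs_le_of_sq_le_sq ?_ (by positivity))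
        rw [mul_pow, h2, hSsq, neg_sq, hvsq]
        linarith [hFb r hr']
      have hκS : κ * (√2 * S) = 2 * n := by
        rw [hκ, dissip, ← hS, div_mul_eq_mul_div, div_eq_iff hSpos.ne']
        linear_combination (n * S) * h2
      have h3 : κ * (-v r) ≤ 2 * n := by rw [← hκS]; gcongr
      have h4 : κ * (-primF g (u r) * v r) = -(κ * (-v r) * (-primF g (u r))) := by ring
      rw [h4]
      have h5 : κ * (-v r) * (-primF g (u r)) ≤ 2 * n * (-primF g (u r)) := by
        gcongr
        linarith
      have hn' : (1 : ℝ) ≤ n := by exact_mod_cast hn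
      nlinarith
  have := hanti ⟨le_rfl, hac⟩ ⟨hac, le_rfl⟩ hac
  simp only at this
  linarith

/-- Over the long interval [R, 4R] a solution confined to the well has a moment of speed at most
2b/(3R), and E ≤ v²/2 there. Hence r E becomes arbitrarily small at suitable late times. -/
theorem exists_mul_nrg_le (h : IsSol n g u v) {R b : ℝ} (hR : 0 < R)
    (hu : ∀ r ∈ Icc R (4 * R), |u r| ≤ b) (hF : ∀ s, |s| ≤ b → primF g s ≤ 0) :
    ∃ ξ ∈ Ioo R (4 * R), ξ * nrg g u v ξ ≤ b ^ 2 / R := by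
  obtain ⟨ξ, hξ, hξ'⟩ := h.exists_mvt (show R < 4 * R by linarith)
  refine ⟨ξ, hξ, ?_⟩
  have h1 := abs_le.1 (hu R ⟨le_rfl, by linarith⟩)
  have h2 := abs_le.1 (hu (4 * R) ⟨by linarith, le_rfl⟩)
  have h3 : |v ξ * (3 * R)| ≤ 2 * b := by
    rw [show v ξ * (3 * R) = u (4 * R) - u R by linarith, abs_le]
    constructor <;> linarith [h1.1, h1.2, h2.1, h2.2]
  have h4 : (v ξ * (3 * R)) ^ 2 ≤ (2 * b) ^ 2 := sq_le_sq' (abs_le.1 h3).1 (abs_le.1 h3).2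
  have h5 := hF (u ξ) (hu ξ ⟨hξ.1.le, hξ.2.le⟩)
  rw [le_div_iff₀ hR]
  have h6 : nrg g u v ξ ≤ v ξ ^ 2 / 2 := by unfold nrg; linarith
  have hξ0 : 0 < ξ := hR.trans hξ.1
  calc ξ * nrg g u v ξ * R ≤ ξ * (v ξ ^ 2 / 2) * R := by gcongr
    _ ≤ (4 * R) * (v ξ ^ 2 / 2) * R := by gcongr; exact hξ.2.le
    _ ≤ b ^ 2 := by nlinarith [sq_nonneg b]

end IsSol

theorem exists_gt_left_of_hasDerivAt_neg {φ : ℝ → ℝ} {a c d : ℝ} (h : HasDerivAt φ d c) (hd : d < 0)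
    (hac : a < c) : ∃ x, a < x ∧ x < c ∧ φ c < φ x := by
  have h1 : HasDerivAt (fun r => φ (-r)) (-d) (-c) := by
    have := HasDerivAt.comp (h := fun r : ℝ => -r) (h₂ := φ) (-c) (by rwa [neg_neg])
      (hasDerivAt_neg (-c))
    exact this.congr_deriv (by simp)
  obtain ⟨x, hx1, hx2, hx3⟩ := exists_gt_of_hasDerivAt_pos h1 (neg_pos.2 hd) (neg_lt_neg hac)
  exact ⟨-x, by linarith, by linarith, by simpa using hx3⟩

theorem exists_lt_left_of_hasDerivAt_pos {φ : ℝ → ℝ} {a c d : ℝ} (h : HasDerivAt φ d c) (hd : 0 < d)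
    (hac : a < c) : ∃ x, a < x ∧ x < c ∧ φ x < φ c := by
  obtain ⟨x, h1, h2, h3⟩ := exists_gt_left_of_hasDerivAt_neg h.neg (neg_neg_of_pos hd) hac
  exact ⟨x, h1, h2, by simpa using h3⟩

theorem eventually_neg_of_hasDerivAt_neg {φ : ℝ → ℝ} {c d : ℝ} (h : HasDerivAt φ d c) (hd : d < 0)
    (hc : φ c = 0) : ∀ᶠ r in 𝓝[>] c, φ r < 0 := by
  have h1 := h.tendsto_slope.mono_left (nhdsGT_le_nhdsNE c)
  filter_upwards [h1.eventually (gt_mem_nhds hd), self_mem_nhdsWithin] with r hr hr'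
  rw [slope_def_field, hc, sub_zero, div_neg_iff] at hr
  have : c < r := hr'
  rcases hr with h2 | h2
  · linarith [h2.2]
  · exact h2.1

namespace IsSol

variable {n : ℕ} {g u v : ℝ → ℝ}

theorem exists_interior_min (h : IsSol n g u v) {p q x : ℝ} (hv : v p < 0) (hx : x ∈ Icc p q)
    (hxq : u x < u q) : ∃ m ∈ Ioo p q, v m = 0 ∧ ∀ r ∈ Icc p q, u m ≤ u r := by
  obtain ⟨m, hm, hmin⟩ := isCompact_Icc.exists_isMinOn ⟨x, hx⟩ h.cu.continuousOn (f := u)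
  have hmq : m < q := lt_of_le_of_ne hm.2 fun heq => by
    have : u m ≤ u x := hmin hx
    rw [heq] at this
    linarith
  have hpm : p < m := lt_of_le_of_ne hm.1 fun heq => by
    obtain ⟨y, hy1, hy2, hy3⟩ := exists_lt_of_hasDerivAt_neg (h.du p) hv (heq ▸ hmq)
    have : u m ≤ u y := hmin ⟨hy1.le, hy2.le⟩
    rw [← heq] at this
    linarith
  exact ⟨m, ⟨hpm, hmq⟩, (hmin.isLocalMin (Icc_mem_nhds hpm hmq)).hasDerivAt_eq_zero (h.du m),
    fun r hr => hmin hr⟩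

theorem exists_interior_max (hodd : ∀ s, g (-s) = -g s) (h : IsSol n g u v) {p q x : ℝ}
    (hv : 0 < v p) (hx : x ∈ Icc p q) (hxq : u q < u x) :
    ∃ m ∈ Ioo p q, v m = 0 ∧ ∀ r ∈ Icc p q, u r ≤ u m := by
  obtain ⟨m, h1, h2, h3⟩ := (h.neg hodd).exists_interior_min (p := p) (q := q) (x := x)
    (by simpa using hv) hx (by simpa using hxq)
  exact ⟨m, h1, by simpa using h2, fun r hr => by simpa using h3 r hr⟩

end IsSol

/-! ### Motion inside the well -/

/-- The potential `F` of `g` has a well on `[-b, b]`, and `lam` lies on its rim. -/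
structure Well (g : ℝ → ℝ) (b lam B Fb : ℝ) : Prop where
  cont : Continuous g
  odd : ∀ s, g (-s) = -g s
  lip : LocallyLipschitzOn {0}ᶜ g
  bdd : ∃ G, ∀ s, |g s| ≤ G
  b_pos : 0 < b
  primF_b : primF g b = 0
  primF_nonpos : ∀ s, |s| ≤ b → primF g s ≤ 0
  primF_ge : ∀ s, |s| ≤ b → -Fb ≤ primF g s
  absPot_pos : ∀ s, 0 < s → s ≤ b → 0 < absPot g s
  absPot_lt : ∀ s, 0 ≤ s → s < b → absPot g s < absPot g b
  b_lt : b < lam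
  lam_lt : lam < B
  g_pos : ∀ s, b < s → s ≤ lam → 0 < g s
  finite_zeros : {s | lam ≤ s ∧ s < B ∧ g s = 0}.Finite
  sign_change : ∀ s, lam ≤ s → s < B → g s = 0 → ChangesSignAt g s
  primF_le : ∀ s, |s| ≤ B → primF g s ≤ primF g B

/-- Once `u` and `v` vanish simultaneously, `u` stays zero. -/
def Canonical (u v : ℝ → ℝ) : Prop := ∀ r, 0 ≤ r → u r = 0 → v r = 0 → ∀ s, r ≤ s → u s = 0

theorem Canonical.neg {u v : ℝ → ℝ} (h : Canonical u v) :
    Canonical (fun r => -u r) (fun r => -v r) := fun r hr h1 h2 s hs => by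
  rw [neg_eq_zero] at *
  exact h r hr h1 h2 s hs

theorem Canonical.ne {u v : ℝ → ℝ} (h : Canonical u v) {T : ℝ} (hT : u T ≠ 0) :
    ∀ r ∈ Icc 0 T, u r ≠ 0 ∨ v r ≠ 0 := by
  intro r hr
  by_contra! hcon
  exact hT (h r hr.1 hcon.1 hcon.2 T hr.2)

namespace Well

variable {n : ℕ} {g u v : ℝ → ℝ} {b lam B Fb : ℝ}

theorem lam_pos (hW : Well g b lam B Fb) : 0 < lam := hW.b_pos.trans hW.b_lt

theorem B_pos (hW : Well g b lam B Fb) : 0 < B := hW.lam_pos.trans hW.lam_lt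

theorem Fb_nonneg (hW : Well g b lam B Fb) : 0 ≤ Fb := by
  have := hW.primF_ge 0 (by simpa using hW.b_pos.le)
  rw [primF_zero] at this
  linarith

theorem primF_strictMonoOn (hW : Well g b lam B Fb) : StrictMonoOn (primF g) (Icc b lam) := by
  apply strictMonoOn_of_deriv_pos (convex_Icc b lam) (continuous_primF hW.cont).continuousOn
  intro s hs
  rw [interior_Icc] at hs
  rw [(hasDerivAt_primF hW.cont s).deriv]
  exact hW.g_pos s hs.1 hs.2.le

theorem primF_pos (hW : Well g b lam B Fb) {s : ℝ} (h1 : b < s) (h2 : s ≤ lam) :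
    0 < primF g s := by
  rw [← hW.primF_b]
  exact hW.primF_strictMonoOn ⟨le_rfl, hW.b_lt.le⟩ ⟨h1.le, h2⟩ h1

theorem primF_le_lam (hW : Well g b lam B Fb) {s : ℝ} (h : |s| ≤ lam) :
    primF g s ≤ primF g lam := by
  rw [← primF_abs hW.odd s]
  rcases le_or_gt |s| b with h1 | h1
  · have := hW.primF_nonpos |s| (by rwa [abs_abs])
    exact this.trans (hW.primF_pos hW.b_lt le_rfl).le
  · exact hW.primF_strictMonoOn.monotoneOn ⟨h1.le, h⟩ ⟨hW.b_lt.le, le_rfl⟩ h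

theorem g_eq_zero (hW : Well g b lam B Fb) {s : ℝ} (h0 : s ≤ lam) (h : g s = 0) : s ≤ b := by
  by_contra hcon
  exact (hW.g_pos s (not_le.1 hcon) h0).ne' h

/-- While descending inside the well the solution either stays there or reaches `0`. -/
theorem descent (hW : Well g b lam B Fb) (hn : 1 ≤ n) (h : IsSol n g u v) {R : ℝ} (hR : 0 < R)
    (hu0 : 0 < u R) (hub : u R ≤ b) (hv : v R < 0) : (∀ r > R, 0 < u r ∧ u r < b) ∨
      ∃ c > R, u c = 0 ∧ (∀ r ∈ Icc R c, v r ≤ 0) ∧ ∀ r, R ≤ r → r < c → 0 < u r := by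
  by_contra! hcon
  obtain ⟨⟨r, hrR, hr⟩, hcon⟩ := hcon
  obtain ⟨x, hx1, hx2, hx3⟩ : ∃ x, R < x ∧ x < r ∧ (0 < u x ∧ u x < b) ∧
      ∀ y ∈ Icc R x, v y < 0 := by
    obtain ⟨ε, hε, hball⟩ := Metric.eventually_nhds_iff_ball.1
      ((h.cv.continuousAt.eventually_lt_const hv).and (h.cu.continuousAt.eventually_const_lt hu0))
    set x := min ((R + r) / 2) (R + ε / 2) with hx
    have hRx : R < x := lt_min (by linarith) (by linarith)
    have hxr : x < r := (min_le_left _ _).trans_lt (by linarith)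
    have hb : ∀ y ∈ Icc R x, v y < 0 ∧ 0 < u y := fun y hy => hball y (by
      rw [Metric.mem_ball, Real.dist_eq, abs_of_nonneg (by linarith [hy.1])]
      linarith [hy.2, min_le_right ((R + r) / 2) (R + ε / 2)])
    refine ⟨x, hRx, hxr, ⟨(hb x ⟨hRx.le, le_rfl⟩).2, ?_⟩, fun y hy => (hb y hy).1⟩
    exact (h.lt_of_v_neg hRx fun y hy => (hb y ⟨hy.1.le, hy.2.le⟩).1).trans_le hub
  obtain ⟨⟨hx3, hx4⟩, hx5⟩ := hx3
  obtain ⟨c, hc1, hc2, hc3, hc4⟩ := exists_first_zero (φ := fun r => min (u r) (b - u r))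
    (by have := h.cu; fun_prop) hx2.le (lt_min hx3 (by linarith))
    (by
      by_contra hh
      obtain ⟨h1, h2⟩ := lt_min_iff.1 (not_le.1 hh)
      linarith [hr h1])
  have hRc : R < c := hx1.trans hc1
  have hpos : ∀ r, R ≤ r → r < c → 0 < u r ∧ u r ≤ b := by
    intro y hy hyc
    rcases le_or_gt x y with hxy | hxy
    · have := lt_min_iff.1 (hc4 y hxy hyc)
      exact ⟨this.1, by linarith [this.2]⟩
    · have h1 : u y ≤ u R := h.antitoneOn_Icc (fun z hz => (hx5 z hz).le)
        ⟨le_rfl, hx1.le⟩ ⟨hy, hxy.le⟩ hy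
      have h2 : u x ≤ u y := h.antitoneOn_Icc (fun z hz => (hx5 z hz).le)
        ⟨hy, hxy.le⟩ ⟨hx1.le, le_rfl⟩ hxy.le
      exact ⟨by linarith, by linarith⟩
  -- A turning point in the well has E = F ≤ 0, whereas leaving through 0 or b needs E ≥ 0. Energy
  -- is then constant in between and nothing moves.
  have key : ∀ m, R < m → m < c → v m = 0 → 0 ≤ nrg g u v c → u m = u c := by
    intro m hm1 hm2 hm3 hm4
    refine (h.eq_of_nrg_le hn hW.cont (hR.trans hm1).le ?_ c ⟨hm2.le, le_rfl⟩).symm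
    have h1 := hpos m hm1.le hm2
    have h2 := hW.primF_nonpos (u m) (by rw [abs_of_pos h1.1]; exact h1.2)
    have h3 : nrg g u v m = primF g (u m) := by simp [nrg, hm3]
    linarith
  rcases min_choice (u c) (b - u c) with h1 | h1
  · rw [h1] at hc3
    have hEc : 0 ≤ nrg g u v c := by
      have := primF_le_nrg g u v c
      rwa [hc3, primF_zero] at this
    obtain ⟨p, hp, hp'⟩ : ∃ p ∈ Icc R c, 0 < v p := by
      by_contra! hh
      obtain ⟨y, hy1, hy2, hy3⟩ := hcon c hRc hc3 hh
      linarith [hpos y hy1 hy2]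
    have hRp : R < p := lt_of_le_of_ne hp.1 fun heq => by rw [← heq] at hp'; linarith
    obtain ⟨y, hy1, hy2, hy3⟩ := exists_lt_left_of_hasDerivAt_pos (h.du p) hp' hRp
    obtain ⟨m, hm, hm1, -⟩ := h.exists_interior_min hv ⟨hy1.le, hy2.le⟩ hy3
    have h2 := key m hm.1 (hm.2.trans_le hp.2) hm1 hEc
    have := hpos m hm.1.le (hm.2.trans_le hp.2)
    linarith
  · rw [h1] at hc3
    have hcb : u c = b := by linarith
    have hEc : 0 ≤ nrg g u v c := by
      have := primF_le_nrg g u v c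
      rwa [hcb, hW.primF_b] at this
    obtain ⟨m, hm, hm1, hm2⟩ := h.exists_interior_min hv ⟨hx1.le, hc1.le⟩
      (show u x < u c by rw [hcb]; exact hx4)
    have h2 := key m hm.1 hm.2 hm1 hEc
    have := hm2 x ⟨hx1.le, hc1.le⟩
    linarith

/-- While ascending inside the well the solution either stays there or reaches `b`. -/
theorem ascent (hW : Well g b lam B Fb) (hn : 1 ≤ n) (h : IsSol n g u v) {R : ℝ} (hR : 0 < R)
    (hu0 : 0 ≤ u R) (hub : u R < b) (hv : 0 < v R) : (∀ r > R, 0 < u r ∧ u r < b) ∨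
      ∃ c > R, u c = b ∧ (∀ r ∈ Icc R c, 0 ≤ v r) ∧ ∀ r ∈ Icc R c, 0 ≤ u r := by
  by_contra! hcon
  obtain ⟨⟨r, hrR, hr⟩, hcon⟩ := hcon
  obtain ⟨x, hx1, hx2, hx3⟩ : ∃ x, R < x ∧ x < r ∧ (0 < u x ∧ u x < b) ∧
      ∀ y ∈ Icc R x, 0 < v y := by
    obtain ⟨ε, hε, hball⟩ := Metric.eventually_nhds_iff_ball.1
      ((h.cv.continuousAt.eventually_const_lt hv).and (h.cu.continuousAt.eventually_lt_const hub))
    set x := min ((R + r) / 2) (R + ε / 2) with hx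
    have hRx : R < x := lt_min (by linarith) (by linarith)
    have hxr : x < r := (min_le_left _ _).trans_lt (by linarith)
    have hb : ∀ y ∈ Icc R x, 0 < v y ∧ u y < b := fun y hy => hball y (by
      rw [Metric.mem_ball, Real.dist_eq, abs_of_nonneg (by linarith [hy.1])]
      linarith [hy.2, min_le_right ((R + r) / 2) (R + ε / 2)])
    refine ⟨x, hRx, hxr, ⟨?_, (hb x ⟨hRx.le, le_rfl⟩).2⟩, fun y hy => (hb y hy).1⟩
    exact hu0.trans_lt (h.lt_of_v_pos hRx fun y hy => (hb y ⟨hy.1.le, hy.2.le⟩).1)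
  obtain ⟨⟨hx3, hx4⟩, hx5⟩ := hx3
  obtain ⟨c, hc1, hc2, hc3, hc4⟩ := exists_first_zero (φ := fun r => min (u r) (b - u r))
    (by have := h.cu; fun_prop) hx2.le (lt_min hx3 (by linarith))
    (by
      by_contra hh
      obtain ⟨h1, h2⟩ := lt_min_iff.1 (not_le.1 hh)
      linarith [hr h1])
  have hRc : R < c := hx1.trans hc1
  have hpos : ∀ r, R ≤ r → r < c → 0 ≤ u r ∧ u r < b := by
    intro y hy hyc
    rcases le_or_gt x y with hxy | hxy
    · have := lt_min_iff.1 (hc4 y hxy hyc)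
      exact ⟨this.1.le, by linarith [this.2]⟩
    · have h1 : u R ≤ u y := h.monotoneOn_Icc (fun z hz => (hx5 z hz).le)
        ⟨le_rfl, hx1.le⟩ ⟨hy, hxy.le⟩ hy
      have h2 : u y ≤ u x := h.monotoneOn_Icc (fun z hz => (hx5 z hz).le)
        ⟨hy, hxy.le⟩ ⟨hx1.le, le_rfl⟩ hxy.le
      exact ⟨by linarith, by linarith⟩
  have key : ∀ m, R < m → m < c → v m = 0 → 0 ≤ nrg g u v c → u m = u c := by
    intro m hm1 hm2 hm3 hm4
    refine (h.eq_of_nrg_le hn hW.cont (hR.trans hm1).le ?_ c ⟨hm2.le, le_rfl⟩).symm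
    have h1 := hpos m hm1.le hm2
    have h2 := hW.primF_nonpos (u m) (by rw [abs_of_nonneg h1.1]; exact h1.2.le)
    have h3 : nrg g u v m = primF g (u m) := by simp [nrg, hm3]
    linarith
  rcases min_choice (u c) (b - u c) with h1 | h1
  · rw [h1] at hc3
    have hEc : 0 ≤ nrg g u v c := by
      have := primF_le_nrg g u v c
      rwa [hc3, primF_zero] at this
    obtain ⟨m, hm, hm1, hm2⟩ := h.exists_interior_max hW.odd hv ⟨hx1.le, hc1.le⟩
      (show u c < u x by rw [hc3]; exact hx3)
    have h2 := key m hm.1 hm.2 hm1 hEc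
    have := hm2 x ⟨hx1.le, hc1.le⟩
    linarith
  · rw [h1] at hc3
    have hcb : u c = b := by linarith
    have hEc : 0 ≤ nrg g u v c := by
      have := primF_le_nrg g u v c
      rwa [hcb, hW.primF_b] at this
    obtain ⟨p, hp, hp'⟩ : ∃ p ∈ Icc R c, v p < 0 := by
      by_contra! hh
      obtain ⟨y, hy1, hy2⟩ := hcon c hRc hcb hh
      rcases eq_or_lt_of_le hy1.2 with h2 | h2
      · rw [h2, hcb] at hy2
        linarith [hW.b_pos]
      · linarith [hpos y hy1.1 h2]
    have hRp : R < p := lt_of_le_of_ne hp.1 fun heq => by rw [← heq] at hp'; linarith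
    obtain ⟨y, hy1, hy2, hy3⟩ := exists_gt_left_of_hasDerivAt_neg (h.du p) hp' hRp
    obtain ⟨m, hm, hm1, -⟩ := h.exists_interior_max hW.odd hv ⟨hy1.le, hy2.le⟩ hy3
    have h2 := key m hm.1 (hm.2.trans_le hp.2) hm1 hEc
    have := hpos m hm.1.le (hm.2.trans_le hp.2)
    linarith

/-- A solution that dissipates its energy while descending stays in the well. -/
theorem stays_of_descending (hW : Well g b lam B Fb) (hn : 1 ≤ n) (h : IsSol n g u v) {R Em : ℝ}
    (hR : 0 < R) (hu0 : 0 < u R) (hub : u R ≤ b) (hv : v R < 0) (hEm : nrg g u v R ≤ Em)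
    (hpos : 0 < Em + Fb) (hE : R * nrg g u v R < dissip n Em Fb * absPot g (u R)) :
    ∀ r > R, 0 < u r ∧ u r < b := by
  refine (hW.descent hn h hR hu0 hub hv).resolve_right ?_
  rintro ⟨c, hRc, hc, hvc, huc⟩
  have hEc : 0 ≤ nrg g u v c := by
    have := primF_le_nrg g u v c
    rwa [hc, primF_zero] at this
  have hmem : ∀ r ∈ Icc R c, |u r| ≤ b := fun r hr => by
    have h1 : u r ≤ u R := h.antitoneOn_Icc hvc ⟨le_rfl, hRc.le⟩ hr hr.1
    have h2 : u c ≤ u r := h.antitoneOn_Icc hvc hr ⟨hRc.le, le_rfl⟩ hr.2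
    rw [abs_of_nonneg (by linarith)]
    linarith
  have := h.dissipation hn hW.cont hR hRc.le (fun r hr => hW.primF_nonpos _ (hmem r hr))
    (fun r hr => hW.primF_ge _ (hmem r hr)) hvc hEc hEm hpos
  rw [hc, absPot_zero, sub_zero] at this
  have h3 : 0 ≤ c * nrg g u v c := mul_nonneg (hR.trans hRc).le hEc
  linarith

/-- Reaching the rim from u R costs κ (∫ |F| from u R to b) of r E, which is more than is available.
The reflected solution is descending, so the dissipation estimate applies to it. -/
theorem stays_of_ascending (hW : Well g b lam B Fb) (hn : 1 ≤ n) (h : IsSol n g u v) {R Em : ℝ}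
    (hR : 0 < R) (hu0 : 0 ≤ u R) (hub : u R < b) (hv : 0 < v R) (hEm : nrg g u v R ≤ Em)
    (hpos : 0 < Em + Fb)
    (hE : R * nrg g u v R < dissip n Em Fb * (absPot g b - absPot g (u R))) :
    ∀ r > R, 0 < u r ∧ u r < b := by
  refine (hW.ascent hn h hR hu0 hub hv).resolve_right ?_
  rintro ⟨c, hRc, hc, hvc, huc⟩
  have hEc : 0 ≤ nrg g u v c := by
    have := primF_le_nrg g u v c
    rwa [hc, hW.primF_b] at this
  have hmem : ∀ r ∈ Icc R c, |-u r| ≤ b := fun r hr => by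
    have h2 : u r ≤ u c := h.monotoneOn_Icc hvc hr ⟨hRc.le, le_rfl⟩ hr.2
    rw [abs_neg, abs_of_nonneg (huc r hr)]
    linarith
  have := (h.neg hW.odd).dissipation hn hW.cont hR hRc.le
    (fun r hr => hW.primF_nonpos _ (hmem r hr)) (fun r hr => hW.primF_ge _ (hmem r hr))
    (fun r hr => by simpa using hvc r hr) (by rwa [nrg_neg hW.odd]) (by rwa [nrg_neg hW.odd]) hpos
  rw [nrg_neg hW.odd, nrg_neg hW.odd, absPot_neg hW.odd, absPot_neg hW.odd, hc] at this
  have h3 : 0 ≤ c * nrg g u v c := mul_nonneg (hR.trans hRc).le hEc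
  linarith

/-- A solution descending in the well with little energy changes sign at most once more. -/
theorem last_sign_change (hW : Well g b lam B Fb) (hn : 1 ≤ n) (h : IsSol n g u v)
    (hcan : Canonical u v) {R Em : ℝ} (hR : 0 < R) (hu0 : 0 < u R) (hub : u R < b) (hv : v R < 0)
    (hEm : nrg g u v R ≤ Em) (hpos : 0 < Em + Fb)
    (hE : R * nrg g u v R < dissip n Em Fb * absPot g b) :
    (∀ r ≥ R, |u r| < b) ∧ ((∀ r ≥ R, 0 ≤ u r) ∨
      ∃ z > R, (∀ r, R ≤ r → r ≤ z → 0 ≤ u r) ∧ ∀ r ≥ z, u r ≤ 0) := by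
  rcases hW.descent hn h hR hu0 hub.le hv with h1 | ⟨c, hRc, hc, hvc, huc⟩
  · have h2 : ∀ r ≥ R, 0 < u r ∧ u r < b := fun r hr => by
      rcases eq_or_lt_of_le hr with h3 | h3
      · rw [← h3]; exact ⟨hu0, hub⟩
      · exact h1 r h3
    exact ⟨fun r hr => abs_lt.2 ⟨by linarith [h2 r hr, hW.b_pos], (h2 r hr).2⟩,
      Or.inl fun r hr => (h2 r hr).1.le⟩
  have hle : ∀ r, R ≤ r → r ≤ c → 0 ≤ u r ∧ u r < b := fun r hr hrc => by
    have h1 : u r ≤ u R := h.antitoneOn_Icc hvc ⟨le_rfl, hRc.le⟩ ⟨hr, hrc⟩ hr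
    have h2 : u c ≤ u r := h.antitoneOn_Icc hvc ⟨hr, hrc⟩ ⟨hRc.le, le_rfl⟩ hrc
    exact ⟨by linarith, by linarith⟩
  have hc0 : 0 < c := hR.trans hRc
  rcases eq_or_lt_of_le (hvc c ⟨hRc.le, le_rfl⟩) with hvc0 | hvc0
  · have hz := hcan c hc0.le hc hvc0
    have h2 : ∀ r ≥ R, 0 ≤ u r ∧ u r < b := fun r hr => by
      rcases le_total r c with h3 | h3
      · exact hle r hr h3
      · rw [hz r h3]; exact ⟨le_rfl, hW.b_pos⟩
    exact ⟨fun r hr => abs_lt.2 ⟨by linarith [h2 r hr, hW.b_pos], (h2 r hr).2⟩,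
      Or.inl fun r hr => (h2 r hr).1⟩
  · have hEc : 0 ≤ nrg g u v c := by
      have := primF_le_nrg g u v c
      rwa [hc, primF_zero] at this
    have hmem : ∀ r ∈ Icc R c, |u r| ≤ b := fun r hr => by
      have := hle r hr.1 hr.2
      rw [abs_of_nonneg this.1]; exact this.2.le
    have h2 := h.dissipation hn hW.cont hR hRc.le (fun r hr => hW.primF_nonpos _ (hmem r hr))
      (fun r hr => hW.primF_ge _ (hmem r hr)) hvc hEc hEm hpos
    rw [hc, absPot_zero, sub_zero] at h2
    have h3 : 0 < dissip n Em Fb * absPot g (u R) :=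
      mul_pos (dissip_pos hn hpos) (hW.absPot_pos _ hu0 hub.le)
    -- The descent to 0 has only reduced r E, so less than κ ∫₀ᵇ |F| is left. That does not suffice
    -- to climb to the opposite rim, and there is no second sign change.
    have h4 := hW.stays_of_ascending hn (h.neg hW.odd) hc0 (by simp [hc])
      (by simpa [hc] using hW.b_pos) (by simpa using hvc0)
      (Em := Em) (by rw [nrg_neg hW.odd]; exact (h.nrg_le hW.cont hR.le hRc.le).trans hEm) hpos
      (by rw [nrg_neg hW.odd, hc, neg_zero, absPot_zero, sub_zero]; linarith)
    have h5 : ∀ r ≥ c, u r ≤ 0 ∧ -b < u r := fun r hr => by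
      rcases eq_or_lt_of_le hr with h6 | h6
      · rw [← h6, hc]; exact ⟨le_rfl, by linarith [hW.b_pos]⟩
      · have := h4 r h6
        exact ⟨by linarith, by linarith⟩
    refine ⟨fun r hr => ?_, Or.inr ⟨c, hRc, fun r hr hrc => (hle r hr hrc).1,
      fun r hr => (h5 r hr).1⟩⟩
    rcases le_total r c with h6 | h6
    · exact abs_lt.2 ⟨by linarith [hle r hr h6, hW.b_pos], (hle r hr h6).2⟩
    · exact abs_lt.2 ⟨(h5 r h6).2, by linarith [h5 r h6, hW.b_pos]⟩

end Well

/-! ### Long-time behaviour with finitely many sign changes -/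

/-- The solution is caught in the well with negative energy. -/
def Trapped (g : ℝ → ℝ) (b : ℝ) (u v : ℝ → ℝ) : Prop := ∃ t > 0, |u t| < b ∧ nrg g u v t < 0

/-- The solution eventually stays beyond `lam` in absolute value. -/
def Stuck (lam : ℝ) (u : ℝ → ℝ) : Prop := ∃ R, ∀ r ≥ R, lam < |u r|

theorem Stuck.neg {lam : ℝ} {u : ℝ → ℝ} (h : Stuck lam u) : Stuck lam fun r => -u r := by
  obtain ⟨R, hR⟩ := h
  exact ⟨R, fun r hr => by rw [abs_neg]; exact hR r hr⟩

/-- Attaining height c requires energy at least F(c), and energy never increases. -/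
theorem IsSol.abs_lt_of_nrg_lt {n : ℕ} {g u v : ℝ → ℝ} (hg : Continuous g)
    (hodd : ∀ s, g (-s) = -g s) (h : IsSol n g u v) {a c : ℝ} (ha : 0 ≤ a) (hu : |u a| < c)
    (hE : nrg g u v a < primF g c) : ∀ r ≥ a, |u r| < c := by
  intro r hr
  by_contra! hcon
  obtain ⟨s, hs, hsc⟩ := intermediate_value_Icc hr h.cu.abs.continuousOn ⟨hu.le, hcon⟩
  have h1 := primF_le_nrg g u v s
  rw [← primF_abs hodd, show |u s| = c from hsc] at h1
  linarith [h.nrg_le hg ha hs.1]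

namespace Well

variable {n : ℕ} {g u v : ℝ → ℝ} {b lam B Fb : ℝ}

/-- A turning point in the well has E ≤ 0, and E cannot become negative later without trapping. So E
and then u are constant from there on, at an equilibrium; backward uniqueness makes u constant from
the start, against b < |u 0|. -/
theorem v_ne_zero (hW : Well g b lam B Fb) (hn : 1 ≤ n) (h : IsSol n g u v) (hcan : Canonical u v)
    (h0 : b < |u 0|) (htrap : ¬ Trapped g b u v) {m : ℝ} (hm : 0 < m) (hum : 0 < u m)
    (humb : u m ≤ b) : v m ≠ 0 := by
  intro hvm
  have hg := hW.cont
  have hE : nrg g u v m = primF g (u m) := by simp [nrg, hvm]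
  have hE0 : nrg g u v m ≤ 0 := by
    rw [hE]; exact hW.primF_nonpos _ (by rwa [abs_of_pos hum])
  have hle : ∀ r ≥ m, |u r| ≤ b := fun r hr => by
    by_contra! hcon
    have h1 : b < min |u r| lam := lt_min hcon hW.b_lt
    have h2 := h.abs_lt_of_nrg_lt hg hW.odd hm.le (c := min |u r| lam)
      (by rw [abs_of_pos hum]; linarith) (hE0.trans_lt (hW.primF_pos h1 (min_le_right _ _))) r hr
    exact absurd h2 (not_lt.2 (min_le_left _ _))
  have hE1 : ∀ r ≥ m, 0 ≤ nrg g u v r := fun r hr => by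
    by_contra! hcon
    refine htrap ⟨r, hm.trans_le hr, lt_of_le_of_ne (hle r hr) fun heq => ?_, hcon⟩
    have h1 := primF_le_nrg g u v r
    rw [← primF_abs hW.odd, heq, hW.primF_b] at h1
    linarith
  have hconst : ∀ r ≥ m, u r = u m := fun r hr =>
    h.eq_of_nrg_le hn hg hm.le (hE0.trans (hE1 r hr)) r ⟨hr, le_rfl⟩
  have hgum : g (u m) = 0 := (h.limit hg (l := u m) (tendsto_const_nhds.congr' (by
    filter_upwards [eventually_ge_atTop m] with r hr using (hconst r hr).symm))).1
  obtain ⟨G, hG⟩ := hW.bdd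
  have heq := h.eq_on_Ioc hg hG hW.lip (IsSol.const hgum) (T := m) (r₀ := m) ⟨hm, le_rfl⟩ rfl hvm
    fun r hr => hcan.ne hum.ne' r ⟨hr.1.le, hr.2⟩
  have h1 : Tendsto u (𝓝[>] 0) (𝓝 (u m)) := by
    refine tendsto_const_nhds.congr' ?_
    filter_upwards [Ioc_mem_nhdsGT hm] with r hr using (heq r hr).1.symm
  have h2 := tendsto_nhds_unique h1 (h.cu.continuousWithinAt (s := Ioi 0) (x := 0))
  rw [← h2, abs_of_pos hum] at h0
  linarith

/-- The limit is a zero of g, and g > 0 on (b, lam]. The limiting energy is F(l) ≤ 0, and a negative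
value would trap the solution. -/
theorem limit_le (hW : Well g b lam B Fb) (h : IsSol n g u v) (htrap : ¬ Trapped g b u v) {l : ℝ}
    (hl : Tendsto u atTop (𝓝 l)) (h0 : 0 ≤ l) (h1 : l ≤ lam) :
    l ≤ b ∧ Tendsto (nrg g u v) atTop (𝓝 0) := by
  obtain ⟨hgl, hE⟩ := h.limit hW.cont hl
  have hlb := hW.g_eq_zero h1 hgl
  refine ⟨hlb, ?_⟩
  rcases eq_or_lt_of_le hlb with h2 | h2
  · rwa [h2, hW.primF_b] at hE
  suffices primF g l = 0 by rwa [this] at hE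
  refine le_antisymm (hW.primF_nonpos l (by rwa [abs_of_nonneg h0])) ?_
  by_contra! hcon
  obtain ⟨t, ht1, ht2, ht3⟩ := ((hE.eventually (gt_mem_nhds hcon)).and
    ((hl.abs.eventually (gt_mem_nhds (show |l| < b by rwa [abs_of_nonneg h0]))).and
      (eventually_gt_atTop 0))).exists
  exact htrap ⟨t, ht3, ht2, ht1⟩

/-- A positive solution that is neither trapped nor stuck converges monotonically to a zero of the
potential in `[0, b]`. -/
theorem tail (hW : Well g b lam B Fb) (hn : 1 ≤ n) (h : IsSol n g u v) (hcan : Canonical u v)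
    (h0 : b < |u 0|) (htrap : ¬ Trapped g b u v) (hstuck : ¬ Stuck lam u) {R : ℝ} (hR : 0 < R)
    (hpos : ∀ r ≥ R, 0 < u r) :
    ∃ l ∈ Icc 0 b, Tendsto u atTop (𝓝 l) ∧ Tendsto (nrg g u v) atTop (𝓝 0) ∧
      ∃ R₁ ≥ R, (∀ r ≥ R₁, v r ≤ 0) ∨ ∀ r ≥ R₁, 0 < v r := by
  have hlow : ∀ T ≥ R, ∃ r ≥ T, u r ≤ lam := by
    intro T hT
    by_contra! hcon
    exact hstuck ⟨T, fun r hr => by rw [abs_of_pos (hpos r (hT.trans hr))]; exact hcon r hr⟩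
  -- Stationary points below lam lie in (b, lam], where g > 0, so the solution descends right after
  -- them.
  have hmax : ∀ r ≥ R, u r ≤ lam → v r = 0 → ∀ x > r, ∃ y, r < y ∧ y < x ∧ u y < u r ∧ v y < 0 := by
    intro r hr hul hvr x hrx
    have hr0 := hR.trans_le hr
    have hub : b < u r := by
      by_contra! hcon
      exact hW.v_ne_zero hn h hcan h0 htrap hr0 (hpos r hr) hcon hvr
    have hd := h.dv r hr0
    have hneg := eventually_neg_of_hasDerivAt_neg hd
      (by rw [hvr]; have := hW.g_pos _ hub hul; simp; exact this) hvr
    obtain ⟨y, hy, hy'⟩ := mem_nhdsGT_iff_exists_Ioo_subset.1 hneg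
    have hy0 : r < y := hy
    set w := min ((r + y) / 2) ((r + x) / 2) with hw
    have hrw : r < w := lt_min (by linarith) (by linarith)
    have hwy : w < y := (min_le_left _ _).trans_lt (by linarith)
    exact ⟨w, hrw, (min_le_right _ _).trans_lt (by linarith),
      h.lt_of_v_neg hrw fun z hz => hy' ⟨hz.1, hz.2.trans hwy⟩, hy' ⟨hrw, hwy⟩⟩
  -- Once descending below lam, the solution cannot turn up: an interior minimum would be
  -- stationary, yet be followed by lower values. If it never descends below lam it increases there,
  -- and not being stuck it cannot pass lam.
  by_cases hI : ∃ p ≥ R, u p ≤ lam ∧ v p ≤ 0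
  · obtain ⟨p, hp, hup, hvp⟩ := hI
    obtain ⟨p, hp, hup, hvp⟩ : ∃ p ≥ R, u p ≤ lam ∧ v p < 0 := by
      rcases eq_or_lt_of_le hvp with h1 | h1
      · obtain ⟨y, hy1, -, hy2, hy3⟩ := hmax p hp hup h1 (p + 1) (by linarith)
        exact ⟨y, hp.trans hy1.le, by linarith, hy3⟩
      · exact ⟨p, hp, hup, h1⟩
    have hv : ∀ r ≥ p, v r ≤ 0 := by
      intro q hq
      by_contra! hvq
      have hpq : p < q := lt_of_le_of_ne hq fun heq => by rw [← heq] at hvq; linarith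
      obtain ⟨x, hx1, hx2, hx3⟩ := exists_lt_left_of_hasDerivAt_pos (h.du q) hvq hpq
      obtain ⟨m, hm, hvm, hmin⟩ := h.exists_interior_min hvp ⟨hx1.le, hx2.le⟩ hx3
      obtain ⟨y, hy1, hy2, hy3, -⟩ := hmax m (hp.trans hm.1.le)
        ((hmin p ⟨le_rfl, hpq.le⟩).trans hup) hvm q hm.2
      linarith [hmin y ⟨hm.1.le.trans hy1.le, hy2.le⟩]
    obtain ⟨l, hl, hl0, hl1⟩ := h.exists_limit_of_antitone (R := p) (m := 0) hv
      fun r hr => (hpos r (hp.trans hr)).le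
    obtain ⟨h1, h2⟩ := hW.limit_le h htrap hl hl0 ((hl1 p le_rfl).trans hup)
    exact ⟨l, ⟨hl0, h1⟩, hl, h2, p, hp, Or.inl hv⟩
  · push Not at hI
    obtain ⟨p, hp, hup⟩ := hlow R le_rfl
    have hle : ∀ r ≥ p, u r ≤ lam := by
      intro s hs
      by_contra! hcon
      obtain ⟨q, hq, huq⟩ := hlow s (hp.trans hs)
      obtain ⟨c, hc1, hc2, hc3, hc4⟩ := exists_first_zero (φ := fun r => u r - lam)
        (by have := h.cu; fun_prop) hq (by linarith) (by linarith)
      have hRc : R ≤ c := hp.trans (hs.trans hc1.le)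
      obtain ⟨y, hy1, hy2, hy3⟩ := exists_lt_left_of_hasDerivAt_pos (h.du c)
        (hI c hRc (by linarith)) hc1
      linarith [hc4 y hy1.le hy2]
    have hv : ∀ r ≥ p, 0 < v r := fun r hr => hI r (hp.trans hr) (hle r hr)
    obtain ⟨l, hl, hl0, hl1⟩ := h.exists_limit_of_monotone (R := p) (m := lam)
      (fun r hr => (hv r hr).le) hle
    have hl2 : 0 ≤ l := (hpos p hp).le.trans (hl1 p le_rfl)
    obtain ⟨h1, h2⟩ := hW.limit_le h htrap hl hl2 hl0
    exact ⟨l, ⟨hl2, h1⟩, hl, h2, p, hp, Or.inr hv⟩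

/-- A limit strictly inside the well eventually confines the solution there, so
`IsSol.exists_mul_nrg_le` applies at every late scale. -/
theorem exists_small (hW : Well g b lam B Fb) (h : IsSol n g u v) {l : ℝ} (hl0 : |l| < b)
    (hl : Tendsto u atTop (𝓝 l)) {c : ℝ} (hc : 0 < c) (R₀ : ℝ) :
    ∃ R ≥ R₀, R * nrg g u v R < c := by
  obtain ⟨R₁, hR₁⟩ := eventually_atTop.1 (hl.abs.eventually (gt_mem_nhds hl0))
  set R := max (max R₀ R₁) (max 1 (b ^ 2 / c + 1)) with hR
  have h1 : 1 ≤ R := (le_max_left 1 _).trans (le_max_right _ _)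
  have h2 : b ^ 2 / c < R :=
    (lt_add_one _).trans_le ((le_max_right 1 _).trans (le_max_right (max R₀ R₁) _))
  have h3 : R₁ ≤ R := (le_max_right R₀ _).trans (le_max_left _ _)
  have h4 : R₀ ≤ R := (le_max_left R₀ _).trans (le_max_left _ _)
  obtain ⟨ξ, hξ, hξ'⟩ := h.exists_mul_nrg_le (R := R) (by linarith)
    (fun r hr => (hR₁ r (h3.trans hr.1)).le) hW.primF_nonpos
  refine ⟨ξ, h4.trans hξ.1.le, hξ'.trans_lt ?_⟩
  rw [div_lt_iff₀ (by linarith)]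
  rw [div_lt_iff₀ hc] at h2
  linarith

end Well

/-- `u` tends to `0`, and at some moment it descends with little energy. -/
def Vanishing (g : ℝ → ℝ) (b κ : ℝ) (u v : ℝ → ℝ) : Prop :=
  Tendsto u atTop (𝓝 0) ∧ ∃ R > 0, u R * v R < 0 ∧ |u R| < b ∧ R * nrg g u v R < κ * absPot g b

/-- At some moment the energy is too small for leaving one half of the well. -/
def Settling (g : ℝ → ℝ) (b κ : ℝ) (u v : ℝ → ℝ) : Prop :=
  ∃ R > 0, |u R| < b ∧ ((u R * v R < 0 ∧ R * nrg g u v R < κ * absPot g |u R|) ∨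
    (0 < u R * v R ∧ R * nrg g u v R < κ * (absPot g b - absPot g |u R|)))

/-- `|u|` tends to the rim `b` of the well without attaining it. -/
def Rimming (g : ℝ → ℝ) (b : ℝ) (u v : ℝ → ℝ) : Prop :=
  ∃ R > 0, (∀ r ≥ R, |u r| ≠ b ∧ 0 < u r * u R) ∧ Tendsto (fun r => |u r|) atTop (𝓝 b) ∧
    Tendsto (nrg g u v) atTop (𝓝 0)

theorem mul_nonneg_of_ne_zero {u : ℝ → ℝ} (hu : Continuous u) {t r : ℝ} (htr : t ≤ r)
    (h : ∀ s ∈ Icc t r, u s ≠ 0) : 0 < u r * u t := by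
  by_contra hcon
  have hr := h r ⟨htr, le_rfl⟩
  have ht := h t ⟨le_rfl, htr⟩
  have h1 : u r * u t < 0 := lt_of_le_of_ne (not_lt.1 hcon) (mul_ne_zero hr ht)
  rcases mul_neg_iff.1 h1 with ⟨h2, h3⟩ | ⟨h2, h3⟩
  · obtain ⟨s, hs, hs'⟩ := intermediate_value_Icc htr hu.continuousOn ⟨h3.le, h2.le⟩
    exact h s hs hs'
  · obtain ⟨s, hs, hs'⟩ := intermediate_value_Icc' htr hu.continuousOn ⟨h2.le, h3.le⟩
    exact h s hs hs'

namespace Well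

variable {n : ℕ} {g u v : ℝ → ℝ} {b lam B Fb : ℝ}

/-- A contact with 0 is a minimum, hence a double zero, and the solution rests there. Otherwise it
converges monotonically to some l in [0, b]: l = 0 is vanishing, l = b rimming, and an interior l
settling, since r E is small at late times. -/
theorem alternatives_of_pos (hW : Well g b lam B Fb) (hn : 1 ≤ n) (h : IsSol n g u v)
    (hcan : Canonical u v) (h0 : b < |u 0|) (htrap : ¬ Trapped g b u v) (hstuck : ¬ Stuck lam u)
    {κ : ℝ} (hκ : 0 < κ) {R : ℝ} (hR : 0 < R) (huR : 0 < u R) (hpos : ∀ r ≥ R, 0 ≤ u r) :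
    Vanishing g b κ u v ∨ Settling g b κ u v ∨ Rimming g b u v := by
  have hb := hW.b_pos
  have hAb : 0 < κ * absPot g b := mul_pos hκ (hW.absPot_pos b hb le_rfl)
  by_cases hz : ∃ r ≥ R, u r ≤ 0
  · obtain ⟨r, hr, hur⟩ := hz
    obtain ⟨c, hc1, hc2, hc3, hc4⟩ := exists_first_zero h.cu hr huR hur
    have hc0 : 0 < c := hR.trans hc1
    have hvc : v c = 0 := by
      have : IsLocalMin u c := by
        filter_upwards [Ioi_mem_nhds hc1] with x hx
        rw [hc3]
        exact hpos x (le_of_lt hx)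
      exact this.hasDerivAt_eq_zero (h.du c)
    have hzero := hcan c hc0.le hc3 hvc
    left
    refine ⟨tendsto_const_nhds.congr' ?_, ?_⟩
    · filter_upwards [eventually_ge_atTop c] with x hx using (hzero x hx).symm
    have hEc : nrg g u v c = 0 := by simp [nrg, hc3, hvc]
    have hev : ∀ᶠ x in 𝓝 c, |u x| < b ∧ x * nrg g u v x < κ * absPot g b := by
      refine (h.cu.abs.continuousAt.eventually_lt_const (by simpa [hc3] using hb)).and ?_
      have h2 : Continuous fun x => x * nrg g u v x := continuous_id.mul (h.continuous_nrg hW.cont)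
      exact h2.continuousAt.eventually_lt_const (by simpa [hEc] using hAb)
    obtain ⟨ε, hε, hball⟩ := Metric.eventually_nhds_iff_ball.1 hev
    -- The descending moment is found just before the double zero, where r E is still almost 0; the
    -- mean value theorem provides the negative velocity.
    set x := max R (c - ε / 2) with hx
    have hxc : x < c := max_lt hc1 (by linarith)
    have hRx : R ≤ x := le_max_left _ _
    obtain ⟨ξ, hξ, hξ'⟩ := h.exists_mvt hxc
    have hux := hc4 x hRx hxc
    have huξ := hc4 ξ (hRx.trans hξ.1.le) hξ.2
    have hb2 := hball ξ (by
      rw [Metric.mem_ball, Real.dist_eq, abs_sub_comm, abs_of_pos (by linarith [hξ.2])]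
      linarith [hξ.1, le_max_right R (c - ε / 2)])
    refine ⟨ξ, hR.trans_le (hRx.trans hξ.1.le), mul_neg_of_pos_of_neg huξ ?_, hb2⟩
    rw [hc3] at hξ'
    by_contra! hcon
    have : 0 ≤ v ξ * (c - x) := mul_nonneg hcon (by linarith)
    linarith
  push Not at hz
  obtain ⟨l, hl0, hl, hE, R₁, hR₁, hmono⟩ := hW.tail hn h hcan h0 htrap hstuck hR hz
  have hvne : ∀ r ≥ R, u r ≤ b → v r ≠ 0 := fun r hr hur =>
    hW.v_ne_zero hn h hcan h0 htrap (hR.trans_le hr) (hz r hr) hur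
  have habs : ∀ {r}, R ≤ r → |u r| = u r := fun hr => abs_of_pos (hz _ hr)
  rcases eq_or_lt_of_le hl0.1 with h1 | h1
  · subst h1
    left
    obtain ⟨R₂, hR₂⟩ := eventually_atTop.1 (hl.eventually (gt_mem_nhds hb))
    have hv : ∀ r ≥ R₁, v r ≤ 0 := by
      refine hmono.resolve_right fun hv => ?_
      have h2 : ∀ r ≥ R₁, u R₁ ≤ u r := fun r hr =>
        h.monotoneOn_Icc (fun z hz => (hv z hz.1).le) ⟨le_rfl, hr⟩ ⟨hr, le_rfl⟩ hr
      have h3 := ge_of_tendsto hl (by filter_upwards [eventually_ge_atTop R₁] using h2)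
      linarith [hz R₁ hR₁]
    obtain ⟨r, hr, hr'⟩ := hW.exists_small h (by simpa using hb) hl hAb (max R₁ R₂)
    have hr1 : R₁ ≤ r := (le_max_left _ _).trans hr
    have hrR : R ≤ r := hR₁.trans hr1
    have hub := hR₂ r ((le_max_right _ _).trans hr)
    refine ⟨hl, r, hR.trans_le hrR, mul_neg_of_pos_of_neg (hz r hrR) ?_, by rwa [habs hrR], hr'⟩
    exact lt_of_le_of_ne (hv r hr1) (hvne r hrR hub.le)
  rcases eq_or_lt_of_le hl0.2 with h2 | h2
  · subst h2
    right; right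
    refine ⟨R₁, hR.trans_le hR₁, fun r hr => ⟨?_, mul_pos (hz r (hR₁.trans hr)) (hz R₁ hR₁)⟩,
      by simpa [abs_of_pos hb] using hl.abs, hE⟩
    rw [habs (hR₁.trans hr)]
    intro hur
    have hv0 := hvne r (hR₁.trans hr) hur.le
    rcases hmono with hv | hv
    · obtain ⟨y, hy1, -, hy2⟩ := exists_lt_of_hasDerivAt_neg (h.du r)
        (lt_of_le_of_ne (hv r hr) hv0) (lt_add_one r)
      have h3 : ∀ x ≥ y, u x ≤ u y := fun x hx =>
        h.antitoneOn_Icc (fun z hz => hv z (hr.le.trans (hy1.le.trans hz.1)))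
          ⟨le_rfl, hx⟩ ⟨hx, le_rfl⟩ hx
      have h4 := le_of_tendsto hl (by filter_upwards [eventually_ge_atTop y] using h3)
      linarith
    · obtain ⟨y, hy1, -, hy2⟩ := exists_gt_of_hasDerivAt_pos (h.du r) (hv r hr) (lt_add_one r)
      have h3 : ∀ x ≥ y, u y ≤ u x := fun x hx =>
        h.monotoneOn_Icc (fun z hz => (hv z (hr.le.trans (hy1.le.trans hz.1))).le)
          ⟨le_rfl, hx⟩ ⟨hx, le_rfl⟩ hx
      have h4 := ge_of_tendsto hl (by filter_upwards [eventually_ge_atTop y] using h3)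
      linarith
  · right; left
    set c := min (κ * absPot g (l / 2)) (κ * (absPot g b - absPot g ((l + b) / 2))) with hc
    have hc0 : 0 < c := lt_min (mul_pos hκ (hW.absPot_pos _ (by linarith) (by linarith)))
      (mul_pos hκ (sub_pos.2 (hW.absPot_lt _ (by linarith) (by linarith))))
    obtain ⟨R₂, hR₂⟩ := eventually_atTop.1
      (hl.eventually (Ioo_mem_nhds (show l / 2 < l by linarith) (show l < (l + b) / 2 by linarith)))
    obtain ⟨r, hr, hr'⟩ := hW.exists_small h (by rwa [abs_of_pos h1]) hl hc0 (max R R₂)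
    have hrR : R ≤ r := (le_max_left _ _).trans hr
    have hur := hR₂ r ((le_max_right _ _).trans hr)
    have hub : u r < b := by linarith [hur.2]
    have hm := absPot_mono hW.cont
    have h3 := hz r hrR
    refine ⟨r, hR.trans_le hrR, by rwa [habs hrR], ?_⟩
    rw [habs hrR]
    rcases lt_or_gt_of_ne (hvne r hrR hub.le) with hv | hv
    · refine Or.inl ⟨mul_neg_of_pos_of_neg h3 hv, ?_⟩
      have := mul_le_mul_of_nonneg_left (hm hur.1.le) hκ.le
      linarith [min_le_left (κ * absPot g (l / 2)) (κ * (absPot g b - absPot g ((l + b) / 2)))]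
    · refine Or.inr ⟨mul_pos h3 hv, ?_⟩
      have := mul_le_mul_of_nonneg_left (hm hur.2.le) hκ.le
      linarith [min_le_right (κ * absPot g (l / 2)) (κ * (absPot g b - absPot g ((l + b) / 2)))]

/-- Boundedly many sign changes give an eventual sign, and oddness reduces to the positive case. -/
theorem alternatives (hW : Well g b lam B Fb) (hn : 1 ≤ n) (h : IsSol n g u v)
    (hcan : Canonical u v) (h0 : b < |u 0|) {k : ℕ} (hk : ¬ HasSignChangesAtLeast u (k + 1))
    (htrap : ¬ Trapped g b u v) (hstuck : ¬ Stuck lam u) {κ : ℝ} (hκ : 0 < κ) :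
    Vanishing g b κ u v ∨ Settling g b κ u v ∨ Rimming g b u v := by
  obtain ⟨R, hR, huR, htail⟩ := exists_tail_sign h.cu
    (abs_pos.1 (hW.b_pos.trans h0)) hk
  rcases lt_or_gt_of_ne huR with h1 | h1
  · have := hW.alternatives_of_pos hn (h.neg hW.odd) hcan.neg (by simpa using h0)
      (fun ⟨t, h2, h3, h4⟩ => htrap ⟨t, h2, by simpa using h3, by rwa [nrg_neg hW.odd] at h4⟩)
      (fun h2 => hstuck (by simpa using h2.neg)) hκ hR (by linarith) (fun r hr => by
        have := htail r hr
        by_contra! hcon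
        nlinarith)
    refine this.imp ?_ (Or.imp ?_ ?_)
    · rintro ⟨h2, R, h3, h4⟩
      exact ⟨by simpa using h2.neg, R, h3, by simpa [nrg_neg hW.odd] using h4⟩
    · rintro ⟨R, h3, h4⟩
      exact ⟨R, h3, by simpa [nrg_neg hW.odd] using h4⟩
    · rintro ⟨R, h3, h4, h5, h6⟩
      refine ⟨R, h3, by simpa using h4, by simpa using h5, ?_⟩
      exact h6.congr fun r => nrg_neg hW.odd u v r
  · refine hW.alternatives_of_pos hn h hcan h0 htrap hstuck hκ hR h1 fun r hr => ?_
    exact nonneg_of_mul_nonneg_left (htail r hr) h1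

theorem stays_of_settling (hW : Well g b lam B Fb) (hn : 1 ≤ n) (h : IsSol n g u v) {R Em : ℝ}
    (hR : 0 < R) (hub : |u R| < b) (hEm : nrg g u v R ≤ Em) (hpos : 0 < Em + Fb)
    (hE : (u R * v R < 0 ∧ R * nrg g u v R < dissip n Em Fb * absPot g |u R|) ∨
      (0 < u R * v R ∧ R * nrg g u v R < dissip n Em Fb * (absPot g b - absPot g |u R|))) :
    ∀ r ≥ R, 0 < u r * u R ∧ |u r| < b := by
  have key : ∀ u v : ℝ → ℝ, IsSol n g u v → |u R| < b → nrg g u v R ≤ Em → 0 < u R →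
      ((u R * v R < 0 ∧ R * nrg g u v R < dissip n Em Fb * absPot g |u R|) ∨
      (0 < u R * v R ∧ R * nrg g u v R < dissip n Em Fb * (absPot g b - absPot g |u R|))) →
      ∀ r ≥ R, 0 < u r * u R ∧ |u r| < b := by
    intro u v h hub hEm hu hE r hr
    rw [abs_of_pos hu] at hE hub
    suffices 0 < u r ∧ u r < b from
      ⟨mul_pos this.1 hu, abs_lt.2 ⟨by linarith [this.1, hW.b_pos], this.2⟩⟩
    rcases eq_or_lt_of_le hr with h1 | h1
    · rw [← h1]; exact ⟨hu, hub⟩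
    rcases hE with ⟨h2, h3⟩ | ⟨h2, h3⟩
    · exact hW.stays_of_descending hn h hR hu hub.le (by
        by_contra! hcon
        exact absurd h2 (not_lt.2 (mul_nonneg hu.le hcon))) hEm hpos h3 r h1
    · exact hW.stays_of_ascending hn h hR hu.le hub (pos_of_mul_pos_right h2 hu.le)
        hEm hpos h3 r h1
  have hne : u R ≠ 0 := by rintro h1; simp [h1] at hE
  rcases lt_or_gt_of_ne hne with h1 | h1
  · have := key _ _ (h.neg hW.odd) (by simpa using hub) (by rwa [nrg_neg hW.odd]) (by linarith)
      (by simpa [nrg_neg hW.odd] using hE)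
    simpa using this
  · exact key u v h hub hEm h1 hE

theorem last_sign_change_of_vanishing (hW : Well g b lam B Fb) (hn : 1 ≤ n) (h : IsSol n g u v)
    (hcan : Canonical u v) {R Em : ℝ} (hR : 0 < R) (hub : |u R| < b) (huv : u R * v R < 0)
    (hEm : nrg g u v R ≤ Em) (hpos : 0 < Em + Fb)
    (hE : R * nrg g u v R < dissip n Em Fb * absPot g b) :
    (∀ r ≥ R, |u r| < b) ∧ ((∀ r ≥ R, 0 ≤ u r * u R) ∨
      ∃ z > R, (∀ r, R ≤ r → r ≤ z → 0 ≤ u r * u R) ∧ ∀ r ≥ z, u r * u R ≤ 0) := by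
  rcases mul_neg_iff.1 huv with ⟨h1, h2⟩ | ⟨h1, h2⟩
  · rw [abs_of_pos h1] at hub
    obtain ⟨h6, h7⟩ := hW.last_sign_change hn h hcan hR h1 hub h2 hEm hpos hE
    refine ⟨h6, ?_⟩
    rcases h7 with h3 | ⟨z, h3, h4, h5⟩
    · exact Or.inl fun r hr => mul_nonneg (h3 r hr) h1.le
    · exact Or.inr ⟨z, h3, fun r hr hrz => mul_nonneg (h4 r hr hrz) h1.le,
        fun r hr => mul_nonpos_of_nonpos_of_nonneg (h5 r hr) h1.le⟩
  · rw [abs_of_neg h1] at hub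
    obtain ⟨h6, h7⟩ := hW.last_sign_change hn (h.neg hW.odd) hcan.neg hR (by linarith) hub
      (by linarith) (by rwa [nrg_neg hW.odd]) hpos (by rwa [nrg_neg hW.odd])
    refine ⟨by simpa using h6, ?_⟩
    rcases h7 with h3 | ⟨z, h3, h4, h5⟩
    · exact Or.inl fun r hr => mul_nonneg_of_nonpos_of_nonpos (by linarith [h3 r hr]) h1.le
    · exact Or.inr ⟨z, h3,
        fun r hr hrz => mul_nonneg_of_nonpos_of_nonpos (by linarith [h4 r hr hrz]) h1.le,
        fun r hr => mul_nonpos_of_nonneg_of_nonpos (by linarith [h5 r hr]) h1.le⟩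

end Well

/-! ### Stability in the initial height -/

/-- A family of canonical solutions, parametrized by their initial heights. -/
structure Family (n : ℕ) (g : ℝ → ℝ) (U V : ℝ → ℝ → ℝ) : Prop where
  sol : ∀ α, IsSol n g (U α) (V α)
  init : ∀ α, U α 0 = α
  canon : ∀ α, Canonical (U α) (V α)
  near : ∀ α T, U α T ≠ 0 → ∀ ε > 0, ∀ᶠ α' in 𝓝 α, ∀ r ∈ Icc 0 T,
    |U α' r - U α r| < ε ∧ |V α' r - V α r| < ε

namespace Family

variable {n : ℕ} {g : ℝ → ℝ} {U V : ℝ → ℝ → ℝ} {b lam B Fb α T : ℝ}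

theorem tendsto_u (hF : Family n g U V) (hT : U α T ≠ 0) {r : ℝ} (hr : r ∈ Icc 0 T) :
    Tendsto (fun α' => U α' r) (𝓝 α) (𝓝 (U α r)) :=
  Metric.tendsto_nhds.2 fun ε hε => (hF.near α T hT ε hε).mono fun _ h => (h r hr).1

theorem tendsto_v (hF : Family n g U V) (hT : U α T ≠ 0) {r : ℝ} (hr : r ∈ Icc 0 T) :
    Tendsto (fun α' => V α' r) (𝓝 α) (𝓝 (V α r)) :=
  Metric.tendsto_nhds.2 fun ε hε => (hF.near α T hT ε hε).mono fun _ h => (h r hr).2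

theorem tendsto_nrg (hF : Family n g U V) (hg : Continuous g) (hT : U α T ≠ 0) {r : ℝ}
    (hr : r ∈ Icc 0 T) :
    Tendsto (fun α' => nrg g (U α') (V α') r) (𝓝 α) (𝓝 (nrg g (U α) (V α) r)) :=
  (((hF.tendsto_v hT hr).pow 2).div_const 2).add
    (((continuous_primF hg).tendsto _).comp (hF.tendsto_u hT hr))

theorem eventually_hasSignChangesAtLeast (hF : Family n g U V) {k : ℕ}
    (h : HasSignChangesAtLeast (U α) k) : ∀ᶠ α' in 𝓝 α, HasSignChangesAtLeast (U α') k := by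
  rcases k with _ | k
  · exact Eventually.of_forall fun _ => hasSignChangesAtLeast_zero _
  obtain ⟨T, r, h0, hT, hlt, hs⟩ := hasSignChangesAtLeast_iff.1 h
  have hne : U α (r (k + 1)) ≠ 0 := fun hz => by
    have := hs k (Nat.lt_succ_self k)
    simp [hz] at this
  obtain ⟨ε, hε, hstab⟩ := SignChangesOn.exists_stable (T := r (k + 1)) ⟨r, h0, le_rfl, hlt, hs⟩
  filter_upwards [hF.near α _ hne ε hε] with α' h'
  exact hasSignChangesAtLeast_iff.2 ⟨_, hstab _ fun x hx => (h' x hx).1⟩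

theorem eventually_signChangesOn_imp (hF : Family n g U V) (hα : α ≠ 0) (hT0 : 0 < T)
    (hT : U α T ≠ 0) :
    ∀ᶠ α' in 𝓝 α, ∀ k, SignChangesOn (U α') T k → SignChangesOn (U α) T k := by
  obtain ⟨ε, hε, h⟩ := exists_signChangesOn_of_near (hF.sol α).cu (hF.sol α).cv hT0
    (by rwa [hF.init]) hT ((hF.canon α).ne hT)
  filter_upwards [hF.near α T hT ε hε] with α' h'
  exact h _ _ (hF.sol α').du h'

/-- If neighbours have no sign change after T, their count is decided on (0, T], where it is upper
semicontinuous because the zeros of U α there are simple. -/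
theorem eventually_not_of_tail (hF : Family n g U V) (hα : α ≠ 0) (hT0 : 0 < T) (hT : U α T ≠ 0)
    {k : ℕ} (hk : ¬ HasSignChangesAtLeast (U α) k)
    (htail : ∀ᶠ α' in 𝓝 α, ∀ r ≥ T, 0 ≤ U α' r * U α' T) :
    ∀ᶠ α' in 𝓝 α, ¬ HasSignChangesAtLeast (U α') k := by
  filter_upwards [hF.eventually_signChangesOn_imp hα hT0 hT, htail,
    (hF.tendsto_u hT ⟨hT0.le, le_rfl⟩).eventually_ne hT] with α' h1 h2 h3 h4
  obtain ⟨T', hT'⟩ := hasSignChangesAtLeast_iff.1 h4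
  exact hk (hasSignChangesAtLeast_iff.2
    ⟨T, h1 k (hT'.of_tail hT0 h3 fun r hr _ => h2 r hr)⟩)

/-- Negative energy is an open condition and excludes any later zero of u, because F(0) = 0. -/
theorem eventually_not_of_trapped (hF : Family n g U V) (hW : Well g b lam B Fb) (hα : α ≠ 0)
    (ht : Trapped g b (U α) (V α)) {k : ℕ} (hk : ¬ HasSignChangesAtLeast (U α) k) :
    ∀ᶠ α' in 𝓝 α, ¬ HasSignChangesAtLeast (U α') k := by
  obtain ⟨t, ht0, htb, hE⟩ := ht
  have hne : ∀ {u v : ℝ → ℝ} {r}, nrg g u v r < 0 → u r ≠ 0 := fun {u v r} h1 h2 => by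
    have := primF_le_nrg g u v r
    rw [h2, primF_zero] at this
    linarith
  refine hF.eventually_not_of_tail hα ht0 (hne hE) hk ?_
  filter_upwards [(hF.tendsto_nrg hW.cont (hne hE) ⟨ht0.le, le_rfl⟩).eventually (gt_mem_nhds hE)]
    with α' h1 r hr
  exact (mul_nonneg_of_ne_zero (hF.sol α').cu hr fun s hs =>
    hne (((hF.sol α').nrg_le hW.cont ht0.le hs.1).trans_lt h1)).le

theorem eventually_not_stuck (hF : Family n g U V) (hW : Well g b lam B Fb) (hT0 : 0 < T)
    (hT : U α T ≠ 0) (hu : |U α T| < lam) (hE : nrg g (U α) (V α) T < primF g lam) :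
    ∀ᶠ α' in 𝓝 α, ¬ Stuck lam (U α') := by
  filter_upwards [(hF.tendsto_u hT ⟨hT0.le, le_rfl⟩).abs.eventually (gt_mem_nhds hu),
    (hF.tendsto_nrg hW.cont hT ⟨hT0.le, le_rfl⟩).eventually (gt_mem_nhds hE)] with α' h1 h2 h3
  obtain ⟨R, hR⟩ := h3
  have h4 := (hF.sol α').abs_lt_of_nrg_lt hW.cont hW.odd hT0.le h1 h2 (max R T) (le_max_right _ _)
  linarith [hR _ (le_max_left R T)]

end Family

/-- The dissipation coefficient that serves all solutions starting in `[-B, B]`. -/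
noncomputable def wellCoeff (n : ℕ) (g : ℝ → ℝ) (B Fb : ℝ) : ℝ := dissip n (primF g B + 1) Fb

namespace Well

variable {n : ℕ} {g : ℝ → ℝ} {b lam B Fb : ℝ}

theorem primF_B_pos (hW : Well g b lam B Fb) : 0 < primF g B :=
  (hW.primF_pos hW.b_lt le_rfl).trans_le (hW.primF_le lam (by
    rw [abs_of_pos hW.lam_pos]; exact hW.lam_lt.le))

theorem level_pos (hW : Well g b lam B Fb) : 0 < primF g B + 1 + Fb := by
  linarith [hW.primF_B_pos, hW.Fb_nonneg]

theorem wellCoeff_pos (hW : Well g b lam B Fb) (hn : 1 ≤ n) : 0 < wellCoeff n g B Fb :=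
  dissip_pos hn hW.level_pos

end Well

namespace Family

variable {n : ℕ} {g : ℝ → ℝ} {U V : ℝ → ℝ → ℝ} {b lam B Fb α T : ℝ}

/-- The slack 1 makes the bound strict, so that it passes to neighbours starting beyond B as well.
-/
theorem nrg_lt (hF : Family n g U V) (hW : Well g b lam B Fb) (hα : |α| ≤ B) {r : ℝ} (hr : 0 ≤ r) :
    nrg g (U α) (V α) r < primF g B + 1 := by
  have h1 := (hF.sol α).nrg_le hW.cont le_rfl hr
  have h2 : nrg g (U α) (V α) 0 = primF g α := by
    simp [nrg, hF.init, (hF.sol α).v_nonpos 0 le_rfl]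
  linarith [hW.primF_le α hα]

/-- The inequalities at the single time R are open. Neighbours satisfying them stay in the well and
change sign at most once more, so the count grows by at most one. -/
theorem eventually_of_vanishing (hF : Family n g U V) (hW : Well g b lam B Fb) (hn : 1 ≤ n)
    (hα : α ≠ 0) (hαB : |α| ≤ B) (h : Vanishing g b (wellCoeff n g B Fb) (U α) (V α)) :
    (∀ᶠ α' in 𝓝 α, ¬ Stuck lam (U α')) ∧ ∀ k, ¬ HasSignChangesAtLeast (U α) k →
      ∀ᶠ α' in 𝓝 α, ¬ HasSignChangesAtLeast (U α') (k + 1) := by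
  obtain ⟨-, R, hR, huv, hub, hE⟩ := h
  have hne : U α R ≠ 0 := by rintro h1; simp [h1] at huv
  have hmem : R ∈ Icc 0 R := ⟨hR.le, le_rfl⟩
  have hu := hF.tendsto_u hne hmem
  have hv := hF.tendsto_v hne hmem
  have hnrg := hF.tendsto_nrg hW.cont hne hmem
  have hev : ∀ᶠ α' in 𝓝 α, (∀ r ≥ R, |U α' r| < b) ∧ ((∀ r ≥ R, 0 ≤ U α' r * U α' R) ∨
      ∃ z > R, (∀ r, R ≤ r → r ≤ z → 0 ≤ U α' r * U α' R) ∧ ∀ r ≥ z, U α' r * U α' R ≤ 0) := by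
    filter_upwards [(hu.mul hv).eventually (gt_mem_nhds huv), hu.abs.eventually (gt_mem_nhds hub),
      hnrg.eventually (gt_mem_nhds (hF.nrg_lt hW hαB hR.le)),
      (hnrg.const_mul R).eventually (gt_mem_nhds hE)] with α' h1 h2 h3 h4
    exact hW.last_sign_change_of_vanishing hn (hF.sol α') (hF.canon α') hR h2 h1 h3.le
      hW.level_pos h4
  refine ⟨?_, fun k hk => ?_⟩
  · filter_upwards [hev] with α' h1 h2
    obtain ⟨R', hR'⟩ := h2
    linarith [hR' _ (le_max_left R' R), h1.1 _ (le_max_right R' R), hW.b_lt]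
  · filter_upwards [hev, hF.eventually_signChangesOn_imp hα hR hne, hu.eventually_ne hne]
      with α' h1 h2 h3 h4
    obtain ⟨T, hT⟩ := hasSignChangesAtLeast_iff.1 h4
    refine hk (hasSignChangesAtLeast_iff.2 ⟨R, h2 k ?_⟩)
    rcases h1.2 with h5 | ⟨z, -, h6, h7⟩
    · obtain ⟨T, hT⟩ := hasSignChangesAtLeast_iff.1 (h4.mono (Nat.le_succ k))
      exact hT.of_tail hR h3 fun r hr _ => h5 r hr
    · exact hT.of_tail_succ hR h3 h6 h7

/-- The condition at time R is open, and each neighbour satisfying it keeps its sign and stays in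
the well afterwards. -/
theorem eventually_of_settling (hF : Family n g U V) (hW : Well g b lam B Fb) (hn : 1 ≤ n)
    (hα : α ≠ 0) (hαB : |α| ≤ B) (h : Settling g b (wellCoeff n g B Fb) (U α) (V α)) :
    (∀ᶠ α' in 𝓝 α, ¬ Stuck lam (U α')) ∧ ∀ k, ¬ HasSignChangesAtLeast (U α) k →
      ∀ᶠ α' in 𝓝 α, ¬ HasSignChangesAtLeast (U α') k := by
  obtain ⟨R, hR, hub, hE⟩ := h
  have hne : U α R ≠ 0 := by rintro h1; simp [h1] at hE
  have hmem : R ∈ Icc 0 R := ⟨hR.le, le_rfl⟩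
  have hu := hF.tendsto_u hne hmem
  have hv := hF.tendsto_v hne hmem
  have hnrg := hF.tendsto_nrg hW.cont hne hmem
  have hA : Tendsto (fun α' => absPot g |U α' R|) (𝓝 α) (𝓝 (absPot g |U α R|)) :=
    ((continuous_absPot hW.cont).tendsto _).comp hu.abs
  have hE' : ∀ᶠ α' in 𝓝 α, (U α' R * V α' R < 0 ∧
      R * nrg g (U α') (V α') R < wellCoeff n g B Fb * absPot g |U α' R|) ∨
      (0 < U α' R * V α' R ∧ R * nrg g (U α') (V α') R <
        wellCoeff n g B Fb * (absPot g b - absPot g |U α' R|)) := by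
    rcases hE with ⟨h1, h2⟩ | ⟨h1, h2⟩
    · filter_upwards [(hu.mul hv).eventually (gt_mem_nhds h1),
        (hnrg.const_mul R).eventually_lt (hA.const_mul _) h2] with α' h3 h4
      exact Or.inl ⟨h3, h4⟩
    · filter_upwards [(hu.mul hv).eventually (lt_mem_nhds h1),
        (hnrg.const_mul R).eventually_lt ((hA.const_sub _).const_mul _) h2] with α' h3 h4
      exact Or.inr ⟨h3, h4⟩
  have hev : ∀ᶠ α' in 𝓝 α, ∀ r ≥ R, 0 < U α' r * U α' R ∧ |U α' r| < b := by
    filter_upwards [hE', hu.abs.eventually (gt_mem_nhds hub),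
      hnrg.eventually (gt_mem_nhds (hF.nrg_lt hW hαB hR.le))] with α' h1 h2 h3
    exact hW.stays_of_settling hn (hF.sol α') hR h2 h3.le hW.level_pos h1
  refine ⟨?_, fun k hk => hF.eventually_not_of_tail hα hR hne hk
    (hev.mono fun α' h1 r hr => (h1 r hr).1.le)⟩
  filter_upwards [hev] with α' h1 h2
  obtain ⟨R', hR'⟩ := h2
  linarith [hR' _ (le_max_left R' R), (h1 _ (le_max_right R' R)).2, hW.b_lt]

theorem exists_low_of_rimming (hW : Well g b lam B Fb) {u v : ℝ → ℝ} (h : Rimming g b u v) :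
    ∃ T > 0, u T ≠ 0 ∧ |u T| < lam ∧ nrg g u v T < primF g lam := by
  obtain ⟨R, hR, h1, h2, h3⟩ := h
  obtain ⟨T, hT1, hT2, hT3⟩ := ((h2.eventually (gt_mem_nhds hW.b_lt)).and
    ((h3.eventually (gt_mem_nhds (hW.primF_pos hW.b_lt le_rfl))).and
      (eventually_ge_atTop R))).exists
  exact ⟨T, hR.trans_le hT3, fun h4 => by simpa [h4] using (h1 T hT3).2, hT1, hT2⟩

/-- Each way of not being stuck is visible at one finite time through strict inequalities, which
neighbours inherit. -/
theorem eventually_not_stuck_of_not (hF : Family n g U V) (hW : Well g b lam B Fb) (hn : 1 ≤ n)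
    (hα : lam < α) (hαB : α ≤ B) {k : ℕ} (hk : ¬ HasSignChangesAtLeast (U α) (k + 1))
    (hstuck : ¬ Stuck lam (U α)) : ∀ᶠ α' in 𝓝 α, ¬ Stuck lam (U α') := by
  have hα0 : 0 < α := hW.lam_pos.trans hα
  have hαB' : |α| ≤ B := by rwa [abs_of_pos hα0]
  by_cases htrap : Trapped g b (U α) (V α)
  · obtain ⟨t, ht0, htb, hE⟩ := htrap
    refine hF.eventually_not_stuck hW ht0 (fun h2 => ?_) (htb.trans hW.b_lt)
      (hE.trans (hW.primF_pos hW.b_lt le_rfl))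
    have := primF_le_nrg g (U α) (V α) t
    rw [h2, primF_zero] at this
    linarith
  rcases hW.alternatives hn (hF.sol α) (hF.canon α)
    (by rw [hF.init, abs_of_pos hα0]; exact hW.b_lt.trans hα) hk htrap hstuck
    (hW.wellCoeff_pos hn) with h | h | h
  · exact (hF.eventually_of_vanishing hW hn hα0.ne' hαB' h).1
  · exact (hF.eventually_of_settling hW hn hα0.ne' hαB' h).1
  · obtain ⟨T, h1, h2, h3, h4⟩ := exists_low_of_rimming hW h
    exact hF.eventually_not_stuck hW h1 h2 h3 h4

end Family

/-! ### Oscillation above a barrier -/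

namespace IsSol

variable {n : ℕ} {g u v : ℝ → ℝ}

/-- A descending solution with energy above the potential barrier reaches `0`. -/
theorem descend (hg : Continuous g) (h : IsSol n g u v) {R₀ R F₀ Fx : ℝ} (hR₀ : 0 < R₀)
    (hR : R₀ ≤ R) (hu : 0 < u R) (hv : v R < 0 ∨ (v R = 0 ∧ 0 < g (u R)))
    (hF₀ : ∀ s ∈ Icc 0 (u R), -F₀ < primF g s)
    (hdich : ∀ s ∈ Icc 0 (u R), primF g s ≤ Fx ∨ 0 < g s)
    (hJ : √(Fx + F₀) < √(nrg g u v R + F₀) - n / (√2 * R₀) * u R) :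
    ∃ z > R, u z = 0 ∧ v z < 0 ∧ (∀ r, R ≤ r → r < z → 0 < u r) ∧ (∀ r ∈ Icc R z, v r ≤ 0) ∧
      √(nrg g u v R + F₀) - n / (√2 * R₀) * u R ≤ √(nrg g u v z + F₀) := by
  set κ := (n : ℝ) / (√2 * R₀) with hκ
  have hκ0 : 0 ≤ κ := by positivity
  have hR0 : 0 < R := hR₀.trans_le hR
  obtain ⟨R₁, hRR₁, hv₁, huR₁, hvR₁⟩ : ∃ R₁ ≥ R, (∀ r ∈ Icc R R₁, v r ≤ 0) ∧ 0 < u R₁ ∧ v R₁ < 0 := by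
    rcases hv with hv | ⟨hv, hgu⟩
    · exact ⟨R, le_rfl, fun r hr => by rw [le_antisymm hr.2 hr.1]; exact hv.le, hu, hv⟩
    · have h1 := eventually_neg_of_hasDerivAt_neg (h.dv R hR0) (by rw [hv]; simpa using hgu) hv
      have h2 : ∀ᶠ r in 𝓝[>] R, 0 < u r :=
        (h.cu.continuousAt.eventually_const_lt hu).filter_mono nhdsWithin_le_nhds
      obtain ⟨y, hy, hy'⟩ := mem_nhdsGT_iff_exists_Ioo_subset.1 (h1.and h2)
      have hy0 : R < y := hy
      have h3 := hy' (show (R + y) / 2 ∈ Ioo R y from ⟨by linarith, by linarith⟩)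
      refine ⟨(R + y) / 2, by linarith, fun r hr => ?_, h3.2, h3.1⟩
      rcases eq_or_lt_of_le hr.1 with h4 | h4
      · rw [← h4, hv]
      · exact (hy' (show r ∈ Ioo R y from ⟨h4, by linarith [hr.2]⟩)).1.le
  -- The margin in `hJ` absorbs the whole loss of a descent, so the energy stays above Fx until 0 is
  -- reached.
  have hloss : ∀ c ≥ R, (∀ r ∈ Icc R c, v r ≤ 0) → 0 ≤ u c →
      √(nrg g u v R + F₀) - κ * u R ≤ √(nrg g u v c + F₀) ∧ Fx < nrg g u v c := by
    intro c hc hvc huc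
    have h1 : √(nrg g u v R + F₀) - κ * u R ≤ √(nrg g u v c + F₀) := by
      have h2 := h.sqrt_nrg_loss hg hR₀ hR hc (F₀ := F₀) (fun r hr => hF₀ _ ⟨?_, ?_⟩) hvc
      · nlinarith
      · exact huc.trans (h.antitoneOn_Icc hvc hr ⟨hc, le_rfl⟩ hr.2)
      · exact h.antitoneOn_Icc hvc ⟨le_rfl, hc⟩ hr hr.1
    refine ⟨h1, ?_⟩
    by_contra! hcon
    linarith [Real.sqrt_le_sqrt (add_le_add_left hcon F₀)]
  by_cases hex : ∃ q ≥ R₁, min (u q) (-v q) ≤ 0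
  · obtain ⟨q, hq, hq'⟩ := hex
    obtain ⟨c, hc1, hc2, hc3, hc4⟩ := exists_first_zero (φ := fun r => min (u r) (-v r))
      (by have := h.cu; have := h.cv; fun_prop) hq (lt_min huR₁ (by linarith)) hq'
    have hc0 : 0 ≤ u c ∧ 0 ≤ -v c := by
      have h1 := min_le_left (u c) (-v c)
      have h2 := min_le_right (u c) (-v c)
      rw [hc3] at h1 h2
      exact ⟨h1, h2⟩
    have hvc : ∀ r ∈ Icc R c, v r ≤ 0 := by
      intro r hr
      rcases le_total r R₁ with h1 | h1
      · exact hv₁ r ⟨hr.1, h1⟩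
      · rcases eq_or_lt_of_le hr.2 with h2 | h2
        · rw [h2]; linarith [hc0.2]
        · linarith [(lt_min_iff.1 (hc4 r h1 h2)).2]
    have hRc : R < c := hRR₁.trans_lt hc1
    obtain ⟨hl1, hl2⟩ := hloss c hRc.le hvc hc0.1
    -- A stop has E = F(u) > Fx, so `hdich` gives g(u) > 0 and v was positive just before, contrary
    -- to the descent.
    have hvc0 : v c < 0 := by
      refine lt_of_le_of_ne (by linarith [hc0.2]) fun hz => ?_
      have hE : nrg g u v c = primF g (u c) := by simp [nrg, hz]
      have hgc := (hdich (u c) ⟨hc0.1, h.antitoneOn_Icc hvc ⟨le_rfl, hRc.le⟩ ⟨hRc.le, le_rfl⟩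
        hRc.le⟩).resolve_left (by linarith)
      obtain ⟨x, hx1, hx2, hx3⟩ := exists_gt_left_of_hasDerivAt_neg (h.dv c (hR0.trans hRc))
        (by rw [hz]; simpa using hgc) hc1
      linarith [(lt_min_iff.1 (hc4 x hx1.le hx2)).2]
    have huc : u c = 0 := by
      rcases min_choice (u c) (-v c) with h1 | h1
      · rw [← hc3, h1]
      · rw [h1] at hc3; linarith
    refine ⟨c, hRc, huc, hvc0, fun r hr hrc => ?_, hvc, hl1⟩
    rcases le_total r R₁ with h1 | h1
    · exact huR₁.trans_le (h.antitoneOn_Icc hv₁ ⟨hr, h1⟩ ⟨hRR₁, le_rfl⟩ h1)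
    · exact (lt_min_iff.1 (hc4 r h1 hrc)).1
  -- An endless descent would converge to a zero l of g, with F(l) > Fx by the energy bound; `hdich`
  -- excludes this.
  · exfalso
    push Not at hex
    have hpos : ∀ r ≥ R₁, 0 < u r ∧ v r < 0 := fun r hr => by
      have := lt_min_iff.1 (hex r hr)
      exact ⟨this.1, by linarith [this.2]⟩
    have hvr : ∀ r ≥ R, v r ≤ 0 := fun r hr => by
      rcases le_total r R₁ with h1 | h1
      · exact hv₁ r ⟨hr, h1⟩
      · exact (hpos r h1).2.le
    obtain ⟨l, hl, hl0, hl1⟩ := h.exists_limit_of_antitone (R := R₁) (m := 0)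
      (fun r hr => (hpos r hr).2.le) fun r hr => (hpos r hr).1.le
    obtain ⟨hgl, hE⟩ := h.limit hg hl
    have hlR : l ≤ u R := (hl1 R₁ le_rfl).trans
      (h.antitoneOn_Icc hv₁ ⟨le_rfl, hRR₁⟩ ⟨hRR₁, le_rfl⟩ hRR₁)
    have h1 : √(nrg g u v R + F₀) - κ * u R ≤ √(primF g l + F₀) := by
      refine ge_of_tendsto ((hE.add_const F₀).sqrt) ?_
      filter_upwards [eventually_ge_atTop R₁] with r hr
      exact (hloss r (hRR₁.trans hr) (fun s hs => hvr s hs.1) (hpos r hr).1.le).1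
    rcases hdich l ⟨hl0, hlR⟩ with h2 | h2
    · linarith [Real.sqrt_le_sqrt (add_le_add_left h2 F₀)]
    · exact h2.ne' hgl

/-- An ascending solution with energy above the barrier turns around. -/
theorem ascend (hg : Continuous g) (hodd : ∀ s, g (-s) = -g s) (h : IsSol n g u v)
    {R₀ R F₀ Fx Y : ℝ} (hR₀ : 0 < R₀) (hR : R₀ ≤ R) (hu : 0 ≤ u R) (huY : u R < Y)
    (hv : 0 < v R) (hEY : nrg g u v R < primF g Y) (hF₀ : ∀ s ∈ Icc 0 Y, -F₀ < primF g s)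
    (hdich : ∀ s, 0 ≤ s → s < Y → primF g s ≤ Fx ∨ 0 < g s)
    (hJ : √(Fx + F₀) < √(nrg g u v R + F₀) - n / (√2 * R₀) * Y) :
    ∃ a > R, v a = 0 ∧ 0 < u a ∧ u a < Y ∧ 0 < g (u a) ∧ (∀ r, R < r → r ≤ a → 0 < u r) ∧
      √(nrg g u v R + F₀) - n / (√2 * R₀) * Y ≤ √(nrg g u v a + F₀) := by
  set κ := (n : ℝ) / (√2 * R₀) with hκ
  have hκ0 : 0 ≤ κ := by positivity
  have hR0 : 0 < R := hR₀.trans_le hR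
  have hlt : ∀ r ≥ R, |u r| < Y :=
    h.abs_lt_of_nrg_lt hg hodd hR0.le (by rwa [abs_of_nonneg hu]) hEY
  have hloss : ∀ c ≥ R, (∀ r ∈ Icc R c, 0 ≤ v r) →
      √(nrg g u v R + F₀) - κ * Y ≤ √(nrg g u v c + F₀) := by
    intro c hc hvc
    have h2 := h.sqrt_nrg_loss' hg hodd hR₀ hR hc (F₀ := F₀) (fun r hr => hF₀ _ ⟨?_, ?_⟩) hvc
    · have := (abs_lt.1 (hlt c hc)).2
      have h3 : κ * (u c - u R) ≤ κ * Y := by gcongr; linarith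
      linarith
    · exact hu.trans <| h.monotoneOn_Icc hvc ⟨le_rfl, hc⟩ hr hr.1
    · exact (abs_lt.1 (hlt r hr.1)).2.le
  by_cases hex : ∃ q ≥ R, v q ≤ 0
  · obtain ⟨q, hq, hq'⟩ := hex
    obtain ⟨a, ha1, ha2, ha3, ha4⟩ := exists_first_zero h.cv hq hv hq'
    have hva : ∀ r ∈ Icc R a, 0 ≤ v r := fun r hr => by
      rcases eq_or_lt_of_le hr.2 with h1 | h1
      · rw [h1, ha3]
      · exact (ha4 r hr.1 h1).le
    have hpos : ∀ r, R < r → r ≤ a → 0 < u r := fun r hr hra =>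
      hu.trans_lt (h.lt_of_v_pos hr fun s hs => ha4 s hs.1.le (hs.2.trans_le hra))
    have hua := hpos a ha1 le_rfl
    have hl := hloss a ha1.le hva
    have hE : nrg g u v a = primF g (u a) := by simp [nrg, ha3]
    refine ⟨a, ha1, ha3, hua, (abs_lt.1 (hlt a ha1.le)).2, ?_, hpos, hl⟩
    refine (hdich (u a) hua.le (abs_lt.1 (hlt a ha1.le)).2).resolve_left fun hcon => ?_
    rw [hE] at hl
    linarith [Real.sqrt_le_sqrt (add_le_add_left hcon F₀)]
  · exfalso
    push Not at hex
    obtain ⟨l, hl, hl0, hl1⟩ := h.exists_limit_of_monotone (R := R) (m := Y)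
      (fun r hr => (hex r hr).le) fun r hr => (abs_lt.1 (hlt r hr)).2.le
    obtain ⟨hgl, hE⟩ := h.limit hg hl
    have h1 : √(nrg g u v R + F₀) - κ * Y ≤ √(primF g l + F₀) := by
      refine ge_of_tendsto ((hE.add_const F₀).sqrt) ?_
      filter_upwards [eventually_ge_atTop R] with r hr
      exact hloss r hr fun s hs => (hex s hs.1).le
    have h2 : primF g l ≤ nrg g u v R := by
      refine le_of_tendsto hE ?_
      filter_upwards [eventually_ge_atTop R] with r hr using h.nrg_le hg hR0.le hr
    have hlY : l < Y := lt_of_le_of_ne hl0 fun heq => by rw [heq] at h2; linarith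
    rcases hdich l (hu.trans (hl1 R le_rfl)) hlY with h3 | h3
    · linarith [Real.sqrt_le_sqrt (add_le_add_left h3 F₀)]
    · exact h3.ne' hgl

/-- Half an oscillation between two zeros. -/
theorem half_swing (hg : Continuous g) (hodd : ∀ s, g (-s) = -g s) (h : IsSol n g u v)
    {R₀ R F₀ Fx Y : ℝ} (hR₀ : 0 < R₀) (hR : R₀ ≤ R) (hY : 0 < Y) (hu : u R = 0) (hv : v R ≠ 0)
    (hEY : nrg g u v R < primF g Y) (hF₀ : ∀ s ∈ Icc 0 Y, -F₀ < primF g s)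
    (hdich : ∀ s, 0 ≤ s → s < Y → primF g s ≤ Fx ∨ 0 < g s)
    (hJ : √(Fx + F₀) < √(nrg g u v R + F₀) - n / (√2 * R₀) * (2 * Y)) :
    ∃ z > R, u z = 0 ∧ v R * v z < 0 ∧ (∀ r, R < r → r < z → 0 < u r * v R) ∧
      √(nrg g u v R + F₀) - n / (√2 * R₀) * (2 * Y) ≤ √(nrg g u v z + F₀) := by
  have hκ0 : 0 ≤ (n : ℝ) / (√2 * R₀) := by positivity
  have key : ∀ u v : ℝ → ℝ, IsSol n g u v → u R = 0 → 0 < v R → nrg g u v R < primF g Y →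
      √(Fx + F₀) < √(nrg g u v R + F₀) - n / (√2 * R₀) * (2 * Y) →
      ∃ z > R, u z = 0 ∧ v z < 0 ∧ (∀ r, R < r → r < z → 0 < u r) ∧
      √(nrg g u v R + F₀) - n / (√2 * R₀) * (2 * Y) ≤ √(nrg g u v z + F₀) := by
    intro u v h hu hv hEY hJ
    have hκY : 0 ≤ (n : ℝ) / (√2 * R₀) * Y := by positivity
    obtain ⟨a, ha1, ha2, ha3, ha4, ha5, ha6, ha7⟩ :=
      h.ascend hg hodd hR₀ hR hu.ge (by rwa [hu]) hv hEY hF₀ hdich (by linarith)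
    have hκa : (n : ℝ) / (√2 * R₀) * u a ≤ n / (√2 * R₀) * Y := by gcongr
    obtain ⟨z, hz1, hz2, hz3, hz4, -, hz5⟩ := h.descend hg hR₀ (hR.trans ha1.le) ha3
      (Or.inr ⟨ha2, ha5⟩) (F₀ := F₀) (Fx := Fx) (fun s hs => hF₀ s ⟨hs.1, hs.2.trans ha4.le⟩)
      (fun s hs => hdich s hs.1 (hs.2.trans_lt ha4)) (by linarith)
    refine ⟨z, ha1.trans hz1, hz2, hz3, fun r hr hrz => ?_, by linarith⟩
    rcases le_total r a with h1 | h1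
    · exact ha6 r hr h1
    · exact hz4 r h1 hrz
  rcases lt_or_gt_of_ne hv with h1 | h1
  · obtain ⟨z, hz1, hz2, hz3, hz4, hz5⟩ := key _ _ (h.neg hodd) (by simpa using hu) (by linarith)
      (by rwa [nrg_neg hodd]) (by rwa [nrg_neg hodd])
    rw [nrg_neg hodd, nrg_neg hodd] at hz5
    refine ⟨z, hz1, by simpa using hz2, mul_neg_of_neg_of_pos h1 (by linarith), fun r hr hrz => ?_,
      hz5⟩
    have := hz4 r hr hrz
    exact mul_pos_of_neg_of_neg (by linarith) h1
  · obtain ⟨z, hz1, hz2, hz3, hz4, hz5⟩ := key u v h hu h1 hEY hJ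
    exact ⟨z, hz1, hz2, mul_neg_of_pos_of_neg h1 hz3, fun r hr hrz => mul_pos (hz4 r hr hrz) h1, hz5⟩

/-- A solution with energy above the barrier has a zero soon. -/
theorem exists_zero_of_nrg (hg : Continuous g) (hodd : ∀ s, g (-s) = -g s) (h : IsSol n g u v)
    {R₀ R F₀ Fx Y : ℝ} (hR₀ : 0 < R₀) (hR : R₀ ≤ R) (huY : |u R| < Y)
    (hEY : nrg g u v R < primF g Y) (hF₀ : ∀ s ∈ Icc 0 Y, -F₀ < primF g s)
    (hdich : ∀ s, 0 ≤ s → s < Y → primF g s ≤ Fx ∨ 0 < g s) (hFx : 0 ≤ Fx)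
    (hJ : √(Fx + F₀) < √(nrg g u v R + F₀) - n / (√2 * R₀) * (2 * Y)) :
    ∃ z ≥ R, u z = 0 ∧ v z ≠ 0 ∧
      √(nrg g u v R + F₀) - n / (√2 * R₀) * (2 * Y) ≤ √(nrg g u v z + F₀) := by
  have hY : 0 < Y := (abs_nonneg _).trans_lt huY
  have hκY : 0 ≤ (n : ℝ) / (√2 * R₀) * Y := by positivity
  have key : ∀ u v : ℝ → ℝ, IsSol n g u v → 0 < u R → u R < Y → nrg g u v R < primF g Y →
      √(Fx + F₀) < √(nrg g u v R + F₀) - n / (√2 * R₀) * (2 * Y) →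
      ∃ z ≥ R, u z = 0 ∧ v z ≠ 0 ∧
      √(nrg g u v R + F₀) - n / (√2 * R₀) * (2 * Y) ≤ √(nrg g u v z + F₀) := by
    intro u v h hu huY hEY hJ
    have hdesc : ∀ a ≥ R, 0 < u a → u a < Y → (v a < 0 ∨ (v a = 0 ∧ 0 < g (u a))) →
        √(nrg g u v R + F₀) - n / (√2 * R₀) * Y ≤ √(nrg g u v a + F₀) →
        ∃ z ≥ R, u z = 0 ∧ v z ≠ 0 ∧
        √(nrg g u v R + F₀) - n / (√2 * R₀) * (2 * Y) ≤ √(nrg g u v z + F₀) := by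
      intro a ha hua haY hva hl
      have hκa : (n : ℝ) / (√2 * R₀) * u a ≤ n / (√2 * R₀) * Y := by gcongr
      obtain ⟨z, hz1, hz2, hz3, -, -, hz5⟩ := h.descend hg hR₀ (hR.trans ha) hua hva (F₀ := F₀)
        (Fx := Fx) (fun s hs => hF₀ s ⟨hs.1, hs.2.trans haY.le⟩)
        (fun s hs => hdich s hs.1 (hs.2.trans_lt haY)) (by linarith)
      exact ⟨z, ha.trans hz1.le, hz2, hz3.ne, by linarith⟩
    rcases lt_trichotomy (v R) 0 with hv | hv | hv
    · exact hdesc R le_rfl hu huY (Or.inl hv) (by linarith)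
    · refine hdesc R le_rfl hu huY (Or.inr ⟨hv, (hdich _ hu.le huY).resolve_left fun hcon => ?_⟩)
        (by linarith)
      have hE : nrg g u v R = primF g (u R) := by simp [nrg, hv]
      rw [hE] at hJ
      linarith [Real.sqrt_le_sqrt (add_le_add_left hcon F₀)]
    · obtain ⟨a, ha1, ha2, ha3, ha4, ha5, -, ha7⟩ :=
        h.ascend hg hodd hR₀ hR hu.le huY hv hEY hF₀ hdich (by linarith)
      exact hdesc a ha1.le ha3 ha4 (Or.inr ⟨ha2, ha5⟩) ha7
  rcases lt_trichotomy (u R) 0 with hu | hu | hu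
  · obtain ⟨z, hz1, hz2, hz3, hz4⟩ := key _ _ (h.neg hodd) (by linarith) (by linarith [neg_abs_le (u R)])
      (by rwa [nrg_neg hodd]) (by rwa [nrg_neg hodd])
    rw [nrg_neg hodd, nrg_neg hodd] at hz4
    exact ⟨z, hz1, by simpa using hz2, by simpa using hz3, hz4⟩
  · refine ⟨R, le_rfl, hu, fun hv => ?_, by linarith⟩
    have hE : nrg g u v R = 0 := by simp [nrg, hv, hu, primF_zero]
    rw [hE] at hJ
    linarith [Real.sqrt_le_sqrt (add_le_add_left hFx F₀)]
  · exact key u v h hu (lt_of_abs_lt huY) hEY hJ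

/-- Each half swing travels at most 2Y and so costs at most n/(√2 R₀) · 2Y of √(E + F₀). The energy
bound pays for m + 1 of them, and midpoints between consecutive zeros serve as sample points. -/
theorem exists_swings (hg : Continuous g) (hodd : ∀ s, g (-s) = -g s) (h : IsSol n g u v)
    {R₀ F₀ Fx Y : ℝ} (hR₀ : 0 < R₀) (hY : 0 < Y) (hF₀ : ∀ s ∈ Icc 0 Y, -F₀ < primF g s)
    (hdich : ∀ s, 0 ≤ s → s < Y → primF g s ≤ Fx ∨ 0 < g s) (m : ℕ) :
    ∀ R ≥ R₀, u R = 0 → v R ≠ 0 → nrg g u v R < primF g Y →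
      √(Fx + F₀) < √(nrg g u v R + F₀) - n / (√2 * R₀) * (2 * Y) * (m + 1) →
      ∃ r : ℕ → ℝ, R < r 0 ∧ (∀ i < m, r i < r (i + 1)) ∧ (∀ i < m, u (r i) * u (r (i + 1)) < 0) ∧
        0 < u (r 0) * v R := by
  have hκ0 : 0 ≤ (n : ℝ) / (√2 * R₀) * (2 * Y) := by positivity
  induction m with
  | zero =>
    intro R hR hu hv hEY hJ
    obtain ⟨z, hz1, -, -, hz4, -⟩ := h.half_swing hg hodd hR₀ hR hY hu hv hEY hF₀ hdich
      (by simpa using hJ)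
    exact ⟨fun _ => (R + z) / 2, by linarith, by simp, by simp,
      hz4 _ (by linarith) (by linarith)⟩
  | succ m ih =>
    intro R hR hu hv hEY hJ
    push_cast at hJ
    have hm : 0 ≤ (n : ℝ) / (√2 * R₀) * (2 * Y) * m := by positivity
    obtain ⟨z, hz1, hz2, hz3, hz4, hz5⟩ := h.half_swing hg hodd hR₀ hR hY hu hv hEY hF₀ hdich
      (by linarith)
    obtain ⟨r, hr0, hr1, hr2, hr3⟩ := ih z (hR.trans hz1.le) hz2
      (fun hz => by simp [hz] at hz3)
      ((h.nrg_le hg (hR₀.le.trans hR) hz1.le).trans_lt hEY) (by linarith)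
    have hmid := hz4 ((R + z) / 2) (by linarith) (by linarith)
    refine ⟨fun i => Nat.casesOn i ((R + z) / 2) r, by show R < (R + z) / 2; linarith, fun i hi => ?_,
      fun i hi => ?_, hmid⟩
    · rcases i with _ | i
      · show (R + z) / 2 < r 0
        linarith
      · exact hr1 i (by omega)
    · rcases i with _ | i
      · exact mul_neg_of_mul_pos hmid hr3 hz3
      · exact hr2 i (by omega)

end IsSol

/-! ### Long humps -/

theorem exists_small_increment {φ : ℕ → ℝ} {B : ℝ} {k : ℕ} (hk : 0 < k) (h : φ k - φ 0 ≤ B) :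
    ∃ i < k, φ (i + 1) - φ i ≤ B / k := by
  by_contra! hcon
  have h1 : ∑ _i ∈ Finset.range k, B / k < ∑ i ∈ Finset.range k, (φ (i + 1) - φ i) :=
    Finset.sum_lt_sum_of_nonempty (Finset.nonempty_range_iff.2 hk.ne') fun i hi =>
      hcon i (Finset.mem_range.1 hi)
  rw [Finset.sum_range_sub, Finset.sum_const, Finset.card_range, nsmul_eq_mul,
    mul_div_cancel₀ _ (by positivity)] at h1
  linarith

namespace IsSol

variable {n : ℕ} {g u v : ℝ → ℝ}

/-- A hump of a solution rises and then falls. -/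
theorem unimodal (hn : 1 ≤ n) (hg : Continuous g) (h : IsSol n g u v) {p r : ℝ} (hp : 0 < p)
    (hpr : p < r) (hmin : ∀ s ∈ Icc p r, u r ≤ u s) :
    ∃ q ∈ Icc p r, (q = p ∨ ∀ s ∈ Icc p q, 0 ≤ v s) ∧ ∀ s ∈ Icc q r, v s ≤ 0 := by
  obtain ⟨q, hq, hqmax⟩ := isCompact_Icc.exists_isMaxOn ⟨p, le_rfl, hpr.le⟩ h.cu.continuousOn (f := u)
  have hqm : ∀ s ∈ Icc p r, u s ≤ u q := fun s hs => hqmax hs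
  -- Since u r is the minimum, a solution rising above u m after a stationary point m must return to
  -- the level u m. Its energy there is no smaller than at m, so it was constant in between.
  have key : ∀ m y, p ≤ m → m ≤ y → y ≤ r → v m = 0 → u m < u y → False := by
    intro m y hm hmy hy hvm hmy'
    obtain ⟨c, hc, hc'⟩ := intermediate_value_Icc' hy h.cu.continuousOn
      ⟨hmin m ⟨hm, hmy.trans hy⟩, hmy'.le⟩
    have hE : nrg g u v m ≤ nrg g u v c := by
      have := primF_le_nrg g u v c
      rw [hc'] at this
      simpa [nrg, hvm] using this
    have := h.eq_of_nrg_le hn hg (hp.le.trans hm) hE y ⟨hmy, hc.1⟩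
    linarith
  have key2 : ∀ s x y, p ≤ s → s ≤ x → x ≤ y → y ≤ r → u x < u s → u x < u y → False := by
    intro s x y hs hsx hxy hy h1 h2
    obtain ⟨m, hm, hm'⟩ := isCompact_Icc.exists_isMinOn ⟨x, hsx, hxy⟩ h.cu.continuousOn (f := u)
    have hmx : u m ≤ u x := hm' ⟨hsx, hxy⟩
    have hsm : s < m := lt_of_le_of_ne hm.1 fun heq => by rw [← heq] at hmx; linarith
    have hmy : m < y := lt_of_le_of_ne hm.2 fun heq => by rw [heq] at hmx; linarith
    exact key m y (hs.trans hsm.le) hmy.le hy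
      ((hm'.isLocalMin (Icc_mem_nhds hsm hmy)).hasDerivAt_eq_zero (h.du m)) (by linarith)
  refine ⟨q, hq, ?_, fun s hs => ?_⟩
  · rcases eq_or_lt_of_le hq.1 with h1 | h1
    · exact Or.inl h1.symm
    right
    intro s hs
    by_contra! hvs
    rcases eq_or_lt_of_le hs.2 with h2 | h2
    · subst h2
      obtain ⟨x, hx1, hx2, hx3⟩ := exists_gt_left_of_hasDerivAt_neg (h.du s) hvs h1
      linarith [hqm x ⟨hx1.le, hx2.le.trans hq.2⟩]
    · obtain ⟨x, hx1, hx2, hx3⟩ := exists_lt_of_hasDerivAt_neg (h.du s) hvs h2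
      exact key2 s x q hs.1 hx1.le hx2.le hq.2 hx3
        (hx3.trans_le (hqm s ⟨hs.1, hs.2.trans hq.2⟩))
  · by_contra! hvs
    have hps : p ≤ s := hq.1.trans hs.1
    rcases eq_or_lt_of_le hs.2 with h2 | h2
    · subst h2
      obtain ⟨x, hx1, hx2, hx3⟩ := exists_lt_left_of_hasDerivAt_pos (h.du s) hvs hpr
      linarith [hmin x ⟨hx1.le, hx2.le⟩]
    · obtain ⟨y, hy1, hy2, hy3⟩ := exists_gt_of_hasDerivAt_pos (h.du s) hvs h2
      have h3 := hqm y ⟨hps.trans hy1.le, hy2.le⟩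
      exact key2 q s y hq.1 hs.1 hy1.le hy2.le (hy3.trans_le h3) hy3

/-- A monotone stretch of length 3k with total variation at most B contains a window of length 3
with variation at most B/k; there both velocity and force are small somewhere. -/
theorem exists_slow_of_monotone (h : IsSol n g u v) {a V B : ℝ} {k : ℕ} (ha : 0 < a) (hk : 0 < k)
    (hmono : MonotoneOn u (Icc a (a + 3 * k)) ∨ AntitoneOn u (Icc a (a + 3 * k)))
    (hV : ∀ r ∈ Icc a (a + 3 * k), |v r| ≤ V) (hB : |u (a + 3 * k) - u a| ≤ B) :
    ∃ p ∈ Icc a (a + 3 * k), ∃ ξ ∈ Icc a (a + 3 * k), |v p| ≤ B / k ∧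
      |g (u ξ)| ≤ 2 * (B / k) + n / a * V ∧ |u ξ - u p| ≤ B / k := by
  obtain ⟨i, hik, hi⟩ : ∃ i < k, ∀ x ∈ Icc (a + 3 * (i : ℝ)) (a + 3 * i + 3),
      ∀ y ∈ Icc (a + 3 * (i : ℝ)) (a + 3 * i + 3), |u x - u y| ≤ B / k := by
    have hsub : ∀ i < k, Icc (a + 3 * (i : ℝ)) (a + 3 * i + 3) ⊆ Icc a (a + 3 * k) := by
      intro i hi x hx
      have h1 : (i : ℝ) + 1 ≤ k := by exact_mod_cast hi
      have h2 : (0 : ℝ) ≤ i := Nat.cast_nonneg i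
      exact ⟨by linarith [hx.1], by linarith [hx.2]⟩
    rcases hmono with hm | hm
    · obtain ⟨i, hik, hi⟩ := exists_small_increment (φ := fun i : ℕ => u (a + 3 * (i : ℝ))) hk
        (by simpa using (le_abs_self _).trans hB)
      refine ⟨i, hik, fun x hx y hy => ?_⟩
      have e : a + 3 * ((i : ℝ) + 1) = a + 3 * i + 3 := by ring
      push_cast at hi
      rw [e] at hi
      have hl : a + 3 * (i : ℝ) ∈ Icc (a + 3 * (i : ℝ)) (a + 3 * i + 3) := ⟨le_rfl, by linarith⟩
      have hr : a + 3 * (i : ℝ) + 3 ∈ Icc (a + 3 * (i : ℝ)) (a + 3 * i + 3) := ⟨by linarith, le_rfl⟩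
      have h1 := hm (hsub i hik hl) (hsub i hik hx) hx.1
      have h2 := hm (hsub i hik hl) (hsub i hik hy) hy.1
      have h3 := hm (hsub i hik hx) (hsub i hik hr) hx.2
      have h4 := hm (hsub i hik hy) (hsub i hik hr) hy.2
      rw [abs_le]
      constructor <;> linarith
    · obtain ⟨i, hik, hi⟩ := exists_small_increment (φ := fun i : ℕ => -u (a + 3 * (i : ℝ))) hk
        (B := B) (by
          simp only [Nat.cast_zero, mul_zero, add_zero]
          linarith [(abs_le.1 hB).1])
      refine ⟨i, hik, fun x hx y hy => ?_⟩
      have e : a + 3 * ((i : ℝ) + 1) = a + 3 * i + 3 := by ring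
      push_cast at hi
      rw [e] at hi
      have hl : a + 3 * (i : ℝ) ∈ Icc (a + 3 * (i : ℝ)) (a + 3 * i + 3) := ⟨le_rfl, by linarith⟩
      have hr : a + 3 * (i : ℝ) + 3 ∈ Icc (a + 3 * (i : ℝ)) (a + 3 * i + 3) := ⟨by linarith, le_rfl⟩
      have h1 := hm (hsub i hik hl) (hsub i hik hx) hx.1
      have h2 := hm (hsub i hik hl) (hsub i hik hy) hy.1
      have h3 := hm (hsub i hik hx) (hsub i hik hr) hx.2
      have h4 := hm (hsub i hik hy) (hsub i hik hr) hy.2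
      rw [abs_le]
      constructor <;> linarith
  have h1 : (i : ℝ) + 1 ≤ k := by exact_mod_cast hik
  have h2 : (0 : ℝ) ≤ i := Nat.cast_nonneg i
  have hs0 : 0 < a + 3 * (i : ℝ) := by positivity
  have hV0 : 0 ≤ V := (abs_nonneg _).trans (hV a ⟨le_rfl, by linarith [(Nat.cast_nonneg k : (0 : ℝ) ≤ k)]⟩)
  obtain ⟨⟨p, hp, hvp⟩, ξ, hξ, hgξ⟩ := h.exists_slow hs0 (η := B / k) (V := V)
    (fun r hr => hV r ⟨by linarith [hr.1], by linarith [hr.2]⟩)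
    (hi _ ⟨by linarith, by linarith⟩ _ ⟨by linarith, by linarith⟩)
    (hi _ ⟨by linarith, by linarith⟩ _ ⟨by linarith, by linarith⟩)
  refine ⟨p, ⟨by linarith [hp.1], by linarith [hp.2]⟩, ξ, ⟨by linarith [hξ.1], by linarith [hξ.2]⟩,
    hvp, hgξ.trans ?_, hi _ ⟨hξ.1.le, hξ.2.le⟩ _ ⟨hp.1.le, by linarith [hp.2]⟩⟩
  gcongr
  linarith

/-- A long hump contains a moment at which the solution is slow and almost in equilibrium. -/
theorem exists_slow_of_hump (hn : 1 ≤ n) (hg : Continuous g) (h : IsSol n g u v) {r B V : ℝ}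
    (hr : 24 ≤ r) (hmin : ∀ s ∈ Icc (r / 2) r, u r ≤ u s)
    (hB : ∀ s ∈ Icc (r / 2) r, u s ≤ u r + B) (hV : ∀ s ∈ Icc (r / 2) r, |v s| ≤ V) :
    ∃ p ∈ Icc (r / 2) r, ∃ ξ ∈ Icc (r / 2) r, |v p| ≤ 24 * B / r ∧
      |g (u ξ)| ≤ (48 * B + 2 * n * V) / r ∧ |u ξ - u p| ≤ 24 * B / r := by
  obtain ⟨q, hq, hq1, hq2⟩ := h.unimodal hn hg (show 0 < r / 2 by linarith)
    (show r / 2 < r by linarith) hmin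
  -- Windows of total length 3k ≤ r/4 fit on one side of the peak q in [r/2, r]. The bound r ≥ 24
  -- gives k ≥ r/24, so that B/k = O(1/r).
  set k := ⌊r / 12⌋₊ with hk
  have hk1 : (k : ℝ) ≤ r / 12 := Nat.floor_le (by linarith)
  have hk2 : r / 24 ≤ k := by
    have := Nat.lt_floor_add_one (r / 12)
    rw [← hk] at this
    linarith
  have hkpos : 0 < k := by
    have : (0 : ℝ) < k := by linarith
    exact_mod_cast this
  obtain ⟨a, ha, hmono⟩ : ∃ a : ℝ, Icc a (a + 3 * k) ⊆ Icc (r / 2) r ∧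
      (MonotoneOn u (Icc a (a + 3 * k)) ∨ AntitoneOn u (Icc a (a + 3 * k))) := by
    rcases le_total q (3 * r / 4) with h1 | h1
    · exact ⟨3 * r / 4, Icc_subset_Icc (by linarith) (by linarith),
        Or.inr (h.antitoneOn_Icc fun s hs => hq2 s ⟨h1.trans hs.1, by linarith [hs.2]⟩)⟩
    · refine ⟨r / 2, Icc_subset_Icc le_rfl (by linarith),
        Or.inl (h.monotoneOn_Icc fun s hs => hq1.resolve_left (by linarith) s ⟨hs.1, ?_⟩)⟩
      linarith [hs.2]
  have hal : a ∈ Icc (r / 2) r := ha ⟨le_rfl, by linarith [(Nat.cast_nonneg k : (0 : ℝ) ≤ k)]⟩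
  have har : a + 3 * k ∈ Icc (r / 2) r := ha ⟨by linarith, le_rfl⟩
  have hB0 : 0 ≤ B := by linarith [hmin a hal, hB a hal]
  have hV0 : 0 ≤ V := (abs_nonneg _).trans (hV a hal)
  obtain ⟨p, hp, ξ, hξ, h1, h2, h3⟩ := h.exists_slow_of_monotone (V := V) (B := B)
    (show 0 < a by linarith [hal.1]) hkpos hmono (fun s hs => hV s (ha hs)) (by
      rw [abs_le]
      constructor <;> linarith [hmin a hal, hB a hal, hmin _ har, hB _ har])
  have hBk : B / k ≤ 24 * B / r := by
    rw [div_le_div_iff₀ (by linarith) (by linarith)]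
    nlinarith
  refine ⟨p, ha hp, ξ, ha hξ, h1.trans hBk, h2.trans ?_, h3.trans hBk⟩
  have h4 : (n : ℝ) / a * V ≤ n / (r / 2) * V := by gcongr; exact hal.1
  calc 2 * (B / k) + n / a * V ≤ 2 * (24 * B / r) + n / (r / 2) * V := by linarith
    _ = _ := by field_simp; ring

end IsSol

/-! ### Barriers and lingering solutions -/

namespace Well

variable {n : ℕ} {g u v : ℝ → ℝ} {b lam B Fb : ℝ}

theorem exists_primF_gt (hW : Well g b lam B Fb) : ∃ F₀, 0 < F₀ ∧ ∀ s, |s| ≤ B → -F₀ < primF g s := by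
  obtain ⟨m, -, hm⟩ := isCompact_Icc.exists_isMinOn (nonempty_Icc.2 hW.B_pos.le)
    (continuous_primF hW.cont).continuousOn (f := primF g) (s := Icc 0 B)
  refine ⟨|primF g m| + 1, by positivity, fun s hs => ?_⟩
  rw [← primF_abs hW.odd s]
  have : primF g m ≤ primF g |s| := hm ⟨abs_nonneg s, hs⟩
  linarith [neg_abs_le (primF g m)]

/-- Near an equilibrium `l` dominating the potential on `[0, l]` the potential stays below
`F l`. -/
theorem eventually_primF_le (hW : Well g b lam B Fb) {l : ℝ} (hl : l ∈ Icc lam B) (hgl : g l = 0)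
    (hF : ∀ s ∈ Icc 0 l, primF g s ≤ primF g l) :
    ∀ᶠ y in 𝓝 l, y ≤ B → primF g y ≤ primF g l := by
  have hl0 : 0 < l := hW.lam_pos.trans_le hl.1
  rcases eq_or_lt_of_le hl.2 with h1 | h1
  · filter_upwards [lt_mem_nhds hl0] with y hy hyB
    rw [h1]
    exact hW.primF_le y (by rwa [abs_of_pos hy])
  · have hcont := continuous_primF hW.cont
    have hleft : ∀ᶠ y in 𝓝[≤] l, primF g y ≤ primF g l := by
      filter_upwards [Ioc_mem_nhdsLE hl0] with y hy using hF y ⟨hy.1.le, hy.2⟩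
    have hright : ∀ᶠ y in 𝓝[>] l, primF g y ≤ primF g l := by
      -- A change of g from negative to positive would make F larger just left of l, against `hF`.
      -- So l is a local maximum of F.
      rcases hW.sign_change l hl.1 h1 hgl with ⟨h2, -⟩ | ⟨-, h2⟩
      · exfalso
        obtain ⟨a, ha, ha'⟩ := mem_nhdsLT_iff_exists_Ioo_subset.1 h2
        have hal : a < l := ha
        set c := max a 0 with hc
        have hcl : c < l := max_lt hal hl0
        have hanti : StrictAntiOn (primF g) (Icc c l) := by
          apply strictAntiOn_of_deriv_neg (convex_Icc c l) hcont.continuousOn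
          intro s hs
          rw [interior_Icc] at hs
          rw [(hasDerivAt_primF hW.cont s).deriv]
          exact ha' ⟨(le_max_left a 0).trans_lt hs.1, hs.2⟩
        have h3 := hanti ⟨le_rfl, hcl.le⟩ ⟨hcl.le, le_rfl⟩ hcl
        linarith [hF c ⟨le_max_right a 0, hcl.le⟩]
      · obtain ⟨a, ha, ha'⟩ := mem_nhdsGT_iff_exists_Ioo_subset.1 h2
        have hal : l < a := ha
        have hanti : AntitoneOn (primF g) (Icc l a) := by
          apply antitoneOn_of_deriv_nonpos (convex_Icc l a) hcont.continuousOn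
            fun s _ => (hasDerivAt_primF hW.cont s).differentiableAt.differentiableWithinAt
          intro s hs
          rw [interior_Icc] at hs
          rw [(hasDerivAt_primF hW.cont s).deriv]
          exact le_of_lt (ha' hs)
        filter_upwards [Ioc_mem_nhdsGT hal] with y hy
        exact hanti ⟨le_rfl, hal.le⟩ ⟨hy.1.le, hy.2⟩ hy.1.le
    rw [← nhdsLE_sup_nhdsGT l]
    exact (eventually_sup.2 ⟨hleft, hright⟩).mono fun y hy _ => hy

/-- A barrier: the potential rises strictly from `x` to `Y`, where it first attains `F l`. -/
theorem exists_barrier (hW : Well g b lam B Fb) {l : ℝ} (hl : l ∈ Icc lam B) (hgl : g l = 0)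
    (hF : ∀ s ∈ Icc 0 l, primF g s ≤ primF g l) :
    ∃ x Y, lam < x ∧ x < Y ∧ Y ≤ l ∧ primF g Y = primF g l ∧ primF g x < primF g Y ∧
      primF g lam < primF g x ∧ ∀ s, 0 ≤ s → s < Y → primF g s ≤ primF g x ∨ 0 < g s := by
  have hcont := continuous_primF hW.cont
  have hlam : lam < l := lt_of_le_of_ne hl.1 fun heq =>
    (hW.g_pos lam hW.b_lt le_rfl).ne' (heq ▸ hgl)
  have hFlam : primF g lam < primF g l := by
    obtain ⟨y, hy1, hy2, hy3⟩ := exists_gt_of_hasDerivAt_pos (hasDerivAt_primF hW.cont lam)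
      (hW.g_pos lam hW.b_lt le_rfl) hlam
    exact hy3.trans_le (hF y ⟨hW.lam_pos.le.trans hy1.le, hy2.le⟩)
  obtain ⟨Y, hY1, hY2, hY3, hY4⟩ := exists_first_zero (φ := fun s => primF g l - primF g s)
    (by fun_prop) hlam.le (by linarith) (by linarith)
  have hYF : primF g Y = primF g l := by linarith
  have hYlt : ∀ s, 0 ≤ s → s < Y → primF g s < primF g Y := by
    intro s hs hsY
    rcases le_total s lam with h1 | h1
    · exact (hW.primF_le_lam (by rwa [abs_of_nonneg hs])).trans_lt (by linarith)
    · linarith [hY4 s h1 hsY]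
  -- Here x₀ is the last zero of g before Y, or lam if there is none. Beyond it g > 0, so x may be
  -- taken so close to Y that F(x) exceeds the maximum of F on [0, x₀].
  obtain ⟨x₀, hx₀, hx₀Y, hgx⟩ : ∃ x₀, lam ≤ x₀ ∧ x₀ < Y ∧ ∀ s ∈ Ioo x₀ Y, g s ≠ 0 := by
    have hfin := hW.finite_zeros.inter_of_left (Iio Y)
    have h1 : (({s | lam ≤ s ∧ s < B ∧ g s = 0} ∩ Iio Y) ∪ {lam}).Nonempty := ⟨lam, Or.inr rfl⟩
    obtain ⟨x₀, hx₀, hmax⟩ := exists_max_image _ id (hfin.union (finite_singleton lam)) h1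
    have hlx : lam ≤ x₀ := hmax lam (Or.inr rfl)
    refine ⟨x₀, hlx, ?_, fun s hs hgs => ?_⟩
    · rcases hx₀ with h2 | h2
      · exact h2.2
      · rw [show x₀ = lam from h2]; exact hY1
    · have := hmax s (Or.inl ⟨⟨hlx.trans hs.1.le, hs.2.trans_le (hY2.trans hl.2), hgs⟩, hs.2⟩)
      exact absurd hs.1 (not_lt.2 this)
  have hgpos : ∀ s ∈ Ioo x₀ Y, 0 < g s := by
    obtain ⟨c, hc, hc'⟩ := exists_hasDerivAt_eq_slope (primF g) g hx₀Y hcont.continuousOn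
      fun s _ => hasDerivAt_primF hW.cont s
    have hgc : 0 < g c := by
      rw [hc']
      exact div_pos (by linarith [hYlt x₀ (hW.lam_pos.le.trans hx₀) hx₀Y]) (by linarith)
    intro s hs
    by_contra! hcon
    rcases le_total s c with h1 | h1
    · obtain ⟨z, hz, hz'⟩ := intermediate_value_Icc h1 hW.cont.continuousOn ⟨hcon, hgc.le⟩
      exact hgx z ⟨hs.1.trans_le hz.1, hz.2.trans_lt hc.2⟩ hz'
    · obtain ⟨z, hz, hz'⟩ := intermediate_value_Icc' h1 hW.cont.continuousOn ⟨hcon, hgc.le⟩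
      exact hgx z ⟨hc.1.trans_le hz.1, hz.2.trans_lt hs.2⟩ hz'
  obtain ⟨m, hm, hmmax⟩ := isCompact_Icc.exists_isMaxOn
    (nonempty_Icc.2 (hW.lam_pos.le.trans hx₀)) hcont.continuousOn (f := primF g) (s := Icc 0 x₀)
  have hmY := hYlt m hm.1 (hm.2.trans_lt hx₀Y)
  obtain ⟨x, ⟨hx1, hx2⟩, hx3⟩ : ∃ x ∈ Ioo x₀ Y, primF g m < primF g x := by
    have h1 : ∀ᶠ x in 𝓝[<] Y, primF g m < primF g x :=
      (hcont.continuousAt.eventually_const_lt hmY).filter_mono nhdsWithin_le_nhds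
    obtain ⟨x, hx, hx'⟩ := (h1.and (Ioo_mem_nhdsLT hx₀Y)).exists
    exact ⟨x, hx', hx⟩
  have hmlam : primF g lam ≤ primF g m := hmmax ⟨hW.lam_pos.le, hx₀⟩
  refine ⟨x, Y, hx₀.trans_lt hx1, hx2, hY2, hYF, hYlt x ?_ hx2, by linarith, fun s hs hsY => ?_⟩
  · linarith [hW.lam_pos]
  · rcases le_or_gt s x₀ with h1 | h1
    · have h2 : primF g s ≤ primF g m := hmmax ⟨hs, h1⟩
      exact Or.inl (by linarith)
    · exact Or.inr (hgpos s ⟨h1, hsY⟩)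

/-- A solution leaving a hump late, with energy barely above the level of an equilibrium, keeps
oscillating for a long time. -/
theorem exists_swings_of_barrier (hW : Well g b lam B Fb) (hn : 1 ≤ n) {x Y : ℝ} (hx : lam < x)
    (hxY : x < Y) (hYB : Y ≤ B) (hFlx : primF g lam < primF g x)
    (hdich : ∀ s, 0 ≤ s → s < Y → primF g s ≤ primF g x ∨ 0 < g s) {V e C : ℝ} (hV : 0 < V)
    (he : primF g x < e) (m : ℕ) :
    ∃ ρ : ℝ, ∀ u v : ℝ → ℝ, ∀ r ≥ ρ, IsSol n g u v → (∀ s ≥ r, |v s| ≤ V) → u r = lam → v r ≤ 0 →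
      e ≤ nrg g u v r → nrg g u v r ≤ primF g Y + C / r ^ 2 → HasSignChangesAtLeast u m := by
  obtain ⟨F₀, hF₀pos, hF₀⟩ := hW.exists_primF_gt
  have hlam := hW.lam_pos
  have hY0 : 0 < Y := by linarith
  have hFlam := hW.primF_pos hW.b_lt le_rfl
  set c := 2 * (primF g x - primF g lam) with hc
  have hc0 : 0 < c := by linarith
  have hn0 : (0 : ℝ) < n := by exact_mod_cast hn
  have hsq : √(primF g x + F₀) < √(e + F₀) := Real.sqrt_lt_sqrt (by linarith) (by linarith)
  have hev1 : ∀ᶠ r : ℝ in atTop, √(primF g x + F₀) <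
      √(e + F₀) - n / (√2 * r) * (lam + 2 * Y * (m + 1)) := by
    have h1 : Tendsto (fun r : ℝ => n / (√2 * r) * (lam + 2 * Y * (m + 1))) atTop
        (𝓝 (0 * (lam + 2 * Y * (m + 1)))) :=
      (tendsto_const_nhds.div_atTop (tendsto_id.const_mul_atTop (by positivity))).mul_const _
    rw [zero_mul] at h1
    have h2 := (tendsto_const_nhds (x := √(e + F₀))).sub h1
    rw [sub_zero] at h2
    exact h2.eventually (lt_mem_nhds hsq)
  obtain ⟨ρ₁, hρ₁⟩ := eventually_atTop.1 hev1
  -- The four bounds serve in turn: the loss of √(E + F₀) is affordable, n/r is tame, the descent to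
  -- 0 ends before 2r, and the energy lost on it, of order 1/r, beats the excess C/r².
  refine ⟨max (max ρ₁ 1) (max (lam / √c) (2 * V * C / (n * c * lam) + 1)),
    fun u v r hr h hVr hur hvr he1 he2 => ?_⟩
  have hr1 : ρ₁ ≤ r := ((le_max_left _ _).trans (le_max_left _ _)).trans hr
  have hr2 : 1 ≤ r := ((le_max_right _ _).trans (le_max_left _ _)).trans hr
  have hr3 : lam / √c ≤ r := ((le_max_left _ _).trans (le_max_right _ _)).trans hr
  have hr4 : 2 * V * C / (n * c * lam) < r :=
    (lt_add_one _).trans_le (((le_max_right _ _).trans (le_max_right _ _)).trans hr)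
  have hr0 : 0 < r := by linarith
  set κ := (n : ℝ) / (√2 * r) with hκ
  have hκ0 : 0 ≤ κ := by positivity
  have hJ := hρ₁ r hr1
  rw [← hκ] at hJ
  have hJe : √(e + F₀) ≤ √(nrg g u v r + F₀) := Real.sqrt_le_sqrt (by linarith)
  have hvr' : v r < 0 := by
    refine lt_of_le_of_ne hvr fun hz => ?_
    have : nrg g u v r = primF g lam := by simp [nrg, hz, hur]
    linarith
  have hκm : 0 ≤ κ * (2 * Y * (m + 1)) := by positivity
  obtain ⟨z, hz1, hz2, hz3, hz4, hz5, hz6⟩ := h.descend hW.cont hr0 le_rfl (by rw [hur]; exact hlam)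
    (Or.inl hvr') (F₀ := F₀) (Fx := primF g x)
    (fun s hs => hF₀ s (by rw [hur] at hs; rw [abs_of_nonneg hs.1]; linarith [hs.2]))
    (fun s hs => Or.inl (by
      rw [hur] at hs
      exact (hW.primF_le_lam (by rw [abs_of_nonneg hs.1]; exact hs.2)).trans hFlx.le))
    (by rw [hur, ← hκ]; linarith)
  rw [hur, ← hκ] at hz6
  have hEz : primF g x < nrg g u v z := by
    by_contra! hcon
    linarith [Real.sqrt_le_sqrt (add_le_add_left hcon F₀)]
  have hvsq : ∀ s ∈ Icc r z, c ≤ v s ^ 2 := by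
    intro s hs
    have h1 := h.nrg_le hW.cont (hr0.le.trans hs.1) hs.2
    have h2 := hz5
    have h3 : u s ≤ lam := hur ▸ h.antitoneOn_Icc hz5 ⟨le_rfl, hz1.le⟩ hs hs.1
    have h4 : 0 ≤ u s := hz2 ▸ h.antitoneOn_Icc hz5 hs ⟨hz1.le, le_rfl⟩ hs.2
    have h5 := hW.primF_le_lam (by rwa [abs_of_nonneg h4])
    rw [h.v_sq]
    linarith
  have hlt : lam / V ≤ z - r ∧ z - r ≤ lam / √c := by
    obtain ⟨ξ, hξ, hξ'⟩ := h.exists_mvt hz1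
    have h1 : |v ξ| ≤ V := hVr ξ hξ.1.le
    have h2 : √c ≤ |v ξ| := Real.sqrt_le_iff.2 ⟨abs_nonneg _, by
      rw [sq_abs]; exact hvsq ξ ⟨hξ.1.le, hξ.2.le⟩⟩
    have h3 : |v ξ| * (z - r) = lam := by
      rw [abs_of_nonpos (hz5 ξ ⟨hξ.1.le, hξ.2.le⟩)]
      linarith
    have hzr : 0 < z - r := by linarith
    constructor
    · rw [div_le_iff₀ hV, ← h3, mul_comm]; gcongr
    · rw [le_div_iff₀ (Real.sqrt_pos.2 hc0), ← h3, mul_comm]; gcongr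
  -- The descent lasts at least lam/V with v² ≥ c, so it loses at least n c lam/(2 r V) of energy.
  -- This exceeds C/r² and puts the energy below the barrier Y.
  have hEzY : nrg g u v z < primF g Y := by
    obtain ⟨ξ, hξ, hξ'⟩ := exists_hasDerivAt_eq_slope (nrg g u v) (fun s => -((n : ℝ) / s * v s ^ 2))
      hz1 (h.continuous_nrg hW.cont).continuousOn
      fun s hs => h.hasDerivAt_nrg hW.cont (hr0.trans hs.1)
    have hzr : 0 < z - r := by linarith
    have hξ0 : 0 < ξ := hr0.trans hξ.1
    have hz0 : z ≤ 2 * r := by linarith [hlt.2]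
    rw [eq_div_iff hzr.ne'] at hξ'
    have h1 : (n : ℝ) / (2 * r) * c * (lam / V) ≤ n / ξ * v ξ ^ 2 * (z - r) := by
      have h2 := hvsq ξ ⟨hξ.1.le, hξ.2.le⟩
      have h3 := hlt.1
      have h4 : ξ ≤ 2 * r := hξ.2.le.trans hz0
      gcongr
    have h5 : C / r ^ 2 < (n : ℝ) / (2 * r) * c * (lam / V) := by
      rw [div_lt_iff₀ (by positivity)] at hr4 ⊢
      have : (n : ℝ) / (2 * r) * c * (lam / V) * r ^ 2 = r * (n * c * lam) / (2 * V) := by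
        field_simp
      rw [this, lt_div_iff₀ (by positivity)]
      linarith
    linarith
  obtain ⟨ρ, hρ0, hρ1, hρ2, -⟩ := h.exists_swings hW.cont hW.odd hr0 hY0 (F₀ := F₀)
    (Fx := primF g x)
    (fun s hs => hF₀ s (by rw [abs_of_nonneg hs.1]; exact hs.2.trans hYB)) hdich m z hz1.le hz2
    hz3.ne hEzY (by
      rw [← hκ]
      linarith)
  exact hasSignChangesAtLeast_iff.2 ⟨ρ m, ρ, (hr0.trans hz1).trans hρ0, le_rfl, hρ1, hρ2⟩

end Well

namespace Well

variable {n : ℕ} {g u v : ℝ → ℝ} {b lam B Fb : ℝ}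

theorem nrg_le_primF_B (hW : Well g b lam B Fb) (h : IsSol n g u v) (hB : ∀ r ≥ 0, |u r| ≤ B)
    {r : ℝ} (hr : 0 ≤ r) : nrg g u v r ≤ primF g B := by
  have h1 : nrg g u v 0 = primF g (u 0) := by simp [nrg, h.v_nonpos 0 le_rfl]
  exact (h.nrg_le hW.cont le_rfl hr).trans (h1 ▸ hW.primF_le _ (hB 0 le_rfl))

theorem exists_velocity_bound (hW : Well g b lam B Fb) : ∃ V > 0, ∀ (n : ℕ) (u v : ℝ → ℝ),
    IsSol n g u v → (∀ r ≥ 0, |u r| ≤ B) → ∀ r ≥ 0, |v r| ≤ V := by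
  obtain ⟨F₀, hF₀pos, hF₀⟩ := hW.exists_primF_gt
  have hB := hW.primF_B_pos
  refine ⟨2 * (primF g B + F₀) + 1, by positivity, fun n u v h hu r hr => ?_⟩
  refine abs_le_of_sq_le_sq ?_ (by positivity)
  rw [h.v_sq]
  nlinarith [hW.nrg_le_primF_B h hu hr, hF₀ (u r) (hu r hr)]

/-- The hump rises and falls once, each time over a distance at most B, and every unit of distance
costs at most n/(√2 R₀). -/
theorem sqrt_nrg_loss_of_hump (hW : Well g b lam B Fb) (hn : 1 ≤ n) (h : IsSol n g u v)
    {R₀ p r F₀ : ℝ} (hR₀ : 0 < R₀) (hp : R₀ ≤ p) (hpr : p ≤ r)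
    (hmin : ∀ s ∈ Icc p r, u r ≤ u s) (hr0 : 0 ≤ u r) (hB : ∀ s ∈ Icc p r, u s ≤ B)
    (hF₀ : ∀ s, |s| ≤ B → -F₀ < primF g s) :
    √(nrg g u v p + F₀) - n / (√2 * R₀) * (2 * B) ≤ √(nrg g u v r + F₀) := by
  set κ := (n : ℝ) / (√2 * R₀) with hκ
  have hκ0 : 0 ≤ κ := by positivity
  have hκB : 0 ≤ κ * B := mul_nonneg hκ0 hW.B_pos.le
  have hF : ∀ s ∈ Icc p r, -F₀ < primF g (u s) := fun s hs => hF₀ _ (by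
    rw [abs_of_nonneg (hr0.trans (hmin s hs))]; exact hB s hs)
  rcases eq_or_lt_of_le hpr with h1 | h1
  · rw [h1]; linarith
  obtain ⟨q, hq, hq1, hq2⟩ := h.unimodal hn hW.cont (hR₀.trans_le hp) h1 hmin
  have h2 := h.sqrt_nrg_loss hW.cont hR₀ (hp.trans hq.1) hq.2 (F₀ := F₀)
    (fun s hs => hF s ⟨hq.1.trans hs.1, hs.2⟩) hq2
  have h3 : √(nrg g u v p + F₀) - κ * (u q - u p) ≤ √(nrg g u v q + F₀) := by
    rcases hq1 with h4 | h4
    · rw [h4]; simp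
    · exact h.sqrt_nrg_loss' hW.cont hW.odd hR₀ hp hq.1 (fun s hs => hF s ⟨hs.1, hs.2.trans hq.2⟩) h4
  have h5 : κ * (u q - u p) ≤ κ * B :=
    mul_le_mul_of_nonneg_left (by linarith [hB q hq, hmin p ⟨le_rfl, hpr⟩]) hκ0
  have h6 : κ * (u q - u r) ≤ κ * B := mul_le_mul_of_nonneg_left (by linarith [hB q hq]) hκ0
  linarith

/-- Solutions that linger beyond `lam` for a long time and then descend have many sign changes. -/
theorem exists_linger (hW : Well g b lam B Fb) (hn : 1 ≤ n) (m : ℕ) :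
    ∃ ρ > 0, ∀ u v : ℝ → ℝ, ∀ r ≥ ρ, IsSol n g u v → (∀ s ≥ 0, |u s| ≤ B) → u r = lam →
      (∀ s ∈ Icc (r / 2) r, lam ≤ u s) → HasSignChangesAtLeast u m := by
  by_contra! hcon
  have hlam := hW.lam_pos
  have hcont := continuous_primF hW.cont
  obtain ⟨V, hV, hVb⟩ := hW.exists_velocity_bound
  obtain ⟨F₀, hF₀pos, hF₀⟩ := hW.exists_primF_gt
  -- Counterexamples with r j → ∞ are collected. Their slow moments p j have heights accumulating at
  -- some l, and g(l) = 0 since the force there is O(1/r j).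
  choose! u v r hr hs hB hur hhump hno using fun j : ℕ => hcon (j + 24) (by positivity)
  have hr24 : ∀ j, 24 ≤ r j := fun j => by
    have := hr j
    have h2 : (0 : ℝ) ≤ j := Nat.cast_nonneg j
    linarith
  have hpos : ∀ j, ∀ s ∈ Icc (r j / 2) (r j), 0 ≤ s := fun j s hs => by
    linarith [hs.1, hr24 j]
  choose p hp ξ hξ hvp hgξ hξp using fun j => (hs j).exists_slow_of_hump hn hW.cont (B := B) (V := V)
    (hr24 j) (fun s h => by rw [hur j]; exact hhump j s h)
    (fun s h => by linarith [le_abs_self (u j s), hB j s (hpos j s h), hur j])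
    (fun s h => hVb n _ _ (hs j) (hB j) s (hpos j s h))
  have hy : ∀ j, u j (p j) ∈ Icc lam B := fun j =>
    ⟨hhump j _ (hp j), (le_abs_self _).trans (hB j _ (hpos j _ (hp j)))⟩
  obtain ⟨l, hl, φ, hφ, hlim⟩ := isCompact_Icc.tendsto_subseq hy
  have hrinf : Tendsto (fun j => r (φ j)) atTop atTop := by
    refine tendsto_atTop_mono (fun j => ?_) tendsto_natCast_atTop_atTop
    have h1 : (j : ℝ) ≤ φ j := by exact_mod_cast hφ.id_le j
    linarith [hr (φ j)]
  have hsmall : ∀ C : ℝ, Tendsto (fun j => C / r (φ j)) atTop (𝓝 0) := fun C =>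
    tendsto_const_nhds.div_atTop hrinf
  have hξlim : Tendsto (fun j => u (φ j) (ξ (φ j))) atTop (𝓝 l) := by
    have h1 : Tendsto (fun j => u (φ j) (ξ (φ j)) - u (φ j) (p (φ j))) atTop (𝓝 0) :=
      squeeze_zero_norm (fun j => hξp (φ j)) (hsmall _)
    simpa using h1.add hlim
  have hgl : g l = 0 := by
    have h1 : Tendsto (fun j => g (u (φ j) (ξ (φ j)))) atTop (𝓝 0) :=
      squeeze_zero_norm (fun j => hgξ (φ j)) (hsmall _)
    exact tendsto_nhds_unique ((hW.cont.tendsto l).comp hξlim) h1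
  have hFy : Tendsto (fun j => primF g (u (φ j) (p (φ j)))) atTop (𝓝 (primF g l)) :=
    (hcont.tendsto l).comp hlim
  have hv2 : ∀ j, v j (p j) ^ 2 ≤ (24 * B / r j) ^ 2 := fun j => by
    rw [← sq_abs (v j (p j))]
    exact pow_le_pow_left₀ (abs_nonneg _) (hvp j) 2
  have hrp : ∀ j, nrg g (u j) (v j) (r j) ≤ nrg g (u j) (v j) (p j) := fun j =>
    (hs j).nrg_le hW.cont (hpos j _ (hp j)) (hp j).2
  -- On its way from height near l down to lam the solution passes s, so F(s) is at most the energy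
  -- at p j, which tends to F(l).
  have hFl1 : ∀ s, lam ≤ s → s < l → primF g s ≤ primF g l := by
    intro s hs1 hs2
    have h1 : Tendsto (fun j => (24 * B / r (φ j)) ^ 2 / 2 + primF g (u (φ j) (p (φ j)))) atTop
        (𝓝 (0 ^ 2 / 2 + primF g l)) := (((hsmall _).pow 2).div_const 2).add hFy
    rw [show (0 : ℝ) ^ 2 / 2 + primF g l = primF g l by ring] at h1
    refine ge_of_tendsto h1 ?_
    filter_upwards [hlim.eventually (lt_mem_nhds hs2)] with j hj
    obtain ⟨c, hc, hc'⟩ := intermediate_value_Icc' (hp (φ j)).2 (hs (φ j)).cu.continuousOn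
      (show s ∈ Icc (u (φ j) (r (φ j))) (u (φ j) (p (φ j))) from ⟨by rw [hur]; exact hs1, hj.le⟩)
    have h2 := primF_le_nrg g (u (φ j)) (v (φ j)) c
    have h3 := (hs (φ j)).nrg_le hW.cont (hpos _ _ (hp (φ j))) hc.1
    have h4 := hv2 (φ j)
    rw [hc'] at h2
    have h5 : nrg g (u (φ j)) (v (φ j)) (p (φ j)) =
      v (φ j) (p (φ j)) ^ 2 / 2 + primF g (u (φ j) (p (φ j))) := rfl
    linarith
  have hlaml : lam < l := lt_of_le_of_ne hl.1 fun heq =>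
    (hW.g_pos lam hW.b_lt le_rfl).ne' (heq ▸ hgl)
  have hFl : ∀ s ∈ Icc 0 l, primF g s ≤ primF g l := by
    intro s hs
    rcases le_total s lam with h1 | h1
    · exact (hW.primF_le_lam (by rwa [abs_of_nonneg hs.1])).trans (hFl1 lam le_rfl hlaml)
    · rcases eq_or_lt_of_le hs.2 with h2 | h2
      · rw [h2]
      · exact hFl1 s h1 h2
  obtain ⟨x, Y, hx1, hx2, hY1, hY2, hY3, hx3, hdich⟩ := hW.exists_barrier hl hgl hFl
  -- The level halfway between F(x) and F(Y) leaves room for the O(1/r) loss between p j and r j.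
  -- The constant C bounds the kinetic energy v²/2 = O(1/r²) at p j.
  obtain ⟨ρ, hρ⟩ := hW.exists_swings_of_barrier hn hx1 hx2 (hY1.trans hl.2) hx3 hdich hV
    (e := (primF g x + primF g Y) / 2) (C := (24 * B) ^ 2 / 2) (by linarith) m
  have hJ : ∀ᶠ j in atTop, √((primF g x + primF g Y) / 2 + F₀) <
      √(primF g (u (φ j) (p (φ j))) + F₀) - n / (√2 * (r (φ j) / 2)) * (2 * B) := by
    have h1 : Tendsto (fun j => (n : ℝ) / (√2 * (r (φ j) / 2)) * (2 * B)) atTop (𝓝 (0 * (2 * B))) :=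
      (tendsto_const_nhds.div_atTop
        ((hrinf.atTop_div_const (by norm_num)).const_mul_atTop (by positivity))).mul_const _
    have h2 := (hFy.add_const F₀).sqrt.sub h1
    rw [zero_mul, sub_zero, ← hY2] at h2
    refine h2.eventually (lt_mem_nhds (Real.sqrt_lt_sqrt ?_ (by linarith)))
    have := hW.primF_pos hW.b_lt le_rfl
    linarith
  obtain ⟨j, hj1, hj2, hj3⟩ := ((hrinf.eventually (eventually_ge_atTop ρ)).and (hJ.and
    (hlim.eventually (hW.eventually_primF_le hl hgl hFl)))).exists
  set i := φ j with hi
  have hri := hr24 i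
  refine hno i (hρ (u i) (v i) (r i) hj1 (hs i)
    (fun s hs' => hVb n _ _ (hs i) (hB i) s (by linarith)) (hur i) ?_ ?_ ?_)
  · by_contra! hvr
    obtain ⟨y, hy1, hy2, hy3⟩ := exists_lt_left_of_hasDerivAt_pos ((hs i).du (r i)) hvr
      (show r i / 2 < r i by linarith)
    linarith [hhump i y ⟨hy1.le, hy2.le⟩, hur i]
  · have h1 := hW.sqrt_nrg_loss_of_hump hn (hs i) (show 0 < r i / 2 by linarith) (hp i).1 (hp i).2
      (fun s hs' => by rw [hur i]; exact hhump i s ⟨(hp i).1.trans hs'.1, hs'.2⟩)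
      (by rw [hur i]; exact hlam.le)
      (fun s hs' => (le_abs_self _).trans (hB i s (hpos i s ⟨(hp i).1.trans hs'.1, hs'.2⟩))) hF₀
    have h2 := Real.sqrt_le_sqrt (add_le_add_left (primF_le_nrg g (u i) (v i) (p i)) F₀)
    by_contra! hcon
    have h3 := Real.sqrt_le_sqrt (add_le_add_left hcon.le F₀)
    have h4 : √(primF g (u i (p i)) + F₀) = √(primF g (u (φ j) (p (φ j))) + F₀) := rfl
    linarith
  · have h1 := hj3 (hy i).2
    have h2 := hrp i
    have h3 : nrg g (u i) (v i) (p i) = v i (p i) ^ 2 / 2 + primF g (u i (p i)) := rfl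
    have h4 := hv2 i
    have h5 : (24 * B / r i) ^ 2 = (24 * B) ^ 2 / r i ^ 2 := div_pow _ _ _
    have h6 : (24 * B) ^ 2 / 2 / r i ^ 2 = (24 * B) ^ 2 / r i ^ 2 / 2 := by ring
    have h7 : primF g (u i (p i)) ≤ primF g l := h1
    rw [h6, hY2]
    linarith

end Well

namespace Family

variable {n : ℕ} {g : ℝ → ℝ} {U V : ℝ → ℝ → ℝ} {b lam B Fb α : ℝ}

/-- Close to a stuck solution, a solution is stuck as well or has many sign changes. -/
theorem eventually_of_stuck (hF : Family n g U V) (hW : Well g b lam B Fb) (hn : 1 ≤ n)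
    (hα : α ≠ 0) {k : ℕ} (hk : ¬ HasSignChangesAtLeast (U α) k) (hstuck : Stuck lam (U α)) (m : ℕ) :
    ∀ᶠ α' in 𝓝 α, (∀ r ≥ 0, |U α' r| ≤ B) → ¬ (Stuck lam (U α') ∧ ¬ HasSignChangesAtLeast (U α') k) →
      HasSignChangesAtLeast (U α') m := by
  obtain ⟨R, hR⟩ := hstuck
  obtain ⟨ρ, hρ, hlinger⟩ := hW.exists_linger hn m
  set R' := max R 1 with hR'
  have hR'0 : 0 < R' := one_pos.trans_le (le_max_right _ _)
  -- Neighbours remain beyond lam on [R', T]. If one returns to lam at a first time r > T, then r/2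
  -- ≥ R' and r ≥ ρ, so it has lingered on [r/2, r] and `exists_linger` applies.
  set T := 2 * max R' ρ with hT
  have hR'T : R' ≤ T := by linarith [le_max_left R' ρ]
  have hne : ∀ r ≥ R', U α r ≠ 0 := fun r hr hz => by
    have := hR r ((le_max_left _ _).trans hr)
    rw [hz, abs_zero] at this
    linarith [hW.lam_pos]
  obtain ⟨c, hc, hcmin⟩ := isCompact_Icc.exists_isMinOn (nonempty_Icc.2 hR'T)
    ((hF.sol α).cu.abs.continuousOn (s := Icc R' T))
  have hcR := hR c ((le_max_left _ _).trans hc.1)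
  filter_upwards [hF.eventually_signChangesOn_imp hα hR'0 (hne R' le_rfl),
    hF.near α T (hne T hR'T) (|U α c| - lam) (by linarith)] with α' h1 h2 hB h3
  have h4 : ∀ r ∈ Icc R' T, lam < |U α' r| := by
    intro r hr
    have h5 := (h2 r ⟨hR'0.le.trans hr.1, hr.2⟩).1
    have h6 : |U α c| ≤ |U α r| := hcmin hr
    have h7 := abs_sub_abs_le_abs_sub (U α r) (U α' r)
    rw [abs_sub_comm] at h7
    linarith
  have hlam := hW.lam_pos
  by_cases hall : ∀ r ≥ R', lam < |U α' r|
  · exfalso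
    have hne' : ∀ r ≥ R', U α' r ≠ 0 := fun r hr hz => by
      have := hall r hr
      rw [hz, abs_zero] at this
      linarith
    refine h3 ⟨⟨R', hall⟩, fun h5 => hk (hasSignChangesAtLeast_iff.2 ⟨R', h1 k ?_⟩)⟩
    obtain ⟨T', hT'⟩ := hasSignChangesAtLeast_iff.1 h5
    exact hT'.of_tail hR'0 (hne' R' le_rfl) fun r hr _ =>
      (mul_nonneg_of_ne_zero (hF.sol α').cu hr fun s hs => hne' s hs.1).le
  · push Not at hall
    obtain ⟨q, hq, hq'⟩ := hall
    obtain ⟨r, hr1, hr2, hr3, hr4⟩ := exists_first_zero (φ := fun r => |U α' r| - lam)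
      (by have := (hF.sol α').cu; fun_prop) hq (by linarith [h4 R' ⟨le_rfl, hR'T⟩]) (by linarith)
    have hrT : T < r := by
      by_contra! hcon
      linarith [h4 r ⟨hr1.le, hcon⟩]
    have hrρ : r ≥ ρ := by linarith [le_max_right R' ρ, hT, hρ]
    have hr2' : R' ≤ r / 2 := by linarith [le_max_left R' ρ, hT]
    have habs : ∀ s ∈ Icc (r / 2) r, lam ≤ |U α' s| := fun s hs => by
      rcases eq_or_lt_of_le hs.2 with h5 | h5
      · rw [h5]; linarith
      · linarith [hr4 s (hr2'.trans hs.1) h5]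
    have hsign : ∀ s ∈ Icc (r / 2) r, 0 < U α' r * U α' s := fun s hs =>
      mul_nonneg_of_ne_zero (hF.sol α').cu hs.2 fun t ht hz => by
        have := habs t ⟨hs.1.trans ht.1, ht.2⟩
        rw [hz, abs_zero] at this
        linarith
    have hr5 : |U α' r| = lam := by linarith
    rcases lt_or_ge (U α' r) 0 with h5 | h5
    · rw [abs_of_neg h5] at hr5
      rw [← hasSignChangesAtLeast_neg]
      refine hlinger _ _ r hrρ ((hF.sol α').neg hW.odd) (by simpa using hB) hr5 fun s hs => ?_
      have h6 := neg_of_mul_pos_right (hsign s hs) h5.le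
      rw [← abs_of_neg h6]
      exact habs s hs
    · rw [abs_of_nonneg h5] at hr5
      refine hlinger _ _ r hrρ (hF.sol α') hB hr5 fun s hs => ?_
      have h6 := pos_of_mul_pos_right (hsign s hs) h5
      rw [← abs_of_pos h6]
      exact habs s hs

end Family

/-! ### Solutions tending to the rim -/

/-- After staying positive from time `R` on, the solution passes the rim downwards at time `r`. -/
def Crossing (b R : ℝ) (u v : ℝ → ℝ) (r : ℝ) : Prop :=
  R < r ∧ u r = b ∧ v r < 0 ∧ ∀ x ∈ Icc R r, 0 < u x

namespace Well

variable {n : ℕ} {g u v : ℝ → ℝ} {b lam B Fb R r y₁ : ℝ}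

theorem nrg_pos_of_crossing (hW : Well g b lam B Fb) (h : Crossing b R u v r) :
    0 < nrg g u v r := by
  obtain ⟨-, h1, h2, -⟩ := h
  unfold nrg
  rw [h1, hW.primF_b]
  have := sq_pos_of_neg h2
  linarith

/-- At the crossing the energy is positive, whereas a stationary point in the well has E ≤ 0.
Descending below the rim would force such a point before the return to b. -/
theorem v_pos_before_crossing (hW : Well g b lam B Fb) (h : IsSol n g u v) (hR : 0 < R)
    (hc : Crossing b R u v r) {y : ℝ} (hy : R ≤ y) (hyr : y < r) (hu : u y ≤ b) : 0 < v y := by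
  have hE := hW.nrg_pos_of_crossing hc
  obtain ⟨-, hub, -, hpos⟩ := hc
  have key : ∀ m, R ≤ m → m ≤ r → u m ≤ b → v m ≠ 0 := by
    intro m hm hmr hum hvm
    have h1 := hpos m ⟨hm, hmr⟩
    have h2 := hW.primF_nonpos (u m) (by rwa [abs_of_pos h1])
    have h3 := h.nrg_le hW.cont (hR.le.trans hm) hmr
    have h4 : nrg g u v m = primF g (u m) := by simp [nrg, hvm]
    linarith
  by_contra! hcon
  have hvy : v y < 0 := lt_of_le_of_ne hcon (key y hy hyr.le hu)
  obtain ⟨x, hx1, hx2, hx3⟩ := exists_lt_of_hasDerivAt_neg (h.du y) hvy hyr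
  obtain ⟨m, hm, hvm, hmin⟩ := h.exists_interior_min hvy ⟨hx1.le, hx2.le⟩
    (show u x < u r by linarith)
  exact key m (hy.trans hm.1.le) hm.2.le ((hmin y ⟨le_rfl, hyr.le⟩).trans hu) hvm

/-- A first crossing would be a moment at rim height with v < 0 before the second one, where the
velocity must be positive. -/
theorem crossing_unique (hW : Well g b lam B Fb) (h : IsSol n g u v) (hR : 0 < R) {r' : ℝ}
    (hc : Crossing b R u v r) (hc' : Crossing b R u v r') : r = r' := by
  have key : ∀ {r r'}, Crossing b R u v r → Crossing b R u v r' → ¬ r < r' := by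
    intro r r' hc hc' hlt
    have := hW.v_pos_before_crossing h hR hc' hc.1.le hlt hc.2.1.le
    linarith [hc.2.2.1]
  exact le_antisymm (not_lt.1 (key hc' hc)) (not_lt.1 (key hc hc'))

/-- The last passage of b before the first zero is a crossing. If r E were below the price κ ∫₀ᵇ |F|
there, the solution would never reach 0. -/
theorem exists_crossing (hW : Well g b lam B Fb) (hn : 1 ≤ n) (h : IsSol n g u v) (hR : 0 < R)
    (hu : 0 < u R) (hRb : b < u R ∨ (u R < b ∧ 0 < v R)) (hEm : nrg g u v R ≤ primF g B + 1)
    (hz : ∃ x ≥ R, u x < 0) :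
    ∃ r, Crossing b R u v r ∧ wellCoeff n g B Fb * absPot g b ≤ r * nrg g u v r := by
  obtain ⟨x, hx, hux⟩ := hz
  obtain ⟨z, hz1, -, hz3, hz4⟩ := exists_first_zero h.cu hx hu hux.le
  have hb := hW.b_pos
  have hEz : 0 ≤ nrg g u v z := by
    have := primF_le_nrg g u v z
    rwa [hz3, primF_zero] at this
  have key : ∀ m, R ≤ m → m < z → u m ≤ b → v m ≠ 0 := by
    intro m hm hmz hum hvm
    have h1 := hz4 m hm hmz
    have h2 := hW.primF_nonpos (u m) (by rwa [abs_of_pos h1])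
    have h4 : nrg g u v m = primF g (u m) := by simp [nrg, hvm]
    have := h.eq_of_nrg_le hn hW.cont (hR.le.trans hm) (by linarith) z ⟨hmz.le, le_rfl⟩
    linarith
  obtain ⟨y, hy1, hy2, hy3⟩ : ∃ y, R ≤ y ∧ y < z ∧ b ≤ u y := by
    rcases hRb with h1 | ⟨h1, h2⟩
    · exact ⟨R, le_rfl, hz1, h1.le⟩
    · obtain ⟨m, hm, hvm, -⟩ := h.exists_interior_max hW.odd h2 ⟨le_rfl, hz1.le⟩
        (show u z < u R by rw [hz3]; exact hu)
      refine ⟨m, hm.1.le, hm.2, ?_⟩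
      by_contra! hcon
      exact key m hm.1.le hm.2 hcon.le hvm
  obtain ⟨c, hc1, hc2, hc3, hc4⟩ := exists_last_zero (φ := fun r => b - u r)
    (by have := h.cu; fun_prop) hy2.le (by linarith) (by rw [hz3]; linarith)
  have huc : u c = b := by linarith
  have hRc : R ≤ c := hy1.trans hc1
  have hvc : v c < 0 := by
    refine lt_of_le_of_ne ?_ (key c hRc hc2 huc.le)
    by_contra! hcon
    obtain ⟨w, hw1, hw2, hw3⟩ := exists_gt_of_hasDerivAt_pos (h.du c) hcon hc2
    linarith [hc4 w hw1 hw2.le]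
  have hRc' : R < c := lt_of_le_of_ne hRc fun heq => by
    rw [heq] at hRb
    rcases hRb with h1 | ⟨h1, -⟩ <;> linarith
  refine ⟨c, ⟨hRc', huc, hvc, fun w hw => hz4 w hw.1 (hw.2.trans_lt hc2)⟩, ?_⟩
  by_contra! hcon
  have := hW.stays_of_descending hn h (hR.trans hRc') (by rw [huc]; exact hb) huc.le hvc
    ((h.nrg_le hW.cont hR.le hRc).trans hEm) hW.level_pos (by rw [huc]; exact hcon) z hc2
  linarith

theorem g_nonneg (hW : Well g b lam B Fb) {s : ℝ} (h1 : b ≤ s) (h2 : s ≤ lam) : 0 ≤ g s := by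
  rcases eq_or_lt_of_le h1 with h | h
  · rw [← h]
    refine ge_of_tendsto (hW.cont.continuousWithinAt (s := Ioi b) (x := b)) ?_
    filter_upwards [Ioc_mem_nhdsGT hW.b_lt] with x hx using (hW.g_pos x hx.1 hx.2).le
  · exact (hW.g_pos s h h2).le

/-- If u were below b at some x ≥ r/4, it would be below b and increasing on all of [R, x], with v²
≥ 2 c₀/r. Over a time of at least r/8 it would rise by more than b. -/
theorem ge_of_crossing (hW : Well g b lam B Fb) (h : IsSol n g u v) (hR : 0 < R)
    (hc : Crossing b R u v r) {c₀ : ℝ} (hc₀ : 0 < c₀) (hE : c₀ ≤ r * nrg g u v r)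
    (hr1 : 8 * R ≤ r) (hr2 : 32 * b ^ 2 / c₀ ≤ r) : ∀ x ∈ Icc (r / 4) r, b ≤ u x := by
  intro x hx
  by_contra! hcon
  have hr0 : 0 < r := by linarith
  have hRx : R < x := by linarith [hx.1]
  have hxr : x < r := lt_of_le_of_ne hx.2 fun heq => by
    have := hc.2.1
    rw [← heq] at this
    linarith
  have hlt : ∀ y, R ≤ y → y ≤ x → u y < b := by
    intro y hy hyx
    by_contra! hcon'
    obtain ⟨c, hc1, hc2, hc3, hc4⟩ := exists_last_zero (φ := fun r => b - u r)
      (by have := h.cu; fun_prop) hyx (by linarith) (by linarith)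
    have hvc := hW.v_pos_before_crossing h hR hc (hy.trans hc1) (hc2.trans hxr) (by linarith)
    obtain ⟨w, hw1, hw2, hw3⟩ := exists_gt_of_hasDerivAt_pos (h.du c) hvc hc2
    linarith [hc4 w hw1 hw2.le]
  obtain ⟨ξ, hξ, hξ'⟩ := h.exists_mvt hRx
  have hξr : ξ < r := hξ.2.trans hxr
  have huξ := hlt ξ hξ.1.le hξ.2.le
  have hpos := hc.2.2.2
  have hvξ := hW.v_pos_before_crossing h hR hc hξ.1.le hξr huξ.le
  have h1 := h.nrg_le hW.cont (hR.trans hξ.1).le hξr.le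
  have h2 := hW.primF_nonpos (u ξ) (by rw [abs_of_pos (hpos ξ ⟨hξ.1.le, hξr.le⟩)]; exact huξ.le)
  have h3 := h.v_sq ξ
  rw [div_le_iff₀ hc₀] at hr2
  have h7 : 2 * c₀ ≤ r * v ξ ^ 2 := by nlinarith
  have h8 : (v ξ * (r / 8)) ^ 2 = r * (r * v ξ ^ 2) / 64 := by ring
  have h9 : r * (2 * c₀) ≤ r * (r * v ξ ^ 2) := by gcongr
  have h11 : v ξ * (r / 8) < b := by
    have h5 : v ξ * (r / 8) ≤ v ξ * (x - R) := by gcongr; linarith [hx.1]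
    have := hlt x hRx.le le_rfl
    linarith [hpos R ⟨le_rfl, hc.1.le⟩]
  have h12 : (v ξ * (r / 8)) ^ 2 < b ^ 2 := pow_lt_pow_left₀ h11 (by positivity) two_ne_zero
  nlinarith

/-- As g ≥ 0 between b and lam, the flux x^n v decreases on [r/4, r]. A large velocity in the middle
would persist, up to a factor 2^n, for a time r/4 on one side and exceed the available distance lam.
-/
theorem velocity_le_of_crossing (hW : Well g b lam B Fb) (h : IsSol n g u v) (hr : 0 < r)
    (hu : ∀ x ∈ Icc (r / 4) r, b ≤ u x ∧ u x ≤ lam) :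
    ∀ s ∈ Icc (r / 2) (3 * r / 4), |v s| ≤ 4 * 2 ^ n * lam / r := by
  have hanti : AntitoneOn (fun x => x ^ n * v x) (Icc (r / 4) r) := by
    apply antitoneOn_of_hasDerivWithinAt_nonpos (convex_Icc _ _)
      (f' := fun x => -(x ^ n * g (u x)))
    · have := h.cv
      fun_prop
    · intro x hx
      have hx' := interior_subset hx
      exact (h.deriv_flux (by linarith [hx'.1])).hasDerivWithinAt
    · intro x hx
      have hx' := interior_subset hx
      have h1 := hW.g_nonneg (hu x hx').1 (hu x hx').2
      have h2 : 0 ≤ x := by linarith [hx'.1]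
      have : 0 ≤ x ^ n * g (u x) := by positivity
      linarith
  have hb := hW.b_pos
  have hlam := hW.lam_pos
  have h2n : (1 : ℝ) ≤ 2 ^ n := one_le_pow₀ (by norm_num)
  intro s hs
  have hs0 : 0 < s := by linarith [hs.1]
  have hsm : s ∈ Icc (r / 4) r := ⟨by linarith [hs.1], by linarith [hs.2]⟩
  have hrm : r ∈ Icc (r / 4) r := ⟨by linarith, le_rfl⟩
  have hqm : r / 4 ∈ Icc (r / 4) r := ⟨le_rfl, by linarith⟩
  rw [le_div_iff₀ hr]
  rcases le_or_gt (v s) 0 with hvs | hvs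
  · rw [abs_of_nonpos hvs]
    obtain ⟨y, hy, hy'⟩ := h.exists_mvt (show s < r by linarith [hs.2])
    have hy0 : 0 < y := hs0.trans hy.1
    have h1 := hanti hsm ⟨hsm.1.trans hy.1.le, hy.2.le⟩ hy.1.le
    simp only at h1
    have h2 : y ^ n ≤ 2 ^ n * s ^ n := by
      rw [← mul_pow]; gcongr; linarith [hs.1, hy.2]
    have hvy : v y ≤ 0 := by
      have : s ^ n * v s ≤ 0 := mul_nonpos_of_nonneg_of_nonpos (by positivity) hvs
      by_contra! hcon
      have : 0 < y ^ n * v y := by positivity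
      linarith
    have h3 : s ^ n * (-v s) ≤ s ^ n * (2 ^ n * (-v y)) := by
      have : y ^ n * (-v y) ≤ 2 ^ n * s ^ n * (-v y) :=
        mul_le_mul_of_nonneg_right h2 (by linarith)
      nlinarith
    have h4 : -v s ≤ 2 ^ n * (-v y) := le_of_mul_le_mul_left h3 (by positivity)
    have h5 : (-v y) * (r / 4) ≤ lam := by
      have : (-v y) * (r / 4) ≤ (-v y) * (r - s) :=
        mul_le_mul_of_nonneg_left (by linarith [hs.2]) (by linarith)
      linarith [(hu s hsm).2, (hu r hrm).1]
    have h6 : (2 : ℝ) ^ n * (-v y * (r / 4)) ≤ 2 ^ n * lam := by gcongr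
    nlinarith
  · rw [abs_of_pos hvs]
    obtain ⟨y, hy, hy'⟩ := h.exists_mvt (show r / 4 < s by linarith [hs.1])
    have hy0 : 0 < y := by linarith [hy.1]
    have h1 := hanti ⟨hy.1.le, hy.2.le.trans hsm.2⟩ hsm hy.2.le
    simp only at h1
    have hvy : v s ≤ v y := by
      have h2 : y ^ n ≤ s ^ n := by gcongr; exact hy.2.le
      have h3 : y ^ n * v s ≤ y ^ n * v y := (mul_le_mul_of_nonneg_right h2 hvs.le).trans h1
      exact le_of_mul_le_mul_left h3 (by positivity)
    have h5 : v s * (r / 4) ≤ lam := by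
      have h6 : v s * (r / 4) ≤ v y * (s - r / 4) := by
        gcongr
        · linarith
        · linarith [hs.1]
      linarith [(hu s hsm).2, (hu _ hqm).1]
    nlinarith

/-- The midpoint height of a late crossing satisfies a differential inequality. -/
theorem midpoint_of_crossing (hW : Well g b lam B Fb) (h : IsSol n g u v) {c₀ K : ℝ}
    (hc₀ : 0 < c₀) (hE : c₀ ≤ r * nrg g u v r) (hr : 4 ≤ r) (hy₁ : y₁ ≤ lam)
    (hu : ∀ x ∈ Icc (r / 4) r, b ≤ u x ∧ u x ≤ y₁) (hK0 : 0 ≤ K)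
    (hK : ∀ x ∈ Icc b y₁, ∀ y ∈ Icc b y₁, |g x - g y| ≤ K * |x - y|)
    (hr2 : (4 * 2 ^ n * lam) ^ 2 / c₀ ≤ r) :
    0 < primF g (u (r / 2)) ∧
      g (u (r / 2)) ≤ 2 * (2 + n + K) * (4 * 2 ^ n * lam) / c₀ * primF g (u (r / 2)) := by
  set C := 4 * 2 ^ n * lam with hC
  have hC0 : 0 < C := by have := hW.lam_pos; positivity
  have hr0 : 0 < r := by linarith
  have hv := hW.velocity_le_of_crossing h hr0 fun x hx => ⟨(hu x hx).1, (hu x hx).2.trans hy₁⟩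
  rw [← hC] at hv
  have hmem : r / 2 ∈ Icc (r / 4) r := ⟨by linarith, by linarith⟩
  have h1 := hv (r / 2) ⟨le_rfl, by linarith⟩
  -- The energy at r/2 is still at least c₀/r, while the kinetic part is O(1/r²). So F is at least
  -- of order 1/r at the midpoint.
  have hF : c₀ / (2 * r) ≤ primF g (u (r / 2)) := by
    have h2 := h.nrg_le hW.cont (show 0 ≤ r / 2 by linarith) (show r / 2 ≤ r by linarith)
    have h3 := h.v_sq (r / 2)
    have h4 : v (r / 2) ^ 2 ≤ (C / r) ^ 2 := by
      rw [← sq_abs]; exact pow_le_pow_left₀ (abs_nonneg _) h1 2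
    have h5 : c₀ / r ≤ nrg g u v r := by rw [div_le_iff₀ hr0]; linarith
    have h6 : (C / r) ^ 2 ≤ c₀ / r := by
      rw [div_le_iff₀ hc₀] at hr2
      rw [div_pow, div_le_div_iff₀ (by positivity) hr0]
      nlinarith
    have h7 : c₀ / (2 * r) = c₀ / r / 2 := by rw [div_div, mul_comm]
    linarith
  have hFpos : 0 < primF g (u (r / 2)) := (by positivity : 0 < c₀ / (2 * r)).trans_le hF
  refine ⟨hFpos, ?_⟩
  obtain ⟨ξ, hξ, hξ'⟩ := exists_hasDerivAt_eq_slope v (fun x => -(n : ℝ) / x * v x - g (u x))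
    (show r / 2 < r / 2 + 1 by linarith) h.cv.continuousOn fun x hx => h.dv x (by linarith [hx.1])
  obtain ⟨η, hη, hη'⟩ := h.exists_mvt hξ.1
  have hξm : ξ ∈ Icc (r / 2) (3 * r / 4) := ⟨hξ.1.le, by linarith [hξ.2]⟩
  have hξm' : ξ ∈ Icc (r / 4) r := ⟨by linarith [hξ.1], by linarith [hξ.2]⟩
  have h2 := hv (r / 2 + 1) ⟨by linarith, by linarith⟩
  have h3 := hv ξ hξm
  have h4 := hv η ⟨hη.1.le, hη.2.le.trans hξm.2⟩
  have h5 : |u (r / 2) - u ξ| ≤ C / r := by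
    rw [abs_sub_comm, ← hη', abs_mul, abs_of_pos (show 0 < ξ - r / 2 by linarith [hξ.1])]
    have h6 : ξ - r / 2 ≤ 1 := by linarith [hξ.2]
    calc |v η| * (ξ - r / 2) ≤ |v η| * 1 := by gcongr
      _ ≤ C / r := by rw [mul_one]; exact h4
  have h6 := hK _ (hu _ hmem) _ (hu _ hξm')
  have h7 : |(n : ℝ) / ξ * v ξ| ≤ n * (C / r) := by
    have hξ1 : 1 ≤ ξ := by linarith [hξ.1]
    rw [abs_mul, abs_of_nonneg (by positivity)]
    have : (n : ℝ) / ξ ≤ n := div_le_self (by positivity) hξ1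
    gcongr
  -- The equation and the mean value of v' over unit time bound the force by O(1/r) too. Comparing
  -- with the lower bound for F eliminates r.
  have h8 : g (u ξ) ≤ (2 + n) * (C / r) := by
    have h9 : g (u ξ) = -((n : ℝ) / ξ * v ξ) - (v (r / 2 + 1) - v (r / 2)) := by
      have h10 : (v (r / 2 + 1) - v (r / 2)) / (r / 2 + 1 - r / 2) = v (r / 2 + 1) - v (r / 2) := by
        rw [add_sub_cancel_left, div_one]
      rw [← h10, ← hξ']; ring
    rw [h9]
    linarith [(abs_le.1 h7).1, (abs_le.1 h2).1, (abs_le.1 h1).2]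
  have h9 : g (u (r / 2)) ≤ (2 + n + K) * (C / r) := by
    have h10 : K * |u (r / 2) - u ξ| ≤ K * (C / r) := by gcongr
    linarith [le_abs_self (g (u (r / 2)) - g (u ξ))]
  calc g (u (r / 2)) ≤ (2 + n + K) * (C / r) := h9
    _ = 2 * (2 + n + K) * C / c₀ * (c₀ / (2 * r)) := by field_simp
    _ ≤ _ := by gcongr

end Well

/-- A family of solutions depending continuously on a parameter. -/
structure Branch (n : ℕ) (g : ℝ → ℝ) (w z : ℝ → ℝ → ℝ) : Prop where
  sol : ∀ t, IsSol n g (w t) (z t)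
  near : ∀ t T, w t T ≠ 0 → ∀ ε > 0, ∀ᶠ t' in 𝓝 t, ∀ r ∈ Icc 0 T,
    |w t' r - w t r| < ε ∧ |z t' r - z t r| < ε

theorem Branch.neg {n : ℕ} {g : ℝ → ℝ} {w z : ℝ → ℝ → ℝ} (hodd : ∀ s, g (-s) = -g s)
    (h : Branch n g w z) : Branch n g (fun t r => -w t r) (fun t r => -z t r) where
  sol t := (h.sol t).neg hodd
  near t T hT ε hε := by
    filter_upwards [h.near t T (by simpa using hT) ε hε] with t' h' r hr
    obtain ⟨h1, h2⟩ := h' r hr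
    rw [← abs_neg] at h1 h2
    exact ⟨by convert h1 using 2; ring, by convert h2 using 2; ring⟩

/-- The crossing is transversal (v < 0), so it persists at a nearby time, and positivity on the
compact interval before it persists as well. -/
theorem eventually_crossing {n : ℕ} {g : ℝ → ℝ} {w z : ℝ → ℝ → ℝ} {b R r t ε : ℝ}
    (hB : Branch n g w z) (hR : 0 < R) (hb : 0 < b) (hc : Crossing b R (w t) (z t) r) (hε : 0 < ε) :
    ∀ᶠ t' in 𝓝 t, ∃ r', |r' - r| < ε ∧ Crossing b R (w t') (z t') r' := by
  obtain ⟨hRr, hwr, hzr, hpos⟩ := hc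
  have h := hB.sol t
  have hev : ∀ᶠ x in 𝓝 r, z t x < 0 ∧ 0 < w t x ∧ R < x :=
    (h.cv.continuousAt.eventually_lt_const hzr).and
      ((h.cu.continuousAt.eventually_const_lt (by rw [hwr]; exact hb)).and (lt_mem_nhds hRr))
  obtain ⟨δ, hδ, hball⟩ := Metric.eventually_nhds_iff_ball.1 hev
  set η := min (ε / 2) (δ / 2) with hη
  have hη0 : 0 < η := by positivity
  have hηε : η < ε := (min_le_left _ _).trans_lt (by linarith)
  have hηδ : η < δ := (min_le_right _ _).trans_lt (by linarith)
  have hloc : ∀ x ∈ Icc (r - η) (r + η), z t x < 0 ∧ 0 < w t x ∧ R < x := fun x hx =>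
    hball x (by
      rw [Metric.mem_ball, Real.dist_eq]
      exact (abs_le.2 ⟨by linarith [hx.1], by linarith [hx.2]⟩ : |x - r| ≤ η).trans_lt hηδ)
  have hneg : ∀ x ∈ Icc (r - η) (r + η), z t x < 0 := fun x hx => (hloc x hx).1
  have hw1 : b < w t (r - η) := hwr ▸ h.lt_of_v_neg (by linarith) fun x hx =>
    hneg x ⟨hx.1.le, by linarith [hx.2]⟩
  have hw2 : w t (r + η) < b := hwr ▸ h.lt_of_v_neg (by linarith) fun x hx =>
    hneg x ⟨by linarith [hx.1], hx.2.le⟩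
  have hRη : R < r - η := (hloc _ ⟨le_rfl, by linarith⟩).2.2
  obtain ⟨p, hp, hpmin⟩ := isCompact_Icc.exists_isMinOn
    (nonempty_Icc.2 (show R ≤ r + η by linarith)) (h.cu.continuousOn (s := Icc R (r + η)))
  obtain ⟨q, hq, hqmax⟩ := isCompact_Icc.exists_isMaxOn
    (nonempty_Icc.2 (show r - η ≤ r + η by linarith)) (h.cv.continuousOn (s := Icc (r - η) (r + η)))
  have hwp : 0 < w t p := by
    rcases le_total p r with h1 | h1
    · exact hpos p ⟨hp.1, h1⟩
    · exact (hloc p ⟨by linarith, hp.2⟩).2.1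
  have hzq := hneg q hq
  have hne : w t (r + η) ≠ 0 := (hloc _ ⟨by linarith, le_rfl⟩).2.1.ne'
  filter_upwards [hB.near t (r + η) hne
    (min (min (w t p) (-z t q)) (min (w t (r - η) - b) (b - w t (r + η))))
    (lt_min (lt_min hwp (by linarith)) (lt_min (by linarith) (by linarith)))] with t' ht'
  have hu : ∀ x ∈ Icc R (r + η), 0 < w t' x := fun x hx => by
    have h1 := (abs_lt.1 (ht' x ⟨hR.le.trans hx.1, hx.2⟩).1).1
    have h2 : w t p ≤ w t x := hpmin hx
    have h3 := (min_le_left (min (w t p) (-z t q)) (min (w t (r - η) - b) (b - w t (r + η)))).trans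
      (min_le_left _ _)
    linarith
  have hz : ∀ x ∈ Icc (r - η) (r + η), z t' x < 0 := fun x hx => by
    have h1 := (abs_lt.1 (ht' x ⟨by linarith [hx.1], hx.2⟩).2).2
    have h2 : z t x ≤ z t q := hqmax hx
    have h3 := (min_le_left (min (w t p) (-z t q)) (min (w t (r - η) - b) (b - w t (r + η)))).trans
      (min_le_right _ _)
    linarith
  have h1 : b ≤ w t' (r - η) := by
    have h1 := (abs_lt.1 (ht' (r - η) ⟨by linarith, by linarith⟩).1).1
    have h3 := (min_le_right (min (w t p) (-z t q)) (min (w t (r - η) - b) (b - w t (r + η)))).trans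
      (min_le_left _ _)
    linarith
  have h2 : w t' (r + η) ≤ b := by
    have h1 := (abs_lt.1 (ht' (r + η) ⟨by linarith, le_rfl⟩).1).2
    have h3 := (min_le_right (min (w t p) (-z t q)) (min (w t (r - η) - b) (b - w t (r + η)))).trans
      (min_le_right _ _)
    linarith
  obtain ⟨r', hr', hwr'⟩ := intermediate_value_Icc' (show r - η ≤ r + η by linarith)
    (hB.sol t').cu.continuousOn ⟨h2, h1⟩
  refine ⟨r', (abs_le.2 ⟨by linarith [hr'.1], by linarith [hr'.2]⟩ : |r' - r| ≤ η).trans_lt hηε,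
    by linarith [hr'.1], hwr', hz r' hr', fun x hx => hu x ⟨hx.1, hx.2.trans hr'.2⟩⟩

namespace Branch

variable {n : ℕ} {g : ℝ → ℝ} {w z : ℝ → ℝ → ℝ} {b lam B Fb : ℝ}

/-- A solution tending to the rim of the well cannot be approached, from one side, by solutions
that all keep changing sign. -/
theorem rim_isolated (hB : Branch n g w z) (hW : Well g b lam B Fb) (hn : 1 ≤ n) {t₀ R : ℝ}
    (hR : 0 < R) (hne : ∀ r ≥ R, w t₀ r ≠ b) (hpos : ∀ r ≥ R, 0 < w t₀ r)
    (hlim : Tendsto (w t₀) atTop (𝓝 b)) (hE : Tendsto (nrg g (w t₀) (z t₀)) atTop (𝓝 0)) :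
    ¬ ∀ R' ≥ R, ∀ᶠ t in 𝓝[>] t₀, ∃ x ≥ R', w t x < 0 := by
  intro hz
  have hb := hW.b_pos
  obtain ⟨K, hK0, s, hs, hK⟩ := exists_lipschitz_nhds hW.lip hb.ne'
  obtain ⟨y₁, hby₁, hy₁lam, hKy⟩ : ∃ y₁, b < y₁ ∧ y₁ ≤ lam ∧ Icc b y₁ ⊆ s := by
    obtain ⟨ε, hε, hball⟩ := Metric.mem_nhds_iff.1 hs
    refine ⟨min (b + ε / 2) lam, lt_min (by linarith) hW.b_lt, min_le_right _ _, fun x hx =>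
      hball ?_⟩
    rw [Metric.mem_ball, Real.dist_eq, abs_of_nonneg (by linarith [hx.1])]
    linarith [hx.2, min_le_left (b + ε / 2) lam]
  set c₀ := wellCoeff n g B Fb * absPot g b with hc₀
  have hc₀pos : 0 < c₀ := mul_pos (hW.wellCoeff_pos hn) (hW.absPot_pos b hb le_rfl)
  have hFy₁ := hW.primF_pos hby₁ hy₁lam
  -- Below the rim there must be an ascending moment, since u tends to b; above it nothing is
  -- needed. These are the two admissible starting states of `Well.exists_crossing`.
  obtain ⟨R₁, hRR₁, hR₁u, hR₁E, hR₁v⟩ : ∃ R₁ ≥ R, w t₀ R₁ < y₁ ∧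
      nrg g (w t₀) (z t₀) R₁ < primF g y₁ ∧ (b < w t₀ R₁ ∨ (w t₀ R₁ < b ∧ 0 < z t₀ R₁)) := by
    obtain ⟨a, ha⟩ := eventually_atTop.1 ((hlim.eventually (gt_mem_nhds hby₁)).and
      ((hE.eventually (gt_mem_nhds hFy₁)).and (eventually_ge_atTop R)))
    obtain ⟨h1, h2, h3⟩ := ha a le_rfl
    rcases lt_or_gt_of_ne (hne a h3) with h4 | h4
    · obtain ⟨c, hc1, hc2⟩ := ((hlim.eventually (lt_mem_nhds h4)).and
        (eventually_gt_atTop a)).exists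
      obtain ⟨ξ, hξ, hξ'⟩ := (hB.sol t₀).exists_mvt hc2
      have h5 : 0 < z t₀ ξ := by
        by_contra! hcon
        have : z t₀ ξ * (c - a) ≤ 0 := mul_nonpos_of_nonpos_of_nonneg hcon (by linarith)
        linarith
      obtain ⟨h6, h7, h8⟩ := ha ξ hξ.1.le
      refine ⟨ξ, h8, h6, h7, Or.inr ⟨?_, h5⟩⟩
      by_contra! hcon
      obtain ⟨x, hx, hx'⟩ := intermediate_value_Icc hξ.1.le (hB.sol t₀).cu.continuousOn
        ⟨h4.le, hcon⟩
      exact hne x (h3.trans hx.1) hx'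
    · exact ⟨a, h3, h1, h2, Or.inl h4⟩
  have hR₁0 : 0 < R₁ := hR.trans_le hRR₁
  have hposR₁ := hpos R₁ hRR₁
  have hmem : R₁ ∈ Icc 0 R₁ := ⟨hR₁0.le, le_rfl⟩
  have htu : ∀ {x}, R₁ ≤ x → Tendsto (fun t => w t x) (𝓝 t₀) (𝓝 (w t₀ x)) := fun {x} hx =>
    Metric.tendsto_nhds.2 fun ε hε => (hB.near t₀ x (hpos x (hRR₁.trans hx)).ne' ε hε).mono
      fun _ h => (h x ⟨hR₁0.le.trans hx, le_rfl⟩).1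
  have htv : ∀ {x}, R₁ ≤ x → Tendsto (fun t => z t x) (𝓝 t₀) (𝓝 (z t₀ x)) := fun {x} hx =>
    Metric.tendsto_nhds.2 fun ε hε => (hB.near t₀ x (hpos x (hRR₁.trans hx)).ne' ε hε).mono
      fun _ h => (h x ⟨hR₁0.le.trans hx, le_rfl⟩).2
  have htE : ∀ {x}, R₁ ≤ x → Tendsto (fun t => nrg g (w t) (z t) x) (𝓝 t₀)
      (𝓝 (nrg g (w t₀) (z t₀) x)) := fun {x} hx =>
    (((htv hx).pow 2).div_const 2).add (((continuous_primF hW.cont).tendsto _).comp (htu hx))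
  -- The limit solution keeps a positive distance from b on compact time intervals, so the crossing
  -- times of its neighbours tend to infinity.
  have hfar : ∀ ρ ≥ R₁, ∀ᶠ t in 𝓝 t₀, ∀ x ∈ Icc R₁ ρ, w t x ≠ b := by
    intro ρ hρ
    obtain ⟨c, hc, hcmin⟩ := isCompact_Icc.exists_isMinOn (nonempty_Icc.2 hρ)
      (((hB.sol t₀).cu.sub continuous_const).abs.continuousOn (s := Icc R₁ ρ) (f := fun x =>
        |w t₀ x - b|))
    filter_upwards [hB.near t₀ ρ (hpos ρ (hRR₁.trans hρ)).ne' |w t₀ c - b|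
      (abs_pos.2 (sub_ne_zero.2 (hne c (hRR₁.trans hc.1))))] with t ht x hx hwx
    have h1 := (ht x ⟨hR₁0.le.trans hx.1, hx.2⟩).1
    have h2 : |w t₀ c - b| ≤ |w t₀ x - b| := hcmin hx
    rw [hwx, abs_sub_comm] at h1
    linarith
  set C := 4 * 2 ^ n * lam with hC
  set D := 2 * (2 + n + K) * C / c₀ with hD
  set ρ := max (8 * R₁) (max (32 * b ^ 2 / c₀) (max 4 (C ^ 2 / c₀))) with hρ
  have hρR : R₁ ≤ ρ := by linarith [le_max_left (8 * R₁) (max (32 * b ^ 2 / c₀) (max 4 (C ^ 2 / c₀)))]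
  have hev : ∀ᶠ t in 𝓝[>] t₀, ∃ r, Crossing b R₁ (w t) (z t) r ∧
      (b < w t (r / 2) ∧ w t (r / 2) ≤ y₁) ∧ R₁ ≤ r / 2 ∧
        g (w t (r / 2)) ≤ D * primF g (w t (r / 2)) := by
    filter_upwards [hz R₁ hRR₁, nhdsWithin_le_nhds (hfar ρ hρR),
      nhdsWithin_le_nhds ((htu le_rfl).eventually (gt_mem_nhds hR₁u)),
      nhdsWithin_le_nhds ((htu le_rfl).eventually (lt_mem_nhds hposR₁)),
      nhdsWithin_le_nhds ((htE le_rfl).eventually (gt_mem_nhds hR₁E)),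
      nhdsWithin_le_nhds (show ∀ᶠ t in 𝓝 t₀, b < w t R₁ ∨ (w t R₁ < b ∧ 0 < z t R₁) by
        rcases hR₁v with h | ⟨h, h'⟩
        · exact ((htu le_rfl).eventually (lt_mem_nhds h)).mono fun _ => Or.inl
        · exact (((htu le_rfl).eventually (gt_mem_nhds h)).and
            ((htv le_rfl).eventually (lt_mem_nhds h'))).mono fun _ => Or.inr)]
      with t h1 h2 h3 h4 h5 h6
    have hsol := hB.sol t
    have hFy : primF g y₁ ≤ primF g B := hW.primF_le y₁ (by
      rw [abs_of_pos (hb.trans hby₁)]; linarith [hW.lam_lt])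
    obtain ⟨r, hr, hrE⟩ := hW.exists_crossing hn hsol hR₁0 h4 h6 (by linarith) h1
    have hρr : ρ < r := by
      by_contra! hcon
      exact h2 r ⟨hr.1.le, hcon⟩ hr.2.1
    have h8R : 8 * R₁ ≤ r := (le_max_left _ _).trans hρr.le
    have hr1 : 32 * b ^ 2 / c₀ ≤ r :=
      ((le_max_left _ _).trans (le_max_right (8 * R₁) _)).trans hρr.le
    have hr2 : 4 ≤ r := (((le_max_left _ _).trans (le_max_right (32 * b ^ 2 / c₀) _)).trans
      (le_max_right (8 * R₁) _)).trans hρr.le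
    have hr3 : C ^ 2 / c₀ ≤ r := (((le_max_right _ _).trans (le_max_right (32 * b ^ 2 / c₀) _)).trans
      (le_max_right (8 * R₁) _)).trans hρr.le
    have hge := hW.ge_of_crossing hsol hR₁0 hr hc₀pos hrE h8R hr1
    have hlt := hsol.abs_lt_of_nrg_lt hW.cont hW.odd hR₁0.le (by rwa [abs_of_pos h4]) h5
    have hle : ∀ x ∈ Icc (r / 4) r, b ≤ w t x ∧ w t x ≤ y₁ := fun x hx =>
      ⟨hge x hx, (abs_lt.1 (hlt x (by linarith [hx.1]))).2.le⟩
    obtain ⟨h7, h8⟩ := hW.midpoint_of_crossing hsol hc₀pos hrE hr2 hy₁lam hle hK0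
      (fun x hx y hy => hK x (hKy hx) y (hKy hy)) hr3
    have h9 := hle (r / 2) ⟨by linarith, by linarith⟩
    refine ⟨r, hr, ⟨lt_of_le_of_ne h9.1 fun heq => ?_, h9.2⟩, by linarith, h8⟩
    rw [← heq, hW.primF_b] at h7
    exact lt_irrefl _ h7
  obtain ⟨t₁, ht₁, hev'⟩ := mem_nhdsGT_iff_exists_Ioo_subset.1 hev
  have ht₁' : t₀ < t₁ := ht₁
  have hprop : ∀ t ∈ Ioo t₀ t₁, _ := fun t ht => hev' ht
  choose! τ hτ using hprop
  -- The height at half the crossing time is continuous in t, because the crossing is unique and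
  -- depends continuously on t.
  set Y : ℝ → ℝ := fun t => w t (τ t / 2) with hY
  have hYc : ContinuousOn Y (Ioo t₀ t₁) := by
    intro t ht
    obtain ⟨hcr, -, hτR, -⟩ := hτ t ht
    refine ContinuousAt.continuousWithinAt ?_
    rw [Metric.continuousAt_iff']
    intro ε hε
    have hτ0 : 0 < τ t := by linarith
    have hcont : ∀ᶠ x in 𝓝 (τ t / 2), |w t x - w t (τ t / 2)| < ε / 2 :=
      Metric.tendsto_nhds.1 (hB.sol t).cu.continuousAt (ε / 2) (by positivity)
    obtain ⟨δ, hδ, hball⟩ := Metric.eventually_nhds_iff_ball.1 hcont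
    filter_upwards [eventually_crossing hB hR₁0 hb hcr (show 0 < min δ (τ t) by positivity),
      hB.near t (τ t) (by rw [hcr.2.1]; exact hb.ne') (ε / 2) (by positivity),
      Ioo_mem_nhds ht.1 ht.2] with t' h1 h2 ht'
    obtain ⟨r', hr', hcr'⟩ := h1
    have heq := hW.crossing_unique (hB.sol t') hR₁0 hcr' (hτ t' ht').1
    rw [heq] at hr'
    have h3 : |τ t' / 2 - τ t / 2| < δ := by
      rw [← sub_div, abs_div, abs_two]
      linarith [min_le_left δ (τ t), abs_nonneg (τ t' - τ t)]
    have h4 := (abs_lt.1 (hr'.trans_le (min_le_right δ (τ t))))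
    have h5 := hball _ (show τ t' / 2 ∈ Metric.ball (τ t / 2) δ by
      rw [Metric.mem_ball, Real.dist_eq]; exact h3)
    have h6 := (h2 (τ t' / 2) ⟨by linarith [h4.1], by linarith [h4.2]⟩).1
    rw [Real.dist_eq]
    calc |Y t' - Y t| ≤ |w t' (τ t' / 2) - w t (τ t' / 2)| +
          |w t (τ t' / 2) - w t (τ t / 2)| := abs_sub_le _ _ _
      _ < ε := by linarith
  -- As t decreases to t₀ the energy at half the crossing time becomes arbitrarily small, so Y comes
  -- arbitrarily close to b. By connectedness Y takes all values between b and Y s₀.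
  have hYlim : ∀ y, b < y → y ≤ lam → ∃ t ∈ Ioo t₀ t₁, Y t < y := by
    intro y hy hylam
    obtain ⟨R₂, hR₂, hR₂'⟩ := ((hE.eventually (gt_mem_nhds (hW.primF_pos hy hylam))).and
      (eventually_ge_atTop R₁)).exists
    have hR₂0 : 0 < R₂ := hR₁0.trans_le hR₂'
    obtain ⟨t, ⟨h1, h2⟩, ht⟩ := ((((hfar (2 * R₂) (by linarith)).and
      ((htE hR₂').eventually (gt_mem_nhds hR₂))).filter_mono
      (nhdsWithin_le_nhds (s := Ioi t₀))).and (Ioo_mem_nhdsGT ht₁')).exists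
    obtain ⟨hcr, hYt, -, -⟩ := hτ t ht
    refine ⟨t, ht, ?_⟩
    have h3 : 2 * R₂ < τ t := by
      by_contra! hcon
      exact h1 _ ⟨hcr.1.le, hcon⟩ hcr.2.1
    have h4 := (hB.sol t).nrg_le hW.cont hR₂0.le (show R₂ ≤ τ t / 2 by linarith)
    have h5 := primF_le_nrg g (w t) (z t) (τ t / 2)
    by_contra! hcon
    have h6 := hW.primF_strictMonoOn.monotoneOn ⟨hy.le, hylam⟩
      ⟨hYt.1.le, hYt.2.trans hy₁lam⟩ hcon
    linarith
  obtain ⟨s₀, hs₀⟩ := nonempty_Ioo.2 ht₁'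
  have hYs := hτ s₀ hs₀
  have himage : (Y '' Ioo t₀ t₁).OrdConnected :=
    (isPreconnected_Ioo.image Y hYc).ordConnected
  have hineq : ∀ y ∈ Ioo b (Y s₀), g y ≤ D * primF g y := by
    intro y hy
    obtain ⟨t, ht, hty⟩ := hYlim y hy.1 (hy.2.le.trans (hYs.2.1.2.trans hy₁lam))
    obtain ⟨t', ht', hyt'⟩ := himage.out ⟨t, ht, rfl⟩ ⟨s₀, hs₀, rfl⟩ ⟨hty.le, hy.2.le⟩
    have := (hτ t' ht').2.2.2
    change g (Y t') ≤ D * primF g (Y t') at this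
    rwa [hyt'] at this
  -- Gronwall: F' = g ≤ D F and F(b) = 0 give F ≤ 0 just above b, contradicting F > 0 there.
  have hanti : AntitoneOn (fun y => primF g y * Real.exp (-D * y)) (Icc b (Y s₀)) := by
    apply antitoneOn_of_hasDerivWithinAt_nonpos (convex_Icc _ _)
      (f' := fun y => g y * Real.exp (-D * y) + primF g y * (Real.exp (-D * y) * (-D)))
    · have := continuous_primF hW.cont
      fun_prop
    · intro y hy
      have h1 : HasDerivAt (fun y : ℝ => -D * y) (-D) y := by
        simpa using (hasDerivAt_id y).const_mul (-D)
      exact ((hasDerivAt_primF hW.cont y).mul h1.exp).hasDerivWithinAt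
    · intro y hy
      rw [interior_Icc] at hy
      have h1 := hineq y hy
      have h2 := Real.exp_pos (-D * y)
      nlinarith
  have hfin := hanti ⟨le_rfl, hYs.2.1.1.le⟩ ⟨hYs.2.1.1.le, le_rfl⟩ hYs.2.1.1.le
  simp only [hW.primF_b, zero_mul] at hfin
  have h1 := hW.primF_pos hYs.2.1.1 (hYs.2.1.2.trans hy₁lam)
  have h2 : 0 < primF g (Y s₀) * Real.exp (-D * Y s₀) := mul_pos h1 (Real.exp_pos _)
  linarith

end Branch

/-! ### Shooting along a path -/

/-- The shooting argument along a path, in abstract form. -/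
theorem exists_of_path {N : ℕ → ℝ → Prop} {S A : ℝ → Prop} {K : ℕ} (hN0 : ∀ t, N 0 t)
    (hmono : ∀ {j k t}, j ≤ k → N k t → N j t)
    (hopen : ∀ k t, N k t → ∀ᶠ t' in 𝓝 t, N k t')
    (hA : ∀ t ∈ Ioo (0 : ℝ) 1, ∀ k, ¬ N (k + 1) t → ¬ S t → ∀ᶠ t' in 𝓝 t, ¬ S t')
    (hmain : ∀ t ∈ Ioo (0 : ℝ) 1, ∀ k, ¬ N (k + 1) t → ¬ S t →
      (∀ᶠ t' in 𝓝[>] t, N (k + 1) t') → A t ∧ ∀ᶠ t' in 𝓝 t, ¬ N (k + 2) t')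
    (hS : ∀ t ∈ Ioc (0 : ℝ) 1, ∀ k m, S t → ¬ N (k + 1) t →
      ∀ᶠ t' in 𝓝[<] t, ¬ (S t' ∧ ¬ N (k + 1) t') → N m t')
    (h0 : ∀ᶠ t in 𝓝[>] (0 : ℝ), ¬ N 1 t ∧ ¬ S t)
    (h1 : (∀ᶠ t in 𝓝[<] (1 : ℝ), N (K + 1) t) ∨ (S 1 ∧ ¬ N 1 1)) :
    ∀ k ≤ K, ∃ t ∈ Ioo (0 : ℝ) 1, A t ∧ N k t ∧ ¬ N (k + 1) t := by
  have step : ∀ k ≤ K, ∀ a b : ℝ, 0 ≤ a → a < b → b ≤ 1 → (∀ t ∈ Ioo a b, N k t) →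
      (∀ᶠ t in 𝓝[>] a, ¬ N (k + 1) t ∧ ¬ S t) →
      ((∀ᶠ t in 𝓝[<] b, N (K + 1) t) ∨ (S b ∧ ¬ N (k + 1) b)) →
      ∃ τ b', a < τ ∧ τ < b' ∧ b' ≤ b ∧ A τ ∧ ¬ N (k + 1) τ ∧ (∀ t ∈ Ioo τ b', N (k + 1) t) ∧
        (∀ᶠ t in 𝓝[>] τ, ¬ N (k + 2) t ∧ ¬ S t) ∧
        ((∀ᶠ t in 𝓝[<] b', N (K + 1) t) ∨ (S b' ∧ ¬ N (k + 2) b')) := by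
    intro k hk a b ha hab hb hNk hleft hright
    obtain ⟨a₁, ha₁, hleft'⟩ := mem_nhdsGT_iff_exists_Ioo_subset.1 hleft
    have haa₁ : a < a₁ := ha₁
    have hleft'' : ∀ t ∈ Ioo a a₁, ¬ N (k + 1) t ∧ ¬ S t := fun t ht => hleft' ht
    -- The interval is cut at the first stuck parameter with at most k sign changes, if there is
    -- one. Just before it no such parameter exists, so `hS` gives N (k + 1) on the left of the cut.
    set Z := {t | t ∈ Ioc a b ∧ S t ∧ ¬ N (k + 1) t} with hZ
    obtain ⟨b', hab', hb', hZb', hNb', hb''⟩ : ∃ b', a < b' ∧ b' ≤ b ∧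
        (∀ t ∈ Ioo a b', ¬ (S t ∧ ¬ N (k + 1) t)) ∧ (∀ᶠ t in 𝓝[<] b', N (k + 1) t) ∧
        ((∀ᶠ t in 𝓝[<] b', N (K + 1) t) ∨ (S b' ∧ ¬ N (k + 1) b')) := by
      rcases Z.eq_empty_or_nonempty with hZe | hZne
      · have hZt : ∀ t ∈ Ioc a b, ¬ (S t ∧ ¬ N (k + 1) t) := fun t ht h => by
          have : t ∈ Z := ⟨ht, h⟩
          rw [hZe] at this
          exact this
        have h2 := hright.resolve_right (hZt b ⟨hab, le_rfl⟩)
        exact ⟨b, hab, le_rfl, fun t ht => hZt t ⟨ht.1, ht.2.le⟩,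
          h2.mono fun t ht => hmono (by omega) ht, Or.inl h2⟩
      · have hbdd : BddBelow Z := ⟨a, fun t ht => ht.1.1.le⟩
        set b' := sInf Z with hb'
        have hab' : a < b' := haa₁.trans_le (le_csInf hZne fun t ht => by
          by_contra! hcon
          exact (hleft'' t ⟨ht.1.1, hcon⟩).2 ht.2.1)
        have hb'b : b' ≤ b := (csInf_le hbdd hZne.some_mem).trans hZne.some_mem.1.2
        have hlt : ∀ t ∈ Ioo a b', ¬ (S t ∧ ¬ N (k + 1) t) := fun t ht h =>
          absurd (csInf_le hbdd (show t ∈ Z from ⟨⟨ht.1, ht.2.le.trans hb'b⟩, h⟩)) (not_le.2 ht.2)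
        have hfreq : ∃ᶠ t in 𝓝 b', t ∈ Z := by
          have := csInf_mem_closure hZne hbdd
          rwa [mem_closure_iff_frequently] at this
        have hNb : ¬ N (k + 1) b' := fun h =>
          hfreq ((hopen _ _ h).mono fun t ht h' => h'.2.2 ht)
        have hSb : S b' := by
          by_contra h
          have hb'1 : b' < 1 := by
            refine lt_of_le_of_ne (hb'b.trans hb) fun heq => ?_
            obtain ⟨t, ht⟩ := hZne
            have h2 := csInf_le hbdd ht
            have h3 : t = b' := le_antisymm ((ht.1.2.trans hb).trans heq.ge) h2
            exact h (h3 ▸ ht.2.1)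
          exact hfreq ((hA b' ⟨ha.trans_lt hab', hb'1⟩ k hNb h).mono fun t ht h' => ht h'.2.1)
        refine ⟨b', hab', hb'b, hlt, ?_, Or.inr ⟨hSb, hNb⟩⟩
        filter_upwards [hS b' ⟨ha.trans_lt hab', hb'b.trans hb⟩ k (k + 1) hSb hNb,
          Ioo_mem_nhdsLT hab'] with t ht ht'
        exact ht (hlt t ht')
    -- The last parameter τ with at most k sign changes exists because the set is nonempty near a
    -- and avoids a left neighbourhood of b'; openness of N puts τ into it. It is not stuck, so
    -- `hmain` applies and (τ, b') is the interval for k + 1.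
    set P := {t | t ∈ Ioo a b' ∧ ¬ N (k + 1) t} with hP
    obtain ⟨p, hp⟩ : P.Nonempty := by
      have h2 : a < min a₁ b' := lt_min haa₁ hab'
      refine ⟨(a + min a₁ b') / 2, ⟨by linarith, ?_⟩, (hleft'' _ ⟨by linarith, ?_⟩).1⟩
      · linarith [min_le_right a₁ b']
      · linarith [min_le_left a₁ b']
    have hPb : BddAbove P := ⟨b', fun t ht => ht.1.2.le⟩
    set τ := sSup P with hτ
    have haτ : a < τ := hp.1.1.trans_le (le_csSup hPb hp)
    obtain ⟨b₁, hb₁, hNb₁⟩ := mem_nhdsLT_iff_exists_Ioo_subset.1 hNb'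
    have hb₁' : b₁ < b' := hb₁
    have hτb : τ < b' := (csSup_le ⟨p, hp⟩ fun t ht => by
      by_contra! hcon
      exact ht.2 (hNb₁ ⟨hcon, ht.1.2⟩)).trans_lt hb₁'
    have hNτ : ¬ N (k + 1) τ := fun h => by
      have := csSup_mem_closure ⟨p, hp⟩ hPb
      rw [mem_closure_iff_frequently] at this
      exact this ((hopen _ _ h).mono fun t ht h' => h'.2 ht)
    have hNright : ∀ t ∈ Ioo τ b', N (k + 1) t := fun t ht => by
      by_contra hcon
      exact absurd (le_csSup hPb (show t ∈ P from ⟨⟨haτ.trans ht.1, ht.2⟩, hcon⟩)) (not_le.2 ht.1)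
    have hSτ : ¬ S τ := fun h => hZb' τ ⟨haτ, hτb⟩ ⟨h, hNτ⟩
    have hτmem : τ ∈ Ioo (0 : ℝ) 1 := ⟨ha.trans_lt haτ, hτb.trans_le (hb'.trans hb)⟩
    obtain ⟨hAτ, hN2⟩ := hmain τ hτmem k hNτ hSτ
      (by filter_upwards [Ioo_mem_nhdsGT hτb] with t ht using hNright t ht)
    exact ⟨τ, b', haτ, hτb, hb', hAτ, hNτ, hNright,
      (hN2.and (hA τ hτmem k hNτ hSτ)).filter_mono nhdsWithin_le_nhds,
      hb''.imp_right fun h => ⟨h.1, fun h' => h.2 (hmono (Nat.le_succ _) h')⟩⟩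
  have hind : ∀ k ≤ K, ∃ a b : ℝ, 0 ≤ a ∧ a < b ∧ b ≤ 1 ∧ (∀ t ∈ Ioo a b, N k t) ∧
      (∀ᶠ t in 𝓝[>] a, ¬ N (k + 1) t ∧ ¬ S t) ∧
      ((∀ᶠ t in 𝓝[<] b, N (K + 1) t) ∨ (S b ∧ ¬ N (k + 1) b)) := by
    intro k
    induction k with
    | zero => exact fun _ => ⟨0, 1, le_rfl, one_pos, le_rfl, fun t _ => hN0 t, h0, h1⟩
    | succ k ih =>
      intro hk
      obtain ⟨a, b, ha, hab, hb, h2, h3, h4⟩ := ih (by omega)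
      obtain ⟨τ, b', h5, h6, h7, -, -, h8, h9, h10⟩ := step k (by omega) a b ha hab hb h2 h3 h4
      exact ⟨τ, b', ha.trans h5.le, h6, h7.trans hb, h8, h9, h10⟩
  intro k hk
  obtain ⟨a, b, ha, hab, hb, h2, h3, h4⟩ := hind k hk
  obtain ⟨τ, b', h5, h6, h7, h8, h9, -⟩ := step k hk a b ha hab hb h2 h3 h4
  exact ⟨τ, ⟨ha.trans_lt h5, h6.trans_le (h7.trans hb)⟩, h8, h2 τ ⟨h5, h6.trans_le h7⟩, h9⟩

namespace Family

variable {n : ℕ} {g : ℝ → ℝ} {U V : ℝ → ℝ → ℝ} {b lam B Fb : ℝ}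

theorem branch (hF : Family n g U V) {p : ℝ → ℝ} (hp : Continuous p) :
    Branch n g (fun t => U (p t)) (fun t => V (p t)) :=
  ⟨fun t => hF.sol (p t), fun t T hT ε hε => hp.continuousAt.eventually (hF.near (p t) T hT ε hε)⟩

/-- Neighbours with more sign changes than the rimming solution must change sign after any given R',
since up to R' the count cannot grow. After a reflection, this is what `Branch.rim_isolated`
forbids. -/
theorem not_eventually_of_rimming (hF : Family n g U V) (hW : Well g b lam B Fb) (hn : 1 ≤ n)
    {p : ℝ → ℝ} (hp : Continuous p) {t₀ : ℝ} (hp0 : p t₀ ≠ 0) {k : ℕ}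
    (hk : ¬ HasSignChangesAtLeast (U (p t₀)) k) (hrim : Rimming g b (U (p t₀)) (V (p t₀))) :
    ¬ ∀ᶠ t in 𝓝[>] t₀, HasSignChangesAtLeast (U (p t)) k := by
  intro hev
  obtain ⟨R, hR, hne, hlim, hE⟩ := hrim
  have hneR : ∀ r ≥ R, U (p t₀) r ≠ 0 := fun r hr hz => by simpa [hz] using (hne r hr).2
  have key : ∀ R' ≥ R, ∀ᶠ t in 𝓝[>] t₀, ∃ x ≥ R', U (p t) x * U (p t₀) R < 0 := by
    intro R' hR'
    have hR'0 : 0 < R' := hR.trans_le hR'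
    have h1 := (hp.continuousAt (x := t₀)).eventually
      (hF.eventually_signChangesOn_imp hp0 hR'0 (hneR R' hR'))
    have h2 : ∀ᶠ t in 𝓝 t₀, 0 < U (p t) R' * U (p t₀) R :=
      (hp.continuousAt (x := t₀)).eventually
        (((hF.tendsto_u (hneR R' hR') ⟨hR'0.le, le_rfl⟩).mul_const (U (p t₀) R)).eventually
          (lt_mem_nhds (hne R' hR').2))
    filter_upwards [nhdsWithin_le_nhds h1, nhdsWithin_le_nhds h2, hev] with t h3 h4 h5
    by_contra! hcon
    obtain ⟨T, hT⟩ := hasSignChangesAtLeast_iff.1 h5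
    refine hk (hasSignChangesAtLeast_iff.2 ⟨R', h3 k (hT.of_tail hR'0 ?_ fun r hr _ => ?_)⟩)
    · rintro hz
      simp [hz] at h4
    · have h6 := hcon r hr
      have h7 := mul_nonneg h6 h4.le
      have h8 : 0 < U (p t₀) R * U (p t₀) R := mul_self_pos.2 (hneR R le_rfl)
      by_contra! hcon'
      nlinarith [mul_neg_of_neg_of_pos hcon' h8]
  rcases lt_or_gt_of_ne (hneR R le_rfl) with hs | hs
  · have hneg : ∀ r ≥ R, U (p t₀) r < 0 := fun r hr => neg_of_mul_pos_left (hne r hr).2 hs.le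
    refine ((hF.branch hp).neg hW.odd).rim_isolated hW hn hR (t₀ := t₀) (fun r hr => ?_)
      (fun r hr => by linarith [hneg r hr]) ?_ ?_ fun R' hR' => ?_
    · rw [← abs_of_neg (hneg r hr)]; exact (hne r hr).1
    · refine hlim.congr' ?_
      filter_upwards [eventually_ge_atTop R] with r hr using abs_of_neg (hneg r hr)
    · exact hE.congr fun r => (nrg_neg hW.odd _ _ r).symm
    · filter_upwards [key R' hR'] with t ht
      obtain ⟨x, hx, hx'⟩ := ht
      refine ⟨x, hx, ?_⟩
      have : 0 < U (p t) x := by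
        by_contra! hcon
        linarith [mul_nonneg_of_nonpos_of_nonpos hcon hs.le]
      linarith
  · have hpos : ∀ r ≥ R, 0 < U (p t₀) r := fun r hr => pos_of_mul_pos_left (hne r hr).2 hs.le
    refine (hF.branch hp).rim_isolated hW hn hR (t₀ := t₀) (fun r hr => ?_) hpos ?_ hE
      fun R' hR' => ?_
    · rw [← abs_of_pos (hpos r hr)]; exact (hne r hr).1
    · refine hlim.congr' ?_
      filter_upwards [eventually_ge_atTop R] with r hr using abs_of_pos (hpos r hr)
    · filter_upwards [key R' hR'] with t ht
      obtain ⟨x, hx, hx'⟩ := ht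
      refine ⟨x, hx, ?_⟩
      by_contra! hcon
      linarith [mul_nonneg hcon hs.le]

/-- Between a height whose solution stays in the well and a height whose solution is stuck or
oscillates a lot there are bound states with any prescribed number of sign changes. -/
theorem exists_bound_states (hF : Family n g U V) (hW : Well g b lam B Fb) (hn : 1 ≤ n) {K : ℕ}
    {p : ℝ → ℝ} (hp : Continuous p) (hpl : ∀ t ∈ Icc (0 : ℝ) 1, lam < p t ∧ p t ≤ B)
    (hB : ∀ t ∈ Ioo (0 : ℝ) 1, ∀ r ≥ 0, |U (p t) r| ≤ B)
    (h0 : ∀ᶠ α in 𝓝 (p 0), ¬ HasSignChangesAtLeast (U α) 1 ∧ ¬ Stuck lam (U α))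
    (h1 : (∀ᶠ α in 𝓝 (p 1), HasSignChangesAtLeast (U α) (K + 1)) ∨
      (Stuck lam (U (p 1)) ∧ ¬ HasSignChangesAtLeast (U (p 1)) 1)) :
    ∀ k ≤ K, ∃ t ∈ Ioo (0 : ℝ) 1, Tendsto (U (p t)) atTop (𝓝 0) ∧
      HasExactlySignChanges (U (p t)) k := by
  have hpt : ∀ t, Tendsto p (𝓝 t) (𝓝 (p t)) := fun t => hp.tendsto t
  have hpos : ∀ t ∈ Icc (0 : ℝ) 1, p t ≠ 0 := fun t ht => (hW.lam_pos.trans (hpl t ht).1).ne'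
  have habs : ∀ t ∈ Icc (0 : ℝ) 1, |p t| ≤ B := fun t ht => by
    rw [abs_of_pos (hW.lam_pos.trans (hpl t ht).1)]; exact (hpl t ht).2
  refine exists_of_path (N := fun k t => HasSignChangesAtLeast (U (p t)) k)
    (S := fun t => Stuck lam (U (p t))) (A := fun t => Tendsto (U (p t)) atTop (𝓝 0))
    (fun t => hasSignChangesAtLeast_zero _) (fun h1 h2 => h2.mono h1)
    (fun k t h => (hpt t).eventually (hF.eventually_hasSignChangesAtLeast h))
    (fun t ht k hk hS => (hpt t).eventually (hF.eventually_not_stuck_of_not hW hn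
      (hpl t ⟨ht.1.le, ht.2.le⟩).1 (hpl t ⟨ht.1.le, ht.2.le⟩).2 hk hS)) ?_ ?_
    ((hpt 0).eventually h0 |>.filter_mono nhdsWithin_le_nhds)
    (h1.imp_left fun h => (hpt 1).eventually h |>.filter_mono nhdsWithin_le_nhds)
  · intro t ht k hk hS hev
    have ht' : t ∈ Icc (0 : ℝ) 1 := ⟨ht.1.le, ht.2.le⟩
    -- The count increases immediately to the right of t, so it cannot be locally bounded by k; this
    -- eliminates the trapped and settling cases.
    have hcontra : ¬ ∀ᶠ α in 𝓝 (p t), ¬ HasSignChangesAtLeast (U α) (k + 1) := fun h => by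
      obtain ⟨t', h1, h2⟩ := ((((hpt t).eventually h).filter_mono
        (nhdsWithin_le_nhds (s := Ioi t))).and hev).exists
      exact h1 h2
    have htrap : ¬ Trapped g b (U (p t)) (V (p t)) := fun h =>
      hcontra (hF.eventually_not_of_trapped hW (hpos t ht') h hk)
    rcases hW.alternatives hn (hF.sol (p t)) (hF.canon (p t))
      (by rw [hF.init, abs_of_pos (hW.lam_pos.trans (hpl t ht').1)]
          exact hW.b_lt.trans (hpl t ht').1) hk htrap hS (hW.wellCoeff_pos hn) with h | h | h
    · exact ⟨h.1, (hpt t).eventually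
        ((hF.eventually_of_vanishing hW hn (hpos t ht') (habs t ht') h).2 _ hk)⟩
    · exact absurd ((hF.eventually_of_settling hW hn (hpos t ht') (habs t ht') h).2 _ hk) hcontra
    · exact absurd hev (hF.not_eventually_of_rimming hW hn hp (hpos t ht') hk h)
  · intro t ht k m hS hk
    filter_upwards [((hpt t).eventually (hF.eventually_of_stuck hW hn (hpos t ⟨ht.1.le, ht.2⟩) hk
      hS m)).filter_mono nhdsWithin_le_nhds, Ioo_mem_nhdsLT ht.1] with t' h2 h3
    exact h2 (hB t' ⟨h3.1, h3.2.trans_le ht.2⟩)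

end Family

/-! ### Truncation of the nonlinearity -/

/-- The projection of `ℝ` onto `[-B, B]`. -/
def clamp (B s : ℝ) : ℝ := max (-B) (min B s)

theorem clamp_mem {B : ℝ} (hB : 0 ≤ B) (s : ℝ) : clamp B s ∈ Icc (-B) B :=
  ⟨le_max_left _ _, max_le (by linarith) (min_le_left _ _)⟩

theorem clamp_of_mem {B s : ℝ} (h : |s| ≤ B) : clamp B s = s := by
  obtain ⟨h1, h2⟩ := abs_le.1 h
  rw [clamp, min_eq_right h2, max_eq_right h1]

theorem clamp_neg {B : ℝ} (hB : 0 ≤ B) (s : ℝ) : clamp B (-s) = -clamp B s := by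
  unfold clamp
  rcases le_total s B with h1 | h1 <;> rcases le_total (-B) s with h2 | h2 <;>
    simp only [min_def, max_def] <;> split_ifs <;> linarith

theorem lipschitzWith_clamp (B : ℝ) : LipschitzWith 1 (clamp B) :=
  (LipschitzWith.id.const_min B).const_max (-B)

theorem clamp_ne_zero {B s : ℝ} (hB : 0 < B) (hs : s ≠ 0) : clamp B s ≠ 0 := by
  unfold clamp
  rcases lt_or_gt_of_ne hs with h | h
  · exact (max_lt (by linarith) ((min_le_right _ _).trans_lt h)).ne
  · exact ((lt_min hB h).trans_le (le_max_right _ _)).ne'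

/-- `f` frozen outside `[-B, B]`. -/
def truncation (f : ℝ → ℝ) (B s : ℝ) : ℝ := f (clamp B s)

section Truncation

variable {f : ℝ → ℝ} {B : ℝ}

theorem truncation_of_mem {s : ℝ} (h : |s| ≤ B) : truncation f B s = f s := by
  rw [truncation, clamp_of_mem h]

theorem continuous_truncation (hB : 0 ≤ B) (hf : ContinuousOn f (Icc (-B) B)) :
    Continuous (truncation f B) :=
  hf.comp_continuous (lipschitzWith_clamp B).continuous fun s => clamp_mem hB s

theorem truncation_neg (hB : 0 ≤ B) (hodd : ∀ s ∈ Icc (-B) B, f (-s) = -f s) (s : ℝ) :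
    truncation f B (-s) = -truncation f B s := by
  rw [truncation, clamp_neg hB, hodd _ (clamp_mem hB s), truncation]

theorem exists_truncation_bound (hB : 0 ≤ B) (hf : ContinuousOn f (Icc (-B) B)) :
    ∃ G, ∀ s, |truncation f B s| ≤ G := by
  obtain ⟨G, hG⟩ := isCompact_Icc.exists_bound_of_continuousOn hf
  exact ⟨G, fun s => hG _ (clamp_mem hB s)⟩

theorem locallyLipschitzOn_truncation (hB : 0 < B) (hf : LocallyLipschitzOn (Icc (-B) B \ {0}) f) :
    LocallyLipschitzOn {0}ᶜ (truncation f B) := by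
  have hmaps : MapsTo (clamp B) {0}ᶜ (Icc (-B) B \ {0}) := fun s hs =>
    ⟨clamp_mem hB.le s, clamp_ne_zero hB hs⟩
  intro x hx
  obtain ⟨K, t, ht, hK⟩ := hf (hmaps hx)
  refine ⟨K * 1, clamp B ⁻¹' t ∩ {0}ᶜ, ?_, ?_⟩
  · exact inter_mem (((lipschitzWith_clamp B).continuous.continuousWithinAt.tendsto_nhdsWithin
      hmaps) ht) self_mem_nhdsWithin
  · exact hK.comp (lipschitzWith_clamp B).lipschitzOnWith fun s hs => hs.1

theorem primF_truncation {s : ℝ} (h : |s| ≤ B) : primF (truncation f B) s = primF f s := by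
  refine intervalIntegral.integral_congr fun t ht => truncation_of_mem ?_
  have := abs_sub_left_of_mem_uIcc ht
  simp only [sub_zero] at this
  exact this.trans h

end Truncation

/-! ### The shape of the potential -/

/-- Between a point where `F` is smaller and the next local maximum, `F` increases. -/
theorem pos_of_no_localMax {g : ℝ → ℝ} (hg : Continuous g) {a c : ℝ}
    (ha : ∀ s, a < s → s < c → primF g a < primF g s)
    (hmax : ∀ s, a < s → s < c → ¬ IsLocalMax (primF g) s)
    (hsign : ∀ s, a < s → s < c → g s = 0 → ChangesSignAt g s) :
    ∀ s, a < s → s < c → 0 < g s := by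
  have hd := hasDerivAt_primF hg
  have hnz : ∀ z, a < z → z < c → g z ≠ 0 := by
    intro z haz hzc hz
    -- A zero of g with change from + to - is a local maximum of F, which is excluded. The other
    -- change puts a larger value of F just before z, and since F exceeds F(a) inside, the maximum
    -- over [a, z] is again an interior local maximum.
    have hkey : ∃ y, a < y ∧ y < z ∧ primF g z < primF g y := by
      rcases hsign z haz hzc hz with ⟨h1, -⟩ | ⟨h1, h2⟩
      · obtain ⟨l, hl, hl'⟩ := mem_nhdsLT_iff_exists_Ioo_subset.1 h1
        have hl0 : l < z := hl
        have hm : max a l < z := max_lt haz hl0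
        refine ⟨(max a l + z) / 2, by linarith [le_max_left a l], by linarith, ?_⟩
        refine strictAntiOn_of_deriv_neg (convex_Icc ((max a l + z) / 2) z)
          (continuous_primF hg).continuousOn (fun x hx => ?_) ⟨le_rfl, by linarith⟩
          ⟨by linarith, le_rfl⟩ (by linarith)
        rw [interior_Icc] at hx
        rw [(hd x).deriv]
        exact hl' ⟨by linarith [hx.1, le_max_right a l], hx.2⟩
      · exfalso
        refine hmax z haz hzc ?_
        obtain ⟨l, hl, hl'⟩ := mem_nhdsLT_iff_exists_Ioo_subset.1 h1
        obtain ⟨r, hr, hr'⟩ := mem_nhdsGT_iff_exists_Ioo_subset.1 h2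
        have hl0 : l < z := hl
        have hr0 : z < r := hr
        filter_upwards [Ioo_mem_nhds hl0 hr0] with x hx
        rcases le_total x z with hxz | hxz
        · refine monotoneOn_of_deriv_nonneg (convex_Icc x z) (continuous_primF hg).continuousOn
            (fun y _ => (hd y).differentiableAt.differentiableWithinAt) (fun y hy => ?_)
            ⟨le_rfl, hxz⟩ ⟨hxz, le_rfl⟩ hxz
          rw [interior_Icc] at hy
          rw [(hd y).deriv]
          exact le_of_lt (hl' ⟨hx.1.trans hy.1, hy.2⟩)
        · refine antitoneOn_of_deriv_nonpos (convex_Icc z x) (continuous_primF hg).continuousOn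
            (fun y _ => (hd y).differentiableAt.differentiableWithinAt) (fun y hy => ?_)
            ⟨le_rfl, hxz⟩ ⟨hxz, le_rfl⟩ hxz
          rw [interior_Icc] at hy
          rw [(hd y).deriv]
          exact le_of_lt (hr' ⟨hy.1, hy.2.trans hx.2⟩)
    obtain ⟨y, hay, hyz, hFy⟩ := hkey
    obtain ⟨m, hm, hmm⟩ := isCompact_Icc.exists_isMaxOn (nonempty_Icc.2 haz.le)
      (continuous_primF hg).continuousOn (f := primF g)
    have h1 : primF g y ≤ primF g m := hmm ⟨hay.le, hyz.le⟩
    have h2 : m ≠ z := fun h => by rw [h] at h1; linarith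
    have h3 : m ≠ a := fun h => by rw [h] at h1; linarith [ha y hay (hyz.trans hzc)]
    have h4 : a < m := lt_of_le_of_ne hm.1 h3.symm
    have h5 : m < z := lt_of_le_of_ne hm.2 h2
    exact hmax m h4 (h5.trans hzc) (hmm.isLocalMax (Icc_mem_nhds h4 h5))
  intro s has hsc
  by_contra! hs
  have hs' : g s < 0 := lt_of_le_of_ne hs (hnz s has hsc)
  obtain ⟨ξ, hξ, hξ'⟩ := exists_hasDerivAt_eq_slope (primF g) g has
    (continuous_primF hg).continuousOn fun x _ => hd x
  have hgξ : 0 < g ξ := by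
    rw [hξ']
    exact div_pos (by linarith [ha s has hsc]) (by linarith)
  obtain ⟨x, hx, hx'⟩ := intermediate_value_Icc' hξ.2.le hg.continuousOn
    (show (0 : ℝ) ∈ Icc (g s) (g ξ) from ⟨hs'.le, hgξ.le⟩)
  exact hnz x (hξ.1.trans_le hx.1) (hx.2.trans_lt hsc) hx'

/-- A potential without local maxima above the level `m` stays below `m` between points where it
does. -/
theorem primF_le_of_no_localMax {g : ℝ → ℝ} (hg : Continuous g) {a c m : ℝ}
    (ha : primF g a ≤ m) (hc : primF g c ≤ m)
    (hmax : ∀ s, a < s → s < c → IsLocalMax (primF g) s → primF g s ≤ m) :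
    ∀ s ∈ Icc a c, primF g s ≤ m := by
  intro s hs
  obtain ⟨x, hx, hxx⟩ := isCompact_Icc.exists_isMaxOn ⟨s, hs⟩
    (continuous_primF hg).continuousOn (f := primF g)
  refine (hxx hs).trans ?_
  rcases eq_or_lt_of_le hx.1 with h1 | h1
  · rwa [← h1]
  rcases eq_or_lt_of_le hx.2 with h2 | h2
  · rwa [h2]
  exact hmax x h1 h2 (hxx.isLocalMax (Icc_mem_nhds h1 h2))

/-- The shape of the potential of a nonlinearity on `[-B, B]`: its first hump is at `c`, its last
zero before `c` is `b`, and beyond `x` it exceeds all its local maxima. -/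
structure Landscape (g : ℝ → ℝ) (δ b c x B : ℝ) : Prop where
  cont : Continuous g
  odd : ∀ s, g (-s) = -g s
  lip : LocallyLipschitzOn {0}ᶜ g
  bdd : ∃ G, ∀ s, |g s| ≤ G
  delta_pos : 0 < δ
  primF_neg : ∀ s, 0 < s → s < δ → primF g s < 0
  finite_zeros : {s | δ < s ∧ s < B ∧ g s = 0}.Finite
  sign_change : ∀ s, δ < s → s < B → g s = 0 → ChangesSignAt g s
  b_pos : 0 < b
  b_lt : b < c
  primF_b : primF g b = 0
  primF_ne_zero : ∀ s, b < s → s < c → primF g s ≠ 0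
  primF_c : 0 < primF g c
  le_zero_of_max : ∀ s, 0 < s → s < c → IsLocalMax (primF g) s → primF g s ≤ 0
  le_of_max : ∀ s, 0 < s → s < B → IsLocalMax (primF g) s → primF g s ≤ primF g x
  c_lt : c < x
  x_lt : x < B
  primF_x : 0 < primF g x
  primF_ne : ∀ s, x < s → s < B → primF g s ≠ primF g x
  primF_B : primF g x < primF g B

namespace Landscape

variable {g : ℝ → ℝ} {δ b c x B : ℝ}

theorem delta_le (hL : Landscape g δ b c x B) : δ ≤ b := by
  by_contra! h
  exact (hL.primF_neg b hL.b_pos h).ne hL.primF_b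

theorem x_pos (hL : Landscape g δ b c x B) : 0 < x :=
  hL.b_pos.trans (hL.b_lt.trans hL.c_lt)

theorem B_pos (hL : Landscape g δ b c x B) : 0 < B := hL.x_pos.trans hL.x_lt

theorem primF_nonpos (hL : Landscape g δ b c x B) : ∀ s ∈ Icc 0 b, primF g s ≤ 0 :=
  primF_le_of_no_localMax hL.cont (primF_zero g).le hL.primF_b.le
    fun s h1 h2 h3 => hL.le_zero_of_max s h1 (h2.trans hL.b_lt) h3

theorem primF_le_x (hL : Landscape g δ b c x B) : ∀ s ∈ Icc 0 x, primF g s ≤ primF g x :=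
  primF_le_of_no_localMax hL.cont ((primF_zero g).le.trans hL.primF_x.le) le_rfl
    fun s h1 h2 h3 => hL.le_of_max s h1 (h2.trans hL.x_lt) h3

theorem primF_pos (hL : Landscape g δ b c x B) {s : ℝ} (h1 : b < s) (h2 : s < c) :
    0 < primF g s := by
  by_contra! h
  obtain ⟨y, hy, hy'⟩ := intermediate_value_Icc h2.le (continuous_primF hL.cont).continuousOn
    (show (0 : ℝ) ∈ Icc (primF g s) (primF g c) from ⟨h, hL.primF_c.le⟩)
  rcases eq_or_lt_of_le hy.2 with h3 | h3
  · rw [h3] at hy'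
    exact hL.primF_c.ne' hy'
  · exact hL.primF_ne_zero y (h1.trans_le hy.1) h3 hy'

theorem lt_primF (hL : Landscape g δ b c x B) {s : ℝ} (h1 : x < s) (h2 : s < B) :
    primF g x < primF g s := by
  by_contra! h
  obtain ⟨y, hy, hy'⟩ := intermediate_value_Icc h2.le (continuous_primF hL.cont).continuousOn
    (show primF g x ∈ Icc (primF g s) (primF g B) from ⟨h, hL.primF_B.le⟩)
  rcases eq_or_lt_of_le hy.2 with h3 | h3
  · rw [h3] at hy'
    exact hL.primF_B.ne' hy'
  · exact hL.primF_ne y (h1.trans_le hy.1) h3 hy'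

theorem g_pos (hL : Landscape g δ b c x B) : ∀ s, b < s → s < c → 0 < g s := by
  have hcB := hL.c_lt.trans hL.x_lt
  refine pos_of_no_localMax hL.cont (fun s h1 h2 => hL.primF_b ▸ hL.primF_pos h1 h2)
    (fun s h1 h2 h3 => ?_)
    fun s h1 h2 => hL.sign_change s (hL.delta_le.trans_lt h1) (h2.trans hcB)
  exact (hL.le_zero_of_max s (hL.b_pos.trans h1) h2 h3).not_gt (hL.primF_pos h1 h2)

/-- Beyond x there is no local maximum above the level F(x), so F increases strictly. At x itself g
≥ 0 by continuity, and a zero would be a sign change contradicting either F ≤ F(x) on [0, x] or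
positivity beyond x. -/
theorem g_pos' (hL : Landscape g δ b c x B) {s : ℝ} (hs : x ≤ s) (hsB : s < B) : 0 < g s := by
  have hbx := hL.b_lt.trans hL.c_lt
  have hpos : ∀ s, x < s → s < B → 0 < g s := by
    refine pos_of_no_localMax hL.cont (fun s h1 h2 => hL.lt_primF h1 h2) (fun s h1 h2 h3 => ?_)
      fun s h1 h2 => hL.sign_change s (hL.delta_le.trans_lt (hbx.trans h1)) h2
    exact (hL.le_of_max s (hL.x_pos.trans h1) h2 h3).not_gt (hL.lt_primF h1 h2)
  rcases eq_or_lt_of_le hs with rfl | h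
  · have h1 : 0 ≤ g x := by
      refine ge_of_tendsto (hL.cont.continuousWithinAt (s := Ioi x)) ?_
      filter_upwards [Ioo_mem_nhdsGT hL.x_lt] with y hy using (hpos y hy.1 hy.2).le
    refine lt_of_le_of_ne h1 fun hz => ?_
    rcases hL.sign_change x (hL.delta_le.trans_lt hbx) hL.x_lt hz.symm with ⟨h2, -⟩ | ⟨-, h2⟩
    · obtain ⟨l, hl, hl'⟩ := mem_nhdsLT_iff_exists_Ioo_subset.1 h2
      have hl0 : l < x := hl
      have hm : max l 0 < x := max_lt hl0 hL.x_pos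
      set y := (max l 0 + x) / 2 with hy
      have hyx : y < x := by linarith
      have hy0 : max l 0 < y := by linarith
      have h3 : primF g x < primF g y := by
        refine strictAntiOn_of_deriv_neg (convex_Icc y x)
          (continuous_primF hL.cont).continuousOn (fun z hz => ?_) ⟨le_rfl, hyx.le⟩
          ⟨hyx.le, le_rfl⟩ hyx
        rw [interior_Icc] at hz
        rw [(hasDerivAt_primF hL.cont z).deriv]
        exact hl' ⟨((le_max_left _ _).trans_lt hy0).trans hz.1, hz.2⟩
      exact (hL.primF_le_x y ⟨(le_max_right _ _).trans hy0.le, hyx.le⟩).not_gt h3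
    · obtain ⟨y, hy⟩ := (h2.and (Ioo_mem_nhdsGT hL.x_lt)).exists
      exact hy.1.not_gt (hpos y hy.2.1 hy.2.2)
  · exact hpos s h hsB

theorem strictMonoOn (hL : Landscape g δ b c x B) : StrictMonoOn (primF g) (Icc x B) := by
  refine strictMonoOn_of_deriv_pos (convex_Icc x B) (continuous_primF hL.cont).continuousOn
    fun s hs => ?_
  rw [interior_Icc] at hs
  rw [(hasDerivAt_primF hL.cont s).deriv]
  exact hL.g_pos' hs.1.le hs.2

/-- The potential at a point beyond `x` dominates the potential before that point. -/
theorem primF_le (hL : Landscape g δ b c x B) {s y : ℝ} (hy : x ≤ y) (hyB : y ≤ B)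
    (hs : |s| ≤ y) : primF g s ≤ primF g y := by
  rw [← primF_abs hL.odd s]
  rcases le_total |s| x with h | h
  · exact (hL.primF_le_x _ ⟨abs_nonneg s, h⟩).trans
      (hL.strictMonoOn.monotoneOn ⟨le_rfl, hL.x_lt.le⟩ ⟨hy, hyB⟩ hy)
  · exact hL.strictMonoOn.monotoneOn ⟨h, hs.trans hyB⟩ ⟨hy, hyB⟩ hs

theorem primF_lt (hL : Landscape g δ b c x B) {s y : ℝ} (hy : x < y) (hyB : y ≤ B)
    (hs : |s| < y) : primF g s < primF g y := by
  have hm : max x |s| < y := max_lt hy hs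
  refine (hL.primF_le (le_max_left x |s|) (hm.le.trans hyB) (le_max_right _ _)).trans_lt ?_
  exact hL.strictMonoOn ⟨le_max_left _ _, hm.le.trans hyB⟩ ⟨hy.le, hyB⟩ hm

/-- The midpoint serves as lam because g is known to be positive on the open interval (b, c) only,
while a well needs this up to lam inclusive. -/
theorem well (hL : Landscape g δ b c x B) {Fb : ℝ} (hFb : ∀ s ∈ Icc 0 b, -Fb ≤ primF g s) :
    Well g b ((b + c) / 2) B Fb where
  cont := hL.cont
  odd := hL.odd
  lip := hL.lip
  bdd := hL.bdd
  b_pos := hL.b_pos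
  primF_b := hL.primF_b
  primF_nonpos s hs := by
    rw [← primF_abs hL.odd s]
    exact hL.primF_nonpos _ ⟨abs_nonneg s, hs⟩
  primF_ge s hs := by
    rw [← primF_abs hL.odd s]
    exact hFb _ ⟨abs_nonneg s, hs⟩
  absPot_pos s hs _ := by
    have hm : 0 < min s (δ / 2) := lt_min hs (half_pos hL.delta_pos)
    refine lt_of_lt_of_le ?_ (absPot_mono hL.cont (min_le_left s (δ / 2)))
    rw [← absPot_zero g]
    refine strictMonoOn_of_deriv_pos (convex_Icc 0 (min s (δ / 2)))
      (continuous_absPot hL.cont).continuousOn (fun y hy => ?_) ⟨le_rfl, hm.le⟩ ⟨hm.le, le_rfl⟩ hm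
    rw [interior_Icc] at hy
    rw [(hasDerivAt_absPot hL.cont y).deriv, abs_pos]
    exact (hL.primF_neg y hy.1 (by linarith [hy.2, min_le_right s (δ / 2), hL.delta_pos])).ne
  -- Equality would make F and hence g vanish on (s, b). This contradicts F < 0 near 0 if b = δ, and
  -- the finiteness of the zeros of g beyond δ otherwise.
  absPot_lt s hs hsb := by
    refine lt_of_le_of_ne (absPot_mono hL.cont hsb.le) fun heq => ?_
    have hconst : ∀ y ∈ Ioo s b, primF g y = 0 := by
      intro y hy
      have h1 : absPot g =ᶠ[𝓝 y] fun _ => absPot g s := by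
        filter_upwards [Ioo_mem_nhds hy.1 hy.2] with z hz
        exact le_antisymm ((absPot_mono hL.cont hz.2.le).trans heq.ge)
          (absPot_mono hL.cont hz.1.le)
      have h2 := (hasDerivAt_absPot hL.cont y).congr_of_eventuallyEq h1.symm
      exact abs_eq_zero.1 (h2.unique (hasDerivAt_const y _))
    have hzero : ∀ y ∈ Ioo s b, g y = 0 := by
      intro y hy
      have h1 : primF g =ᶠ[𝓝 y] fun _ => 0 := by
        filter_upwards [Ioo_mem_nhds hy.1 hy.2] with z hz using hconst z hz
      exact ((hasDerivAt_primF hL.cont y).congr_of_eventuallyEq h1.symm).unique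
        (hasDerivAt_const y _)
    rcases eq_or_lt_of_le hL.delta_le with h | h
    · have hy : (s + b) / 2 ∈ Ioo s b := ⟨by linarith, by linarith⟩
      exact (hL.primF_neg _ (by linarith [hy.1]) (by linarith [hy.2])).ne (hconst _ hy)
    · refine (Ioo_infinite (max_lt hsb h)).mono (fun y hy => ?_) hL.finite_zeros
      exact ⟨(le_max_right s δ).trans_lt hy.1, hy.2.trans (hL.b_lt.trans (hL.c_lt.trans hL.x_lt)),
        hzero y ⟨(le_max_left s δ).trans_lt hy.1, hy.2⟩⟩
  b_lt := by linarith [hL.b_lt]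
  lam_lt := by linarith [hL.b_lt, hL.c_lt, hL.x_lt]
  g_pos s h1 h2 := hL.g_pos s h1 (by linarith [hL.b_lt])
  finite_zeros := hL.finite_zeros.subset fun s hs =>
    ⟨by linarith [hs.1, hL.b_lt, hL.delta_le], hs.2⟩
  sign_change s h1 h2 := hL.sign_change s (by linarith [hL.b_lt, hL.delta_le]) h2
  primF_le _ hs := hL.primF_le hL.x_lt.le le_rfl hs

end Landscape

theorem ChangesSignAt.congr {f g : ℝ → ℝ} {z : ℝ} (h : f =ᶠ[𝓝 z] g) (hf : ChangesSignAt f z) :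
    ChangesSignAt g z := by
  have hl : f =ᶠ[𝓝[<] z] g := h.filter_mono nhdsWithin_le_nhds
  have hr : f =ᶠ[𝓝[>] z] g := h.filter_mono nhdsWithin_le_nhds
  refine hf.imp (fun h => ⟨?_, ?_⟩) (fun h => ⟨?_, ?_⟩)
  · filter_upwards [hl, h.1] with s h1 h2 using h1 ▸ h2
  · filter_upwards [hr, h.2] with s h1 h2 using h1 ▸ h2
  · filter_upwards [hl, h.1] with s h1 h2 using h1 ▸ h2
  · filter_upwards [hr, h.2] with s h1 h2 using h1 ▸ h2

theorem Icc_subset_fDomain {γs : EReal} {B : ℝ} (hB : (B : EReal) ≤ γs) :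
    Icc (-B) B ⊆ fDomain γs := fun _ hs =>
  (EReal.coe_le_coe_iff.2 (abs_le.2 hs)).trans hB

namespace IsRecordMaxima

variable {f : ℝ → ℝ} {γs : EReal} {M : ℕ} {γ : ℕ → ℝ}

theorem primF_pos (hγ : IsRecordMaxima f γs M γ) {i : ℕ} (h1 : 1 ≤ i) (hi : i ≤ M) :
    γ i ∈ localMaxAbove f γs 0 := by
  induction i, h1 using Nat.le_induction with
  | base => exact hγ.first.1
  | succ i h1 ih =>
    have h2 := ih (by omega)
    have h3 := (hγ.next i h1 (by omega)).1
    exact ⟨h3.1, h3.2.1, h3.2.2.1, h2.2.2.2.trans h3.2.2.2⟩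

end IsRecordMaxima

section

variable {N : ℕ} {f : ℝ → ℝ} {γs : EReal} {δ : ℝ} {M : ℕ} {γ : ℕ → ℝ} {β₁ βs B : ℝ}

theorem primF_truncation_eventuallyEq {z : ℝ} (h : |z| < B) :
    primF (truncation f B) =ᶠ[𝓝 z] primF f := by
  filter_upwards [continuous_abs.continuousAt.eventually_lt_const h] with s hs
    using primF_truncation hs.le

theorem truncation_eventuallyEq {z : ℝ} (h : |z| < B) : f =ᶠ[𝓝 z] truncation f B := by
  filter_upwards [continuous_abs.continuousAt.eventually_lt_const h] with s hs
    using (truncation_of_mem hs.le).symm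

namespace NonlinearityAssumptions

/-- Truncation alters neither F nor its local maxima in (0, B), so the record maxima and the
extremal choices of β₁ and βs translate directly. The only input on B is that F(B) exceeds the last
record. -/
theorem landscape (hf : NonlinearityAssumptions N f γs δ) (hγ : IsRecordMaxima f γs M γ)
    (hβ₁ : IsGreatest {s : ℝ | 0 < s ∧ s < γ 1 ∧ primF f s = 0} β₁)
    (hβs : IsGreatest {s : ℝ | γ M < s ∧ (s : EReal) < γs ∧ primF f s = primF f (γ M)} βs)
    (hβB : βs < B) (hB : (B : EReal) ≤ γs) (hFB : primF f (γ M) < primF f B) :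
    Landscape (truncation f B) δ β₁ (γ 1) βs B := by
  have hM := hγ.primF_pos hγ.one_le le_rfl
  have h1M : γ 1 ≤ γ M := hγ.first.2 hM
  obtain ⟨⟨hb0, hb1, hbF⟩, hbmax⟩ := hβ₁
  obtain ⟨⟨hx0, hx1, hxF⟩, hxmax⟩ := hβs
  have hB0 : 0 < B := by linarith
  have hlt : ∀ {s : ℝ}, s < B → (s : EReal) < γs := fun hs =>
    (EReal.coe_lt_coe_iff.2 hs).trans_le hB
  have hsub := Icc_subset_fDomain hB
  have hF : ∀ {s : ℝ}, 0 ≤ s → s ≤ B → primF (truncation f B) s = primF f s := fun h1 h2 =>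
    primF_truncation (by rwa [abs_of_nonneg h1])
  have hg : ∀ {s : ℝ}, 0 ≤ s → s ≤ B → truncation f B s = f s := fun h1 h2 =>
    truncation_of_mem (by rwa [abs_of_nonneg h1])
  have hmax : ∀ {s : ℝ}, 0 < s → s < B → IsLocalMax (primF (truncation f B)) s →
      IsLocalMax (primF f) s := fun h1 h2 h3 =>
    (primF_truncation_eventuallyEq (by rwa [abs_of_pos h1])).isLocalMax_iff.1 h3
  have hδb : δ ≤ β₁ := by
    by_contra! h
    exact (hf.primF_neg β₁ (abs_pos.2 hb0.ne') (by rwa [abs_of_pos hb0])).ne hbF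
  constructor
  · exact continuous_truncation hB0.le (hf.cont.mono hsub)
  · exact truncation_neg hB0.le fun s hs => hf.odd s (hsub hs)
  · exact locallyLipschitzOn_truncation hB0 (hf.locLip.mono (sdiff_subset_sdiff_left hsub))
  · exact exists_truncation_bound hB0.le (hf.cont.mono hsub)
  · exact hf.delta_pos
  · intro s h1 h2
    rw [hF h1.le (by linarith)]
    exact hf.primF_neg s (abs_pos.2 h1.ne') (by rwa [abs_of_pos h1])
  · refine hf.finite_zeros.subset fun s hs => ⟨hs.1, hlt hs.2.1, ?_⟩
    rw [← hg (hf.delta_pos.trans hs.1).le hs.2.1.le]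
    exact hs.2.2
  · intro s h1 h2 h3
    have h4 := hf.delta_pos.trans h1
    refine (hf.sign_change s h1 (hlt h2) ?_).congr
      (truncation_eventuallyEq (by rwa [abs_of_pos h4]))
    rw [← hg h4.le h2.le]
    exact h3
  · exact hb0
  · exact hb1
  · rw [hF hb0.le (by linarith), hbF]
  · intro s h1 h2 h3
    rw [hF (by linarith) (by linarith)] at h3
    exact (hbmax ⟨hb0.trans h1, h2, h3⟩).not_gt h1
  · rw [hF (by linarith) (by linarith)]
    exact hγ.first.1.2.2.2
  · intro s h1 h2 h3
    by_contra! h4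
    rw [hF h1.le (by linarith)] at h4
    exact (hγ.first.2 ⟨h1, hlt (by linarith), hmax h1 (by linarith) h3, h4⟩).not_gt h2
  · intro s h1 h2 h3
    by_contra! h4
    rw [hF h1.le h2.le, hF (by linarith) hβB.le, hxF] at h4
    have h5 : s ∈ localMaxAbove f γs (primF f (γ M)) := ⟨h1, hlt h2, hmax h1 h2 h3, h4⟩
    rw [hγ.last] at h5
    exact h5
  · linarith
  · exact hβB
  · rw [hF (by linarith) hβB.le, hxF]
    exact hM.2.2.2
  · intro s h1 h2 h3
    rw [hF (by linarith) h2.le, hF (by linarith) hβB.le, hxF] at h3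
    exact (hxmax ⟨by linarith, hlt h2, h3⟩).not_gt h1
  · rwa [hF (by linarith) hβB.le, hF hB0.le le_rfl, hxF]

theorem continuous_of_top {N : ℕ} (hf : NonlinearityAssumptions N f ⊤ δ) : Continuous f := by
  rw [← continuousOn_univ]
  exact hf.cont.mono fun s _ => show ((|s| : ℝ) : EReal) ≤ ⊤ from le_top

/-- F eventually exceeds F(γ M), because the limit of F does. Were F(B) not above that level, F
would return to it beyond βs, against the maximality of βs. -/
theorem primF_lt_of_top (hf : NonlinearityAssumptions N f ⊤ δ)
    (hβs : IsGreatest {s : ℝ | γ M < s ∧ (s : EReal) < ⊤ ∧ primF f s = primF f (γ M)} βs)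
    (hB : βs < B) : primF f (γ M) < primF f B := by
  have hc := hf.continuous_of_top
  obtain ⟨L, hL, hlt⟩ := hf.primF_lt_top rfl
  obtain ⟨⟨hx0, -, -⟩, hxmax⟩ := hβs
  obtain ⟨t, ht, hBt⟩ := ((hL.eventually (lt_mem_nhds (hlt (γ M)))).and (eventually_gt_atTop B)).exists
  rw [EReal.coe_lt_coe_iff] at ht
  by_contra! h
  obtain ⟨y, hy, hy'⟩ := intermediate_value_Icc hBt.le (continuous_primF hc).continuousOn
    (show primF f (γ M) ∈ Icc (primF f B) (primF f t) from ⟨h, ht.le⟩)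
  exact (hxmax ⟨hx0.trans (hB.trans_le hy.1), EReal.coe_lt_top y, hy'⟩).not_gt (hB.trans_le hy.1)

theorem pos_of_top (hf : NonlinearityAssumptions N f ⊤ δ) (hγ : IsRecordMaxima f ⊤ M γ)
    (hβ₁ : IsGreatest {s : ℝ | 0 < s ∧ s < γ 1 ∧ primF f s = 0} β₁)
    (hβs : IsGreatest {s : ℝ | γ M < s ∧ (s : EReal) < ⊤ ∧ primF f s = primF f (γ M)} βs)
    {s : ℝ} (hs : βs ≤ s) : 0 < f s := by
  have hB : βs < s + 1 := by linarith
  have hL := hf.landscape hγ hβ₁ hβs hB le_top (hf.primF_lt_of_top hβs hB)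
  have := hL.g_pos' hs (by linarith)
  rwa [truncation_of_mem (by rw [abs_of_pos (hL.x_pos.trans_le hs)]; linarith)] at this

end NonlinearityAssumptions

end

/-! ### Energy and time needed for the descent to the rim -/

namespace IsSol

variable {n : ℕ} {g u v : ℝ → ℝ}

theorem v_neg_of_g_pos (h : IsSol n g u v) {r : ℝ} (hr : 0 < r)
    (hg : ∀ s ∈ Ioo 0 r, 0 < g (u s)) : v r < 0 := by
  have h1 : StrictAntiOn (fun s => s ^ n * v s) (Icc 0 r) := by
    refine strictAntiOn_of_deriv_neg (convex_Icc 0 r)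
      ((continuous_id.pow n).mul h.cv).continuousOn fun s hs => ?_
    rw [interior_Icc] at hs
    rw [(h.deriv_flux hs.1).deriv]
    have := hg s hs
    have := hs.1
    rw [neg_lt_zero]
    positivity
  have h2 := h1 ⟨le_rfl, hr.le⟩ ⟨hr.le, le_rfl⟩ hr
  simp only [h.v_nonpos 0 le_rfl, mul_zero] at h2
  exact neg_of_mul_neg_right h2 (by positivity)

theorem v_nonpos_of_g_pos (h : IsSol n g u v) {r : ℝ} (hr : 0 ≤ r)
    (hg : ∀ s ∈ Ioo 0 r, 0 < g (u s)) : v r ≤ 0 := by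
  rcases eq_or_lt_of_le hr with h1 | h1
  · exact (h.v_nonpos r h1.ge).le
  · exact (h.v_neg_of_g_pos h1 hg).le

/-- A force bounded below makes the solution fall quadratically. -/
theorem le_sub_sq (h : IsSol n g u v) {a r μ : ℝ} (ha : 0 < a) (har : a ≤ r) (hv : v a ≤ 0)
    (hg : ∀ s ∈ Icc a r, μ ≤ g (u s)) (hμ : 0 ≤ μ) :
    u r ≤ u a - μ / (2 * (n + 1)) * (r - a) ^ 2 := by
  set c := μ / (n + 1) with hc
  have hc0 : 0 ≤ c := by positivity
  have hcμ : c * (n + 1) = μ := by rw [hc]; field_simp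
  have h1 : ∀ s ∈ Icc a r, v s ≤ -(c * (s - a)) := by
    intro s hs
    -- The comparison term c s^n (s - a) has derivative at most c (n + 1) s^n = μ s^n, which the
    -- flux derivative -s^n g(u) compensates.
    have h2 : AntitoneOn (fun s => s ^ n * v s + c * (s ^ (n + 1) - a * s ^ n)) (Icc a r) := by
      refine antitoneOn_of_hasDerivWithinAt_nonpos (convex_Icc a r)
        (by have := h.cv; fun_prop) (f' := fun s => -(s ^ n * g (u s)) +
          c * ((n + 1 : ℕ) * s ^ n - a * (n * s ^ (n - 1)))) (fun s hs => ?_) fun s hs => ?_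
      · rw [interior_Icc] at hs
        have h3 := ((hasDerivAt_pow (n + 1) s).sub ((hasDerivAt_pow n s).const_mul a)).const_mul c
        exact ((h.deriv_flux (ha.trans hs.1)).add h3).hasDerivWithinAt
      · rw [interior_Icc] at hs
        have hs0 := ha.trans hs.1
        have h3 := hg s ⟨hs.1.le, hs.2.le⟩
        have h4 : s ^ n * μ ≤ s ^ n * g (u s) := by gcongr
        have h5 : 0 ≤ c * (a * (n * s ^ (n - 1))) := by positivity
        rw [← hcμ] at h4
        push_cast
        nlinarith
    have h3 := h2 ⟨le_rfl, har⟩ hs hs.1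
    have hs0 := ha.trans_le hs.1
    have h4 : a ^ n * v a ≤ 0 := mul_nonpos_of_nonneg_of_nonpos (by positivity) hv
    have h5 : s ^ n * (v s + c * (s - a)) ≤ 0 := by
      simp only at h3
      have h6 : s ^ (n + 1) = s ^ n * s := pow_succ s n
      have h7 : a ^ (n + 1) = a ^ n * a := pow_succ a n
      rw [h6, h7] at h3
      linarith [h3, h4]
    have h6 := nonpos_of_mul_nonpos_right h5 (by positivity)
    linarith
  have h2 : AntitoneOn (fun s => u s + c / 2 * (s - a) ^ 2) (Icc a r) := by
    refine antitoneOn_of_hasDerivWithinAt_nonpos (convex_Icc a r)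
      (by have := h.cu; fun_prop) (f' := fun s => v s + c * (s - a)) (fun s hs => ?_) fun s hs => ?_
    · refine ((h.du s).add ((((hasDerivAt_id s).sub_const a).pow 2).const_mul
        (c / 2))).hasDerivWithinAt.congr_deriv ?_
      simp
      ring
    · rw [interior_Icc] at hs
      linarith [h1 s ⟨hs.1.le, hs.2.le⟩]
  have h3 := h2 ⟨le_rfl, har⟩ ⟨har, le_rfl⟩ har
  simp only [sub_self] at h3
  have h4 : μ / (2 * (n + 1)) = c / 2 := by rw [hc]; field_simp
  rw [h4]
  linarith

end IsSol

namespace Landscape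

variable {g u v : ℝ → ℝ} {δ b c x B : ℝ} {n : ℕ}

theorem abs_lt (hL : Landscape g δ b c x B) (h : IsSol n g u v) (h0 : |u 0| < B) :
    ∀ r ≥ 0, |u r| < B := by
  refine h.abs_lt_of_nrg_lt hL.cont hL.odd le_rfl h0 ?_
  simpa [nrg, h.v_nonpos 0 le_rfl] using hL.primF_lt hL.x_lt le_rfl h0

/-- If v = 0 at the first contact, then either g(b) = 0 and backward uniqueness makes u constant, or
g(b) > 0 and u was increasing towards b from below; both contradict u > b before. -/
theorem v_neg_of_touch (hL : Landscape g δ b c x B) (h : IsSol n g u v) {r : ℝ} (hr : 0 < r)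
    (hu : ∀ s, 0 ≤ s → s < r → b < u s) (hur : u r = b) : v r < 0 := by
  have hle : v r ≤ 0 := by
    by_contra! hv
    obtain ⟨s, h1, h2, h3⟩ := exists_lt_left_of_hasDerivAt_pos (h.du r) hv hr
    linarith [hu s h1.le h2]
  refine lt_of_le_of_ne hle fun hv => ?_
  have hgb : 0 ≤ g b := by
    refine ge_of_tendsto (hL.cont.continuousWithinAt (s := Ioi b)) ?_
    filter_upwards [Ioo_mem_nhdsGT hL.b_lt] with y hy using (hL.g_pos y hy.1 hy.2).le
  rcases eq_or_lt_of_le hgb with h0 | h0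
  · obtain ⟨G, hG⟩ := hL.bdd
    have h1 := (IsSol.const (n := n) h0.symm).eq_on_Ioc hL.cont hG hL.lip h (T := r)
      (r₀ := r) ⟨hr, le_rfl⟩ hur.symm hv.symm fun _ _ => Or.inl hL.b_pos.ne'
    have h2 := (h1 (r / 2) ⟨by linarith, by linarith⟩).1
    linarith [hu (r / 2) (by linarith) (by linarith)]
  · have h1 := h.dv r hr
    rw [hv, hur, mul_zero, zero_sub] at h1
    obtain ⟨ρ, hρ1, hρ2, hρ3⟩ : ∃ ρ, 0 ≤ ρ ∧ ρ < r ∧ ∀ s ∈ Ioo ρ r, 0 < v s := by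
      have h2 := h1.tendsto_slope.mono_left (nhdsLT_le_nhdsNE r)
      obtain ⟨l, hl, hl'⟩ := mem_nhdsLT_iff_exists_Ioo_subset.1
        (h2.eventually (gt_mem_nhds (neg_lt_zero.2 h0)))
      have hl0 : l < r := hl
      refine ⟨max l 0, le_max_right _ _, max_lt hl0 hr, fun s hs => ?_⟩
      have h3 : slope v r s < 0 := hl' ⟨(le_max_left _ _).trans_lt hs.1, hs.2⟩
      rw [slope_def_field, hv, sub_zero, div_neg_iff] at h3
      rcases h3 with h4 | h4
      · exact h4.1
      · linarith [h4.2, hs.2]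
    have h2 := h.lt_of_v_pos hρ2 hρ3
    linarith [hu ρ hρ1 hρ2]

variable {y m₀ C : ℝ}

/-- Not too much energy is lost while the solution descends from `y` to `b`. -/
theorem nrg_ge (hL : Landscape g δ b c x B) (h : IsSol n g u v) (hxy : x < y) (hyB : y ≤ B)
    (hm : ∀ s ∈ Icc b x, m₀ ≤ primF g s) (hC0 : 0 < C)
    (hC : 2 * n * (y - b) * √(2 * (primF g y - m₀)) ≤ C * (primF g y - primF g x))
    (hu : u C = y) {r : ℝ} (hr : C ≤ r) (hv : ∀ s ∈ Icc C r, v s ≤ 0) (hb : b ≤ u r) :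
    (primF g y + primF g x) / 2 ≤ nrg g u v r := by
  have hF : primF g x < primF g y := hL.strictMonoOn ⟨le_rfl, hL.x_lt.le⟩ ⟨hxy.le, hyB⟩ hxy
  set S := √(2 * (primF g y - m₀)) with hS
  have hbx := hL.b_lt.trans hL.c_lt
  by_contra! hcon
  have hEC : primF g y ≤ nrg g u v C := by rw [← hu]; exact primF_le_nrg g u v C
  -- After the last time t with E = F(y) the speed is at most S. From then on the loss is at most n
  -- S/C times the distance y - b, which `hC` makes no more than half the gap F(y) - F(x).
  obtain ⟨t, ht1, ht2, ht3, -⟩ := exists_last_zero (φ := fun s => primF g y - nrg g u v s)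
    (continuous_const.sub (h.continuous_nrg hL.cont)) hr (by simpa using hEC)
    (by linarith)
  have hanti := h.antitoneOn_Icc hv
  have hub : ∀ s ∈ Icc t r, b ≤ u s ∧ u s ≤ y := fun s hs =>
    ⟨hb.trans (hanti ⟨ht1.trans hs.1, hs.2⟩ ⟨hr, le_rfl⟩ hs.2),
      hu ▸ hanti ⟨le_rfl, hr⟩ ⟨ht1.trans hs.1, hs.2⟩ (ht1.trans hs.1)⟩
  have hvS : ∀ s ∈ Icc t r, -v s ≤ S := by
    intro s hs
    refine Real.le_sqrt_of_sq_le ?_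
    rw [neg_sq, h.v_sq]
    have h1 := h.nrg_le hL.cont (hC0.le.trans ht1) hs.1
    have h2 : m₀ ≤ primF g (u s) := by
      rcases le_total (u s) x with h3 | h3
      · exact hm _ ⟨(hub s hs).1, h3⟩
      · exact (hm x ⟨hbx.le, le_rfl⟩).trans
          (hL.strictMonoOn.monotoneOn ⟨le_rfl, hL.x_lt.le⟩ ⟨h3, (hub s hs).2.trans hyB⟩ h3)
    simp only [sub_eq_zero] at ht3
    linarith
  have hmono : MonotoneOn (fun s => nrg g u v s - n * S / C * u s) (Icc t r) := by
    refine monotoneOn_of_hasDerivWithinAt_nonneg (convex_Icc t r)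
      ((h.continuous_nrg hL.cont).sub (h.cu.const_mul _)).continuousOn
      (f' := fun s => -((n : ℝ) / s * v s ^ 2) - n * S / C * v s) (fun s hs => ?_) fun s hs => ?_
    · rw [interior_Icc] at hs
      exact ((h.hasDerivAt_nrg hL.cont ((hC0.trans_le ht1).trans hs.1)).sub
        ((h.du s).const_mul _)).hasDerivWithinAt
    · rw [interior_Icc] at hs
      have hs' : s ∈ Icc t r := ⟨hs.1.le, hs.2.le⟩
      have hCs : C ≤ s := ht1.trans hs'.1
      have hs0 := hC0.trans_le hCs
      have h1 : -v s / s ≤ S / C := by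
        have := hvS s hs'
        have h2 := hv s ⟨hCs, hs'.2⟩
        gcongr
      have h2 : 0 ≤ -v s := by linarith [hv s ⟨hCs, hs'.2⟩]
      have h3 : -((n : ℝ) / s * v s ^ 2) - n * S / C * v s = n * (-v s) * (S / C - -v s / s) := by
        field_simp
        ring
      rw [h3]
      exact mul_nonneg (by positivity) (by linarith)
  have h1 := hmono ⟨le_rfl, ht2.le⟩ ⟨ht2.le, le_rfl⟩ ht2.le
  have h2 : n * S / C * (u t - u r) ≤ (primF g y - primF g x) / 2 := by
    have h3 : n * S / C * (u t - u r) ≤ n * S / C * (y - b) := by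
      gcongr
      · exact (hub t ⟨le_rfl, ht2.le⟩).2
    refine h3.trans ?_
    rw [div_mul_eq_mul_div, div_le_iff₀ hC0]
    linarith
  simp only at h1 ht3
  linarith

/-- A solution that reaches `y` at time `C` goes on to reach `b` soon after. -/
theorem exists_crossing (hL : Landscape g δ b c x B) (h : IsSol n g u v) (hxy : x < y) (hyB : y < B)
    (hm : ∀ s ∈ Icc b x, m₀ ≤ primF g s) (hC0 : 0 < C)
    (hC : 2 * n * (y - b) * √(2 * (primF g y - m₀)) ≤ C * (primF g y - primF g x))
    {μ : ℝ} (hμ : 0 < μ) (hμg : ∀ s ∈ Icc x y, μ ≤ g s) (h0 : u 0 < B)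
    (hu : u C = y) (hle : ∀ s ∈ Icc 0 C, y ≤ u s) :
    ∃ r > C, r ≤ C + ((x - b) / √(primF g y - primF g x) + √(2 * (n + 1) * (y - x) / μ)) ∧
      u r = b ∧ ∀ s, 0 ≤ s → s < r → b < u s := by
  have hF : primF g x < primF g y := hL.strictMonoOn ⟨le_rfl, hL.x_lt.le⟩ ⟨hxy.le, hyB.le⟩ hxy
  have hbx := hL.b_lt.trans hL.c_lt
  have hx0 := hL.x_pos
  have hlt : ∀ r ≥ 0, u r < B := fun r hr => (_root_.abs_lt.1 (hL.abs_lt h (by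
    rw [abs_of_nonneg (by linarith [hle 0 ⟨le_rfl, hC0.le⟩])]; exact h0) r hr)).2
  set T₂ := √(2 * (n + 1) * (y - x) / μ) with hT₂
  set κ := √(primF g y - primF g x) with hκ
  have hκ0 : 0 < κ := Real.sqrt_pos.2 (by linarith)
  have hT₂0 : 0 ≤ T₂ := Real.sqrt_nonneg _
  have hvC : ∀ r, 0 ≤ r → (∀ s ∈ Icc 0 r, x ≤ u s) → v r ≤ 0 := fun r hr hx =>
    h.v_nonpos_of_g_pos hr fun s hs => hL.g_pos' (hx s ⟨hs.1.le, hs.2.le⟩) (hlt s hs.1.le)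
  have hxC : ∀ s ∈ Icc 0 C, x ≤ u s := fun s hs => hxy.le.trans (hle s hs)
  -- From y to x the force is at least μ, and the quadratic fall takes at most T₂.
  obtain ⟨p, hp1, hp2⟩ : ∃ p ∈ Icc C (C + T₂), u p ≤ x := by
    by_contra! hcon
    have hx : ∀ s ∈ Icc 0 (C + T₂), x ≤ u s := fun s hs => by
      rcases le_total s C with h1 | h1
      · exact hxC s ⟨hs.1, h1⟩
      · exact (hcon s ⟨h1, hs.2⟩).le
    have hanti := h.antitoneOn_Icc (a := C) (b := C + T₂) fun s hs =>
      hvC s (hC0.le.trans hs.1) fun t ht => hx t ⟨ht.1, ht.2.trans hs.2⟩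
    have h1 := h.le_sub_sq hC0 (by linarith : C ≤ C + T₂) (hvC C hC0.le hxC) (fun s hs =>
      hμg (u s) ⟨(hcon s hs).le, hu ▸ hanti ⟨le_rfl, by linarith⟩ hs hs.1⟩) hμ.le
    have h2 : μ / (2 * (n + 1)) * (C + T₂ - C) ^ 2 = y - x := by
      rw [add_sub_cancel_left, hT₂, Real.sq_sqrt (by
        have : 0 ≤ y - x := by linarith
        positivity)]
      field_simp
    rw [h2, hu] at h1
    linarith [hcon (C + T₂) ⟨by linarith, le_rfl⟩]
  obtain ⟨q, hq1, hq2, hq3, hq4⟩ := exists_first_zero (φ := fun s => u s - x)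
    (h.cu.sub continuous_const) hp1.1 (by linarith) (by simpa using hp2)
  simp only [sub_pos, sub_eq_zero] at hq3 hq4
  have hq0 := hC0.trans hq1
  have hxq : ∀ s ∈ Icc 0 q, x ≤ u s := fun s hs => by
    rcases le_total s C with h1 | h1
    · exact hxC s ⟨hs.1, h1⟩
    rcases eq_or_lt_of_le hs.2 with h2 | h2
    · rw [h2, hq3]
    · exact (hq4 s h1 h2).le
  have hvq : ∀ s ∈ Icc C q, v s ≤ 0 := fun s hs =>
    hvC s (hC0.le.trans hs.1) fun t ht => hxq t ⟨ht.1, ht.2.trans hs.2⟩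
  have hvq' : v q < 0 := h.v_neg_of_g_pos hq0 fun s hs =>
    hL.g_pos' (hxq s ⟨hs.1.le, hs.2.le⟩) (hlt s hs.1.le)
  set T₃ := (x - b) / κ with hT₃
  have hT₃0 : 0 < T₃ := div_pos (by linarith) hκ0
  -- From x to b, E is at least the mean of F(y) and F(x) while F(u) ≤ F(x). So v² ≥ κ², the
  -- solution cannot stop, and it needs at most (x - b)/κ.
  obtain ⟨p, hp1', hp2'⟩ : ∃ p ∈ Icc q (q + T₃), u p ≤ b := by
    by_contra! hcon
    have hvneg : ∀ r ∈ Icc q (q + T₃), v r < 0 := by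
      by_contra! hcon'
      obtain ⟨r, hr, hvr⟩ := hcon'
      obtain ⟨z, hz1, hz2, hz3, hz4⟩ := exists_first_zero (φ := fun s => -v s) h.cv.neg hr.1
        (by simpa using hvq') (by simpa using hvr)
      simp only [neg_eq_zero, neg_pos] at hz3 hz4
      have hv : ∀ s ∈ Icc C z, v s ≤ 0 := fun s hs => by
        rcases le_total s q with h1 | h1
        · exact hvq s ⟨hs.1, h1⟩
        rcases eq_or_lt_of_le hs.2 with h2 | h2
        · rw [h2, hz3]
        · exact (hz4 s h1 h2).le
      have hbz := hcon z ⟨hz1.le, hz2.trans hr.2⟩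
      have h1 := hL.nrg_ge h hxy hyB.le hm hC0 hC hu (hq1.le.trans hz1.le) hv hbz.le
      have h2 : u z ≤ x := hq3 ▸ h.antitoneOn_Icc hv ⟨hq1.le, hz1.le⟩ ⟨hq1.le.trans hz1.le, le_rfl⟩
        hz1.le
      have h3 := hL.primF_le_x (u z) ⟨(hL.b_pos.trans hbz).le, h2⟩
      have h4 : nrg g u v z = primF g (u z) := by simp [nrg, hz3]
      linarith
    have hv : ∀ s ∈ Icc C (q + T₃), v s ≤ 0 := fun s hs => by
      rcases le_total s q with h1 | h1
      · exact hvq s ⟨hs.1, h1⟩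
      · exact (hvneg s ⟨h1, hs.2⟩).le
    obtain ⟨ξ, hξ, hξ'⟩ := h.exists_mvt (by linarith : q < q + T₃)
    have hξC : C ≤ ξ := hq1.le.trans hξ.1.le
    have hbξ := hcon ξ ⟨hξ.1.le, hξ.2.le⟩
    have h1 := hL.nrg_ge h hxy hyB.le hm hC0 hC hu hξC (fun s hs => hv s ⟨hs.1, hs.2.trans hξ.2.le⟩)
      hbξ.le
    have h2 : u ξ ≤ x := hq3 ▸ h.antitoneOn_Icc hv ⟨hq1.le, by linarith⟩ ⟨hξC, hξ.2.le⟩ hξ.1.le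
    have h3 := hL.primF_le_x (u ξ) ⟨(hL.b_pos.trans hbξ).le, h2⟩
    have h4 : κ ≤ -v ξ := by
      have := hvneg ξ ⟨hξ.1.le, hξ.2.le⟩
      refine Real.sqrt_le_iff.2 ⟨by linarith, ?_⟩
      rw [neg_sq, h.v_sq]
      linarith
    have h5 : κ * T₃ = x - b := by rw [hT₃]; field_simp
    have h6 : κ * T₃ ≤ -v ξ * T₃ := by gcongr
    rw [hq3, add_sub_cancel_left] at hξ'
    linarith [hcon (q + T₃) ⟨by linarith, le_rfl⟩]
  obtain ⟨r, hr1, hr2, hr3, hr4⟩ := exists_first_zero (φ := fun s => u s - b)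
    (h.cu.sub continuous_const) hp1'.1 (by linarith) (by simpa using hp2')
  simp only [sub_pos, sub_eq_zero] at hr3 hr4
  refine ⟨r, hq1.trans hr1, by linarith [hp1.2, hp1'.2], hr3, fun s hs hsr => ?_⟩
  rcases le_total s q with h1 | h1
  · linarith [hxq s ⟨hs, h1⟩]
  · exact hr4 s h1 hsr

end Landscape

/-! ### Heights from which solutions fall into the well -/

theorem not_hasSignChangesAtLeast_one_of_pos {u : ℝ → ℝ} (hu : ∀ r > 0, 0 < u r) :
    ¬ HasSignChangesAtLeast u 1 := by
  rintro ⟨r, -, hr0, hr⟩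
  exact (mul_pos (hu _ (hr0 0)) (hu _ (hr0 1))).not_gt (hr 0)

namespace Family

variable {n : ℕ} {g : ℝ → ℝ} {U V : ℝ → ℝ → ℝ} {b lam B Fb α : ℝ}

/-- A solution that falls into the well with little energy stays there, and so do its
neighbours. -/
theorem eventually_of_descent (hF : Family n g U V) (hW : Well g b lam B Fb) (hn : 1 ≤ n)
    {R Em : ℝ} (hR : 0 < R) (hpos : ∀ s ∈ Icc 0 R, b ≤ U α s) (hu : U α R = b) (hv : V α R < 0)
    (hE : nrg g (U α) (V α) R ≤ Em) (hEm : 0 < Em + Fb)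
    (hdis : R * nrg g (U α) (V α) R < dissip n Em Fb * absPot g b) :
    ∀ᶠ α' in 𝓝 α, ¬ HasSignChangesAtLeast (U α') 1 ∧ ¬ Stuck lam (U α') := by
  have h := hF.sol α
  have hn0 : (0 : ℝ) < n := by exact_mod_cast hn
  have hE' := h.hasDerivAt_nrg hW.cont hR
  have hEneg : -((n : ℝ) / R * V α R ^ 2) < 0 := by
    have := sq_pos_of_neg hv
    rw [neg_lt_zero]
    positivity
  have e1 : ∀ᶠ r in 𝓝[>] R, U α r - b < 0 :=
    eventually_neg_of_hasDerivAt_neg ((h.du R).sub_const b) hv (by rw [hu, sub_self])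
  have e2 : ∀ᶠ r in 𝓝[>] R, nrg g (U α) (V α) r - nrg g (U α) (V α) R < 0 :=
    eventually_neg_of_hasDerivAt_neg (hE'.sub_const _) hEneg (by rw [sub_self])
  have e3 : ∀ᶠ r in 𝓝[>] R, 0 < U α r :=
    (h.cu.continuousAt.eventually_const_lt (hu.symm ▸ hW.b_pos)).filter_mono nhdsWithin_le_nhds
  have e4 : ∀ᶠ r in 𝓝[>] R, V α r < 0 :=
    (h.cv.continuousAt.eventually_lt_const hv).filter_mono nhdsWithin_le_nhds
  have e5 : ∀ᶠ r in 𝓝[>] R, r * nrg g (U α) (V α) r < dissip n Em Fb * absPot g (U α r) := by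
    have hc1 : Continuous fun r => r * nrg g (U α) (V α) r :=
      continuous_id.mul (h.continuous_nrg hW.cont)
    have hc2 : Continuous fun r => dissip n Em Fb * absPot g (U α r) :=
      ((continuous_absPot hW.cont).comp h.cu).const_mul _
    exact (hc1.continuousAt.eventually_lt hc2.continuousAt (by rwa [hu])).filter_mono
      nhdsWithin_le_nhds
  -- The state is observed slightly after R: there u < b and E ≤ Em hold strictly, so all conditions
  -- become open in α.
  obtain ⟨y, hy, hy'⟩ := mem_nhdsGT_iff_exists_Ioo_subset.1
    (e1.and (e2.and (e3.and (e4.and e5))))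
  have hy0 : R < y := hy
  obtain ⟨T, hRT, hTy⟩ := exists_between hy0
  obtain ⟨h1, h2, h3, h4, h5⟩ := hy' ⟨hRT, hTy⟩
  have hT0 := hR.trans hRT
  have hposT : ∀ s ∈ Icc 0 T, 0 < U α s := fun s hs => by
    rcases le_or_gt s R with h6 | h6
    · exact hW.b_pos.trans_le (hpos s ⟨hs.1, h6⟩)
    · exact (hy' ⟨h6, hs.2.trans_lt hTy⟩).2.2.1
  obtain ⟨m, hm, hmin⟩ := isCompact_Icc.exists_isMinOn (nonempty_Icc.2 hT0.le)
    h.cu.continuousOn (f := U α)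
  have hT : U α T ≠ 0 := h3.ne'
  have hTT : T ∈ Icc 0 T := ⟨hT0.le, le_rfl⟩
  have tu := hF.tendsto_u hT hTT
  have tE := hF.tendsto_nrg hW.cont hT hTT
  filter_upwards [hF.near α T hT _ (hposT m hm), tu.eventually (gt_mem_nhds (sub_neg.1 h1)),
    (hF.tendsto_v hT hTT).eventually (gt_mem_nhds h4),
    tE.eventually (gt_mem_nhds ((sub_neg.1 h2).trans_le hE)),
    (tE.const_mul T).eventually_lt ((((continuous_absPot hW.cont).tendsto _).comp tu).const_mul
      (dissip n Em Fb)) h5] with α' a1 a2 a3 a4 a5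
  have hpos' : ∀ s ∈ Icc 0 T, 0 < U α' s := fun s hs => by
    have b1 := (abs_lt.1 (a1 s hs).1).1
    have b2 : U α m ≤ U α s := hmin hs
    linarith
  have hst := hW.stays_of_descending hn (hF.sol α') hT0 (hpos' T hTT) a2.le a3 a4.le hEm a5
  have hall : ∀ s ≥ 0, 0 < U α' s := fun s hs => by
    rcases le_or_gt s T with h6 | h6
    · exact hpos' s ⟨hs, h6⟩
    · exact (hst s h6).1
  constructor
  · exact not_hasSignChangesAtLeast_one_of_pos fun r hr => hall r hr.le
  · rintro ⟨R', hR'⟩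
    have b1 := hst (max R' (T + 1)) (lt_max_of_lt_right (by linarith))
    have b2 := hR' _ (le_max_left R' (T + 1))
    rw [abs_of_pos b1.1] at b2
    linarith [hW.b_lt]

/-- Solutions starting at a zero of `g` away from the origin are constant. -/
theorem eq_const (hF : Family n g U V) (hn : 1 ≤ n) (hg : Continuous g) {G : ℝ}
    (hG : ∀ s, |g s| ≤ G) (hL : LocallyLipschitzOn {0}ᶜ g) (hα : α ≠ 0) (h0 : g α = 0) {r : ℝ}
    (hr : 0 ≤ r) : U α r = α :=
  ((IsSol.const (n := n) h0).eq_of_init hn hg hG hL (hF.sol α) (hF.init α).symm (T := r)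
    (fun _ _ => Or.inl hα) r ⟨hr, le_rfl⟩).1.symm

end Family

/-- An open condition that fails somewhere fails for the first time. -/
theorem exists_first_of_open {P : ℝ → Prop} {a α₀ : ℝ} (ha : a ≤ α₀) (hP : P α₀)
    (hopen : ∀ α ≥ a, ¬ P α → ∀ᶠ α' in 𝓝 α, ¬ P α') :
    ∃ α ∈ Icc a α₀, P α ∧ ∀ α', a ≤ α' → α' < α → ¬ P α' := by
  set S := {α | a ≤ α ∧ P α} with hS
  have hne : S.Nonempty := ⟨α₀, ha, hP⟩
  have hbdd : BddBelow S := ⟨a, fun α h => h.1⟩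
  have hge : a ≤ sInf S := le_csInf hne fun α h => h.1
  refine ⟨sInf S, ⟨hge, csInf_le hbdd ⟨ha, hP⟩⟩, ?_, fun α' h1 h2 h3 =>
    h2.not_ge (csInf_le hbdd ⟨h1, h3⟩)⟩
  by_contra hcon
  obtain ⟨ε, hε, hball⟩ := Metric.eventually_nhds_iff.1 (hopen _ hge hcon)
  obtain ⟨α, hα, hlt⟩ := exists_lt_of_csInf_lt hne (lt_add_of_pos_right (sInf S) hε)
  refine hball ?_ hα.2
  rw [Real.dist_eq, abs_of_nonneg (by linarith [csInf_le hbdd hα])]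
  linarith

namespace Family

variable {n : ℕ} {g : ℝ → ℝ} {U V : ℝ → ℝ → ℝ} {α δ b c x B y m₀ C μ A : ℝ}

/-- The value `U α r` can be brought into `(0, y)` at an earlier time. -/
theorem exists_between (hF : Family n g U V) (hy : 0 < y) {r : ℝ} (hr : 0 ≤ r) (hα : y ≤ α)
    (h : U α r < y) : ∃ s ∈ Icc 0 r, 0 < U α s ∧ U α s < y := by
  obtain ⟨s, hs, hs'⟩ := intermediate_value_Icc' hr (hF.sol α).cu.continuousOn
    (show max (U α r) (y / 2) ∈ Icc (U α r) (U α 0) from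
      ⟨le_max_left _ _, by rw [hF.init]; exact (max_lt h (by linarith)).le.trans hα⟩)
  exact ⟨s, hs, by rw [hs']; exact lt_max_of_lt_right (by linarith),
    by rw [hs']; exact max_lt h (by linarith)⟩

/-- Continuity in α is available only up to times with U α ≠ 0, so the violation is first moved to a
moment with value in (0, y). -/
theorem eventually_not_ge (hF : Family n g U V) (hy : 0 < y) (hα : y ≤ α)
    (h : ¬ ∀ r ∈ Icc 0 C, y ≤ U α r) : ∀ᶠ α' in 𝓝 α, ¬ ∀ r ∈ Icc 0 C, y ≤ U α' r := by
  push Not at h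
  obtain ⟨r, hr, hrα⟩ := h
  obtain ⟨s, hs, hs0, hsy⟩ := hF.exists_between hy hr.1 hα hrα
  filter_upwards [(hF.tendsto_u hs0.ne' ⟨hs.1, le_rfl⟩).eventually (gt_mem_nhds hsy)] with α' h2 h3
  exact (h3 s ⟨hs.1, hs.2.trans hr.2⟩).not_gt h2

theorem lt_B (hF : Family n g U V) (hL : Landscape g δ b c x B) (hα : 0 ≤ α) (hαB : α < B) {r : ℝ}
    (hr : 0 ≤ r) : U α r < B :=
  (abs_lt.1 (hL.abs_lt (hF.sol α) (by rwa [hF.init, abs_of_nonneg hα]) r hr)).2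

theorem v_neg_of_ge (hF : Family n g U V) (hL : Landscape g δ b c x B) (hα : 0 ≤ α) (hαB : α < B)
    {r : ℝ} (hr : 0 < r) (hu : ∀ s ∈ Icc 0 r, x ≤ U α s) : V α r < 0 :=
  (hF.sol α).v_neg_of_g_pos hr fun s hs =>
    hL.g_pos' (hu s ⟨hs.1.le, hs.2.le⟩) (hF.lt_B hL hα hαB hs.1.le)

theorem strictAntiOn_of_ge (hF : Family n g U V) (hL : Landscape g δ b c x B) (hα : 0 ≤ α)
    (hαB : α < B) {r : ℝ} (hu : ∀ s ∈ Icc 0 r, x ≤ U α s) : StrictAntiOn (U α) (Icc 0 r) :=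
  fun _ hp _ hq hpq => (hF.sol α).lt_of_v_neg hpq fun _ hs =>
    hF.v_neg_of_ge hL hα hαB (hp.1.trans_lt hs.1) fun _ ht =>
      hu _ ⟨ht.1, ht.2.trans (hs.2.le.trans hq.2)⟩

/-- While above x the solution decreases strictly, so its minimum on [0, C] is at C. If that value
exceeded y, slightly lower heights would also stay above y, against minimality. -/
theorem eq_at_of_first (hF : Family n g U V) (hL : Landscape g δ b c x B) (hxy : x < y) (hC : 0 < C)
    (hα : y ≤ α) (hαB : α < B) (h : ∀ r ∈ Icc 0 C, y ≤ U α r)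
    (hmin : ∀ α', y ≤ α' → α' < α → ¬ ∀ r ∈ Icc 0 C, y ≤ U α' r) : U α C = y := by
  have hx0 := hL.x_pos
  have hCC : C ∈ Icc 0 C := ⟨hC.le, le_rfl⟩
  have hanti := hF.strictAntiOn_of_ge hL (by linarith) hαB fun s hs => hxy.le.trans (h s hs)
  refine le_antisymm ?_ (h C hCC)
  by_contra! hlt
  have hyα : y < α := by
    have := hanti ⟨le_rfl, hC.le⟩ hCC hC
    rw [hF.init] at this
    linarith
  have hev := hF.near α C (by linarith) (U α C - y) (by linarith)
  obtain ⟨α', h1, h2⟩ := ((hev.filter_mono nhdsWithin_le_nhds).and (Ioo_mem_nhdsLT hyα)).exists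
  refine hmin α' h2.1.le h2.2 fun r hr => ?_
  have h3 := (abs_lt.1 (h1 r hr).1).1
  have h4 := hanti.antitoneOn hr hCC hr.2
  linarith

/-- A solution descends into the well before time `C + A` when a higher one stays at a zero of
`g`. -/
theorem exists_descent_of_zero (hF : Family n g U V) (hL : Landscape g δ b c x B) (hn : 1 ≤ n)
    (hgB : g B = 0) (hxy : x < y) (hyB : y < B) (hm : ∀ s ∈ Icc b x, m₀ ≤ primF g s) (hC0 : 0 < C)
    (hC : 2 * n * (y - b) * √(2 * (primF g y - m₀)) ≤ C * (primF g y - primF g x))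
    (hμ : 0 < μ) (hμg : ∀ s ∈ Icc x y, μ ≤ g s)
    (hA : (x - b) / √(primF g y - primF g x) + √(2 * (n + 1) * (y - x) / μ) ≤ A) :
    ∃ α ∈ Ioo x B, ∃ R > 0, R ≤ C + A ∧ (∀ s ∈ Icc 0 R, b ≤ U α s) ∧ U α R = b ∧ V α R < 0 ∧
      nrg g (U α) (V α) R ≤ primF g B := by
  obtain ⟨G, hG⟩ := hL.bdd
  have hx0 := hL.x_pos
  have hB0 := hL.B_pos
  have hconst : ∀ r ≥ 0, U B r = B := fun r hr => hF.eq_const hn hL.cont hG hL.lip hB0.ne' hgB hr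
  obtain ⟨α₀, h1, h2⟩ : ∃ α₀ ∈ Ioo y B, ∀ r ∈ Icc 0 C, y ≤ U α₀ r := by
    have hev := hF.near B C (by rw [hconst C hC0.le]; exact hB0.ne') (B - y) (by linarith)
    obtain ⟨α', h1, h2⟩ := ((hev.filter_mono nhdsWithin_le_nhds).and (Ioo_mem_nhdsLT hyB)).exists
    refine ⟨α', h2, fun r hr => ?_⟩
    have h3 := (abs_lt.1 (h1 r hr).1).1
    rw [hconst r hr.1] at h3
    linarith
  obtain ⟨α, hα, hP, hmin⟩ := exists_first_of_open h1.1.le h2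
    fun α hα h => hF.eventually_not_ge (hx0.trans hxy) hα h
  have hαB : α < B := hα.2.trans_lt h1.2
  have huC := hF.eq_at_of_first hL hxy hC0 hα.1 hαB hP hmin
  obtain ⟨R, hR1, hR2, hR3, hR4⟩ := hL.exists_crossing (hF.sol α) hxy hyB hm hC0 hC hμ hμg
    (by rwa [hF.init]) huC hP
  have hR0 := hC0.trans hR1
  refine ⟨α, ⟨by linarith [hα.1], hαB⟩, R, hR0, by linarith, fun s hs => ?_, hR3,
    hL.v_neg_of_touch (hF.sol α) hR0 hR4 hR3, ?_⟩
  · rcases eq_or_lt_of_le hs.2 with h3 | h3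
    · rw [h3, hR3]
    · exact (hR4 s hs.1 h3).le
  · refine ((hF.sol α).nrg_le hL.cont le_rfl hR0.le).trans ?_
    simp only [nrg, (hF.sol α).v_nonpos 0 le_rfl, hF.init]
    have := hL.primF_le hL.x_lt.le le_rfl (s := α) (by rw [abs_of_nonneg] <;> linarith [hα.1])
    linarith

/-- A solution that stays above `b` until `C + 1` but gets below `y` has bounded energy. -/
theorem exists_moderate (hF : Family n g U V) (hL : Landscape g δ b c x B) (hxy : x < y)
    (hyB : y < B) (hα : y ≤ α) (hαB : α < B) (hC : 0 ≤ C) (hb : ∀ r ∈ Icc 0 (C + 1), b ≤ U α r)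
    {s : ℝ} (hs : s ∈ Icc 0 C) (hsy : U α s ≤ y) :
    ∃ ξ ∈ Ioo C (C + 1), b ≤ U α ξ ∧ U α ξ ≤ y ∧ |V α ξ| ≤ y - b := by
  have h := hF.sol α
  have hb0 := hL.b_pos
  have hx0 := hL.x_pos
  have hle : ∀ r ∈ Icc s (C + 1), U α r ≤ y := by
    intro r hr
    -- A dip below y before r would contain a stationary minimum with |u| < y, so with energy below
    -- F(y), and the solution could not regain y. Without a dip it is decreasing.
    by_contra! hlt
    have hr0 : 0 ≤ r := hs.1.trans hr.1
    obtain ⟨z, hz, hmin⟩ := isCompact_Icc.exists_isMinOn (nonempty_Icc.2 hr0)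
      h.cu.continuousOn (f := U α)
    rcases lt_or_ge (U α z) y with hzy | hzy
    · have hz0 : 0 < z := lt_of_le_of_ne hz.1 fun h0 => by
        rw [← h0, hF.init] at hzy
        linarith
      have hzr : z < r := lt_of_le_of_ne hz.2 fun h0 => by
        rw [h0] at hzy
        linarith
      have hvz := (hmin.isLocalMin (Icc_mem_nhds hz0 hzr)).hasDerivAt_eq_zero (h.du z)
      have hbz := hb z ⟨hz.1, hz.2.trans hr.2⟩
      have habs : |U α z| < y := by rwa [abs_of_nonneg (by linarith)]
      have h1 := h.abs_lt_of_nrg_lt hL.cont hL.odd hz.1 habs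
        (by simpa [nrg, hvz] using hL.primF_lt hxy hyB.le habs) r hzr.le
      linarith [le_abs_self (U α r)]
    · have h1 := (hF.strictAntiOn_of_ge hL (by linarith) hαB fun t ht =>
        hxy.le.trans (hzy.trans (hmin ht))).antitoneOn ⟨hs.1, hr.1⟩ ⟨hr0, le_rfl⟩ hr.1
      linarith
  obtain ⟨ξ, hξ, hξ'⟩ := h.exists_mvt (by linarith : C < C + 1)
  have h1 := hle C ⟨hs.2, by linarith⟩
  have h2 := hle (C + 1) ⟨by linarith [hs.2], le_rfl⟩
  have h3 := hb C ⟨hC, by linarith⟩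
  have h4 := hb (C + 1) ⟨by linarith, le_rfl⟩
  rw [add_sub_cancel_left, mul_one] at hξ'
  exact ⟨ξ, hξ, hb ξ ⟨hC.trans hξ.1.le, hξ.2.le⟩, hle ξ ⟨hs.2.trans hξ.1.le, hξ.2.le⟩,
    abs_le.2 ⟨by linarith, by linarith⟩⟩

/-- A solution descends into the well before time `C + A` when a higher one has large energy
until `C + 1`. -/
theorem exists_descent_of_large (hF : Family n g U V) (hL : Landscape g δ b c x B)
    (hxy : x < y) (hyB : y < B) (hm : ∀ s ∈ Icc b x, m₀ ≤ primF g s) (hC0 : 0 < C)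
    (hC : 2 * n * (y - b) * √(2 * (primF g y - m₀)) ≤ C * (primF g y - primF g x))
    (hμ : 0 < μ) (hμg : ∀ s ∈ Icc x y, μ ≤ g s)
    (hA : (x - b) / √(primF g y - primF g x) + √(2 * (n + 1) * (y - x) / μ) ≤ A) (hA1 : 1 ≤ A)
    {α₀ : ℝ} (hα₀ : y ≤ α₀) (hα₀B : α₀ < B)
    (hbig : ∀ r ∈ Ioo C (C + 1), y < |U α₀ r| ∨ y - b < |V α₀ r|) :
    ∃ α ∈ Ioc x α₀, ∃ R > 0, R ≤ C + A ∧ (∀ s ∈ Icc 0 R, b ≤ U α s) ∧ U α R = b ∧ V α R < 0 ∧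
      nrg g (U α) (V α) R ≤ primF g y + (y - b) ^ 2 / 2 := by
  have hx0 := hL.x_pos
  have hb0 := hL.b_pos
  have hbx := hL.b_lt.trans hL.c_lt
  set P : ℝ → Prop := fun α => (∀ r ∈ Icc 0 C, y ≤ U α r) ∨ ∃ r ∈ Icc 0 (C + 1), U α r ≤ b with hP
  have hP₀ : P α₀ := by
    by_contra hcon
    simp only [hP, not_or] at hcon
    obtain ⟨h1, h2⟩ := hcon
    push Not at h1 h2
    obtain ⟨s, hs, hsy⟩ := h1
    obtain ⟨ξ, hξ, h3, h4, h5⟩ := hF.exists_moderate hL hxy hyB hα₀ hα₀B hC0.le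
      (fun r hr => (h2 r hr).le) hs hsy.le
    rcases hbig ξ hξ with h6 | h6
    · rw [abs_of_nonneg (by linarith)] at h6
      linarith
    · linarith
  have hopen : ∀ α ≥ y, ¬ P α → ∀ᶠ α' in 𝓝 α, ¬ P α' := by
    intro α hα hPα
    simp only [hP, not_or] at hPα ⊢
    obtain ⟨h1, h2⟩ := hPα
    refine (hF.eventually_not_ge (hx0.trans hxy) hα h1).and ?_
    push Not at h2 ⊢
    have hC1 : (0 : ℝ) ≤ C + 1 := by linarith
    obtain ⟨z, hz, hmin⟩ := isCompact_Icc.exists_isMinOn (nonempty_Icc.2 hC1)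
      (hF.sol α).cu.continuousOn (f := U α)
    have h3 := h2 (C + 1) ⟨hC1, le_rfl⟩
    filter_upwards [hF.near α (C + 1) (by linarith) (U α z - b) (by linarith [h2 z hz])]
      with α' h4 r hr
    have h5 := (abs_lt.1 (h4 r hr).1).1
    have h6 : U α z ≤ U α r := hmin hr
    linarith
  obtain ⟨α, hα, hPα, hfirst⟩ := exists_first_of_open hα₀ hP₀ hopen
  have hαB : α < B := hα.2.trans_lt hα₀B
  have h := hF.sol α
  have hα0 : 0 ≤ α := by linarith [hα.1]
  have hreach : (∃ r ∈ Icc 0 (C + 1), U α r ≤ b) → ∃ R > 0, R ≤ C + 1 ∧ U α R = b ∧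
      ∀ s, 0 ≤ s → s < R → b < U α s := by
    rintro ⟨r, hr, hrb⟩
    obtain ⟨R, h1, h2, h3, h4⟩ := exists_first_zero (φ := fun s => U α s - b)
      (h.cu.sub continuous_const) hr.1 (by rw [hF.init]; linarith [hα.1]) (by simpa using hrb)
    simp only [sub_pos, sub_eq_zero] at h3 h4
    exact ⟨R, h1, h2.trans hr.2, h3, h4⟩
  suffices hsuff : ∃ R > 0, R ≤ C + A ∧ U α R = b ∧ (∀ s, 0 ≤ s → s < R → b < U α s) ∧
      nrg g (U α) (V α) R ≤ primF g y + (y - b) ^ 2 / 2 by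
    obtain ⟨R, hR0, hR1, hR2, hR3, hR4⟩ := hsuff
    refine ⟨α, ⟨by linarith [hα.1], hα.2⟩, R, hR0, hR1, fun s hs => ?_, hR2,
      hL.v_neg_of_touch h hR0 hR3 hR2, hR4⟩
    rcases eq_or_lt_of_le hs.2 with h3 | h3
    · rw [h3, hR2]
    · exact (hR3 s hs.1 h3).le
  rcases eq_or_lt_of_le hα.1 with hyα | hyα
  · have hnot : ¬ ∀ r ∈ Icc 0 C, y ≤ U α r := fun hcon => by
      have h1 := hF.strictAntiOn_of_ge hL hα0 hαB (fun s hs => hxy.le.trans (hcon s hs))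
        ⟨le_rfl, hC0.le⟩ ⟨hC0.le, le_rfl⟩ hC0
      rw [hF.init] at h1
      linarith [hcon C ⟨hC0.le, le_rfl⟩]
    obtain ⟨R, hR0, hR1, hR2, hR3⟩ := hreach (hPα.resolve_left hnot)
    refine ⟨R, hR0, by linarith, hR2, hR3, ?_⟩
    have h1 := h.nrg_le hL.cont le_rfl hR0.le
    simp only [nrg, h.v_nonpos 0 le_rfl, hF.init] at h1 ⊢
    rw [← hyα] at h1 ⊢
    nlinarith [sq_nonneg (y - b)]
  -- A value below b by time C + 1 would be inherited by slightly smaller heights, contradicting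
  -- that α is the first with P.
  · have hbU : ∀ r ∈ Icc 0 (C + 1), b ≤ U α r := by
      intro r hr
      by_contra! hlt
      obtain ⟨s, hs, hs0, hsb⟩ := hF.exists_between hb0 hr.1 (by linarith) hlt
      have hev := (hF.tendsto_u hs0.ne' ⟨hs.1, le_rfl⟩).eventually (gt_mem_nhds hsb)
      obtain ⟨α', h1, h2⟩ :=
        ((hev.filter_mono nhdsWithin_le_nhds).and (Ioo_mem_nhdsLT hyα)).exists
      exact hfirst α' h2.1.le h2.2 (Or.inr ⟨s, ⟨hs.1, hs.2.trans hr.2⟩, h1.le⟩)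
    have hlate : ∀ R > 0, U α R = b → (∀ s, 0 ≤ s → s < R → b < U α s) → C + 1 ≤ R := by
      intro R hR0 hR1 hR2
      by_contra! hlt
      obtain ⟨s, h1, h2, h3⟩ :=
        exists_lt_of_hasDerivAt_neg (h.du R) (hL.v_neg_of_touch h hR0 hR2 hR1) hlt
      linarith [hbU s ⟨(hR0.trans h1).le, h2.le⟩]
    have hbound : (∃ s ∈ Icc 0 C, U α s ≤ y) → ∀ R ≥ C + 1,
        nrg g (U α) (V α) R ≤ primF g y + (y - b) ^ 2 / 2 := by
      rintro ⟨s, hs, hsy⟩ R hR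
      obtain ⟨ξ, hξ, h3, h4, h5⟩ := hF.exists_moderate hL hxy hyB hα.1 hαB hC0.le hbU hs hsy
      refine (h.nrg_le hL.cont (hC0.trans hξ.1).le (hξ.2.le.trans hR)).trans ?_
      have h6 := hL.primF_le hxy.le hyB.le (s := U α ξ) (by rwa [abs_of_nonneg (by linarith)])
      have h7 := sq_le_sq' (by linarith [abs_nonneg (V α ξ)]) h5
      rw [sq_abs] at h7
      unfold nrg
      linarith
    by_cases hge : ∀ r ∈ Icc 0 C, y ≤ U α r
    · have huC := hF.eq_at_of_first hL hxy hC0 hα.1 hαB hge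
        fun α' h1 h2 h3 => hfirst α' h1 h2 (Or.inl h3)
      obtain ⟨R, hR1, hR2, hR3, hR4⟩ := hL.exists_crossing h hxy hyB hm hC0 hC hμ hμg
        (by rwa [hF.init]) huC hge
      have hR0 := hC0.trans hR1
      exact ⟨R, hR0, by linarith, hR3, hR4,
        hbound ⟨C, ⟨hC0.le, le_rfl⟩, huC.le⟩ R (hlate R hR0 hR3 hR4)⟩
    -- Here the contact with b comes no later than C + 1; this is the case for which A ≥ 1 is
    -- needed.
    · obtain ⟨R, hR0, hR1, hR2, hR3⟩ := hreach (hPα.resolve_left hge)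
      push Not at hge
      obtain ⟨s, hs, hsy⟩ := hge
      exact ⟨R, hR0, by linarith, hR2, hR3, hbound ⟨s, hs, hsy.le⟩ R (hlate R hR0 hR2 hR3)⟩

end Family

/-! ### Pohozaev functional and large heights -/

namespace IsSol

variable {n : ℕ} {g u v : ℝ → ℝ}

/-- The Pohozaev functional. -/
noncomputable def pohozaev (n : ℕ) (g u v : ℝ → ℝ) (r : ℝ) : ℝ :=
  2 * r ^ (n + 1) * nrg g u v r + (n - 1) * r ^ n * (u r * v r)

theorem hasDerivAt_pohozaev (hg : Continuous g) (h : IsSol n g u v) {r : ℝ} (hr : 0 < r) :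
    HasDerivAt (pohozaev n g u v) (r ^ n * pohozaevQ (n + 1) g (u r)) r := by
  have h1 := ((hasDerivAt_pow (n + 1) r).const_mul 2).mul (h.hasDerivAt_nrg hg hr)
  have h2 := (((hasDerivAt_pow n r).const_mul ((n : ℝ) - 1)).mul ((h.du r).mul (h.dv r hr)))
  refine (h1.add h2).congr_deriv ?_
  simp only [pohozaevQ, nrg, Pi.mul_apply]
  rcases n with _ | n
  · simp only [Nat.cast_zero, pow_zero, zero_mul]
    field_simp
    push_cast
    ring
  · simp only [Nat.add_sub_cancel]
    push_cast
    field_simp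
    ring

theorem pohozaev_ge (hg : Continuous g) (h : IsSol n g u v) {a r q : ℝ} (ha : 0 ≤ a) (har : a ≤ r)
    (hq : ∀ s ∈ Icc a r, q ≤ pohozaevQ (n + 1) g (u s)) :
    pohozaev n g u v a + q / (n + 1) * (r ^ (n + 1) - a ^ (n + 1)) ≤ pohozaev n g u v r := by
  have h1 : MonotoneOn (fun s => pohozaev n g u v s - q / (n + 1) * s ^ (n + 1)) (Icc a r) := by
    refine monotoneOn_of_hasDerivWithinAt_nonneg (convex_Icc a r) ?_
      (f' := fun s => s ^ n * pohozaevQ (n + 1) g (u s) - q / (n + 1) * ((n + 1 : ℕ) * s ^ n))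
      (fun s hs => ?_) fun s hs => ?_
    · have := h.cu
      have := h.cv
      have := h.continuous_nrg hg
      unfold pohozaev
      fun_prop
    · rw [interior_Icc] at hs
      exact ((h.hasDerivAt_pohozaev hg (ha.trans_lt hs.1)).sub
        ((hasDerivAt_pow (n + 1) s).const_mul _)).hasDerivWithinAt
    · rw [interior_Icc] at hs
      have h2 := hq s ⟨hs.1.le, hs.2.le⟩
      have h3 : q / (n + 1) * ((n + 1 : ℕ) * s ^ n) = s ^ n * q := by
        push_cast
        field_simp
      rw [h3, ← mul_sub]
      have := ha.trans_lt hs.1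
      exact mul_nonneg (by positivity) (by linarith)
  have h2 := h1 ⟨le_rfl, har⟩ ⟨har, le_rfl⟩ har
  simp only at h2
  linarith

theorem v_ge_neg_mul (h : IsSol n g u v) {r G : ℝ} (hr : 0 ≤ r) (hG : 0 ≤ G)
    (hg : ∀ s ∈ Icc 0 r, g (u s) ≤ G) : -(G * r) ≤ v r := by
  rcases eq_or_lt_of_le hr with h0 | hr0
  · rw [← h0, h.v_nonpos 0 le_rfl]
    simp
  have h1 : MonotoneOn (fun s => s ^ n * v s + G * s ^ (n + 1)) (Icc 0 r) := by
    refine monotoneOn_of_hasDerivWithinAt_nonneg (convex_Icc 0 r)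
      (by have := h.cv; fun_prop)
      (f' := fun s => -(s ^ n * g (u s)) + G * ((n + 1 : ℕ) * s ^ n)) (fun s hs => ?_) fun s hs => ?_
    · rw [interior_Icc] at hs
      exact ((h.deriv_flux hs.1).add ((hasDerivAt_pow (n + 1) s).const_mul _)).hasDerivWithinAt
    · rw [interior_Icc] at hs
      have h2 : s ^ n * g (u s) ≤ s ^ n * G := by
        have := hs.1
        gcongr
        exact hg s ⟨hs.1.le, hs.2.le⟩
      have h3 : 0 ≤ G * (n * s ^ n) := by
        have := hs.1
        positivity
      push_cast
      linarith
  have h2 := h1 ⟨le_rfl, hr⟩ ⟨hr, le_rfl⟩ hr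
  simp only [h.v_nonpos 0 le_rfl, mul_zero, zero_add] at h2
  have h3 : 0 ≤ r ^ n * (v r + G * r) := by
    have : r ^ n * (v r + G * r) = r ^ n * v r + G * r ^ (n + 1) := by ring
    rw [this]
    simpa using h2
  have := nonneg_of_mul_nonneg_right h3 (by positivity)
  linarith

/-- Pohozaev's identity makes the functional large once the solution has left `[θ α, α]`. -/
theorem pohozaev_large (hg : Continuous g) (h : IsSol n g u v) {α θ G K q r : ℝ} (hα : 0 < α)
    (hθ1 : θ < 1) (h0 : u 0 = α) (hle : ∀ s ≥ 0, u s ≤ α) (hG0 : 0 < G)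
    (hG : ∀ s ∈ Icc (θ * α) α, g s ≤ G)
    (hK : ∀ s ∈ Icc (θ * α) α, K ≤ pohozaevQ (n + 1) g s * (α / G) ^ (((n + 1 : ℕ) : ℝ) / 2))
    (hK0 : 0 ≤ K) (hq0 : 0 ≤ q) (hq : ∀ s ≥ 0, -q ≤ pohozaevQ (n + 1) g (u s)) (hr : 0 ≤ r)
    (hur : u r < θ * α) :
    (2 * (1 - θ)) ^ (((n + 1 : ℕ) : ℝ) / 2) / (n + 1) * K - q / (n + 1) * r ^ (n + 1) ≤
      pohozaev n g u v r := by
  obtain ⟨t, ht0, htr, htu, htpos⟩ := exists_first_zero (φ := fun s => u s - θ * α)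
    (h.cu.sub continuous_const) hr (by rw [h0]; nlinarith) (by linarith)
  simp only [sub_pos, sub_eq_zero] at htu htpos
  have hge : ∀ s ∈ Icc 0 t, θ * α ≤ u s := fun s hs => by
    rcases eq_or_lt_of_le hs.2 with h1 | h1
    · rw [h1, htu]
    · exact (htpos s hs.1 h1).le
  set p : ℝ := ((n + 1 : ℕ) : ℝ) / 2 with hp
  set X := α / G with hX
  have hX0 : 0 < X := div_pos hα hG0
  have hmem : ∀ s ∈ Icc 0 t, u s ∈ Icc (θ * α) α := fun s hs => ⟨hge s hs, hle s hs.1⟩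
  -- Leaving [θ α, α] takes a time t with t² ≥ 2 (1 - θ) α/G, because the force is at most G there
  -- and so |v| ≤ G s. During this time the functional gathers at least a multiple of K.
  have htX : 2 * (1 - θ) * X ≤ t ^ 2 := by
    have h1 : MonotoneOn (fun s => u s + G / 2 * s ^ 2) (Icc 0 t) := by
      refine monotoneOn_of_hasDerivWithinAt_nonneg (convex_Icc 0 t)
        (by have := h.cu; fun_prop) (f' := fun s => v s + G * s) (fun s hs => ?_) fun s hs => ?_
      · refine ((h.du s).add (((hasDerivAt_id s).pow 2).const_mul
          (G / 2))).hasDerivWithinAt.congr_deriv ?_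
        simp
        ring
      · rw [interior_Icc] at hs
        linarith [h.v_ge_neg_mul hs.1.le hG0.le fun z hz => hG _ (hmem z ⟨hz.1, hz.2.trans hs.2.le⟩)]
    have h2 := h1 ⟨le_rfl, ht0.le⟩ ⟨ht0.le, le_rfl⟩ ht0.le
    simp only [h0, htu] at h2
    rw [hX, mul_div_assoc', div_le_iff₀ hG0]
    nlinarith
  have hQ : ∀ s ∈ Icc 0 t, K / X ^ p ≤ pohozaevQ (n + 1) g (u s) := fun s hs => by
    rw [div_le_iff₀ (Real.rpow_pos_of_pos hX0 p)]
    exact hK _ (hmem s hs)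
  have h1 := h.pohozaev_ge hg le_rfl ht0.le hQ
  have h2 := h.pohozaev_ge hg ht0.le htr fun s hs => hq s (ht0.le.trans hs.1)
  have h3 : pohozaev n g u v 0 = 0 := by simp [pohozaev, h.v_nonpos 0 le_rfl]
  have h4 : (2 * (1 - θ)) ^ p * X ^ p ≤ t ^ (n + 1) := by
    have h5 : (t ^ 2) ^ p = t ^ (n + 1) := by
      rw [← Real.rpow_natCast t 2, ← Real.rpow_mul ht0.le, ← Real.rpow_natCast t (n + 1), hp]
      congr 1
      push_cast
      ring
    rw [← Real.mul_rpow (by linarith) hX0.le, ← h5]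
    exact Real.rpow_le_rpow (mul_nonneg (by linarith) hX0.le) htX (by positivity)
  have h5 : (2 * (1 - θ)) ^ p / (n + 1) * K ≤ K / X ^ p / (n + 1) * (t ^ (n + 1) - 0 ^ (n + 1)) := by
    have hXp := Real.rpow_pos_of_pos hX0 p
    rw [zero_pow (Nat.succ_ne_zero n), sub_zero]
    have h6 : (2 * (1 - θ)) ^ p / (n + 1) * K =
        K / X ^ p / (n + 1) * ((2 * (1 - θ)) ^ p * X ^ p) := by
      field_simp
    rw [h6]
    gcongr
  have h6 : 0 ≤ q / (n + 1) * t ^ (n + 1) := by positivity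
  have h7 : -q / (n + 1) * (r ^ (n + 1) - t ^ (n + 1)) =
      q / (n + 1) * t ^ (n + 1) - q / (n + 1) * r ^ (n + 1) := by ring
  linarith

end IsSol

namespace Landscape

variable {g u v : ℝ → ℝ} {δ b c x B : ℝ} {n : ℕ}

theorem abs_le_init (hL : Landscape g δ b c x B) (h : IsSol n g u v) (h0 : x ≤ u 0) (h0B : u 0 < B) :
    ∀ r ≥ 0, |u r| ≤ u 0 := by
  intro r hr
  by_contra! hlt
  have hx0 := hL.x_pos
  have h1 := hL.abs_lt h (by rwa [abs_of_nonneg (by linarith)]) r hr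
  have h2 := hL.primF_lt (s := u 0) (h0.trans_lt hlt) h1.le (by rwa [abs_of_nonneg (by linarith)])
  have h3 := h.nrg_le hL.cont le_rfl hr
  simp only [nrg, h.v_nonpos 0 le_rfl] at h3
  rw [primF_abs hL.odd] at h2
  nlinarith [sq_nonneg (v r)]

/-- A solution without sign changes loses its energy down to the level of the largest hump. -/
theorem exists_nrg_le (hL : Landscape g δ b c x B) (h : IsSol n g u v) (h0 : u 0 ≠ 0)
    (h0B : |u 0| < B) {m : ℕ} (hm : ¬ HasSignChangesAtLeast u m) {y : ℝ} (hxy : x < y)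
    (hyB : y < B) : ∃ r > 0, nrg g u v r ≤ primF g y := by
  have hx0 := hL.x_pos
  have hFxy : primF g x < primF g y := hL.strictMonoOn ⟨le_rfl, hL.x_lt.le⟩ ⟨hxy.le, hyB.le⟩ hxy
  have key : ∀ u v : ℝ → ℝ, IsSol n g u v → |u 0| < B → ∀ R > 0, (∀ r ≥ R, 0 ≤ u r) →
      ∃ r > 0, nrg g u v r ≤ primF g y := by
    intro u v h h0B R hR hpos
    by_contra! hE
    have hlt : ∀ r ≥ R, u r < B := fun r hr => (lt_of_abs_lt (hL.abs_lt h h0B r (hR.le.trans hr)))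
    -- A positive tail with E > F(y) has only maxima as stationary points, so it is eventually
    -- monotone. Its limit l would satisfy F(l) ≥ F(y), hence lie beyond x, where g has no zero
    -- below B.
    have hturn : ∀ r ≥ R, v r = 0 → 0 < g (u r) := by
      intro r hr hv
      have h1 : primF g y < primF g (u r) := by simpa [nrg, hv] using hE r (hR.trans_le hr)
      refine hL.g_pos' ?_ (hlt r hr)
      by_contra! h2
      have := hL.primF_le hxy.le hyB.le (s := u r) (by rw [abs_of_nonneg (hpos r hr)]; linarith)
      linarith
    have hlim : ∀ l, 0 ≤ l → l ≤ B → Tendsto u atTop (𝓝 l) → False := by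
      intro l hl0 hlB hl
      obtain ⟨h1, h2⟩ := h.limit hL.cont hl
      have h3 : primF g y ≤ primF g l := ge_of_tendsto h2 (by
        filter_upwards [eventually_gt_atTop 0] with r hr using (hE r hr).le)
      have h4 : primF g l ≤ primF g (u 0) := by
        refine le_of_tendsto h2 ?_
        filter_upwards [eventually_ge_atTop 0] with r hr
        have := h.nrg_le hL.cont le_rfl hr
        simpa [nrg, h.v_nonpos 0 le_rfl] using this
      have h5 := hL.primF_lt hL.x_lt le_rfl h0B
      have hlB' : l < B := lt_of_le_of_ne hlB fun heq => by rw [heq] at h4; linarith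
      have hxl : x ≤ l := by
        by_contra! h6
        linarith [hL.primF_le_x l ⟨hl0, h6.le⟩]
      exact (hL.g_pos' hxl hlB').ne' h1
    by_cases hex : ∃ r₀ ≥ R, v r₀ ≤ 0
    · obtain ⟨r₀, hr₀, hv₀⟩ := hex
      have hv : ∀ r ≥ r₀, v r ≤ 0 := by
        intro r hr
        by_contra! hvr
        obtain ⟨z, hz1, hz2, hz3, hz4⟩ := exists_last_zero h.cv hr hv₀ hvr
        have hzR := hr₀.trans hz1
        have h1 := h.dv z (hR.trans_le hzR)
        rw [hz3, mul_zero, zero_sub] at h1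
        obtain ⟨w, hw1, hw2⟩ := ((eventually_neg_of_hasDerivAt_neg h1
          (neg_lt_zero.2 (hturn z hzR hz3)) hz3).and (Ioo_mem_nhdsGT hz2)).exists
        exact hw1.not_gt (hz4 w hw2.1 hw2.2.le)
      obtain ⟨l, hl, hl0, hl1⟩ := h.exists_limit_of_antitone (R := r₀) (m := 0) hv
        fun r hr => hpos r (hr₀.trans hr)
      exact hlim l hl0 ((hl1 r₀ le_rfl).trans (hlt r₀ hr₀).le) hl
    · push Not at hex
      obtain ⟨l, hl, hl0, hl1⟩ := h.exists_limit_of_monotone (R := R) (m := B)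
        (fun r hr => (hex r hr).le) fun r hr => (hlt r hr).le
      exact hlim l ((hpos R le_rfl).trans (hl1 R le_rfl)) hl0 hl
  obtain ⟨R, hR, hRne, htail⟩ := exists_tail_sign h.cu h0 fun hcon => hm (hcon.mono (Nat.le_succ m))
  rcases lt_or_gt_of_ne hRne with h1 | h1
  · obtain ⟨r, hr, hE⟩ := key _ _ (h.neg hL.odd) (by rwa [abs_neg]) R hR fun r hr => by
      have := htail r hr
      have := nonpos_of_mul_nonneg_left this h1
      linarith
    exact ⟨r, hr, by rwa [nrg_neg hL.odd] at hE⟩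
  · exact key u v h h0B R hR fun r hr => nonneg_of_mul_nonneg_left (htail r hr) h1

/-- Solutions with much energy at time `R₀` have many sign changes. -/
theorem hasSignChangesAtLeast_of_nrg (hL : Landscape g δ b c x B) (h : IsSol n g u v)
    (h0 : u 0 ≠ 0) (h0B : |u 0| < B) {y z Y R₀ F₀ : ℝ} (hxy : x < y) (hyz : y < z) (hzY : z < Y)
    (hYB : Y ≤ B) (hR₀ : 0 < R₀) (hF₀ : ∀ s ∈ Icc 0 Y, -F₀ < primF g s) (m : ℕ)
    (hloss : √(primF g y + F₀) <
      √(primF g z + F₀) - n / (√2 * R₀) * (2 * Y) * (m + 2))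
    (hE : primF g z < nrg g u v R₀) : HasSignChangesAtLeast u m := by
  by_contra hm
  have hx0 := hL.x_pos
  have hyB : y < B := by linarith
  have hY : 0 < Y := by linarith
  obtain ⟨r, hr, hEr⟩ := hL.exists_nrg_le h h0 h0B hm (hxy.trans hyz) (hzY.trans_le hYB)
  have hRr : R₀ < r := by
    by_contra! hcon
    linarith [h.nrg_le hL.cont hr.le hcon]
  -- The clock restarts when the energy has dropped to exactly F(z). Since R ≥ R₀ the friction is
  -- small, and since F(z) < F(Y) the oscillations remain inside [-Y, Y].
  obtain ⟨R, hR, hRE⟩ := intermediate_value_Icc' hRr.le (h.continuous_nrg hL.cont).continuousOn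
    (show primF g z ∈ Icc (nrg g u v r) (nrg g u v R₀) from ⟨hEr, hE.le⟩)
  have hzB := hL.abs_lt h h0B R (hR₀.le.trans hR.1)
  have huR : |u R| < Y := by
    by_contra! hcon
    have h1 := hL.primF_lt (s := z) (by linarith : x < |u R|) hzB.le
      (by rw [abs_of_nonneg (by linarith)]; linarith)
    rw [primF_abs hL.odd] at h1
    linarith [primF_le_nrg g u v R]
  have hEY : nrg g u v R < primF g Y := by
    rw [hRE]
    exact hL.strictMonoOn ⟨by linarith, by linarith⟩ ⟨by linarith, hYB⟩ hzY
  have hdich : ∀ s, 0 ≤ s → s < Y → primF g s ≤ primF g y ∨ 0 < g s := by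
    intro s hs hsY
    rcases le_total s y with h1 | h1
    · exact Or.inl (hL.primF_le hxy.le hyB.le (by rwa [abs_of_nonneg hs]))
    · exact Or.inr (hL.g_pos' (hxy.le.trans h1) (hsY.trans_le hYB))
  have hFy : 0 ≤ primF g y :=
    (hL.primF_x.trans (hL.strictMonoOn ⟨le_rfl, hL.x_lt.le⟩ ⟨hxy.le, hyB.le⟩ hxy)).le
  have hκ : 0 ≤ (n : ℝ) / (√2 * R₀) * (2 * Y) := by positivity
  have hκm : 0 ≤ (n : ℝ) / (√2 * R₀) * (2 * Y) * m := by positivity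
  obtain ⟨p, hp1, hp2, hp3, hp4⟩ := h.exists_zero_of_nrg hL.cont hL.odd hR₀ hR.1 huR hEY hF₀ hdich
    hFy (by rw [hRE]; linarith)
  rw [hRE] at hp4
  obtain ⟨ρ, hρ0, hρ1, hρ2, -⟩ := h.exists_swings hL.cont hL.odd hR₀ hY hF₀ hdich m p
    (hR.1.trans hp1) hp2 hp3 ((h.nrg_le hL.cont (hR₀.le.trans hR.1) hp1).trans_lt hEY)
    (by linarith)
  exact hm (hasSignChangesAtLeast_iff.2
    ⟨ρ m, ρ, ((hR₀.trans_le (hR.1.trans hp1)).trans hρ0), le_rfl, hρ1, hρ2⟩)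

end Landscape

section

variable {n : ℕ} {f : ℝ → ℝ} {δ : ℝ} {M : ℕ} {γ : ℕ → ℝ} {β₁ βs B : ℝ}

theorem pohozaevQ_truncation (N : ℕ) {s : ℝ} (h : |s| ≤ B) :
    pohozaevQ N (truncation f B) s = pohozaevQ N f s := by
  rw [pohozaevQ, pohozaevQ, primF_truncation h, truncation_of_mem h]

namespace NonlinearityAssumptions

theorem odd_of_top {N : ℕ} (hf : NonlinearityAssumptions N f ⊤ δ) (s : ℝ) : f (-s) = -f s :=
  hf.odd s (show ((|s| : ℝ) : EReal) ≤ ⊤ from le_top)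

theorem pohozaevQ_neg_of_top {N : ℕ} (hf : NonlinearityAssumptions N f ⊤ δ) (s : ℝ) :
    pohozaevQ N f (-s) = pohozaevQ N f s := by
  rw [pohozaevQ, pohozaevQ, _root_.primF_neg hf.odd_of_top, hf.odd_of_top]
  ring

/-- Subcriticality with constant 1 makes Q nonnegative for large s, Q is even, and a continuous
function is bounded on the remaining compact interval. -/
theorem exists_pohozaevQ_ge {N : ℕ} (hf : NonlinearityAssumptions N f ⊤ δ) {a : ℝ}
    (hpos : ∀ s, a ≤ s → 0 < f s) : ∃ q ≥ 0, ∀ s, -q ≤ pohozaevQ N f s := by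
  obtain ⟨θ, hθ0, hθ1, hK⟩ := hf.subcritical rfl
  obtain ⟨S, hS⟩ := eventually_atTop.1 (((hK 1).and (eventually_ge_atTop a)).and
    (eventually_ge_atTop 0))
  have hcF := continuous_primF hf.continuous_of_top
  have hcf := hf.continuous_of_top
  have hcQ : Continuous (pohozaevQ N f) := by
    unfold pohozaevQ
    fun_prop
  obtain ⟨q, hq⟩ := isCompact_Icc.exists_bound_of_continuousOn (s := Icc (-S) S) hcQ.continuousOn
  have hlarge : ∀ s ≥ S, 0 ≤ pohozaevQ N f s := by
    intro s hs
    obtain ⟨⟨h1, h2⟩, h3⟩ := hS s hs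
    have hmem : s ∈ Icc (θ * s) s := ⟨by nlinarith, le_rfl⟩
    have h4 := h1 s hmem s hmem
    by_contra! h5
    have h6 : 0 ≤ (s / f s) ^ ((N : ℝ) / 2) := Real.rpow_nonneg (div_nonneg h3 (hpos s h2).le) _
    nlinarith [mul_nonpos_of_nonpos_of_nonneg h5.le h6]
  refine ⟨max q 0, le_max_right _ _, fun s => ?_⟩
  rcases le_or_gt |s| S with h | h
  · have := hq s (abs_le.1 h)
    rw [Real.norm_eq_abs] at this
    linarith [neg_abs_le (pohozaevQ N f s), le_max_left q 0]
  · have h1 : pohozaevQ N f s = pohozaevQ N f |s| := by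
      rcases abs_choice s with h2 | h2
      · rw [h2]
      · rw [h2, hf.pohozaevQ_neg_of_top]
    rw [h1]
    linarith [hlarge _ h.le, le_max_right q 0]

/-- Solutions from large heights have large position or velocity for a long time. -/
theorem exists_height (hf : NonlinearityAssumptions (n + 1) f ⊤ δ) (hn : 1 ≤ n)
    (hγ : IsRecordMaxima f ⊤ M γ)
    (hβ₁ : IsGreatest {s : ℝ | 0 < s ∧ s < γ 1 ∧ primF f s = 0} β₁)
    (hβs : IsGreatest {s : ℝ | γ M < s ∧ (s : EReal) < ⊤ ∧ primF f s = primF f (γ M)} βs)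
    {R W : ℝ} (hR : 0 < R) (hW : 0 ≤ W) :
    ∃ α₀ > βs, ∀ α ≥ α₀, ∀ B > α, ∀ u v, IsSol n (truncation f B) u v → u 0 = α →
      ∀ r ∈ Ioc 0 R, W < |u r| ∨ W < |v r| := by
  have hcf := hf.continuous_of_top
  have hpos : ∀ s, βs ≤ s → 0 < f s := fun s => hf.pos_of_top hγ hβ₁ hβs
  obtain ⟨q, hq0, hq⟩ := hf.exists_pohozaevQ_ge hpos
  obtain ⟨θ, hθ0, hθ1, hK⟩ := hf.subcritical rfl
  obtain ⟨Fm, hFm⟩ := isCompact_Icc.exists_bound_of_continuousOn (s := Icc (-W) W)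
    (continuous_primF hcf).continuousOn
  have hFm0 : 0 ≤ Fm := (norm_nonneg _).trans (hFm 0 ⟨by linarith, hW⟩)
  have hn1 : (1 : ℝ) ≤ n := by exact_mod_cast hn
  set p : ℝ := ((n + 1 : ℕ) : ℝ) / 2 with hp
  set c := (2 * (1 - θ)) ^ p / (n + 1) with hc
  have hc0 : 0 < c := div_pos (Real.rpow_pos_of_pos (by linarith) _) (by positivity)
  -- This bounds the functional at times r ≤ R when |u| and |v| are at most W; K is chosen so that
  -- `pohozaev_large` exceeds it by 1.
  set D := 2 * R ^ (n + 1) * (W ^ 2 / 2 + Fm) + n * R ^ n * W ^ 2 with hD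
  have hD0 : 0 ≤ D := by positivity
  set K := (D + q / (n + 1) * R ^ (n + 1) + 1) / c with hKdef
  have hK0 : 0 ≤ K := by positivity
  have hcK : c * K = D + q / (n + 1) * R ^ (n + 1) + 1 := by
    rw [hKdef]
    field_simp
  obtain ⟨α₁, hα₁⟩ := eventually_atTop.1 (((hK K).and
    (eventually_gt_atTop (max (W / θ) (βs / θ)))).and (eventually_gt_atTop (max βs 0)))
  refine ⟨max α₁ (βs + 1), lt_max_of_lt_right (by linarith), fun α hα B hB u v h h0 r hr => ?_⟩
  obtain ⟨⟨h1, h2⟩, h3⟩ := hα₁ α ((le_max_left _ _).trans hα)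
  have hαs : βs < α := (le_max_left _ _).trans_lt h3
  have hα0 : 0 < α := (le_max_right _ _).trans_lt h3
  have hθW : W < θ * α := by
    have := (le_max_left (W / θ) (βs / θ)).trans_lt h2
    rw [div_lt_iff₀ hθ0] at this
    linarith
  have hθs : βs < θ * α := by
    have := (le_max_right (W / θ) (βs / θ)).trans_lt h2
    rw [div_lt_iff₀ hθ0] at this
    linarith
  have hsB : βs < B := hαs.trans hB
  have hL := hf.landscape hγ hβ₁ hβs hsB le_top (hf.primF_lt_of_top hβs hsB)
  have huα : ∀ r ≥ 0, |u r| ≤ α := by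
    have := hL.abs_le_init h (by rw [h0]; exact hαs.le) (by rw [h0]; exact hB)
    rwa [h0] at this
  have hθα : θ * α ≤ α := by nlinarith
  -- The maximum of f on [θ α, α] is the force bound G, and s₁ is the point to which the
  -- subcriticality condition is applied.
  obtain ⟨s₁, hs₁, hmax⟩ := isCompact_Icc.exists_isMaxOn (nonempty_Icc.2 hθα)
    hcf.continuousOn (f := f)
  have habs : ∀ s ∈ Icc (θ * α) α, |s| ≤ B := fun s hs => by
    rw [abs_of_nonneg (by linarith [hL.x_pos, hs.1])]
    linarith [hs.2]
  by_contra! hcon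
  have hur : u r < θ * α := (le_abs_self _).trans_lt (hcon.1.trans_lt hθW)
  have hlow := h.pohozaev_large hL.cont (α := α) (θ := θ) (G := f s₁) (K := K) (q := q) (r := r)
    hα0 hθ1 h0 (fun s hs => (le_abs_self _).trans (huα s hs))
    (hpos s₁ (hθs.le.trans hs₁.1)) (fun s hs => by
      rw [truncation_of_mem (habs s hs)]
      exact hmax hs) (fun s hs => by
      rw [pohozaevQ_truncation _ (habs s hs)]
      exact h1 s₁ hs₁ s hs) hK0 hq0 (fun s hs => by
      rw [pohozaevQ_truncation _ ((huα s hs).trans hB.le)]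
      exact hq _) hr.1.le hur
  rw [← hp, ← hc, hcK] at hlow
  have hr0 := hr.1
  have e1 : q / (n + 1) * r ^ (n + 1) ≤ q / (n + 1) * R ^ (n + 1) := by
    gcongr
    exact hr.2
  have e2 : nrg (truncation f B) u v r ≤ W ^ 2 / 2 + Fm := by
    have h4 := hFm (u r) (abs_le.1 hcon.1)
    rw [Real.norm_eq_abs] at h4
    have h5 := sq_le_sq' (by linarith [abs_nonneg (v r)]) hcon.2
    rw [sq_abs] at h5
    rw [nrg, primF_truncation ((huα r hr0.le).trans hB.le)]
    linarith [le_abs_self (primF f (u r))]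
  have e3 : 2 * r ^ (n + 1) * nrg (truncation f B) u v r ≤ 2 * R ^ (n + 1) * (W ^ 2 / 2 + Fm) := by
    refine (mul_le_mul_of_nonneg_left e2 (by positivity)).trans ?_
    gcongr
    exact hr.2
  have e4 : ((n : ℝ) - 1) * r ^ n * (u r * v r) ≤ n * R ^ n * W ^ 2 := by
    have h4 : u r * v r ≤ W ^ 2 := by
      refine (le_abs_self _).trans ?_
      rw [abs_mul, sq]
      exact mul_le_mul hcon.1 hcon.2 (abs_nonneg _) hW
    have h5 : 0 ≤ ((n : ℝ) - 1) * r ^ n := mul_nonneg (by linarith) (by positivity)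
    refine (mul_le_mul_of_nonneg_left h4 h5).trans ?_
    gcongr
    · linarith
    · exact hr.2
  unfold IsSol.pohozaev at hlow
  linarith

/-- Solutions from large heights have many sign changes. -/
theorem exists_height_of_signChanges (hf : NonlinearityAssumptions (n + 1) f ⊤ δ) (hn : 1 ≤ n)
    (hγ : IsRecordMaxima f ⊤ M γ)
    (hβ₁ : IsGreatest {s : ℝ | 0 < s ∧ s < γ 1 ∧ primF f s = 0} β₁)
    (hβs : IsGreatest {s : ℝ | γ M < s ∧ (s : EReal) < ⊤ ∧ primF f s = primF f (γ M)} βs)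
    (m : ℕ) : ∃ α₀ > βs, ∀ α ≥ α₀, ∀ B > α, ∀ u v, IsSol n (truncation f B) u v → u 0 = α →
      HasSignChangesAtLeast u m := by
  have hcf := hf.continuous_of_top
  set Y := βs + 3 with hY
  obtain ⟨F₁, hF₁⟩ := isCompact_Icc.exists_bound_of_continuousOn (s := Icc 0 Y)
    (continuous_primF hcf).continuousOn
  have hLY := hf.landscape hγ hβ₁ hβs (by linarith : βs < Y) le_top
    (hf.primF_lt_of_top hβs (by linarith))
  have hx0 := hLY.x_pos
  have hF₁0 : 0 ≤ F₁ := (norm_nonneg _).trans (hF₁ 0 ⟨le_rfl, by linarith⟩)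
  have hFY : ∀ s, 0 ≤ s → s ≤ Y → primF (truncation f Y) s = primF f s := fun s h1 h2 =>
    primF_truncation (by rwa [abs_of_nonneg h1])
  set F₀ := F₁ + 1 with hF₀
  have hF₀' : ∀ s ∈ Icc 0 Y, -F₀ < primF f s := fun s hs => by
    have := hF₁ s hs
    rw [Real.norm_eq_abs] at this
    linarith [neg_abs_le (primF f s)]
  have hyz : primF f (βs + 1) < primF f (βs + 2) := by
    have := hLY.primF_lt (s := βs + 1) (y := βs + 2) (by linarith) (by linarith)
      (by rw [abs_of_nonneg] <;> linarith)
    rwa [hFY _ (by linarith) (by linarith), hFY _ (by linarith) (by linarith)] at this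
  have hxy : 0 < primF f (βs + 1) := by
    have h1 := hLY.lt_primF (s := βs + 1) (by linarith) (by linarith)
    have h2 := hLY.primF_x
    rw [hFY (βs + 1) (by linarith) (by linarith)] at h1
    linarith
  have hsq : √(primF f (βs + 1) + F₀) < √(primF f (βs + 2) + F₀) :=
    Real.sqrt_lt_sqrt (by linarith) (by linarith)
  obtain ⟨R₀, hR₀, hloss⟩ : ∃ R₀ > 0, √(primF f (βs + 1) + F₀) <
      √(primF f (βs + 2) + F₀) - n / (√2 * R₀) * (2 * Y) * (m + 2) := by
    have h1 : Tendsto (fun r : ℝ => n / (√2 * r) * (2 * Y) * (m + 2)) atTop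
        (𝓝 (0 * (2 * Y) * (m + 2))) :=
      ((tendsto_const_nhds.div_atTop (tendsto_id.const_mul_atTop (by positivity))).mul_const
        _).mul_const _
    rw [zero_mul, zero_mul] at h1
    have h2 := (tendsto_const_nhds (x := √(primF f (βs + 2) + F₀))).sub h1
    rw [sub_zero] at h2
    obtain ⟨r, h3, h4⟩ := ((h2.eventually (lt_mem_nhds hsq)).and (eventually_gt_atTop 0)).exists
    exact ⟨r, h4, h3⟩
  -- Either alternative at time R₀ now forces energy above F(βs + 2): a large position through F, a
  -- large velocity because v²/2 outweighs the lower bound -F₀.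
  set W := max (βs + 2) (2 * (primF f (βs + 2) + F₀) + 1) with hWdef
  obtain ⟨α₀, hα₀, hbig⟩ := hf.exists_height hn hγ hβ₁ hβs hR₀ (W := W)
    (le_max_of_le_left (by linarith))
  refine ⟨max α₀ Y, lt_max_of_lt_left hα₀, fun α hα B hB u v h h0 => ?_⟩
  have hαY : Y ≤ α := (le_max_right _ _).trans hα
  have hL := hf.landscape hγ hβ₁ hβs (by linarith : βs < B) le_top
    (hf.primF_lt_of_top hβs (by linarith))
  have hF : ∀ s, 0 ≤ s → s ≤ Y → primF (truncation f B) s = primF f s := fun s h1 h2 =>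
    primF_truncation (by rw [abs_of_nonneg h1]; linarith)
  have h0B : |u 0| < B := by rw [h0, abs_of_nonneg (by linarith)]; exact hB
  refine hL.hasSignChangesAtLeast_of_nrg h (by rw [h0]; linarith) h0B (y := βs + 1)
    (z := βs + 2) (Y := Y) (F₀ := F₀) (by linarith) (by linarith) (by linarith) (by linarith) hR₀
    (fun s hs => by rw [hF s hs.1 hs.2]; exact hF₀' s hs) m ?_ ?_
  · rwa [hF _ (by linarith) (by linarith), hF _ (by linarith) (by linarith)]
  · have huB := hL.abs_lt h h0B R₀ hR₀.le
    rcases hbig α ((le_max_left _ _).trans hα) B hB u v h h0 R₀ ⟨hR₀, le_rfl⟩ with h1 | h1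
    · have h2 := (le_max_left _ _).trans_lt h1
      have h3 := hL.primF_lt (s := βs + 2) (by linarith : βs < |u R₀|) huB.le
        (by rwa [abs_of_nonneg (by linarith)])
      rw [primF_abs hL.odd] at h3
      exact h3.trans_le (primF_le_nrg _ u v R₀)
    · have h2 := (le_max_right _ _).trans_lt h1
      have h3 : -F₀ < primF (truncation f B) (u R₀) := by
        rw [← primF_abs hL.odd]
        rcases le_total |u R₀| Y with h4 | h4
        · rw [hF _ (abs_nonneg _) h4]
          exact hF₀' _ ⟨abs_nonneg _, h4⟩
        · have h5 := hL.primF_le (s := βs) (by linarith : βs ≤ |u R₀|) huB.le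
            (by rw [abs_of_nonneg hx0.le]; linarith)
          linarith [hL.primF_x]
      rw [hF _ (by linarith) (by linarith), nrg]
      have h6 : |v R₀| ^ 2 = v R₀ ^ 2 := sq_abs _
      nlinarith

end NonlinearityAssumptions

end

/-! ### Two bound states and the main theorem -/

namespace Family

variable {n : ℕ} {g : ℝ → ℝ} {U V : ℝ → ℝ → ℝ} {α δ b c x B Fb : ℝ}

theorem abs_le_B (hF : Family n g U V) (hL : Landscape g δ b c x B) (hα : x ≤ α) (hαB : α < B)
    {r : ℝ} (hr : 0 ≤ r) : |U α r| ≤ B := by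
  have := hL.abs_le_init (hF.sol α) (by rwa [hF.init]) (by rwa [hF.init]) r hr
  rw [hF.init] at this
  exact this.trans hαB.le

/-- The solution starting at `x` never falls back over the hump at the same level. -/
theorem lt_of_init_eq (hF : Family n g U V) (hL : Landscape g δ b c x B) (hn : 1 ≤ n) {z : ℝ}
    (hzx : z < x) (hFz : primF g z = primF g x) {r : ℝ} (hr : 0 ≤ r) :
    z < U x r := by
  have h := hF.sol x
  have hx0 := hL.x_pos
  have hE0 : nrg g (U x) (V x) 0 = primF g x := by simp [nrg, h.v_nonpos 0 le_rfl, hF.init]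
  by_contra! hle
  obtain ⟨t, ht0, -, ht, -⟩ := exists_first_zero (φ := fun s => U x s - z)
    (h.cu.sub continuous_const) hr (by rw [hF.init]; linarith) (by linarith)
  rw [sub_eq_zero] at ht
  have h1 := h.eq_of_nrg_le hn hL.cont le_rfl (b := t) (by
    rw [hE0, ← hFz, ← ht]
    exact primF_le_nrg g _ _ t) t ⟨ht0.le, le_rfl⟩
  rw [hF.init] at h1
  linarith

/-- Two bound states, starting below and above a height from which solutions fall into the
well. -/
theorem exists_pair (hF : Family n g U V) (hL : Landscape g δ b c x B) (hn : 1 ≤ n)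
    (hFb : ∀ s ∈ Icc 0 b, -Fb ≤ primF g s) {z : ℝ} (hcz : c ≤ z) (hzx : z < x)
    (hFz : primF g z = primF g x) {R Em : ℝ} (hxα : x < α) (hR : 0 < R)
    (hge : ∀ s ∈ Icc 0 R, b ≤ U α s) (hu : U α R = b) (hv : V α R < 0)
    (hE : nrg g (U α) (V α) R ≤ Em)
    (hdis : R * Em < dissip n Em Fb * absPot g b) {k : ℕ} {α₁ : ℝ} (hα₁ : α < α₁) (hα₁B : α₁ ≤ B)
    (h1 : HasSignChangesAtLeast (U α₁) (k + 1) ∨ (g α₁ = 0)) :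
    ∃ α' ∈ Ioo x α, ∃ α'' ∈ Ioo α α₁, (Tendsto (U α') atTop (𝓝 0) ∧
      HasExactlySignChanges (U α') k) ∧ Tendsto (U α'') atTop (𝓝 0) ∧
      HasExactlySignChanges (U α'') k := by
  have hW := hL.well hFb
  have hx0 := hL.x_pos
  have hbc := hL.b_lt
  have hcx := hL.c_lt
  obtain ⟨G, hG⟩ := hL.bdd
  have hpos : 0 < nrg g (U α) (V α) R := by
    rw [nrg, hu, hL.primF_b, add_zero]
    have := sq_pos_of_neg hv
    positivity
  have hev := hF.eventually_of_descent hW hn hR hge hu hv hE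
    (by linarith [hW.Fb_nonneg]) ((mul_le_mul_of_nonneg_left hE hR.le).trans_lt hdis)
  -- Both paths are straight segments starting at the settling height α. One leads down to x and one
  -- up to α₁, so the initial values found lie on different sides of α.
  have hpath : ∀ a : ℝ, Continuous fun t : ℝ => α + t * (a - α) := fun a => by fun_prop
  have key : ∀ a : ℝ, x ≤ a → a ≤ B →
      ((∀ᶠ α in 𝓝 a, HasSignChangesAtLeast (U α) (k + 1)) ∨
        (Stuck ((b + c) / 2) (U a) ∧ ¬ HasSignChangesAtLeast (U a) 1)) →
      ∃ t ∈ Ioo (0 : ℝ) 1, Tendsto (U (α + t * (a - α))) atTop (𝓝 0) ∧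
        HasExactlySignChanges (U (α + t * (a - α))) k := by
    intro a hxa haB ha
    have hαB : α < B := hα₁.trans_le hα₁B
    refine hF.exists_bound_states hW hn (hpath a) (fun t ht => ⟨?_, ?_⟩) (fun t ht r hr => ?_)
      (by simpa using hev) (by simpa using ha) k le_rfl
    · nlinarith [ht.1, ht.2, mul_nonneg ht.1 (sub_nonneg.2 hxa),
        mul_nonneg (sub_nonneg.2 ht.2) (sub_nonneg.2 hxα.le)]
    · nlinarith [ht.1, ht.2, mul_nonneg ht.1 (sub_nonneg.2 haB),
        mul_nonneg (sub_nonneg.2 ht.2) (sub_nonneg.2 hαB.le)]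
    · refine hF.abs_le_B hL ?_ ?_ hr
      · nlinarith [ht.1, ht.2, mul_nonneg ht.1.le (sub_nonneg.2 hxa),
          mul_nonneg (sub_nonneg.2 ht.2.le) (sub_nonneg.2 hxα.le)]
      · nlinarith [ht.1, ht.2, mul_nonneg ht.1.le (sub_nonneg.2 haB),
          mul_pos (sub_pos.2 ht.2) (sub_pos.2 hαB)]
  obtain ⟨t, ht, ht'⟩ := key x le_rfl hL.x_lt.le (Or.inr ⟨⟨0, fun r hr => by
      have := hF.lt_of_init_eq hL hn hzx hFz hr
      exact (by linarith : (b + c) / 2 < U x r).trans_le (le_abs_self _)⟩,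
    not_hasSignChangesAtLeast_one_of_pos fun r hr => by
      have := hF.lt_of_init_eq hL hn hzx hFz hr.le
      linarith [hL.b_pos]⟩)
  obtain ⟨s, hs, hs'⟩ := key α₁ (hxα.trans hα₁).le hα₁B (by
    refine h1.imp (fun h => hF.eventually_hasSignChangesAtLeast h) fun h => ?_
    have hc : ∀ r ≥ 0, U α₁ r = α₁ := fun r hr =>
      hF.eq_const hn hL.cont hG hL.lip (by linarith) h hr
    refine ⟨⟨0, fun r hr => ?_⟩, not_hasSignChangesAtLeast_one_of_pos fun r hr => ?_⟩
    · rw [hc r hr]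
      exact (by linarith : (b + c) / 2 < α₁).trans_le (le_abs_self _)
    · rw [hc r hr.le]
      linarith)
  refine ⟨_, ⟨?_, ?_⟩, _, ⟨?_, ?_⟩, ht', hs'⟩
  · nlinarith [ht.2]
  · nlinarith [ht.1]
  · nlinarith [hs.1]
  · nlinarith [hs.2]

/-- Solutions of the truncated equation are bound states of the original one. -/
theorem isRadialBoundState {f : ℝ → ℝ} {γs : EReal} (hF : Family n (truncation f B) U V)
    (hB : (B : EReal) ≤ γs) (hle : ∀ r ≥ 0, |U α r| ≤ B) (hlim : Tendsto (U α) atTop (𝓝 0)) :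
    IsRadialBoundState (n + 1) f γs (U α) where
  mem_domain r hr := (EReal.coe_le_coe_iff.2 (hle r hr)).trans hB
  ode := by
    have h := hF.sol α
    refine ⟨V α, h.cv.continuousOn, h.v_nonpos 0 le_rfl, fun r _ => (h.du r).hasDerivWithinAt,
      fun r hr => ⟨_, h.dv r hr, ?_⟩⟩
    rw [truncation_of_mem (hle r hr.le)]
    push_cast
    ring
  tendsto_zero := hlim

end Family

section

variable {n : ℕ} {f : ℝ → ℝ} {γs : EReal} {δ : ℝ} {M : ℕ} {γ : ℕ → ℝ} {β₁ βs βbar s₀ B : ℝ}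

theorem Cbar_succ_pos {γM : ℝ} (hn : 1 ≤ n) (hb : β₁ < βbar) (hF : primF f γM < primF f βbar)
    (hm : sInf (primF f '' Icc β₁ βs) < primF f βbar) : 0 < Cbar (n + 1) f γM β₁ βs βbar := by
  have hn0 : (0 : ℝ) < n := by exact_mod_cast hn
  have h1 : 0 < (βbar - β₁) / (primF f βbar - primF f γM) :=
    div_pos (by linarith) (by linarith)
  have h2 : 0 < √(2 * (primF f βbar - sInf (primF f '' Icc β₁ βs))) :=
    Real.sqrt_pos.2 (by linarith)
  unfold Cbar
  push_cast
  rw [add_sub_cancel_right]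
  positivity

theorem Cbar_succ_mul {γM : ℝ} (hF : primF f γM < primF f βbar) :
    Cbar (n + 1) f γM β₁ βs βbar * (primF f βbar - primF f γM) =
      2 * n * (βbar - β₁) * √(2 * (primF f βbar - sInf (primF f '' Icc β₁ βs))) := by
  have h0 : primF f βbar - primF f γM ≠ 0 := by linarith [sub_pos.2 hF]
  unfold Cbar
  push_cast
  rw [add_sub_cancel_right]
  field_simp

/-- The left side is the energy bound furnished by `Family.exists_descent_of_large`. In Ī the
bracket is at least twice this, because sup Q ≥ Q(β̄) ≥ inf Q; its prefactor is at least 1, and the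
last term is nonnegative. -/
theorem le_Ibar_top {γM : ℝ} (hc : Continuous f) (hC : 0 < Cbar (n + 1) f γM β₁ βs βbar)
    (hb : β₁ ≤ βbar) (hs₀ : s₀ ≤ βbar) (hF : 0 ≤ primF f βbar) :
    primF f βbar + (βbar - β₁) ^ 2 / 2 ≤ Ibar (n + 1) f ⊤ γM β₁ βs βbar s₀ := by
  rw [Ibar, if_pos rfl]
  set C := Cbar (n + 1) f γM β₁ βs βbar
  have hcF := continuous_primF hc
  have hcQ : Continuous (pohozaevQ (n + 1) f) := by
    unfold pohozaevQ
    fun_prop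
  have h1 : pohozaevQ (n + 1) f βbar ≤ sSup (pohozaevQ (n + 1) f '' Icc β₁ βbar) :=
    le_csSup (isCompact_Icc.image hcQ).bddAbove ⟨βbar, ⟨hb, le_rfl⟩, rfl⟩
  have h2 : sInf (pohozaevQ (n + 1) f '' Icc s₀ βbar) ≤ pohozaevQ (n + 1) f βbar :=
    csInf_le (isCompact_Icc.image hcQ).bddBelow ⟨βbar, ⟨hs₀, le_rfl⟩, rfl⟩
  have h3 : 0 ≤ 1 / ((n + 1 : ℕ) : ℝ) * (sSup (pohozaevQ (n + 1) f '' Icc β₁ βbar) -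
      sInf (pohozaevQ (n + 1) f '' Icc s₀ βbar)) := mul_nonneg (by positivity) (by linarith)
  have h4 : 1 ≤ ((C + 1) / C) ^ (n + 1) :=
    one_le_pow₀ ((one_le_div hC).2 (by linarith))
  have h5 : 0 ≤ (((n + 1 : ℕ) : ℝ) - 2) ^ 2 * βbar ^ 2 / (2 * C ^ 2) := by positivity
  have h6 := le_mul_of_one_le_left (a := ((C + 1) / C) ^ (n + 1))
    (b := 2 * primF f βbar + (βbar - β₁) ^ 2 + 1 / ((n + 1 : ℕ) : ℝ) *
      (sSup (pohozaevQ (n + 1) f '' Icc β₁ βbar) - sInf (pohozaevQ (n + 1) f '' Icc s₀ βbar)))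
    (by positivity) h4
  linarith [sq_nonneg (βbar - β₁)]

namespace Family

/-- The bound states found from a height at which solutions of the truncated equation fall into
the well. -/
theorem exists_two_bound_states (hn : 1 ≤ n) {U V : ℝ → ℝ → ℝ} (hF : Family n (truncation f B) U V)
    (hL : Landscape (truncation f B) δ β₁ (γ 1) βs B) (hB : (B : EReal) ≤ γs)
    (h1M : γ 1 ≤ γ M) (hMs : γ M < βs) (hFM : primF f βs = primF f (γ M)) {C A I R α α₁ : ℝ}
    (hcond : (C + A) * I <
      √2 * (((n + 1 : ℕ) : ℝ) - 1) / √(I + Fbar f β₁) * ∫ s in (0 : ℝ)..β₁, |primF f s|)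
    (hα : βs < α) (hR : 0 < R) (hRC : R ≤ C + A) (hge : ∀ s ∈ Icc 0 R, β₁ ≤ U α s)
    (hu : U α R = β₁) (hv : V α R < 0) (hE : nrg (truncation f B) (U α) (V α) R ≤ I) {k : ℕ}
    (hα₁ : α < α₁) (hα₁B : α₁ ≤ B)
    (h1 : HasSignChangesAtLeast (U α₁) (k + 1) ∨ truncation f B α₁ = 0) :
    ∃ u₁ u₂ : ℝ → ℝ,
      (IsRadialBoundState (n + 1) f γs u₁ ∧ βs < u₁ 0 ∧ ((u₁ 0 : ℝ) : EReal) < γs ∧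
        HasExactlySignChanges u₁ k) ∧
      (IsRadialBoundState (n + 1) f γs u₂ ∧ βs < u₂ 0 ∧ ((u₂ 0 : ℝ) : EReal) < γs ∧
        HasExactlySignChanges u₂ k) ∧
      ¬ EqOn u₁ u₂ (Ici 0) := by
  have hb0 := hL.b_pos
  have hbB : β₁ ≤ B := (hL.b_lt.trans (hL.c_lt.trans hL.x_lt)).le
  have hP : ∀ s, 0 ≤ s → s ≤ B → primF (truncation f B) s = primF f s := fun s h1 h2 =>
    primF_truncation (by rwa [abs_of_nonneg h1])
  have hFb : ∀ s ∈ Icc 0 β₁, -Fbar f β₁ ≤ primF (truncation f B) s := by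
    intro s hs
    have hcont : ContinuousOn (primF f) (Icc 0 β₁) :=
      (continuous_primF hL.cont).continuousOn.congr fun s hs => (hP s hs.1 (hs.2.trans hbB)).symm
    rw [hP s hs.1 (hs.2.trans hbB), Fbar, neg_neg]
    exact csInf_le (isCompact_Icc.image_of_continuousOn hcont).bddBelow ⟨s, hs, rfl⟩
  have hI : 0 < I := by
    have h2 : 0 < nrg (truncation f B) (U α) (V α) R := by
      rw [nrg, hu, hL.primF_b, add_zero]
      have := sq_pos_of_neg hv
      positivity
    linarith
  have hpot : absPot (truncation f B) β₁ = ∫ s in (0 : ℝ)..β₁, |primF f s| := by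
    refine intervalIntegral.integral_congr fun s hs => ?_
    rw [uIcc_of_le hb0.le] at hs
    simp only [hP s hs.1 (hs.2.trans hbB)]
  -- The numerical hypothesis enters here: r E at the rim is at most (C + A) I, less than what the
  -- descent from β₁ to 0 dissipates.
  have hdis : R * I < dissip n I (Fbar f β₁) * absPot (truncation f B) β₁ := by
    refine (mul_le_mul_of_nonneg_right hRC hI.le).trans_lt ?_
    rw [hpot, dissip]
    push_cast at hcond
    rwa [add_sub_cancel_right] at hcond
  have hFz : primF (truncation f B) (γ M) = primF (truncation f B) βs := by
    have := hL.b_lt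
    have := hL.x_lt
    rw [hP _ (by linarith) (by linarith), hP _ (by linarith) (by linarith), hFM]
  obtain ⟨α', hα', α'', hα'', ⟨ht1, hs1⟩, ht2, hs2⟩ := hF.exists_pair hL hn hFb h1M hMs hFz hα hR
    hge hu hv hE hdis hα₁ hα₁B h1
  have hαB : α < B := hα₁.trans_le hα₁B
  have hα''B : α'' < B := hα''.2.trans_le hα₁B
  refine ⟨U α', U α'', ⟨hF.isRadialBoundState hB (fun r hr => hF.abs_le_B hL hα'.1.le
    (hα'.2.trans hαB) hr) ht1, ?_, ?_, hs1⟩, ⟨hF.isRadialBoundState hB (fun r hr =>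
    hF.abs_le_B hL (hα.trans hα''.1).le hα''B hr) ht2, ?_, ?_, hs2⟩, fun heq => ?_⟩
  · rw [hF.init]
    exact hα'.1
  · rw [hF.init]
    exact (EReal.coe_lt_coe_iff.2 (hα'.2.trans hαB)).trans_le hB
  · rw [hF.init]
    exact hα.trans hα''.1
  · rw [hF.init]
    exact (EReal.coe_lt_coe_iff.2 hα''B).trans_le hB
  · have := heq self_mem_Ici
    rw [hF.init, hF.init] at this
    linarith [hα'.2, hα''.1]

end Family

end

theorem mainTheorem8 (N : ℕ) (hN : 2 ≤ N) (f : ℝ → ℝ) (γs : EReal) (δ : ℝ)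
    (hf : NonlinearityAssumptions N f γs δ)
    (M : ℕ) (γ : ℕ → ℝ) (hγ : IsRecordMaxima f γs M γ)
    (β₁ : ℝ) (hβ₁ : IsGreatest {s : ℝ | 0 < s ∧ s < γ 1 ∧ primF f s = 0} β₁)
    (βs : ℝ) (hβs : IsGreatest
      {s : ℝ | γ M < s ∧ (s : EReal) < γs ∧ primF f s = primF f (γ M)} βs)
    (βbar : ℝ) (hβbar : βs < βbar) (hβbar' : (βbar : EReal) < γs)
    (s₀ : ℝ) (hs₀ : 0 ≤ s₀) (hs₀' : s₀ ≤ βbar)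
    (hcond : (Cbar N f (γ M) β₁ βs βbar + Aconst N f γs (γ M) β₁ βs βbar) *
        Ibar N f γs (γ M) β₁ βs βbar s₀ <
      √2 * ((N : ℝ) - 1) / √(Ibar N f γs (γ M) β₁ βs βbar s₀ + Fbar f β₁) *
        ∫ s in (0 : ℝ)..β₁, |primF f s|) :
    ∀ k : ℕ, ∃ u₁ u₂ : ℝ → ℝ,
      (IsRadialBoundState N f γs u₁ ∧ βs < u₁ 0 ∧ ((u₁ 0 : ℝ) : EReal) < γs ∧
        HasExactlySignChanges u₁ k) ∧
      (IsRadialBoundState N f γs u₂ ∧ βs < u₂ 0 ∧ ((u₂ 0 : ℝ) : EReal) < γs ∧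
        HasExactlySignChanges u₂ k) ∧
      ¬ EqOn u₁ u₂ (Ici 0) := by
  intro k
  obtain ⟨n, rfl⟩ : ∃ n, N = n + 1 := ⟨N - 1, by omega⟩
  have hn : 1 ≤ n := by omega
  have hM := hγ.primF_pos hγ.one_le le_rfl
  have h1M : γ 1 ≤ γ M := hγ.first.2 hM
  obtain ⟨⟨hMs, hsγ, hFM⟩, -⟩ := id hβs
  have main : ∀ B : ℝ, βbar < B → (B : EReal) ≤ γs → primF f (γ M) < primF f B →
      ∃ (_ : Landscape (truncation f B) δ β₁ (γ 1) βs B) (U V : ℝ → ℝ → ℝ),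
        Family n (truncation f B) U V ∧
        (∀ s, 0 ≤ s → s ≤ B → primF (truncation f B) s = primF f s) ∧
        (∀ s ∈ Icc β₁ βs, sInf (primF f '' Icc β₁ βs) ≤ primF (truncation f B) s) ∧
        0 < Cbar (n + 1) f (γ M) β₁ βs βbar ∧
        2 * n * (βbar - β₁) * √(2 * (primF (truncation f B) βbar -
          sInf (primF f '' Icc β₁ βs))) ≤ Cbar (n + 1) f (γ M) β₁ βs βbar *
            (primF (truncation f B) βbar - primF (truncation f B) βs) ∧
        0 < sInf (f '' Icc βs βbar) ∧
        (∀ s ∈ Icc βs βbar, sInf (f '' Icc βs βbar) ≤ truncation f B s) ∧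
        (βs - β₁) / √(primF (truncation f B) βbar - primF (truncation f B) βs) +
          √(2 * (n + 1) * (βbar - βs) / sInf (f '' Icc βs βbar)) =
            Abase (n + 1) f (γ M) β₁ βs βbar := by
    intro B hbB hB hFB
    have hL := hf.landscape hγ hβ₁ hβs (hβbar.trans hbB) hB hFB
    obtain ⟨G, hG⟩ := hL.bdd
    have hg0 : truncation f B 0 = 0 := by
      rw [truncation_of_mem (by rw [abs_zero]; exact hL.B_pos.le), hf.map_zero]
    obtain ⟨U, V, h1, h2, h3, h4⟩ := exists_family hn hL.cont hg0 hG hL.lip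
    have hP : ∀ s, 0 ≤ s → s ≤ B → primF (truncation f B) s = primF f s := fun s h1 h2 =>
      primF_truncation (by rwa [abs_of_nonneg h1])
    have hb0 := hL.b_pos
    have hbx := hL.b_lt.trans hL.c_lt
    have hPbar := hP βbar (by linarith) hbB.le
    have hPs := hP βs (by linarith) (by linarith)
    have hFbar : primF f (γ M) < primF f βbar := by
      rw [← hFM, ← hPs, ← hPbar]
      exact hL.lt_primF hβbar hbB
    have hm : ∀ s ∈ Icc β₁ βs, sInf (primF f '' Icc β₁ βs) ≤ primF (truncation f B) s := by
      intro s hs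
      have hcont : ContinuousOn (primF f) (Icc β₁ βs) :=
        (continuous_primF hL.cont).continuousOn.congr fun s hs =>
          (hP s (by linarith [hs.1]) (by linarith [hs.2])).symm
      rw [hP s (by linarith [hs.1]) (by linarith [hs.2])]
      exact csInf_le (isCompact_Icc.image_of_continuousOn hcont).bddBelow ⟨s, hs, rfl⟩
    have hT : ∀ s ∈ Icc βs βbar, truncation f B s = f s := fun s hs =>
      truncation_of_mem (by rw [abs_of_nonneg] <;> linarith [hs.1, hs.2])
    have himg : IsCompact (f '' Icc βs βbar) := isCompact_Icc.image_of_continuousOn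
      (hL.cont.continuousOn.congr fun s hs => (hT s hs).symm)
    refine ⟨hL, U, V, ⟨h1, h2, h3, h4⟩, hP, hm, ?_, ?_, ?_, ?_, ?_⟩
    · refine Cbar_succ_pos hn (by linarith) hFbar ?_
      have := hm βs ⟨hbx.le, le_rfl⟩
      rw [hPs] at this
      linarith
    · rw [hPbar, hPs, hFM, Cbar_succ_mul hFbar]
    · obtain ⟨s, hs, hs'⟩ := himg.sInf_mem ((nonempty_Icc.2 hβbar.le).image f)
      rw [← hs', ← hT s hs]
      exact hL.g_pos' hs.1 (hs.2.trans_lt hbB)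
    · intro s hs
      rw [hT s hs]
      exact csInf_le himg.bddBelow ⟨s, hs, rfl⟩
    · rw [hPbar, hPs, hFM, Abase]
      push_cast
      rfl
  by_cases htop : γs = ⊤
  · subst htop
    obtain ⟨a, ha, haN⟩ := hf.exists_height_of_signChanges hn hγ hβ₁ hβs (k + 1)
    have hβs0 : 0 < βs := (hM.1.trans hMs)
    -- The maximum with 0 keeps the time positive before C̄ > 0 is available. Beyond α₀ solutions
    -- have |u| or |v| above β̄ throughout (C̄, C̄ + 1).
    obtain ⟨a', ha', haW⟩ := hf.exists_height hn hγ hβ₁ hβs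
      (R := max (Cbar (n + 1) f (γ M) β₁ βs βbar) 0 + 1) (W := βbar) (by positivity) (by linarith)
    -- The order is β̄ ≤ α₀ < α₁ < B: α₀ bounds the search for the settling height, α₁ oscillates k
    -- + 1 times, and truncation at α₁ + 1 does not affect solutions starting at or below α₁.
    set α₀ := max a' βbar
    have haα₀ : a' ≤ α₀ := le_max_left _ _
    have hbα₀ : βbar ≤ α₀ := le_max_right _ _
    set α₁ := max a (α₀ + 1)
    have haα : a ≤ α₁ := le_max_left _ _
    have hα₀₁ : α₀ + 1 ≤ α₁ := le_max_right _ _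
    obtain ⟨hL, U, V, hF, hP, hm, hC0, hC, hμ0, hμ, hA⟩ := main (α₁ + 1) (by linarith) le_top
      (hf.primF_lt_of_top hβs (by linarith))
    rw [max_eq_left hC0.le] at haW
    have hb0 := hL.b_pos
    have hbx := hL.b_lt.trans hL.c_lt
    have hPbar := hP βbar (by linarith) (by linarith)
    have hAc : Aconst (n + 1) f ⊤ (γ M) β₁ βs βbar =
        max 1 (Abase (n + 1) f (γ M) β₁ βs βbar) := if_pos rfl
    rw [hAc] at hcond
    obtain ⟨α, hα, R, hR, hRC, hge, hu, hv, hE⟩ := hF.exists_descent_of_large hL hβbar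
      (by linarith) hm hC0 hC hμ0 hμ (hA.le.trans (le_max_right 1 _)) (le_max_left 1 _)
      hbα₀ (by linarith) fun r hr => by
        refine (haW α₀ haα₀ (α₁ + 1) (by linarith) _ _ (hF.sol α₀) (hF.init α₀) r
          ⟨hC0.trans hr.1, hr.2.le⟩).imp id fun h => ?_
        linarith
    have hFbar : 0 ≤ primF f βbar := by
      rw [← hPbar]
      exact (hL.primF_x.trans (hL.lt_primF hβbar (by linarith))).le
    have hI := le_Ibar_top (n := n) (γM := γ M) (βs := βs) hf.continuous_of_top hC0
      (by linarith : β₁ ≤ βbar) hs₀' hFbar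
    rw [hPbar] at hE
    have hsc := haN α₁ haα (α₁ + 1) (by linarith) _ _ (hF.sol α₁) (hF.init α₁)
    exact hF.exists_two_bound_states hn hL le_top h1M hMs hFM hcond hα.1 hR hRC hge hu hv
      (hE.trans hI) (by linarith [hα.2]) (by linarith) (Or.inl hsc)
  · have hbot : γs ≠ ⊥ := (bot_lt_iff_ne_bot.1 (bot_le.trans_lt hsγ))
    have hB : ((γs.toReal : ℝ) : EReal) = γs := EReal.coe_toReal htop hbot
    have hbB : βbar < γs.toReal := EReal.coe_lt_coe_iff.1 (by rwa [hB])
    obtain ⟨hL, U, V, hF, hP, hm, hC0, hC, hμ0, hμ, hA⟩ := main γs.toReal hbB hB.le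
      (hf.primF_lt_end htop (γ M) (by rw [abs_of_pos hM.1]; exact hM.2.1))
    -- In the bounded case the endpoint is an equilibrium. It provides higher solutions that stay up
    -- for long, and also the stuck end of the upper path.
    have hg0 : truncation f γs.toReal γs.toReal = 0 := by
      rw [truncation_of_mem (abs_of_pos hL.B_pos).le, hf.end_zero htop]
    have hAc : Aconst (n + 1) f γs (γ M) β₁ βs βbar = Abase (n + 1) f (γ M) β₁ βs βbar :=
      if_neg htop
    have hIc : Ibar (n + 1) f γs (γ M) β₁ βs βbar s₀ = primF f γs.toReal := if_neg htop
    rw [hAc, hIc] at hcond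
    obtain ⟨α, hα, R, hR, hRC, hge, hu, hv, hE⟩ := hF.exists_descent_of_zero hL hn hg0 hβbar hbB hm
      hC0 hC hμ0 hμ hA.le
    rw [hP _ hL.B_pos.le le_rfl] at hE
    exact hF.exists_two_bound_states hn hL hB.le h1M hMs hFM hcond hα.1 hR hRC hge hu hv hE hα.2
      le_rfl (Or.inr hg0)
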